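/- Let $d\in\mathbb N_0$, $h=-\Delta+V$ on $L^2(\mathbb R^d)$, and let $$\mathbb H=\int \psi^*(x)(h\psi)(x)\,dx+\tfrac12\iint v(x-y)\,\psi^*(x)\psi^*(y)\psi(x)\psi(y)\,dx\,dy$$ be the many-body Hamiltonian on the bosonic Fock space over $L^2(\mathbb R^d)$, where $V,v:\mathbb R^d\to\mathbb R$ are measurable and, as multiplication operators, infinitesimally bounded with respect to $-\Delta$, and $v(-x)=v(x)$. Let $M=\sqrt{1-\Delta}$ and, for $j\in\mathbb N_0$, let $X^j$ be the set of triples $(\phi,\gamma,\sigma)$, $\phi\in L^2(\mathbb R^d)$, $\gamma,\sigma$ bounded operators on $L^2(\mathbb R^d)$, with $\gamma=\gamma^*\ge0$, $\sigma^*=\bar\sigma$ and $$\|(\phi,\gamma,\sigma)\|_{X^j}=\|M^j\phi\|_{L^2}+\|M^j\gamma M^j\|_{\mathcal L^1}+\|M^j\sigma\|_{\mathcal L^2}+\|\sigma M^j\|_{\mathcal L^2}<\infty$$ ($\mathcal L^p$ = Schatten classes). Fix $j\ge2$ and an interval $I\subseteq\mathbb R$ (for instance $[0,T)$ or $\mathbb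 R$). Let $(\omega^q_t)_{t\in I}$ be a family of quasifree states (density matrices on Fock space all of whose field moments exist and whose truncated expectations of order greater than two vanish), with truncated expectations $$\phi_t(x)=\omega^q_t(\psi(x)),\quad \gamma_t(x,y)=\omega^q_t(\psi^*(y)\psi(x))-\overline{\phi_t(y)}\phi_t(x),\quad \sigma_t(x,y)=\omega^q_t(\psi(x)\psi(y))-\phi_t(x)\phi_t(y)$$ such that $(\phi_t,\gamma_t,\sigma_t)\in C^0(I;X^j)\cap C^1(I;X^0)$. Assume that $$i\partial_t\omega^q_t(\mathbb A)=\omega^q_t([\mathbb A,\mathbb H]),\qquad t\in I,$$ holds for the monomials $\mathbb A=\psi(x),\ \psi^*(x)\psi(y),\ \psi(x)\psi(y)$, smeared with Schwartz functions. (Expectations $\omega([\mathbb A,\mathbb H])$ are understood in the sense of quadratic forms, $\omega([\mathbb A,\mathbb H])=\sum_k\big(\langle \mathbb A^*\xi_k,\mathbb H\xi_k\rangle-\langle \mathbb H\xi_k,\mathbb A\xi_k\rangle\big)$ for the density matrix $\sum_k|\xi_k\rangle\langle\xi_k|$ of $\omega$.) Then: 1. Let $\mathbb A$ be an observable that is at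 most quadratic in the fields, $$\mathbb A=c+\int \overline{f}\,\psi+\int g\,\psi^*+\int\psi^*(x)(T\psi)(x)\,dx+\iint \overline{b(x,y)}\,\psi(x)\psi(y)\,dx\,dy+\iint b'(x,y)\,\psi^*(x)\psi^*(y)\,dx\,dy,$$ with $c\in\mathbb C$, $f,g\in L^2(\mathbb R^d)$, $b,b'\in L^2(\mathbb R^d\times\mathbb R^d)$ and a one-particle operator $T$ that, together with its formal adjoint, is bounded from $H^j(\mathbb R^d)$ to $L^2(\mathbb R^d)$. If $[\mathbb H,\mathbb A]=0$, i.e. $\langle \mathbb A^*\xi,\mathbb H\zeta\rangle=\langle \mathbb H\xi,\mathbb A\zeta\rangle$ for all $\xi,\zeta$ in the common domain of $\mathbb A,\mathbb A^*,\mathbb H$, then $\omega^q_t(\mathbb A)$ is well defined and independent of $t\in I$. 2. (Conservation of the particle number.) $\omega^q_t(\mathbb N)$, with $\mathbb N$ the particle number operator, is well defined and independent of $t\in I$. 3. (Existence and conservation of the energy.) $\omega^q_t(\mathbb H)$ is well defined and independent of $t\in I$, and it is equal to $\mathcal E(\phi_t,\gamma_t,\sigma_t)$, where $$\mathcal E(\phi,\gamma,\sigma)=\operatorname{Tr}\Big[h(\gamma+|\phi\rangle\langle\phi|)+b[|\phi\rangle\langle\phi|]\gamma+\tfrac12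 b[\gamma]\gamma\Big]+\tfrac12\iint v(x-y)\,|\sigma(x,y)+\phi(x)\phi(y)|^2\,dx\,dy,$$ all terms of this expression being well defined. Here $b[\alpha]$ is the sum of the operator of multiplication by $x\mapsto\int v(x-y)\alpha(y,y)\,dy$ and the operator with integral kernel $v(x-y)\alpha(x,y)$. -/

import Mathlib

open MeasureTheory Filter Topology
open scoped SchwartzMap ENNReal Laplacian ComplexConjugate

noncomputable section

namespace HFB

/-! ### One-particle space -/

/-- Physical space `ℝ^d`. -/
abbrev Pt (d : ℕ) : Type := EuclideanSpace ℝ (Fin d)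

/-- Test functions: the Schwartz space of `ℝ^d`. -/
abbrev Test (d : ℕ) : Type := 𝓢(Pt d, ℂ)

/-- The one-particle Hilbert space `L²(ℝ^d)`. -/
abbrev L2 (d : ℕ) : Type := Lp ℂ 2 (volume : Measure (Pt d))

/-- A test function as an element of `L²`. -/
abbrev Test.l2 {d : ℕ} (f : Test d) : L2 d := f.toLp 2 volume

/-- Fourier symbol `(1 + |2πk|²)^{j/2}` of `M^j = (1 - Δ)^{j/2}`. -/
def sobSymbol (d j : ℕ) (k : Pt d) : ℝ :=
  (1 + ‖(2 * Real.pi) • k‖ ^ 2) ^ ((j : ℝ) / 2)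

theorem sobSymbol_hasTemperateGrowth (d j : ℕ) :
    (fun k => ((sobSymbol d j k : ℝ) : ℂ)).HasTemperateGrowth := by
  have h : (fun x : Pt d => ((1 + ‖x‖ ^ 2) ^ ((j : ℝ) / 2) : ℝ)).HasTemperateGrowth := by
    fun_prop
  have h2 := h.comp ((2 * Real.pi) • ContinuousLinearMap.id ℝ (Pt d)).hasTemperateGrowth
  exact (Complex.ofRealCLM.hasTemperateGrowth).comp h2

/-- `M^j = (1 - Δ)^{j/2}` acting on test functions. -/
def sobM (d j : ℕ) : Test d →L[ℂ] Test d :=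
  SchwartzMap.fourierMultiplierCLM ℂ (fun k => ((sobSymbol d j k : ℝ) : ℂ))

/-- The function `U` is infinitesimally bounded with respect to the Laplacian, as a
multiplication operator on `L²(ℝ^d)`. (Schwartz functions are a core of the Laplacian.) -/
def InfinitesimallyLaplaceBounded {d : ℕ} (U : Pt d → ℝ) : Prop :=
  ∀ ε : ℝ, 0 < ε → ∃ C : ℝ, ∀ f : Test d,
    eLpNorm (fun x => (U x : ℂ) * f x) 2 volume ≤
      ENNReal.ofReal ε * eLpNorm (Δ f : Test d) 2 volume +
        ENNReal.ofReal C * eLpNorm f 2 volume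

/-! ### Bosonic Fock space -/

/-- The Fock space `⨁ₙ L²((ℝ^d)ⁿ)` over `L²(ℝ^d)`, without symmetry. -/
abbrev FullFock (d : ℕ) : Type :=
  lp (fun n : ℕ => Lp ℂ 2 (volume : Measure (Fin n → Pt d))) 2

theorem quasiMeasurePreserving_perm {d n : ℕ} (π : Equiv.Perm (Fin n)) :
    Measure.QuasiMeasurePreserving (fun x : Fin n → Pt d => fun i => x (π i)) volume volume := by
  have h := (volume_measurePreserving_piCongrLeft (fun _ : Fin n => Pt d) π⁻¹)
  convert h.quasiMeasurePreserving using 1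
  funext x i
  have h2 := MeasurableEquiv.piCongrLeft_apply_apply (β := fun _ : Fin n => Pt d) π⁻¹ x (π i)
  simpa using h2.symm

/-- The bosonic Fock space `𝓕`: all components are symmetric functions. -/
def boseFock (d : ℕ) : Submodule ℂ (FullFock d) where
  carrier := {ξ | ∀ (n : ℕ) (π : Equiv.Perm (Fin n)),
    ∀ᵐ x : Fin n → Pt d, (ξ n : (Fin n → Pt d) → ℂ) (fun i => x (π i)) = ξ n x}
  zero_mem' := by
    intro n π
    have h0 : ((0 : FullFock d) n : (Fin n → Pt d) → ℂ) =ᵐ[volume] 0 := Lp.coeFn_zero ℂ 2 volume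
    filter_upwards [h0, (quasiMeasurePreserving_perm π).ae h0] with x hx hx'
    rw [hx, hx']
    rfl
  add_mem' := by
    intro ξ η hξ hη n π
    have h0 : ((ξ + η : FullFock d) n : (Fin n → Pt d) → ℂ) =ᵐ[volume] ξ n + η n :=
      Lp.coeFn_add (ξ n) (η n)
    filter_upwards [h0, (quasiMeasurePreserving_perm π).ae h0, hξ n π, hη n π] with x h1 h2 h3 h4
    rw [h1, h2, Pi.add_apply, Pi.add_apply, h3, h4]
  smul_mem' := by
    intro c ξ hξ n π
    have h0 : ((c • ξ : FullFock d) n : (Fin n → Pt d) → ℂ) =ᵐ[volume] c • ⇑(ξ n) :=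
      Lp.coeFn_smul c (ξ n)
    filter_upwards [h0, (quasiMeasurePreserving_perm π).ae h0, hξ n π] with x h1 h2 h3
    rw [h1, h2, Pi.smul_apply, Pi.smul_apply, h3]

abbrev Fock (d : ℕ) : Type := boseFock d

/-- The `n`-particle component of a Fock vector, as a function. -/
def Fock.comp {d : ℕ} (ξ : Fock d) (n : ℕ) : (Fin n → Pt d) → ℂ := (ξ : FullFock d) n

/-- The `L²` pairing `⟨G, Ψ⟩`, antilinear in `G`. -/
def pair {d n : ℕ} (G Ψ : (Fin n → Pt d) → ℂ) : ℂ := ∫ x, conj (G x) * Ψ x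

/-- The product function `f₁ ⊗ ⋯ ⊗ fₙ`. -/
def tens {d n : ℕ} (F : Fin n → Pt d → ℂ) (x : Fin n → Pt d) : ℂ := ∏ i, F i (x i)

/-- Product of test functions. -/
def tensT {d n : ℕ} (F : Fin n → Test d) : (Fin n → Pt d) → ℂ := tens fun i => ⇑(F i)

/-- A (possibly unbounded) operator on Fock space, given by its graph: `T ξ η` means that `ξ`
is in the domain and is mapped to `η`. All operators below are defined weakly: `T ξ = η` holds if
and only if `⟨T⁺ F, ξ⟩ = ⟨F, η⟩` for all products `F` of test functions, with `T⁺` the formal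
adjoint. As such products are total, `η` is determined by `ξ`. -/
abbrev Op (d : ℕ) : Type := Fock d → Fock d → Prop

/-! ### Creation and annihilation operators -/

/-- `⟨F, (a(f) ξ)ₙ⟩`, where
`(a(f) ξ)ₙ(x₁,…,xₙ) = √(n+1) ∫ conj f(y) ξₙ₊₁(y,x₁,…,xₙ) dy`, that is
`a(f) = ∫ conj f(y) ψ(y) dy`. -/
def annTerm {d : ℕ} (f : Pt d → ℂ) (ξ : Fock d) (n : ℕ) (F : Fin n → Test d) : ℂ :=
  (Real.sqrt (n + 1) : ℂ) *
    pair (fun x : Fin (n + 1) → Pt d => f (x 0) * ∏ i : Fin n, F i (x i.succ)) (ξ.comp (n + 1))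

/-- `⟨F, (a*(f) ξ)ₙ⟩`, where
`(a*(f) ξ)ₙ₊₁(x₁,…,xₙ₊₁) = (n+1)^{-1/2} ∑ᵢ f(xᵢ) ξₙ(x₁,…,x̂ᵢ,…,xₙ₊₁)`, that is
`a*(f) = ∫ f(y) ψ*(y) dy`. -/
def creTerm {d : ℕ} (f : Pt d → ℂ) (ξ : Fock d) : (n : ℕ) → (Fin n → Test d) → ℂ
  | 0, _ => 0
  | n + 1, F => (Real.sqrt (n + 1) : ℂ)⁻¹ *
      ∑ i : Fin (n + 1), (∫ y, conj (F i y) * f y) *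
        pair (tensT fun k => F (i.succAbove k)) (ξ.comp n)

/-- The annihilation operator `a(f) = ∫ conj f(x) ψ(x) dx`. -/
def annOp {d : ℕ} (f : Pt d → ℂ) : Op d := fun ξ η =>
  ∀ (n : ℕ) (F : Fin n → Test d), pair (tensT F) (η.comp n) = annTerm f ξ n F

/-- The creation operator `a*(f) = ∫ f(x) ψ*(x) dx`. -/
def creOp {d : ℕ} (f : Pt d → ℂ) : Op d := fun ξ η =>
  ∀ (n : ℕ) (F : Fin n → Test d), pair (tensT F) (η.comp n) = creTerm f ξ n F

/-- A smeared creation (`creation = true`) or annihilation operator. -/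
structure FieldOp (d : ℕ) where
  test : Test d
  creation : Bool

def FieldOp.ann {d : ℕ} (f : Test d) : FieldOp d := ⟨f, false⟩

def FieldOp.cre {d : ℕ} (f : Test d) : FieldOp d := ⟨f, true⟩

def FieldOp.adj {d : ℕ} (b : FieldOp d) : FieldOp d := ⟨b.test, !b.creation⟩

def FieldOp.op {d : ℕ} (b : FieldOp d) : Op d :=
  if b.creation then creOp b.test else annOp b.test

/-- The monomial `b₁ b₂ ⋯ bₙ` (composition of operators). -/
def wordOp {d : ℕ} : List (FieldOp d) → Op d
  | [] => fun ξ η => η = ξ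
  | b :: L => fun ξ η => ∃ ζ, wordOp L ξ ζ ∧ b.op ζ η

/-- The adjoint monomial `bₙ* ⋯ b₁*`. -/
def adjWord {d : ℕ} (L : List (FieldOp d)) : List (FieldOp d) := (L.map FieldOp.adj).reverse

/-- The smeared monomials `ψ(x)`, `ψ*(x) ψ(y)`, `ψ(x) ψ(y)`. -/
def quadraticMonomials (d : ℕ) : Set (List (FieldOp d)) :=
  {w | ∃ f g : Test d, w = [.ann f] ∨ w = [.cre g, .ann f] ∨ w = [.ann f, .ann g]}

/-! ### Number operator and Hamiltonian -/

/-- The particle number operator. -/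
def numberOp (d : ℕ) : Op d := fun ξ η =>
  ∀ n : ℕ, (η : FullFock d) n = (n : ℂ) • (ξ : FullFock d) n

/-- The `n`-particle Hamiltonian `∑ᵢ (-Δᵢ + V(xᵢ)) + ½ ∑_{i ≠ k} v(xᵢ - xₖ)` applied to a product
of test functions. -/
def hamTest {d : ℕ} (V v : Pt d → ℝ) {n : ℕ} (F : Fin n → Test d) (x : Fin n → Pt d) : ℂ :=
  (∑ i, (-(Δ (F i) : Test d) (x i) + (V (x i) : ℂ) * F i (x i)) *
      ∏ k ∈ Finset.univ.erase i, F k (x k)) +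
    (1 / 2 : ℂ) * (∑ i, ∑ k ∈ Finset.univ.erase i, (v (x i - x k) : ℂ)) * tensT F x

/-- The many-body Hamiltonian
`ℍ = ∫ ψ*(x) (hψ)(x) dx + ½ ∫∫ v(x-y) ψ*(x) ψ*(y) ψ(x) ψ(y) dx dy`, `h = -Δ + V`. -/
def hamOp {d : ℕ} (V v : Pt d → ℝ) : Op d := fun ξ η =>
  ∀ (n : ℕ) (F : Fin n → Test d), pair (tensT F) (η.comp n) = pair (hamTest V v F) (ξ.comp n)

/-! ### General observables that are linear or quadratic in the fields -/

/-- The observable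
`c + a(f) + a*(g) + ∫ ψ*(x) (T ψ)(x) dx + ∫∫ conj b(x,y) ψ(x)ψ(y) + ∫∫ b'(x,y) ψ*(x)ψ*(y)`
with `f, g ∈ L²(ℝ^d)`, `b, b' ∈ L²(ℝ^d × ℝ^d)` and a one-particle operator `T` which, together
with its formal adjoint, is bounded from `H^j(ℝ^d)` to `L²(ℝ^d)`. -/
structure QuadObs (d j : ℕ) where
  c : ℂ
  f : L2 d
  g : L2 d
  T : Test d →ₗ[ℂ] L2 d
  Tadj : Test d →ₗ[ℂ] L2 d
  adj_eq : ∀ u w : Test d, inner ℂ u.l2 (T w) = inner ℂ (Tadj u) w.l2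
  bound : ∃ C : ℝ, ∀ u : Test d, ‖T u‖ ≤ C * ‖(sobM d j u).l2‖
  bound_adj : ∃ C : ℝ, ∀ u : Test d, ‖Tadj u‖ ≤ C * ‖(sobM d j u).l2‖
  b : Lp ℂ 2 (volume : Measure (Pt d × Pt d))
  b' : Lp ℂ 2 (volume : Measure (Pt d × Pt d))

/-- The adjoint observable. -/
def QuadObs.adjoint {d j : ℕ} (A : QuadObs d j) : QuadObs d j where
  c := conj A.c
  f := A.g
  g := A.f
  T := A.Tadj
  Tadj := A.T
  adj_eq u w := by
    rw [← inner_conj_symm, ← A.adj_eq, inner_conj_symm]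
  bound := A.bound_adj
  bound_adj := A.bound
  b := A.b'
  b' := A.b

/-- `⟨F, (∫ ψ*(x) (T ψ)(x) dx ξ)ₙ⟩`, in terms of the adjoint of `T`. -/
def oneBodyTerm {d : ℕ} (Tadj : Test d →ₗ[ℂ] L2 d) (ξ : Fock d) (n : ℕ) (F : Fin n → Test d) : ℂ :=
  ∑ i, pair (fun x => (Tadj (F i) : Pt d → ℂ) (x i) *
    ∏ k ∈ Finset.univ.erase i, F k (x k)) (ξ.comp n)

/-- `⟨F, (∫∫ conj b(x,y) ψ(x)ψ(y) ξ)ₙ⟩`. -/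
def pairAnnTerm {d : ℕ} (b : Pt d × Pt d → ℂ) (ξ : Fock d) (n : ℕ) (F : Fin n → Test d) : ℂ :=
  (Real.sqrt ((n + 1) * (n + 2)) : ℂ) *
    pair (fun x : Fin (n + 2) → Pt d => b (x 0, x 1) * ∏ i : Fin n, F i (x i.succ.succ))
      (ξ.comp (n + 2))

/-- `⟨F, (∫∫ b'(x,y) ψ*(x)ψ*(y) ξ)ₙ⟩`. -/
def pairCreTerm {d : ℕ} (b' : Pt d × Pt d → ℂ) (ξ : Fock d) : (n : ℕ) → (Fin n → Test d) → ℂ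
  | 0, _ => 0
  | 1, _ => 0
  | n + 2, F => (Real.sqrt ((n + 1) * (n + 2)) : ℂ)⁻¹ *
      ∑ i : Fin (n + 2), ∑ k : Fin (n + 1),
        (∫ p : Pt d × Pt d, conj (F i p.1 * F (i.succAbove k) p.2) * b' p) *
          pair (tensT fun l => F (i.succAbove (k.succAbove l))) (ξ.comp n)

/-- The observable as an operator on Fock space. -/
def QuadObs.op {d j : ℕ} (A : QuadObs d j) : Op d := fun ξ η =>
  ∀ (n : ℕ) (F : Fin n → Test d), pair (tensT F) (η.comp n) =
    A.c * pair (tensT F) (ξ.comp n) + annTerm A.f ξ n F + creTerm A.g ξ n F +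
      oneBodyTerm A.Tadj ξ n F + pairAnnTerm A.b ξ n F + pairCreTerm A.b' ξ n F

/-- `[ℍ, A] = 0` in the sense of quadratic forms, on the common domain of `A`, `A*` and `ℍ`:
`⟨A* ξ, ℍ ζ⟩ = ⟨ℍ ξ, A ζ⟩`. -/
def FormCommute {d : ℕ} (A Aadj H : Op d) : Prop :=
  ∀ ξ α α' η ζ β β' θ : Fock d, A ξ α → Aadj ξ α' → H ξ η → A ζ β → Aadj ζ β' → H ζ θ →
    inner ℂ α' θ = inner ℂ η β

/-! ### States and expectation values -/

/-- A state on the bosonic Fock space, given by a density matrix `ρ = ∑ₖ |ξₖ⟩⟨ξₖ|` of trace one. -/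
structure State (d : ℕ) where
  vec : ℕ → Fock d
  hasSum_norm : HasSum (fun k => ‖vec k‖ ^ 2) 1

/-- The expectation `ω(B) = Tr(ρ B) = ∑ₖ ⟨ξₖ, B ξₖ⟩` is well defined and equal to `z`. -/
def HasExp {d : ℕ} (ω : State d) (B : Op d) (z : ℂ) : Prop :=
  ∃ η : ℕ → Fock d, (∀ k, B (ω.vec k) (η k)) ∧ HasSum (fun k => inner ℂ (ω.vec k) (η k)) z

/-- The expectation `ω([A, H]) = ∑ₖ (⟨A* ξₖ, H ξₖ⟩ - ⟨H ξₖ, A ξₖ⟩)` of the commutator with a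
symmetric `H`, understood as a quadratic form, is well defined and equal to `z`. -/
def HasCommExp {d : ℕ} (ω : State d) (A Aadj H : Op d) (z : ℂ) : Prop :=
  ∃ α α' η : ℕ → Fock d, (∀ k, A (ω.vec k) (α k)) ∧ (∀ k, Aadj (ω.vec k) (α' k)) ∧
    (∀ k, H (ω.vec k) (η k)) ∧
    HasSum (fun k => inner ℂ (α' k) (η k) - inner ℂ (η k) (α k)) z

/-- Quasifree states: all moments in the fields exist, and all truncated expectations of order
larger than two vanish. The latter is Wick's theorem
`ω(b L) = ω(b) ω(L) + ∑ᵢ (ω(b Lᵢ) - ω(b) ω(Lᵢ)) ω(L without Lᵢ)`. -/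
def State.IsQuasifree {d : ℕ} (ω : State d) : Prop :=
  ∃ m : List (FieldOp d) → ℂ, (∀ L, HasExp ω (wordOp L) (m L)) ∧
    ∀ (b : FieldOp d) (L : List (FieldOp d)),
      m (b :: L) = m [b] * m L +
        ∑ i : Fin L.length, (m [b, L.get i] - m [b] * m [L.get i]) * m (L.eraseIdx i)

/-- Triples `(φ, γ, σ)`. -/
abbrev Triple (d : ℕ) : Type := L2 d × (L2 d →L[ℂ] L2 d) × (L2 d →L[ℂ] L2 d)

/-- `μ = (φ, γ, σ)` are the truncated expectations of first and second order of `ω`: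
`φ(x) = ω(ψ(x))`, `γ(x,y) = ω(ψ*(y)ψ(x)) - ω(ψ*(y)) ω(ψ(x))` and
`σ(x,y) = ω(ψ(x)ψ(y)) - ω(ψ(x)) ω(ψ(y))`. -/
def State.HasMoments {d : ℕ} (ω : State d) (μ : Triple d) : Prop :=
  ∀ f g : Test d,
    HasExp ω (wordOp [.ann f]) (inner ℂ f.l2 μ.1) ∧
    HasExp ω (wordOp [.cre g, .ann f])
      (inner ℂ f.l2 (μ.2.1 g.l2) + inner ℂ μ.1 g.l2 * inner ℂ f.l2 μ.1) ∧
    HasExp ω (wordOp [.ann f, .ann g])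
      (inner ℂ f.l2 (μ.2.2 (star g.l2)) + inner ℂ f.l2 μ.1 * inner ℂ g.l2 μ.1)

/-! ### The spaces of truncated expectations -/

/-- `‖M^j φ‖_{L²}`, with value `∞` if `φ ∉ H^j`. -/
def sobNorm {d : ℕ} (j : ℕ) (φ : L2 d) : ℝ≥0∞ :=
  ⨆ (u : Test d) (_ : ‖u.l2‖ ≤ 1), ‖inner ℂ (sobM d j u).l2 φ‖ₑ

/-- The trace norm `‖M^j γ M^j‖_{𝓛¹}`, as the supremum of `∑ᵢ |⟨uᵢ, M^j γ M^j wᵢ⟩|` over finite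
orthonormal families of test functions. -/
def traceNorm {d : ℕ} (j : ℕ) (γ : L2 d →L[ℂ] L2 d) : ℝ≥0∞ :=
  ⨆ (n : ℕ) (u : Fin n → Test d) (w : Fin n → Test d)
    (_ : Orthonormal ℂ fun i => (u i).l2) (_ : Orthonormal ℂ fun i => (w i).l2),
    ∑ i, ‖inner ℂ (sobM d j (u i)).l2 (γ (sobM d j (w i)).l2)‖ₑ

/-- The Hilbert-Schmidt norm `‖σ M^j‖_{𝓛²}`. -/
def hsNorm {d : ℕ} (j : ℕ) (σ : L2 d →L[ℂ] L2 d) : ℝ≥0∞ :=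
  (⨆ (n : ℕ) (w : Fin n → Test d) (_ : Orthonormal ℂ fun i => (w i).l2),
    ∑ i, ‖σ (sobM d j (w i)).l2‖ₑ ^ 2) ^ (1 / 2 : ℝ)

/-- `‖M^j φ‖ + ‖M^j γ M^j‖_{𝓛¹} + ‖M^j σ‖_{𝓛²} + ‖σ M^j‖_{𝓛²}`, using
`‖M^j σ‖_{𝓛²} = ‖σ* M^j‖_{𝓛²}`. -/
def XNorm {d : ℕ} (j : ℕ) (μ : Triple d) : ℝ≥0∞ :=
  sobNorm j μ.1 + traceNorm j μ.2.1 + hsNorm j (ContinuousLinearMap.adjoint μ.2.2) + hsNorm j μ.2.2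

/-- Membership in the space `X^j`. -/
def MemX {d : ℕ} (j : ℕ) (μ : Triple d) : Prop :=
  XNorm j μ < ⊤ ∧ μ.2.1.IsPositive ∧
    ∀ u, ContinuousLinearMap.adjoint μ.2.2 u = star (μ.2.2 (star u))

/-- `μ ∈ C⁰(I; X^j) ∩ C¹(I; X⁰)` (one-sided derivatives at the endpoints of `I`). -/
def MemXFamily {d : ℕ} (j : ℕ) (I : Set ℝ) (μ : ℝ → Triple d) : Prop :=
  (∀ t ∈ I, MemX j (μ t) ∧ Tendsto (fun s => XNorm j (μ s - μ t)) (𝓝[I] t) (𝓝 0)) ∧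
  ∃ μ' : ℝ → Triple d, ∀ t ∈ I, XNorm 0 (μ' t) < ⊤ ∧
    Tendsto (fun s => XNorm 0 (μ' s - μ' t)) (𝓝[I] t) (𝓝 0) ∧
    Tendsto (fun s => XNorm 0 (((s - t : ℝ) : ℂ)⁻¹ • (μ s - μ t) - μ' t))
      (𝓝[I \ {t}] t) (𝓝 0)

/-- `i ∂ₜ ωₜ(A) = ωₜ([A, ℍ])` on `I`, for all smeared monomials `A` of the form
`ψ(x)`, `ψ*(x)ψ(y)`, `ψ(x)ψ(y)`. -/
def SolvesQuasifreeEq {d : ℕ} (V v : Pt d → ℝ) (I : Set ℝ) (ω : ℝ → State d) : Prop :=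
  ∀ w ∈ quadraticMonomials d, ∃ m : ℝ → ℂ, (∀ t ∈ I, HasExp (ω t) (wordOp w) (m t)) ∧
    ∀ t ∈ I, ∃ z : ℂ, HasCommExp (ω t) (wordOp w) (wordOp (adjWord w)) (hamOp V v) z ∧
      HasDerivWithinAt m (-Complex.I * z) I t

/-! ### The energy functional -/

/-- The one-particle Hamiltonian: `(-Δ + V) u = w`. -/
def OneBodyHam {d : ℕ} (V : Pt d → ℝ) (u w : L2 d) : Prop :=
  ∀ f : Test d, ∫ x, conj (-(Δ f : Test d) x + (V x : ℂ) * f x) * u x = inner ℂ f.l2 w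

/-- `S` is a trace class operator with trace `τ`. -/
def IsTrace {d : ℕ} (S : L2 d →L[ℂ] L2 d) (τ : ℂ) : Prop :=
  traceNorm 0 S < ⊤ ∧
    ∀ (ι : Type) (e : HilbertBasis ι ℂ (L2 d)), HasSum (fun i => inner ℂ (e i) (S (e i))) τ

/-- `K ∈ L²(ℝ^d × ℝ^d)` is the integral kernel of `α`. -/
def IsKernel {d : ℕ} (α : L2 d →L[ℂ] L2 d) (K : Pt d × Pt d → ℂ) : Prop :=
  MemLp K 2 volume ∧ ∀ f g : Test d,
    inner ℂ f.l2 (α g.l2) = ∫ p : Pt d × Pt d, conj (f p.1) * K p * g p.2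

/-- `n = d(α)` is the diagonal `n(x) = α(x,x)` of the kernel of `α`: the integrable function with
`Tr(χ α) = ∫ χ(x) n(x) dx` for all test functions `χ`. -/
def IsDiagonal {d : ℕ} (α : L2 d →L[ℂ] L2 d) (n : Pt d → ℂ) : Prop :=
  Integrable n ∧ ∀ χ : Test d, ∃ S : L2 d →L[ℂ] L2 d,
    (∀ u : L2 d, (S u : Pt d → ℂ) =ᵐ[volume] fun x => χ x * (α u : Pt d → ℂ) x) ∧
    IsTrace S (∫ x, χ x * n x)

/-- `B = b[α] = v * d(α) + v ♯ α`, where the first term is a multiplication operator and the second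
term has the integral kernel `v(x-y) α(x,y)`. -/
def IsMeanField {d : ℕ} (v : Pt d → ℝ) (α B : L2 d →L[ℂ] L2 d) : Prop :=
  ∃ (n : Pt d → ℂ) (K : Pt d × Pt d → ℂ), IsDiagonal α n ∧ IsKernel α K ∧
    ∀ f g : Test d,
      Integrable (fun p : Pt d × Pt d => conj (f p.1) * ((v (p.1 - p.2) : ℂ) * n p.2) * g p.1) ∧
      Integrable (fun p : Pt d × Pt d => conj (f p.1) * ((v (p.1 - p.2) : ℂ) * K p) * g p.2) ∧
      inner ℂ f.l2 (B g.l2) =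
        (∫ p : Pt d × Pt d, conj (f p.1) * ((v (p.1 - p.2) : ℂ) * n p.2) * g p.1) +
        ∫ p : Pt d × Pt d, conj (f p.1) * ((v (p.1 - p.2) : ℂ) * K p) * g p.2

/-- The rank-one operator `|φ⟩⟨φ|`. -/
def proj {d : ℕ} (φ : L2 d) : L2 d →L[ℂ] L2 d := InnerProductSpace.rankOne ℂ φ φ

/-- All terms of the energy functional
`𝓔(φ,γ,σ) = Tr[h(γ + |φ⟩⟨φ|) + b[|φ⟩⟨φ|] γ + ½ b[γ] γ]
  + ½ ∫∫ v(x-y) |σ(x,y) + φ(x)φ(y)|² dx dy`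
are well defined, and its value is `E`. -/
def IsEnergy {d : ℕ} (V v : Pt d → ℝ) (μ : Triple d) (E : ℝ) : Prop :=
  ∃ (S B₁ B₂ : L2 d →L[ℂ] L2 d) (K : Pt d × Pt d → ℂ) (τ₁ τ₂ τ₃ : ℂ),
    (∀ u, OneBodyHam V (μ.2.1 u + proj μ.1 u) (S u)) ∧ IsTrace S τ₁ ∧
    IsMeanField v (proj μ.1) B₁ ∧ IsTrace (B₁ ∘L μ.2.1) τ₂ ∧
    IsMeanField v μ.2.1 B₂ ∧ IsTrace (B₂ ∘L μ.2.1) τ₃ ∧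
    IsKernel μ.2.2 K ∧
    Integrable (fun p : Pt d × Pt d => v (p.1 - p.2) * ‖K p + μ.1 p.1 * μ.1 p.2‖ ^ 2) ∧
    (E : ℂ) = τ₁ + τ₂ + τ₃ / 2 +
      ((1 / 2 * ∫ p : Pt d × Pt d, v (p.1 - p.2) * ‖K p + μ.1 p.1 * μ.1 p.2‖ ^ 2 : ℝ) : ℂ)

end HFB

end

open scoped NNReal

/-! ### Test functions, Bessel potentials and the bounded inverse R of M^j. -/

noncomputable section

namespace HFB

/-! ### Test functions and Sobolev operators -/

/-! The density matrix Σ|ξ_k⟩⟨ξ_k| is treated as one vector Ψ = (ξ_k) in the Hilbert sum `G`, so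
that ω(A) = ⟨Ψ, AΨ⟩, and monomials in the fields become vectors `W L` whose Gram matrix consists of
moments. For A of degree at most two the equation of motion says that ⟨Ψ, AΨ⟩ has derivative
-i(⟨A*Ψ, ℍΨ⟩ - ⟨ℍΨ, AΨ⟩). For a quartic monomial, Wick's theorem makes ω(A) a polynomial in moments
of order at most two, and the product rule gives its derivative. The point of the proof is that the
result is again this bracket, with AΨ and A*Ψ replaced by their orthogonal projections ΠAΨ and ΠA*Ψ
onto the closed span of the polynomials of degree at most two (`Quasifree.Pl_four`,
`WordDeriv.follows_four`).

This law applies to A = ℍ, where the bracket is ⟨ΠℍΨ, ℍΨ⟩ - ⟨ℍΨ, ΠℍΨ⟩ = 0 because Π is self-adjoint: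
the energy is conserved. If A is at most quadratic, then ΠAΨ = AΨ, and the bracket is the
expectation of [A, ℍ], which vanishes when A commutes with ℍ. For the particle number it vanishes
because ℍ is symmetric in every n-particle sector.

Analytically, all these operators must be applicable to Ψ. Contracting one field at a time with
Wick's theorem bounds the moments with one factor M^j, and hence Σ (1+n)^4 ‖M^j ξ_{k,n}‖² with M^j
acting on the first variable (`exists_moment_bound`, `exists_totalWeight_bound`), locally uniformly
in time. So ξ_{k,n} = (R ⊗ 1)χ with R = M^{-j}, and every normal ordered operator with at most two
creation and two annihilation operators and kernel B R^{-1}, B bounded, acts on Ψ (`Cell.nvec`). As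
j ≥ 2, the relative bounds on V and v put both parts of ℍ into this form. The vector depends
linearly on B and continuously under strong convergence, and for suitable rank-one B it comes from a
monomial; identities for monomials therefore extend to all kernels that have a formal adjoint
(`Cell.pair_induction`). The evolution law is kept in the integrated form `Follows`, which survives
these limits.

The energy formula follows from the same density argument. Writing γ = Σ|R y_i⟩⟨R y_i| turns each
term of the functional into an absolutely convergent sum that is strongly continuous in the kernel,
and on rank-one kernels it agrees with the expectation by Wick's theorem (`Cell.functional_ext`,
`Decomp.expect_one`, `Decomp.expect_two`). -/

theorem Test.coeFn_l2 {d : ℕ} (f : Test d) : (f.l2 : Pt d → ℂ) =ᵐ[volume] f :=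
  f.coeFn_toLp 2 volume

theorem Test.l2_add {d : ℕ} (f g : Test d) : (f + g).l2 = f.l2 + g.l2 :=
  map_add (SchwartzMap.toLpCLM ℂ ℂ 2 (volume : Measure (Pt d))) f g

theorem Test.l2_smul {d : ℕ} (c : ℂ) (f : Test d) : (c • f).l2 = c • f.l2 :=
  map_smul (SchwartzMap.toLpCLM ℂ ℂ 2 (volume : Measure (Pt d))) c f

/-- The inclusion of test functions into `L²`, as a linear map. -/
def Test.toL2 (d : ℕ) : Test d →ₗ[ℂ] L2 d :=
  (SchwartzMap.toLpCLM ℂ ℂ 2 (volume : Measure (Pt d))).toLinearMap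

@[simp] theorem Test.toL2_apply {d : ℕ} (f : Test d) : Test.toL2 d f = f.l2 := rfl

theorem Test.denseRange_l2 (d : ℕ) : DenseRange (fun f : Test d => f.l2) :=
  SchwartzMap.denseRange_toLpCLM (F := ℂ) (p := 2) (μ := (volume : Measure (Pt d))) (by simp)

theorem Test.l2_injective {d : ℕ} : Function.Injective (fun f : Test d => f.l2) :=
  SchwartzMap.injective_toLp 2 volume

theorem Test.norm_l2 {d : ℕ} (f : Test d) : ‖f.l2‖ = (eLpNorm f 2 volume).toReal :=
  SchwartzMap.norm_toLp

theorem Test.inner_l2 {d : ℕ} (f g : Test d) : inner ℂ f.l2 g.l2 = ∫ x, conj (f x) * g x := by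
  refine (SchwartzMap.inner_toL2_toL2_eq f g volume).trans ?_
  simp [mul_comm]

theorem ext_inner_test {d : ℕ} {u w : L2 d} (h : ∀ f : Test d, inner ℂ f.l2 u = inner ℂ f.l2 w) :
    u = w := by
  refine ext_inner_left ℂ fun x => ?_
  refine (Test.denseRange_l2 d).induction_on x ?_ h
  exact isClosed_eq (by fun_prop) (by fun_prop)

theorem exists_seq_test {d : ℕ} (u : L2 d) :
    ∃ f : ℕ → Test d, Tendsto (fun n => (f n).l2) atTop (𝓝 u) := by
  have h := (Test.denseRange_l2 d) u
  rw [mem_closure_iff_seq_limit] at h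
  obtain ⟨x, hx, hx2⟩ := h
  choose f hf using hx
  exact ⟨f, by simpa only [hf] using hx2⟩

/-- A linear map on test functions, bounded in `L²`, extends to `L²`. -/
theorem exists_extension {d : ℕ} {E : Type*} [NormedAddCommGroup E] [NormedSpace ℂ E]
    [CompleteSpace E] (A : Test d →ₗ[ℂ] E) (C : ℝ) (hA : ∀ f : Test d, ‖A f‖ ≤ C * ‖f.l2‖) :
    ∃ B : L2 d →L[ℂ] E, (∀ f : Test d, B f.l2 = A f) ∧ ∀ u, ‖B u‖ ≤ C * ‖u‖ :=
  ⟨A.extendOfNorm (Test.toL2 d),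
    fun f => A.extendOfNorm_eq (Test.denseRange_l2 d) ⟨C, hA⟩ f,
    fun u => A.norm_extendOfNorm_apply_le (Test.denseRange_l2 d) C hA u⟩

/-- The Fourier symbol `(1 + |2πk|²)^{s/2}` with a real exponent. -/
def bessel (d : ℕ) (s : ℝ) (k : Pt d) : ℝ := (1 + ‖(2 * Real.pi) • k‖ ^ 2) ^ (s / 2)

theorem bessel_real_hasTemperateGrowth (d : ℕ) (s : ℝ) :
    (fun k => bessel d s k).HasTemperateGrowth := by
  have h : (fun x : Pt d => ((1 + ‖x‖ ^ 2) ^ (s / 2) : ℝ)).HasTemperateGrowth := by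
    fun_prop
  exact h.comp ((2 * Real.pi) • ContinuousLinearMap.id ℝ (Pt d)).hasTemperateGrowth

theorem bessel_hasTemperateGrowth (d : ℕ) (s : ℝ) :
    (fun k => ((bessel d s k : ℝ) : ℂ)).HasTemperateGrowth :=
  (Complex.ofRealCLM.hasTemperateGrowth).comp (bessel_real_hasTemperateGrowth d s)

theorem bessel_pos {d : ℕ} (s : ℝ) (k : Pt d) : 0 < bessel d s k := by
  unfold bessel; positivity

theorem bessel_mul {d : ℕ} (s t : ℝ) (k : Pt d) : bessel d s k * bessel d t k = bessel d (s + t) k := by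
  unfold bessel
  rw [← Real.rpow_add (by positivity)]
  congr 1; ring

theorem bessel_zero {d : ℕ} (k : Pt d) : bessel d 0 k = 1 := by simp [bessel]

theorem bessel_mono {d : ℕ} {s t : ℝ} (h : s ≤ t) (k : Pt d) : bessel d s k ≤ bessel d t k := by
  unfold bessel
  apply Real.rpow_le_rpow_of_exponent_le
  · nlinarith [sq_nonneg ‖(2 * Real.pi) • k‖]
  · linarith

/-- `M^s = (1 - Δ)^{s/2}` for real `s`, on test functions. -/
def besselM (d : ℕ) (s : ℝ) : Test d →L[ℂ] Test d :=
  SchwartzMap.fourierMultiplierCLM ℂ (fun k => ((bessel d s k : ℝ) : ℂ))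

theorem sobM_eq (d j : ℕ) : sobM d j = besselM d j := rfl

theorem besselM_besselM {d : ℕ} (s t : ℝ) (f : Test d) :
    besselM d s (besselM d t f) = besselM d (s + t) f := by
  unfold besselM
  rw [SchwartzMap.fourierMultiplierCLM_fourierMultiplierCLM_apply
    (bessel_hasTemperateGrowth d s) (bessel_hasTemperateGrowth d t)]
  congr 2
  funext k
  simp only [Pi.mul_apply]
  rw [← Complex.ofReal_mul, bessel_mul]

theorem besselM_zero {d : ℕ} (f : Test d) : besselM d 0 f = f := by
  unfold besselM
  simp [bessel_zero]

/-- By Plancherel both sides are norms of symbol times Fourier transform, so a pointwise comparison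
of the symbols suffices. -/
theorem norm_multiplier_le {d : ℕ} {g h : Pt d → ℂ} (hg : g.HasTemperateGrowth)
    (hh : h.HasTemperateGrowth) (hle : ∀ k, ‖g k‖ ≤ ‖h k‖) (f : Test d) :
    ‖Test.l2 (SchwartzMap.fourierMultiplierCLM ℂ g f)‖ ≤
      ‖Test.l2 (SchwartzMap.fourierMultiplierCLM ℂ h f)‖ := by
  have key : ∀ g : Pt d → ℂ, ‖Test.l2 (SchwartzMap.fourierMultiplierCLM ℂ g f)‖ =
      ‖Test.l2 (SchwartzMap.smulLeftCLM ℂ g (FourierTransform.fourier f))‖ := by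
    intro g
    rw [← SchwartzMap.norm_fourier_toL2_eq, SchwartzMap.fourierMultiplierCLM_apply,
      FourierTransform.fourier_fourierInv_eq]
  rw [key, key, Test.norm_l2, Test.norm_l2]
  apply ENNReal.toReal_mono (SchwartzMap.eLpNorm_lt_top _ 2 volume).ne
  apply eLpNorm_mono
  intro k
  rw [SchwartzMap.smulLeftCLM_apply_apply hg, SchwartzMap.smulLeftCLM_apply_apply hh,
    norm_smul, norm_smul]
  gcongr
  exact hle k

theorem norm_besselM_mono {d : ℕ} {s t : ℝ} (h : s ≤ t) (f : Test d) :
    ‖(besselM d s f).l2‖ ≤ ‖(besselM d t f).l2‖ := by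
  refine norm_multiplier_le (bessel_hasTemperateGrowth d s) (bessel_hasTemperateGrowth d t) ?_ f
  intro k
  simp only [Complex.norm_real, Real.norm_eq_abs, abs_of_pos (bessel_pos _ k)]
  exact bessel_mono h k

theorem inner_besselM {d : ℕ} (s : ℝ) (f g : Test d) :
    inner ℂ (besselM d s f).l2 g.l2 = inner ℂ f.l2 (besselM d s g).l2 := by
  have h1 : inner ℂ (besselM d s f).l2 g.l2 = inner ℂ
      (Test.l2 (SchwartzMap.smulLeftCLM ℂ (fun k => ((bessel d s k : ℝ) : ℂ))
        (FourierTransform.fourier f))) (Test.l2 (FourierTransform.fourier g)) := by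
    rw [← SchwartzMap.inner_fourier_toL2_eq, besselM, SchwartzMap.fourierMultiplierCLM_apply,
      FourierTransform.fourier_fourierInv_eq]
  have h2 : inner ℂ f.l2 (besselM d s g).l2 = inner ℂ (Test.l2 (FourierTransform.fourier f))
      (Test.l2 (SchwartzMap.smulLeftCLM ℂ (fun k => ((bessel d s k : ℝ) : ℂ))
        (FourierTransform.fourier g))) := by
    rw [← SchwartzMap.inner_fourier_toL2_eq, besselM, SchwartzMap.fourierMultiplierCLM_apply,
      FourierTransform.fourier_fourierInv_eq]
  rw [h1, h2, Test.inner_l2, Test.inner_l2]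
  congr 1
  funext k
  rw [SchwartzMap.smulLeftCLM_apply_apply (bessel_hasTemperateGrowth d s),
    SchwartzMap.smulLeftCLM_apply_apply (bessel_hasTemperateGrowth d s)]
  simp [mul_comm, mul_left_comm]

theorem norm_laplacian_le {d : ℕ} (f : Test d) : ‖(Δ f : Test d).l2‖ ≤ ‖(besselM d 2 f).l2‖ := by
  have ht : (fun k : Pt d => (-(2 * Real.pi) ^ 2 : ℂ) * ((‖k‖ ^ 2 : ℝ) : ℂ)).HasTemperateGrowth := by
    fun_prop
  have h : (Δ f : Test d) = SchwartzMap.fourierMultiplierCLM ℂ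
      (fun k : Pt d => (-(2 * Real.pi) ^ 2 : ℂ) * ((‖k‖ ^ 2 : ℝ) : ℂ)) f := by
    have ht2 : (fun k : Pt d => (((‖k‖ ^ 2 : ℝ)) : ℂ)).HasTemperateGrowth := by fun_prop
    have h3 : (fun k : Pt d => (-(2 * Real.pi) ^ 2 : ℂ) * ((‖k‖ ^ 2 : ℝ) : ℂ)) =
        (-(2 * Real.pi) ^ 2 : ℂ) • (fun k : Pt d => (((‖k‖ ^ 2 : ℝ)) : ℂ)) := rfl
    have h4 := SchwartzMap.fourierMultiplierCLM_ofReal ℂ (g := fun k : Pt d => ‖k‖ ^ 2)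
      (by fun_prop) f
    rw [h3, SchwartzMap.fourierMultiplierCLM_smul ht2, SchwartzMap.laplacian_eq_fourierMultiplierCLM]
    change _ = (-(2 * Real.pi) ^ 2 : ℂ) • (SchwartzMap.fourierMultiplierCLM ℂ _ f)
    have h4' : (SchwartzMap.fourierMultiplierCLM ℂ (fun k : Pt d => (((‖k‖ ^ 2 : ℝ)) : ℂ)) f) =
      SchwartzMap.fourierMultiplierCLM ℂ (fun k : Pt d => ‖k‖ ^ 2) f := h4
    rw [h4']
    ext x
    simp
  rw [h]
  refine norm_multiplier_le ht (bessel_hasTemperateGrowth d 2) ?_ f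
  intro k
  have : bessel d 2 k = 1 + (2 * Real.pi) ^ 2 * ‖k‖ ^ 2 := by
    simp [bessel, norm_smul, mul_pow, abs_of_pos Real.pi_pos]
  rw [Complex.norm_real, this, norm_mul, Complex.norm_real, Real.norm_of_nonneg (by positivity),
    Real.norm_of_nonneg (by positivity)]
  have : ‖(-(2 * Real.pi) ^ 2 : ℂ)‖ = (2 * Real.pi) ^ 2 := by
    simp [abs_of_pos Real.pi_pos]
  rw [this]; linarith

theorem norm_besselM_neg_le {d : ℕ} {s : ℝ} (hs : 0 ≤ s) (f : Test d) :
    ‖(besselM d (-s) f).l2‖ ≤ ‖f.l2‖ := by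
  simpa [besselM_zero] using norm_besselM_mono (d := d) (s := -s) (t := 0) (by linarith) f

theorem sobM_besselM_neg {d j : ℕ} (f : Test d) : sobM d j (besselM d (-j) f) = f := by
  rw [sobM_eq, besselM_besselM, add_neg_cancel, besselM_zero]

theorem besselM_neg_sobM {d j : ℕ} (f : Test d) : besselM d (-j) (sobM d j f) = f := by
  rw [sobM_eq, besselM_besselM, neg_add_cancel, besselM_zero]

theorem exists_resolvent (d j : ℕ) : ∃ B : L2 d →L[ℂ] L2 d,
    (∀ f : Test d, B f.l2 = (besselM d (-j) f).l2) ∧ ∀ u, ‖B u‖ ≤ 1 * ‖u‖ :=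
  exists_extension (Test.toL2 d ∘ₗ (besselM d (-j)).toLinearMap) 1 fun f => by
    simpa using norm_besselM_neg_le (d := d) (s := j) (by positivity) f

/-- The bounded operator `R = M^{-j}` on `L²`; its range is `H^j`. -/
def resolv (d j : ℕ) : L2 d →L[ℂ] L2 d := (exists_resolvent d j).choose

theorem resolv_test {d j : ℕ} (f : Test d) : resolv d j f.l2 = (besselM d (-j) f).l2 :=
  (exists_resolvent d j).choose_spec.1 f

theorem norm_resolv_le {d j : ℕ} (u : L2 d) : ‖resolv d j u‖ ≤ ‖u‖ :=
  (((exists_resolvent d j).choose_spec.2 u).trans_eq (one_mul _))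

theorem resolv_sobM {d j : ℕ} (f : Test d) : resolv d j (sobM d j f).l2 = f.l2 := by
  rw [resolv_test, besselM_neg_sobM]

theorem inner_resolv {d j : ℕ} (u w : L2 d) :
    inner ℂ (resolv d j u) w = inner ℂ u (resolv d j w) := by
  refine (Test.denseRange_l2 d).induction_on₂ (p := fun u w : L2 d =>
    inner ℂ (resolv d j u) w = inner ℂ u (resolv d j w)) ?_ ?_ u w
  · exact isClosed_eq (by fun_prop) (by fun_prop)
  · intro f g
    rw [resolv_test, resolv_test, inner_besselM]

theorem adjoint_resolv (d j : ℕ) : ContinuousLinearMap.adjoint (resolv d j) = resolv d j := by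
  refine ContinuousLinearMap.ext fun u => ext_inner_left ℂ fun w => ?_
  rw [ContinuousLinearMap.adjoint_inner_right, inner_resolv]

/-- On test functions R is the square of the symmetric operator M^{-j/2}; density gives the rest.
Positivity is what makes R + ε bounded below. -/
theorem re_inner_resolv_nonneg {d j : ℕ} (u : L2 d) : 0 ≤ (inner ℂ u (resolv d j u)).re := by
  refine (Test.denseRange_l2 d).induction_on (p := fun u : L2 d =>
    0 ≤ (inner ℂ u (resolv d j u)).re) u ?_ ?_
  · exact isClosed_le continuous_const (Complex.continuous_re.comp (by fun_prop))
  · intro f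
    have h : besselM d (-j) f = besselM d (-j / 2) (besselM d (-j / 2) f) := by
      rw [besselM_besselM]; congr 1; ring_nf
    rw [resolv_test, h, ← inner_besselM]
    rw [inner_self_eq_norm_sq_to_K]
    norm_cast
    exact sq_nonneg _

theorem inner_sobM_resolv {d j : ℕ} (f : Test d) (u : L2 d) :
    inner ℂ (sobM d j f).l2 (resolv d j u) = inner ℂ f.l2 u := by
  rw [← inner_resolv, resolv_sobM]

/-- Functional calculus: regularized inverse `(R + ε)⁻¹`. -/
theorem exists_regularized_inverse (d j : ℕ) {ε : ℝ} (hε : 0 < ε) : ∃ D : L2 d →L[ℂ] L2 d,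
    ContinuousLinearMap.adjoint D = D ∧ (∀ u, resolv d j (D u) = D (resolv d j u)) ∧
    (∀ u, D (resolv d j u) + (ε : ℂ) • D u = u) ∧ (∀ u, ‖D (resolv d j u)‖ ≤ ‖u‖) ∧
    (∀ u, ε * ‖D u‖ ≤ ‖u‖) := by
  set T : L2 d →L[ℂ] L2 d := resolv d j + (ε : ℂ) • ContinuousLinearMap.id ℂ _ with hT
  have hTa : ∀ u, T u = resolv d j u + (ε : ℂ) • u := fun u => rfl
  -- The cross term is nonnegative since R ≥ 0. Dropping terms gives both lower bounds below, which
  -- later become ‖ε D‖ ≤ 1 and ‖D R‖ ≤ 1.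
  have hsq : ∀ u, ‖T u‖ ^ 2 = ‖resolv d j u‖ ^ 2 +
      2 * ε * (inner ℂ u (resolv d j u)).re + ε ^ 2 * ‖u‖ ^ 2 := by
    intro u
    rw [hTa, @norm_add_sq ℂ, inner_smul_right, norm_smul, inner_resolv]
    simp [mul_pow]
    ring
  have hlow : ∀ u, ε * ‖u‖ ≤ ‖T u‖ := by
    intro u
    refine le_of_sq_le_sq ?_ (norm_nonneg _)
    rw [hsq, mul_pow]
    have := re_inner_resolv_nonneg (j := j) u
    nlinarith [sq_nonneg ‖resolv d j u‖, mul_nonneg hε.le this]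
  have hlow2 : ∀ u, ‖resolv d j u‖ ≤ ‖T u‖ := by
    intro u
    refine le_of_sq_le_sq ?_ (norm_nonneg _)
    rw [hsq]
    have := re_inner_resolv_nonneg (j := j) u
    nlinarith [sq_nonneg (ε * ‖u‖), mul_nonneg hε.le this]
  have hTs : ∀ u w, inner ℂ (T u) w = inner ℂ u (T w) := by
    intro u w
    rw [hTa, hTa, inner_add_left, inner_add_right, inner_resolv, inner_smul_left, inner_smul_right]
    simp
  have hinj : T.ker = ⊥ := by
    rw [LinearMap.ker_eq_bot']
    intro u hu
    have := hlow u
    have hu' : T u = 0 := hu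
    rw [hu', norm_zero] at this
    exact norm_le_zero_iff.1 (by nlinarith [norm_nonneg u])
  have hanti : AntilipschitzWith (Real.toNNReal ε⁻¹) T := by
    refine T.antilipschitz_of_bound fun u => ?_
    rw [Real.coe_toNNReal _ (by positivity)]
    rw [inv_mul_eq_div, le_div_iff₀ hε]
    linarith [hlow u]
  -- The lower bound makes the range closed, and its orthogonal complement is the kernel of the
  -- symmetric operator T, hence trivial.
  have hrange : T.range = ⊤ := by
    have hcl : IsClosed (T.range : Set (L2 d)) := by
      rw [LinearMap.coe_range]
      exact hanti.isClosed_range T.uniformContinuous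
    have : CompleteSpace T.range := hcl.completeSpace_coe
    rw [← Submodule.orthogonal_eq_bot_iff, Submodule.eq_bot_iff]
    intro x hx
    have hx2 : T x = 0 := by
      refine ext_inner_right ℂ fun w => ?_
      rw [hTs, inner_zero_left, ← inner_conj_symm, (Submodule.mem_orthogonal _ _).1 hx (T w) ⟨w, rfl⟩,
        map_zero]
    have := hlow x
    rw [hx2, norm_zero] at this
    exact norm_le_zero_iff.1 (by nlinarith [norm_nonneg x])
  set e := ContinuousLinearEquiv.ofBijective T hinj hrange with he
  have he' : ∀ u, e u = T u := fun u => rfl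
  set D : L2 d →L[ℂ] L2 d := (e.symm : L2 d →L[ℂ] L2 d) with hD
  have hTD : ∀ u, T (D u) = u := fun u => by rw [← he']; exact e.apply_symm_apply u
  have hDT : ∀ u, D (T u) = u := fun u => by rw [← he']; exact e.symm_apply_apply u
  have hcomm : ∀ u, resolv d j (D u) = D (resolv d j u) := by
    intro u
    have h1 : T (resolv d j (D u)) = resolv d j u := by
      rw [hTa]
      conv_rhs => rw [← hTD u, hTa, map_add, map_smul]
    rw [← h1, hDT]
  refine ⟨D, ?_, hcomm, ?_, ?_, ?_⟩
  · refine ContinuousLinearMap.ext fun u => ext_inner_left ℂ fun w => ?_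
    rw [ContinuousLinearMap.adjoint_inner_right]
    conv_lhs => rw [← hTD u, ← hTs, hTD]
  · intro u
    rw [← hcomm, ← hTa, hTD]
  · intro u
    rw [← hcomm]
    simpa [hTD] using hlow2 (D u)
  · intro u
    simpa [hTD] using hlow (D u)

theorem resolv_injective {d j : ℕ} {u : L2 d} (h : resolv d j u = 0) : u = 0 := by
  refine ext_inner_test fun f => ?_
  rw [← inner_sobM_resolv (j := j), h, inner_zero_right, inner_zero_right]

/-- R is self-adjoint and injective, so nothing is orthogonal to its range. -/
theorem denseRange_resolv (d j : ℕ) : DenseRange (resolv d j) := by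
  have h : (resolv d j).range.topologicalClosure = ⊤ := by
    rw [Submodule.topologicalClosure_eq_top_iff, Submodule.eq_bot_iff]
    intro x hx
    apply resolv_injective (j := j)
    refine ext_inner_right ℂ fun w => ?_
    rw [inner_resolv, inner_zero_left, ← inner_conj_symm]
    have := (Submodule.mem_orthogonal _ _).1 hx (resolv d j w) ⟨w, rfl⟩
    rw [this, map_zero]
  intro x
  have : x ∈ ((resolv d j).range.topologicalClosure : Set (L2 d)) := by rw [h]; trivial
  exact this

/-- Approximate inverses `Dₙ` of `R = M^{-j}`: bounded, self-adjoint, with `Dₙ R → 1` strongly. -/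
theorem exists_regularization (d j : ℕ) : ∃ D : ℕ → L2 d →L[ℂ] L2 d,
    (∀ n, ContinuousLinearMap.adjoint (D n) = D n) ∧
    (∀ n u, resolv d j (D n u) = D n (resolv d j u)) ∧
    (∀ n u, ‖D n (resolv d j u)‖ ≤ ‖u‖) ∧
    ∀ u, Tendsto (fun n => D n (resolv d j u)) atTop (𝓝 u) := by
  have hpos : ∀ n : ℕ, (0 : ℝ) < 1 / ((n : ℝ) + 1) := fun n => by positivity
  choose D h1 h2 h3 h4 h5 using fun n : ℕ => exists_regularized_inverse d j (hpos n)
  refine ⟨D, h1, h2, h4, fun u => ?_⟩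
  -- D R - 1 = -ε D is a contraction on all of L², and has size at most ε‖w‖ on vectors R w. Density
  -- of the range of R then gives strong convergence.
  have hdiff : ∀ n w, ‖D n (resolv d j w) - w‖ ≤ ‖w‖ := by
    intro n w
    have : D n (resolv d j w) - w = -(((1 / ((n : ℝ) + 1) : ℝ) : ℂ) • D n w) := by
      rw [sub_eq_iff_eq_add, ← sub_eq_neg_add, eq_sub_iff_add_eq]; exact h3 n w
    rw [this, norm_neg, norm_smul, Complex.norm_real, Real.norm_of_nonneg (hpos n).le]
    exact h5 n w
  have hran : ∀ n w, ‖D n (resolv d j (resolv d j w)) - resolv d j w‖ ≤ 1 / ((n : ℝ) + 1) * ‖w‖ := by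
    intro n w
    have e3 := h3 n (resolv d j w)
    have : D n (resolv d j (resolv d j w)) - resolv d j w =
        -(((1 / ((n : ℝ) + 1) : ℝ) : ℂ) • D n (resolv d j w)) := by
      rw [sub_eq_iff_eq_add, ← sub_eq_neg_add, eq_sub_iff_add_eq]; exact e3
    rw [this, norm_neg, norm_smul, Complex.norm_real, Real.norm_of_nonneg (hpos n).le]
    gcongr
    exact h4 n w
  rw [Metric.tendsto_atTop]
  intro ε hε
  obtain ⟨w, hw⟩ := Metric.mem_closure_range_iff.1 (denseRange_resolv d j u) (ε / 3) (by positivity)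
  rw [dist_eq_norm] at hw
  obtain ⟨N, hN⟩ := exists_nat_gt (3 * ‖w‖ / ε)
  refine ⟨N, fun n hn => ?_⟩
  rw [dist_eq_norm]
  have e1 : D n (resolv d j u) - u = (D n (resolv d j (u - resolv d j w)) - (u - resolv d j w)) +
      (D n (resolv d j (resolv d j w)) - resolv d j w) := by
    rw [map_sub, map_sub]; abel
  rw [e1]
  have b1 := hdiff n (u - resolv d j w)
  have b2 := hran n w
  have b3 : 1 / ((n : ℝ) + 1) * ‖w‖ ≤ ε / 3 := by
    have hn' : (N : ℝ) ≤ n := by exact_mod_cast hn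
    rw [div_mul_eq_mul_div, one_mul, div_le_iff₀ (by positivity)]
    rw [div_lt_iff₀ hε] at hN
    nlinarith [norm_nonneg w]
  calc _ ≤ _ := norm_add_le _ _
    _ < ε := by linarith

end HFB
end

/-! ### Orthonormal bases of test functions and relatively bounded potentials. -/

noncomputable section

namespace HFB

/-! ### Schwartz bases adapted to `H^j` -/

/-- An orthonormal basis of `L²` of test functions whose span is a core of `M^j`. -/
structure SobBasis (d j : ℕ) where
  ι : Type
  countable : Countable ι
  b : HilbertBasis ι ℂ (L2 d)
  f : ι → Test d
  hf : ∀ i, (f i).l2 = b i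
  core : ∀ φ χ : L2 d, (∀ i, inner ℂ (sobM d j (f i)).l2 φ = inner ℂ (b i) χ) → φ = resolv d j χ

theorem exists_dense_seq_test (d : ℕ) : ∃ e : ℕ → Test d, DenseRange fun n => (e n).l2 := by
  have : Fact ((2 : ℝ≥0∞) ≠ ⊤) := ⟨by simp⟩
  have hd : Dense (Set.range fun f : Test d => f.l2) := Test.denseRange_l2 d
  obtain ⟨t, ht, htc, htd⟩ := hd.exists_countable_dense_subset
  have hne : t.Nonempty := htd.nonempty
  obtain ⟨e, he⟩ := htc.exists_eq_range hne
  have : ∀ n, ∃ f : Test d, f.l2 = e n := fun n => ht (he ▸ ⟨n, rfl⟩)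
  choose f hf using this
  refine ⟨f, ?_⟩
  simp only [hf]
  rw [DenseRange, ← he]; exact htd

/-- The basis is the Gram-Schmidt orthonormalization of M^{-j} e_n for a sequence e_n of test
functions dense in L². The span is unchanged, so M^j maps it onto a space containing all e_n; this
gives the core property, and completeness of the basis follows from it. -/
theorem nonempty_sobBasis (d j : ℕ) : Nonempty (SobBasis d j) := by
  obtain ⟨e, he⟩ := exists_dense_seq_test d
  set w : ℕ → L2 d := fun n => (besselM d (-j) (e n)).l2 with hw
  have hwR : ∀ n, w n = resolv d j (e n).l2 := fun n => (resolv_test _).symm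
  set g := InnerProductSpace.gramSchmidtNormed ℂ w with hg
  have hspan : Submodule.span ℂ (Set.range g) = Submodule.span ℂ (Set.range w) := by
    rw [hg, InnerProductSpace.span_gramSchmidtNormed_range, InnerProductSpace.span_gramSchmidt]
  have hgt : ∀ n, ∃ f : Test d, f.l2 = g n := by
    intro n
    have h1 : g n ∈ Submodule.span ℂ (Set.range w) := hspan ▸ Submodule.subset_span ⟨n, rfl⟩
    have h2 : Submodule.span ℂ (Set.range w) ≤ LinearMap.range (Test.toL2 d) := by
      rw [Submodule.span_le]
      rintro _ ⟨n, rfl⟩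
      exact ⟨besselM d (-j) (e n), rfl⟩
    exact h2 h1
  choose f hf using hgt
  have hcore : ∀ φ χ : L2 d, (∀ n, inner ℂ (sobM d j (f n)).l2 φ = inner ℂ (f n).l2 χ) →
      φ = resolv d j χ := by
    intro φ χ h
    let S : Submodule ℂ (L2 d) :=
      { carrier := {p | ∃ u : Test d, u.l2 = p ∧
          inner ℂ (sobM d j u).l2 φ = inner ℂ u.l2 χ}
        zero_mem' := ⟨0, (Test.toL2 d).map_zero, by
          have h0 : (0 : Test d).l2 = 0 := (Test.toL2 d).map_zero
          rw [map_zero, h0, inner_zero_left, inner_zero_left]⟩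
        add_mem' := by
          rintro _ _ ⟨u, rfl, hu⟩ ⟨v, rfl, hv⟩
          refine ⟨u + v, Test.l2_add u v, ?_⟩
          rw [map_add, Test.l2_add, Test.l2_add, inner_add_left, inner_add_left, hu, hv]
        smul_mem' := by
          rintro c _ ⟨u, rfl, hu⟩
          refine ⟨c • u, Test.l2_smul c u, ?_⟩
          rw [map_smul, Test.l2_smul, Test.l2_smul, inner_smul_left, inner_smul_left, hu] }
    have hS : Submodule.span ℂ (Set.range g) ≤ S := by
      rw [Submodule.span_le]
      rintro _ ⟨n, rfl⟩
      exact ⟨f n, hf n, h n⟩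
    -- The hypothesis passes to the span, hence to M^{-j} e_n, where M^j cancels and leaves e_n.
    have hwS : ∀ n, inner ℂ (e n).l2 φ = inner ℂ (e n).l2 (resolv d j χ) := by
      intro n
      have h1 : w n ∈ Submodule.span ℂ (Set.range g) := hspan ▸ Submodule.subset_span ⟨n, rfl⟩
      obtain ⟨u, hu, hu2⟩ := hS h1
      have : u = besselM d (-j) (e n) := Test.l2_injective hu
      rw [this, sobM_besselM_neg, ← resolv_test, inner_resolv] at hu2
      exact hu2
    refine ext_inner_left ℂ fun x => ?_
    exact he.induction_on (p := fun x => inner ℂ x φ = inner ℂ x (resolv d j χ)) x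
      (isClosed_eq (by fun_prop) (by fun_prop)) hwS
  have hon := InnerProductSpace.gramSchmidtNormed_orthonormal' (𝕜 := ℂ) w
  set ι : Type := ↥{i : ℕ | InnerProductSpace.gramSchmidtNormed ℂ w i ≠ 0} with hι
  have hz : ∀ n, g n = 0 → f n = 0 := by
    intro n hn
    apply Test.l2_injective
    change (f n).l2 = (Test.toL2 d) 0
    rw [hf, hn, map_zero]
  have hcore' : ∀ φ χ : L2 d, (∀ i : ι, inner ℂ (sobM d j (f i)).l2 φ = inner ℂ (g i) χ) →
      φ = resolv d j χ := by
    intro φ χ h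
    refine hcore φ χ fun n => ?_
    by_cases hn : g n = 0
    · have h0 : (0 : Test d).l2 = 0 := (Test.toL2 d).map_zero
      rw [hz n hn, map_zero, h0, inner_zero_left, inner_zero_left]
    · rw [hf]; exact h ⟨n, hn⟩
  -- A vector x orthogonal to the basis satisfies the core condition with φ = 0 and χ = x, so R x =
  -- 0 and x = 0.
  have hbot : (Submodule.span ℂ (Set.range fun i : ι => g i))ᗮ = ⊥ := by
    rw [Submodule.eq_bot_iff]
    intro x hx
    have h1 : ∀ i : ι, inner ℂ (g i) x = 0 := fun i =>
      (Submodule.mem_orthogonal _ _).1 hx _ (Submodule.subset_span ⟨i, rfl⟩)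
    have := hcore' 0 x fun i => by rw [inner_zero_right, h1]
    exact resolv_injective (j := j) this.symm
  refine ⟨⟨ι, inferInstance, HilbertBasis.mkOfOrthogonalEqBot hon hbot, fun i => f i, ?_, ?_⟩⟩
  · intro i; rw [HilbertBasis.coe_mkOfOrthogonalEqBot]; exact hf i
  · intro φ χ h
    refine hcore' φ χ fun i => ?_
    have := h i
    rwa [HilbertBasis.coe_mkOfOrthogonalEqBot] at this

/-- A fixed basis of test functions adapted to `H^j`. -/
def basis (d j : ℕ) : SobBasis d j := (nonempty_sobBasis d j).some

theorem hasSum_norm_sq_hilbertBasis {ι E : Type*} [NormedAddCommGroup E] [InnerProductSpace ℂ E]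
    (b : HilbertBasis ι ℂ E) (x : E) :
    HasSum (fun i => ‖(inner ℂ (b i) x : ℂ)‖ ^ 2) (‖x‖ ^ 2) := by
  have h := (b.hasSum_inner_mul_inner x x).mapL Complex.reCLM
  have h2 : Complex.reCLM (inner ℂ x x) = ‖x‖ ^ 2 := by
    rw [Complex.reCLM_apply, inner_self_eq_norm_sq_to_K]; norm_cast
  rw [h2] at h
  refine h.congr_fun ?_ |> fun h => h
  intro i
  rw [Complex.reCLM_apply, ← inner_conj_symm x, ← Complex.normSq_eq_conj_mul_self, Complex.ofReal_re,
    Complex.normSq_eq_norm_sq]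

theorem tsum_enorm_sq_hilbertBasis {ι E : Type*} [NormedAddCommGroup E] [InnerProductSpace ℂ E]
    (b : HilbertBasis ι ℂ E) (x : E) :
    ∑' i, ‖(inner ℂ (b i) x : ℂ)‖ₑ ^ 2 = ‖x‖ₑ ^ 2 := by
  have h := hasSum_norm_sq_hilbertBasis b x
  have : ∀ i, ‖(inner ℂ (b i) x : ℂ)‖ₑ ^ 2 = ENNReal.ofReal (‖(inner ℂ (b i) x : ℂ)‖ ^ 2) := by
    intro i
    rw [ENNReal.ofReal_pow (norm_nonneg _), ofReal_norm]
  simp_rw [this]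
  rw [← ENNReal.ofReal_tsum_of_nonneg (fun _ => by positivity) h.summable, h.tsum_eq,
    ENNReal.ofReal_pow (norm_nonneg _), ofReal_norm]

/-- Vectors given by square summable coefficients. -/
theorem exists_of_tsum_enorm_sq {ι E : Type*} [NormedAddCommGroup E] [InnerProductSpace ℂ E]
    (b : HilbertBasis ι ℂ E) (c : ι → ℂ) (hc : ∑' i, ‖c i‖ₑ ^ 2 < ⊤) :
    ∃ x : E, (∀ i, inner ℂ (b i) x = c i) ∧ ‖x‖ₑ ^ 2 = ∑' i, ‖c i‖ₑ ^ 2 := by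
  have hs : Summable fun i => ‖c i‖ ^ 2 := by
    have := ENNReal.summable_toReal hc.ne
    refine this.congr fun i => ?_
    simp
  have hm : Memℓp c 2 := by
    apply memℓp_gen
    simpa using hs
  let y : lp (fun _ : ι => ℂ) 2 := ⟨c, hm⟩
  refine ⟨b.repr.symm y, ?_, ?_⟩
  · intro i
    rw [← b.repr_apply_apply, LinearIsometryEquiv.apply_symm_apply]
  · rw [← tsum_enorm_sq_hilbertBasis b]
    congr 1
    funext i
    rw [← b.repr_apply_apply, LinearIsometryEquiv.apply_symm_apply]

/-- `‖M^j φ‖²`, possibly infinite. -/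
def SobBasis.sobSq {d j : ℕ} (B : SobBasis d j) (φ : L2 d) : ℝ≥0∞ :=
  ∑' i, ‖(inner ℂ (sobM d j (B.f i)).l2 φ : ℂ)‖ₑ ^ 2

/-- The square-summable numbers ⟨M^j f_i, φ⟩ are the coefficients of a vector χ, and the core
property identifies φ with R χ. -/
theorem SobBasis.exists_of_sobSq {d j : ℕ} (B : SobBasis d j) {φ : L2 d} (h : B.sobSq φ < ⊤) :
    ∃ χ : L2 d, φ = resolv d j χ ∧ ‖χ‖ₑ ^ 2 = B.sobSq φ := by
  obtain ⟨χ, h1, h2⟩ := exists_of_tsum_enorm_sq B.b _ h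
  exact ⟨χ, B.core φ χ fun i => (h1 i).symm, h2⟩

/-! ### Relatively bounded multiplication operators -/

/-- R χ is a limit of the test functions M^{-j} g_n with g_n → χ. Along an almost everywhere
convergent subsequence Fatou's lemma carries the bound over. -/
theorem eLpNorm_mul_resolv_le {d j : ℕ} {U : Pt d → ℝ} (hU : Measurable U) {C : ℝ≥0}
    (h : ∀ f : Test d, eLpNorm (fun x => (U x : ℂ) * f x) 2 volume ≤ C * ‖(sobM d j f).l2‖ₑ)
    (χ : L2 d) :
    eLpNorm (fun x => (U x : ℂ) * (resolv d j χ : Pt d → ℂ) x) 2 volume ≤ C * ‖χ‖ₑ := by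
  obtain ⟨g, hg⟩ := exists_seq_test χ
  set f : ℕ → Test d := fun n => besselM d (-j) (g n) with hf
  have hfl : Tendsto (fun n => (f n).l2) atTop (𝓝 (resolv d j χ)) := by
    have := ((resolv d j).continuous.tendsto χ).comp hg
    refine this.congr fun n => ?_
    simp [hf, resolv_test]
  obtain ⟨ns, hns, hae⟩ := (tendstoInMeasure_of_tendsto_Lp hfl).exists_seq_tendsto_ae
  have hall : ∀ᵐ x, ∀ n, ((f n).l2 : Pt d → ℂ) x = f n x :=
    ae_all_iff.2 fun n => (f n).coeFn_l2
  have hlim : ∀ᵐ x, Tendsto (fun n => (U x : ℂ) * f (ns n) x) atTop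
      (𝓝 ((U x : ℂ) * (resolv d j χ : Pt d → ℂ) x)) := by
    filter_upwards [hae, hall] with x h1 h2
    refine Tendsto.const_mul _ (h1.congr fun n => h2 _)
  refine (Lp.eLpNorm_lim_le_liminf_eLpNorm
    (fun n => ((Complex.measurable_ofReal.comp hU).aestronglyMeasurable.mul
      (f (ns n)).continuous.aestronglyMeasurable)) _ hlim).trans ?_
  have hb : ∀ n, eLpNorm (fun x => (U x : ℂ) * f (ns n) x) 2 volume ≤ C * ‖(g (ns n)).l2‖ₑ := by
    intro n
    refine (h (f (ns n))).trans_eq ?_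
    rw [hf]; simp only [sobM_besselM_neg]
  have ht : Tendsto (fun n => (C : ℝ≥0∞) * ‖(g (ns n)).l2‖ₑ) atTop (𝓝 (C * ‖χ‖ₑ)) := by
    refine ENNReal.Tendsto.const_mul ?_ (Or.inr ENNReal.coe_ne_top)
    exact (continuous_enorm.tendsto χ).comp (hg.comp hns.tendsto_atTop)
  rw [← ht.liminf_eq]
  exact liminf_le_liminf (Eventually.of_forall hb)

theorem laplacian_translate {d : ℕ} (p : Pt d) (f : Test d) (x : Pt d) :
    (Δ (SchwartzMap.compSubConstCLM ℂ p f) : Test d) x = (Δ f : Test d) (x - p) := by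
  have hl : ∀ (m : Pt d) (g : Test d), LineDeriv.lineDerivOp m (SchwartzMap.compSubConstCLM ℂ p g) =
      SchwartzMap.compSubConstCLM ℂ p (LineDeriv.lineDerivOp m g : Test d) := by
    intro m g
    ext x
    rw [SchwartzMap.lineDerivOp_apply, SchwartzMap.compSubConstCLM_apply,
      SchwartzMap.lineDerivOp_apply]
    unfold lineDeriv
    congr 1
    funext t
    rw [SchwartzMap.compSubConstCLM_apply]
    congr 1; abel
  let b := stdOrthonormalBasis ℝ (Pt d)
  rw [SchwartzMap.laplacian_eq_sum b, SchwartzMap.laplacian_eq_sum b]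
  simp only [hl, sum_apply, SchwartzMap.compSubConstCLM_apply]

/-- The relative bound with ε = 1 is enough. The Laplacian and the L² norm are translation
invariant, so the constant does not depend on p; for j ≥ 2 both norms on the right are dominated by
that of M^j f. -/
theorem InfinitesimallyLaplaceBounded.exists_bound {d j : ℕ} {U : Pt d → ℝ}
    (hU : InfinitesimallyLaplaceBounded U) (hUm : Measurable U) (hj : 2 ≤ j) :
    ∃ C : ℝ≥0, ∀ (p : Pt d) (f : Test d),
      eLpNorm (fun x => (U (x - p) : ℂ) * f x) 2 volume ≤ C * ‖(sobM d j f).l2‖ₑ := by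
  obtain ⟨C, hC⟩ := hU 1 one_pos
  refine ⟨1 + C.toNNReal, fun p f => ?_⟩
  have hmp : MeasurePreserving (fun x : Pt d => x + p) volume volume :=
    measurePreserving_add_right volume p
  have hmeas : AEStronglyMeasurable (fun x : Pt d => (U (x - p) : ℂ) * f x) volume :=
    ((Complex.measurable_ofReal.comp (hUm.comp (measurable_id.sub_const p))).aestronglyMeasurable.mul
      f.continuous.aestronglyMeasurable)
  have h1 : eLpNorm (fun x => (U (x - p) : ℂ) * f x) 2 volume =
      eLpNorm (fun x => (U x : ℂ) * (SchwartzMap.compSubConstCLM ℂ (-p) f : Test d) x) 2 volume := by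
    rw [← eLpNorm_comp_measurePreserving hmeas hmp]
    congr 1
    funext x
    simp [SchwartzMap.compSubConstCLM_apply]
  have htr : ∀ g : Test d, eLpNorm (fun x => g (x + p)) 2 volume = ‖g.l2‖ₑ := by
    intro g
    have h2 := eLpNorm_comp_measurePreserving (p := 2) g.continuous.aestronglyMeasurable hmp
    have h3 : eLpNorm g 2 volume = ‖g.l2‖ₑ := by
      rw [Lp.enorm_def]; exact eLpNorm_congr_ae g.coeFn_l2.symm
    rw [← h3, ← h2]; rfl
  rw [h1]
  refine (hC _).trans ?_
  have e1 : (fun x => (Δ (SchwartzMap.compSubConstCLM ℂ (-p) f) : Test d) x) =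
      fun x => (Δ f : Test d) (x + p) := by
    funext x; rw [laplacian_translate, sub_neg_eq_add]
  have e2 : (fun x => (SchwartzMap.compSubConstCLM ℂ (-p) f : Test d) x) = fun x => f (x + p) := by
    funext x; rw [SchwartzMap.compSubConstCLM_apply, sub_neg_eq_add]
  rw [show (⇑(Δ (SchwartzMap.compSubConstCLM ℂ (-p) f) : Test d)) = fun x => (Δ f : Test d) (x + p)
    from e1, show ⇑(SchwartzMap.compSubConstCLM ℂ (-p) f : Test d) = fun x => f (x + p) from e2, htr,
    htr, ENNReal.ofReal_one, one_mul]
  have b1 : ‖(Δ f : Test d).l2‖ₑ ≤ ‖(sobM d j f).l2‖ₑ := by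
    rw [enorm_le_iff_norm_le]
    refine (norm_laplacian_le f).trans (norm_besselM_mono ?_ f)
    exact_mod_cast hj
  have b2 : ‖f.l2‖ₑ ≤ ‖(sobM d j f).l2‖ₑ := by
    rw [enorm_le_iff_norm_le]
    have := norm_besselM_mono (d := d) (s := 0) (t := j) (by positivity) f
    rwa [besselM_zero] at this
  rw [ENNReal.coe_add, ENNReal.coe_one, add_mul, one_mul]
  gcongr
  exact le_refl _

/-- A relative bound for multiplication by `U(· - p)`, uniform in `p`. -/
theorem SobBasis.eLpNorm_translate_mul_le {d j : ℕ} (B : SobBasis d j) {U : Pt d → ℝ}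
    (hUm : Measurable U) {C : ℝ≥0} (h : ∀ (p : Pt d) (f : Test d),
      eLpNorm (fun x => (U (x - p) : ℂ) * f x) 2 volume ≤ C * ‖(sobM d j f).l2‖ₑ)
    (p : Pt d) (φ : L2 d) (hφ : B.sobSq φ < ⊤) :
    eLpNorm (fun x => (U (x - p) : ℂ) * (φ : Pt d → ℂ) x) 2 volume ^ 2 ≤ C ^ 2 * B.sobSq φ := by
  obtain ⟨χ, rfl, h2⟩ := B.exists_of_sobSq hφ
  rw [← h2, ← mul_pow]
  gcongr
  exact eLpNorm_mul_resolv_le (hUm.comp (measurable_id.sub_const p)) (h p) χ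

end HFB
end

/-! ### Tensor products and partial inner products in L². -/

noncomputable section

namespace HFB

/-! ### Tensor products of `L²` functions -/

/-- The Hilbert space `L²(X; ℂ)`. -/
abbrev H (X : Type*) [MeasureSpace X] : Type _ := Lp ℂ 2 (volume : Measure X)

theorem H.enorm_sq {X : Type*} [MeasureSpace X] (f : H X) : ‖f‖ₑ ^ 2 = ∫⁻ x, ‖f x‖ₑ ^ 2 := by
  rw [Lp.enorm_def, eLpNorm_eq_lintegral_rpow_enorm_toReal (by simp) (by simp)]
  rw [← ENNReal.rpow_natCast, ← ENNReal.rpow_mul]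
  simp

theorem eLpNorm_two_sq {X : Type*} [MeasureSpace X] (f : X → ℂ) :
    eLpNorm f 2 volume ^ 2 = ∫⁻ x, ‖f x‖ₑ ^ 2 := by
  rw [eLpNorm_eq_lintegral_rpow_enorm_toReal (by simp) (by simp),
    ← ENNReal.rpow_natCast, ← ENNReal.rpow_mul]
  simp

theorem memLp_two_of_lintegral {X : Type*} [MeasureSpace X] {f : X → ℂ}
    (hf : AEStronglyMeasurable f volume) (h : ∫⁻ x, ‖f x‖ₑ ^ 2 < ⊤) : MemLp f 2 volume := by
  refine ⟨hf, ?_⟩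
  by_contra hc
  rw [not_lt, top_le_iff] at hc
  rw [← eLpNorm_two_sq, hc] at h
  simp at h

theorem H.inner_eq {X : Type*} [MeasureSpace X] (f g : H X) :
    inner ℂ f g = ∫ x, conj (f x) * g x := by
  rw [L2.inner_def]
  simp [mul_comm]

theorem H.integrable {X : Type*} [MeasureSpace X] (f g : H X) :
    Integrable (fun x => conj (f x) * g x) := by
  have := L2.integrable_inner (𝕜 := ℂ) f g
  simpa [mul_comm] using this

theorem inner_toLp {X : Type*} [MeasureSpace X] {f g : X → ℂ} (hf : MemLp f 2 volume)
    (hg : MemLp g 2 volume) : inner ℂ (hf.toLp f) (hg.toLp g) = ∫ x, conj (f x) * g x := by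
  rw [H.inner_eq]
  refine integral_congr_ae ?_
  filter_upwards [hf.coeFn_toLp, hg.coeFn_toLp] with x h1 h2
  rw [h1, h2]

theorem ae_prod_fst {X Y : Type*} [MeasureSpace X] [MeasureSpace Y] {p : X → Prop} (h : ∀ᵐ x, p x) : ∀ᵐ q : X × Y, p q.1 :=
  Measure.quasiMeasurePreserving_fst.ae h

theorem ae_prod_snd {X Y : Type*} [MeasureSpace X] [MeasureSpace Y] {p : Y → Prop} (h : ∀ᵐ x, p x) : ∀ᵐ q : X × Y, p q.2 :=
  Measure.quasiMeasurePreserving_snd.ae h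

section Product

variable {X Y : Type*} [MeasureSpace X] [MeasureSpace Y] [SFinite (volume : Measure X)]
  [SFinite (volume : Measure Y)]

theorem lintegral_volume_prod_symm {F : X × Y → ℝ≥0∞} (hF : AEMeasurable F volume) :
    ∫⁻ p, F p = ∫⁻ y, ∫⁻ x, F (x, y) :=
  lintegral_prod_symm F hF

theorem integral_volume_prod_symm {F : X × Y → ℂ} (hF : Integrable F volume) :
    ∫ p, F p = ∫ y, ∫ x, F (x, y) :=
  integral_prod_symm F hF

theorem memLp_mul_prod {f : X → ℂ} {g : Y → ℂ} (hf : MemLp f 2 volume) (hg : MemLp g 2 volume) :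
    MemLp (fun p : X × Y => f p.1 * g p.2) 2 volume := by
  refine memLp_two_of_lintegral (hf.1.comp_fst.mul hg.1.comp_snd) ?_
  have h : ∀ p : X × Y, ‖f p.1 * g p.2‖ₑ ^ 2 = ‖f p.1‖ₑ ^ 2 * ‖g p.2‖ₑ ^ 2 := by
    intro p; rw [enorm_mul, mul_pow]
  simp_rw [h]
  have h2 : ∫⁻ p : X × Y, ‖f p.1‖ₑ ^ 2 * ‖g p.2‖ₑ ^ 2 =
      (∫⁻ x, ‖f x‖ₑ ^ 2) * ∫⁻ y, ‖g y‖ₑ ^ 2 :=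
    lintegral_prod_mul (hf.1.enorm.pow_const 2) (hg.1.enorm.pow_const 2)
  rw [h2, ← eLpNorm_two_sq, ← eLpNorm_two_sq]
  exact ENNReal.mul_lt_top (ENNReal.pow_lt_top hf.2) (ENNReal.pow_lt_top hg.2)

/-- `f ⊗ g` as an element of `L²(X × Y)`. -/
def tmul (f : H X) (g : H Y) : H (X × Y) := (memLp_mul_prod (Lp.memLp f) (Lp.memLp g)).toLp _

theorem tmul_coe (f : H X) (g : H Y) : tmul f g =ᵐ[volume] fun p => f p.1 * g p.2 :=
  MemLp.coeFn_toLp _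

theorem inner_tmul_eq (f : H X) (g : H Y) (ξ : H (X × Y)) :
    inner ℂ (tmul f g) ξ = ∫ p, conj (f p.1 * g p.2) * ξ p := by
  rw [H.inner_eq]
  refine integral_congr_ae ?_
  filter_upwards [tmul_coe f g] with p hp
  rw [hp]

theorem inner_tmul_tmul (f f' : H X) (g g' : H Y) :
    inner ℂ (tmul f g) (tmul f' g') = inner ℂ f f' * inner ℂ g g' := by
  rw [inner_tmul_eq, H.inner_eq, H.inner_eq]
  have : ∫ p : X × Y, conj (f p.1 * g p.2) * tmul f' g' p =
      ∫ p : X × Y, (conj (f p.1) * f' p.1) * (conj (g p.2) * g' p.2) := by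
    refine integral_congr_ae ?_
    filter_upwards [tmul_coe f' g'] with p hp
    rw [hp, map_mul]; ring
  rw [this, Measure.volume_eq_prod]
  exact integral_prod_mul (fun x => conj (f x) * f' x) (fun y => conj (g y) * g' y)

theorem tmul_add_left (f f' : H X) (g : H Y) : tmul (f + f') g = tmul f g + tmul f' g := by
  apply Lp.ext
  filter_upwards [tmul_coe (f + f') g, Lp.coeFn_add (tmul f g) (tmul f' g), tmul_coe f g,
    tmul_coe f' g, ae_prod_fst (Lp.coeFn_add f f')] with p h1 h2 h3 h4 h5
  rw [h1, h2, Pi.add_apply, h3, h4, h5, Pi.add_apply, add_mul]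

theorem tmul_add_right (f : H X) (g g' : H Y) : tmul f (g + g') = tmul f g + tmul f g' := by
  apply Lp.ext
  filter_upwards [tmul_coe f (g + g'), Lp.coeFn_add (tmul f g) (tmul f g'), tmul_coe f g,
    tmul_coe f g', ae_prod_snd (Lp.coeFn_add g g')] with p h1 h2 h3 h4 h5
  rw [h1, h2, Pi.add_apply, h3, h4, h5, Pi.add_apply, mul_add]

theorem tmul_smul_left (c : ℂ) (f : H X) (g : H Y) : tmul (c • f) g = c • tmul f g := by
  apply Lp.ext
  filter_upwards [tmul_coe (c • f) g, Lp.coeFn_smul c (tmul f g), tmul_coe f g,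
    ae_prod_fst (Lp.coeFn_smul c f)] with p h1 h2 h3 h5
  rw [h1, h2, Pi.smul_apply, h3, h5, Pi.smul_apply, smul_eq_mul, smul_eq_mul, mul_assoc]

theorem tmul_smul_right (c : ℂ) (f : H X) (g : H Y) : tmul f (c • g) = c • tmul f g := by
  apply Lp.ext
  filter_upwards [tmul_coe f (c • g), Lp.coeFn_smul c (tmul f g), tmul_coe f g,
    ae_prod_snd (Lp.coeFn_smul c g)] with p h1 h2 h3 h5
  rw [h1, h2, Pi.smul_apply, h3, h5, Pi.smul_apply, smul_eq_mul, smul_eq_mul, mul_left_comm]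

theorem norm_tmul (f : H X) (g : H Y) : ‖tmul f g‖ = ‖f‖ * ‖g‖ := by
  have h : ((‖tmul f g‖ ^ 2 : ℝ) : ℂ) = ((‖f‖ * ‖g‖) ^ 2 : ℝ) := by
    have := inner_tmul_tmul f f g g
    rw [inner_self_eq_norm_sq_to_K, inner_self_eq_norm_sq_to_K, inner_self_eq_norm_sq_to_K] at this
    push_cast
    rw [mul_pow]
    exact this
  have h2 : ‖tmul f g‖ ^ 2 = (‖f‖ * ‖g‖) ^ 2 := by exact_mod_cast h
  exact (sq_eq_sq₀ (norm_nonneg _) (by positivity)).1 h2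

/-- The tensor product as a continuous bilinear map. -/
def tmulL : H X →L[ℂ] H Y →L[ℂ] H (X × Y) :=
  LinearMap.mkContinuous₂ (LinearMap.mk₂ ℂ tmul tmul_add_left tmul_smul_left tmul_add_right
    tmul_smul_right) 1 fun f g => by
      rw [one_mul]; exact (norm_tmul f g).le

@[simp] theorem tmulL_apply (f : H X) (g : H Y) : tmulL f g = tmul f g := rfl

/-- Slices `ξ(·, y)` and the partial inner product. -/
theorem contract_aux (f : H X) (ξ : H (X × Y)) :
    (∀ᵐ y, MemLp (fun x => ξ (x, y)) 2 volume) ∧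
    ((ContinuousLinearMap.adjoint (tmulL (Y := Y) f) ξ : H Y) =ᵐ[volume]
      fun y => ∫ x, conj (f x) * ξ (x, y)) := by
  have hm : AEStronglyMeasurable (ξ : X × Y → ℂ) (volume.prod volume) :=
    (Lp.aestronglyMeasurable ξ)
  have hfin : ∫⁻ y, ∫⁻ x, ‖ξ (x, y)‖ₑ ^ 2 < ⊤ := by
    have h1 := H.enorm_sq ξ
    rw [lintegral_volume_prod_symm (hm.enorm.pow_const 2)] at h1
    rw [← h1]
    exact ENNReal.pow_lt_top enorm_lt_top
  have hslice : ∀ᵐ y, MemLp (fun x => ξ (x, y)) 2 volume := by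
    have hmeas : AEMeasurable (fun y => ∫⁻ x, ‖ξ (x, y)‖ₑ ^ 2) volume := by
      have : AEMeasurable (fun p : Y × X => ‖ξ p.swap‖ₑ ^ 2) (volume.prod volume) := by
        have := hm.prod_swap
        fun_prop
      exact this.lintegral_prod_right'
    have h2 := ae_lt_top' hmeas hfin.ne
    have h3 : ∀ᵐ y, AEStronglyMeasurable (fun x => ξ (x, y)) volume := by
      have := hm.prod_swap.prodMk_left
      exact this
    filter_upwards [h2, h3] with y h4 h5
    exact memLp_two_of_lintegral h5 h4
  refine ⟨hslice, ?_⟩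
  have hψm : AEStronglyMeasurable (fun y => ∫ x, conj (f x) * ξ (x, y)) volume := by
    have : AEStronglyMeasurable (fun p : Y × X => conj (f p.2) * ξ p.swap) (volume.prod volume) := by
      refine AEStronglyMeasurable.mul ?_ hm.prod_swap
      exact Complex.continuous_conj.comp_aestronglyMeasurable (Lp.aestronglyMeasurable f).comp_snd
    exact this.integral_prod_right'
  have hbound : ∀ᵐ y, ‖∫ x, conj (f x) * ξ (x, y)‖ₑ ^ 2 ≤ ‖f‖ₑ ^ 2 * ∫⁻ x, ‖ξ (x, y)‖ₑ ^ 2 := by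
    filter_upwards [hslice] with y hy
    have h1 : ∫ x, conj (f x) * ξ (x, y) = inner ℂ f (hy.toLp _) := by
      rw [H.inner_eq]
      refine integral_congr_ae ?_
      filter_upwards [hy.coeFn_toLp] with x hx
      rw [hx]
    rw [h1, ← eLpNorm_two_sq, ← mul_pow]
    gcongr
    have h2 : ‖hy.toLp _‖ₑ = eLpNorm (fun x => ξ (x, y)) 2 volume := by
      rw [Lp.enorm_def]; exact eLpNorm_congr_ae hy.coeFn_toLp
    rw [← h2]
    have h3 := norm_inner_le_norm (𝕜 := ℂ) f (hy.toLp _)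
    rw [← ofReal_norm, ← ofReal_norm, ← ofReal_norm, ← ENNReal.ofReal_mul (norm_nonneg _)]
    exact ENNReal.ofReal_le_ofReal h3
  have hψ : MemLp (fun y => ∫ x, conj (f x) * ξ (x, y)) 2 volume := by
    refine memLp_two_of_lintegral hψm ((lintegral_mono_ae hbound).trans_lt ?_)
    rw [lintegral_const_mul' _ _ (by simp)]
    exact ENNReal.mul_lt_top (ENNReal.pow_lt_top enorm_lt_top) hfin
  -- Fubini, tested against g: integrating first over x exhibits the slicewise pairing as the
  -- adjoint of g ↦ f ⊗ g.
  have heq : ContinuousLinearMap.adjoint (tmulL (Y := Y) f) ξ = hψ.toLp _ := by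
    refine ext_inner_left ℂ fun g => ?_
    rw [ContinuousLinearMap.adjoint_inner_right, tmulL_apply, inner_tmul_eq, H.inner_eq]
    have hint : Integrable (fun p : X × Y => conj (f p.1 * g p.2) * ξ p) (volume.prod volume) := by
      have h1 := H.integrable (tmul f g) ξ
      refine h1.congr ?_
      filter_upwards [tmul_coe f g] with p hp
      rw [hp]
    rw [integral_volume_prod_symm hint]
    refine integral_congr_ae ?_
    filter_upwards [hψ.coeFn_toLp] with y hy
    rw [hy, ← integral_const_mul]
    congr 1; funext x
    rw [map_mul]; ring
  rw [heq]
  exact hψ.coeFn_toLp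

/-- A Tonelli principle: a countable family of partial inner products is computed slicewise. -/
theorem tsum_enorm_sq_adjoint_tmulL {ι : Type*} [Countable ι] (f : ι → H X) (ξ : H (X × Y)) :
    ∃ s : Y → H X, (∀ᵐ y, (s y : X → ℂ) =ᵐ[volume] fun x => ξ (x, y)) ∧
    ∑' i, ‖ContinuousLinearMap.adjoint (tmulL (Y := Y) (f i)) ξ‖ₑ ^ 2 =
      ∫⁻ y, ∑' i, ‖(inner ℂ (f i) (s y) : ℂ)‖ₑ ^ 2 := by
  have h0 : ∀ᵐ y, MemLp (fun x => ξ (x, y)) 2 volume := (contract_aux 0 ξ).1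
  classical
  -- Slices that are not square integrable occur only for a null set of y and are replaced by 0.
  refine ⟨fun y => if h : MemLp (fun x => ξ (x, y)) 2 volume then h.toLp _ else 0, ?_, ?_⟩
  · filter_upwards [h0] with y hy
    rw [dif_pos hy]; exact hy.coeFn_toLp
  · simp_rw [H.enorm_sq]
    rw [← lintegral_tsum (fun i => by fun_prop)]
    refine lintegral_congr_ae ?_
    filter_upwards [h0, ae_all_iff.2 fun i => (contract_aux (f i) ξ).2] with y hy hy2
    congr 1; funext i
    rw [hy2 i, dif_pos hy, H.inner_eq]
    congr 2
    refine integral_congr_ae ?_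
    filter_upwards [hy.coeFn_toLp] with x hx
    rw [hx]

/-- Parseval's identity in almost every slice, integrated over the remaining variable. -/
theorem tsum_enorm_sq_adjoint_tmulL_basis {ι : Type*} [Countable ι] (b : HilbertBasis ι ℂ (H X))
    (ξ : H (X × Y)) :
    ∑' i, ‖ContinuousLinearMap.adjoint (tmulL (Y := Y) (b i)) ξ‖ₑ ^ 2 = ‖ξ‖ₑ ^ 2 := by
  obtain ⟨s, hs, h⟩ := tsum_enorm_sq_adjoint_tmulL (fun i => b i) ξ
  rw [h, H.enorm_sq]
  have hm : AEStronglyMeasurable (ξ : X × Y → ℂ) (volume.prod volume) := Lp.aestronglyMeasurable ξ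
  rw [lintegral_volume_prod_symm (hm.enorm.pow_const 2)]
  refine lintegral_congr_ae ?_
  filter_upwards [hs] with y hy
  rw [tsum_enorm_sq_hilbertBasis, H.enorm_sq]
  refine lintegral_congr_ae ?_
  filter_upwards [hy] with x hx
  rw [hx]

end Product

end HFB
end

/-! ### Operators acting on some of the variables. -/

noncomputable section

namespace HFB

instance fact_two_ne_top : Fact ((2 : ℝ≥0∞) ≠ ⊤) := ⟨by simp⟩

/-- Orthonormal vectors have distance √2, so balls of radius 1/2 around them are disjoint open sets.
-/
theorem countable_of_orthonormal {ι E : Type*} [NormedAddCommGroup E] [InnerProductSpace ℂ E]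
    [SecondCountableTopology E] {v : ι → E} (hv : Orthonormal ℂ v) : Countable ι := by
  refine Pairwise.countable_of_isOpen_disjoint (s := fun i => Metric.ball (v i) (1 / 2)) ?_
    (fun i => Metric.isOpen_ball) (fun i => ⟨v i, Metric.mem_ball_self (by norm_num)⟩)
  intro i k hik
  apply Metric.ball_disjoint_ball
  have h : ‖v i - v k‖ ^ 2 = 2 := by
    rw [@norm_sub_sq ℂ, hv.1, hv.1, hv.2 hik]; norm_num
  rw [dist_eq_norm]
  have := norm_nonneg (v i - v k)
  nlinarith

/-- Index set of a chosen Hilbert basis. -/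
def BasisIndex (E : Type) [NormedAddCommGroup E] [InnerProductSpace ℂ E] [CompleteSpace E] : Type :=
  (exists_hilbertBasis ℂ E).choose

/-- A chosen Hilbert basis. -/
def hbasis (E : Type) [NormedAddCommGroup E] [InnerProductSpace ℂ E] [CompleteSpace E] :
    HilbertBasis (BasisIndex E) ℂ E :=
  (exists_hilbertBasis ℂ E).choose_spec.choose

instance countable_basisIndex (E : Type) [NormedAddCommGroup E] [InnerProductSpace ℂ E]
    [CompleteSpace E] [SecondCountableTopology E] : Countable (BasisIndex E) :=
  countable_of_orthonormal (hbasis E).orthonormal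

/-! ### Componentwise operators on Hilbert sums -/

theorem lp_norm_sq {ι : Type*} {E : ι → Type*} [∀ i, NormedAddCommGroup (E i)] (x : lp E 2) :
    HasSum (fun i => ‖x i‖ ^ 2) (‖x‖ ^ 2) := by
  have := lp.hasSum_norm (p := 2) (by simp) x
  simpa using this

theorem memℓp_two {ι : Type*} {E : ι → Type*} [∀ i, NormedAddCommGroup (E i)] {x : ∀ i, E i}
    (h : Summable fun i => ‖x i‖ ^ 2) : Memℓp x 2 := by
  apply memℓp_gen
  simpa using h

theorem summable_of_memℓp_two {ι : Type*} {E : ι → Type*} [∀ i, NormedAddCommGroup (E i)]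
    (x : lp E 2) : Summable fun i => ‖x i‖ ^ 2 := (lp_norm_sq x).summable

/-- An operator acting on every component of a Hilbert sum. -/
def lpMap {ι : Type*} {E E' : Type*} [NormedAddCommGroup E] [InnerProductSpace ℂ E]
    [NormedAddCommGroup E'] [InnerProductSpace ℂ E']
    (T : E →L[ℂ] E') : lp (fun _ : ι => E) 2 →L[ℂ] lp (fun _ : ι => E') 2 :=
  have hb : ∀ x : lp (fun _ : ι => E) 2, ∀ i, ‖T (x i)‖ ^ 2 ≤ ‖T‖ ^ 2 * ‖x i‖ ^ 2 := fun x i => by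
    rw [← mul_pow]; gcongr; exact T.le_opNorm _
  have hs : ∀ x : lp (fun _ : ι => E) 2, Summable fun i => ‖T (x i)‖ ^ 2 := fun x =>
    Summable.of_nonneg_of_le (fun i => sq_nonneg _) (hb x) ((summable_of_memℓp_two x).mul_left _)
  LinearMap.mkContinuous
    { toFun := fun x => ⟨fun i => T (x i), memℓp_two (hs x)⟩
      map_add' := fun x y => Subtype.ext (funext fun i => map_add T _ _)
      map_smul' := fun c x => Subtype.ext (funext fun i => map_smul T _ _) } ‖T‖ fun x => by
    refine le_of_sq_le_sq ?_ (by positivity)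
    rw [mul_pow, ← (lp_norm_sq _).tsum_eq, ← (lp_norm_sq x).tsum_eq, ← tsum_mul_left]
    exact Summable.tsum_le_tsum (hb x) (hs x) ((summable_of_memℓp_two x).mul_left _)

@[simp] theorem lpMap_apply {ι : Type*} {E E' : Type*} [NormedAddCommGroup E]
    [InnerProductSpace ℂ E] [NormedAddCommGroup E'] [InnerProductSpace ℂ E']
    (T : E →L[ℂ] E') (x : lp (fun _ : ι => E) 2) (i : ι) : lpMap T x i = T (x i) := rfl

theorem norm_lpMap_le {ι : Type*} {E E' : Type*} [NormedAddCommGroup E] [InnerProductSpace ℂ E]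
    [NormedAddCommGroup E'] [InnerProductSpace ℂ E']
    {T : E →L[ℂ] E'} {C : ℝ} (hC : 0 ≤ C) (hT : ∀ u, ‖T u‖ ≤ C * ‖u‖)
    (x : lp (fun _ : ι => E) 2) : ‖lpMap T x‖ ≤ C * ‖x‖ := by
  refine le_of_sq_le_sq ?_ (by positivity)
  rw [mul_pow, ← (lp_norm_sq _).tsum_eq, ← (lp_norm_sq x).tsum_eq, ← tsum_mul_left]
  refine Summable.tsum_le_tsum (fun i => ?_) (summable_of_memℓp_two _)
    ((summable_of_memℓp_two x).mul_left _)
  rw [← mul_pow]; gcongr; exact hT _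

/-! ### Splitting off variables -/

/-- An identification of the measure space `Ω` with a product `X × Y`. -/
structure Split (Ω X Y : Type) [MeasureSpace Ω] [MeasureSpace X] [MeasureSpace Y] where
  e : Ω ≃ᵐ X × Y
  mp : MeasurePreserving e volume volume

namespace Split

variable {Ω X Y : Type} [MeasureSpace Ω] [MeasureSpace X] [MeasureSpace Y]
  [SFinite (volume : Measure X)] [SFinite (volume : Measure Y)] (S : Split Ω X Y)

/-- The identification of `L²(X × Y)` with `L²(Ω)`. -/
def pull : H (X × Y) ≃ₗᵢ[ℂ] H Ω :=
  LinearIsometryEquiv.ofSurjective (Lp.compMeasurePreservingₗᵢ ℂ S.e S.mp) fun ξ => by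
    refine ⟨Lp.compMeasurePreserving S.e.symm S.mp.symm ξ, ?_⟩
    change Lp.compMeasurePreserving S.e S.mp (Lp.compMeasurePreserving S.e.symm S.mp.symm ξ) = ξ
    rw [← Lp.compMeasurePreserving_comp_apply]
    apply Lp.ext
    refine (Lp.coeFn_compMeasurePreserving _ _).trans ?_
    filter_upwards with x
    simp

theorem pull_coe (ξ : H (X × Y)) : S.pull ξ =ᵐ[volume] fun ω => ξ (S.e ω) :=
  Lp.coeFn_compMeasurePreserving ξ S.mp

/-- The tensor product of functions on `X` and `Y`, as a function on `Ω`. -/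
def tenL : H X →L[ℂ] H Y →L[ℂ] H Ω :=
  (ContinuousLinearMap.compL ℂ (H Y) (H (X × Y)) (H Ω)
    (S.pull.toContinuousLinearEquiv : H (X × Y) →L[ℂ] H Ω)).comp tmulL

def ten (f : H X) (g : H Y) : H Ω := S.pull (tmul f g)

theorem tenL_apply (f : H X) (g : H Y) : S.tenL f g = S.ten f g := rfl

theorem ten_coe (f : H X) (g : H Y) :
    S.ten f g =ᵐ[volume] fun ω => f (S.e ω).1 * g (S.e ω).2 := by
  refine (S.pull_coe _).trans ?_
  exact S.mp.quasiMeasurePreserving.ae (tmul_coe f g)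

theorem inner_ten_ten (f f' : H X) (g g' : H Y) :
    inner ℂ (S.ten f g) (S.ten f' g') = inner ℂ f f' * inner ℂ g g' := by
  rw [ten, ten, LinearIsometryEquiv.inner_map_map, inner_tmul_tmul]

theorem norm_ten (f : H X) (g : H Y) : ‖S.ten f g‖ = ‖f‖ * ‖g‖ := by
  rw [ten, LinearIsometryEquiv.norm_map, norm_tmul]

/-- Contraction of the `X` variable with `f`. -/
def ctL (f : H X) : H Ω →L[ℂ] H Y := ContinuousLinearMap.adjoint (S.tenL f)

/-- Contraction of the `Y` variable with `g`. -/
def ctR (g : H Y) : H Ω →L[ℂ] H X := ContinuousLinearMap.adjoint (S.tenL.flip g)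

theorem inner_ctL (f : H X) (g : H Y) (ξ : H Ω) :
    inner ℂ g (S.ctL f ξ) = inner ℂ (S.ten f g) ξ := by
  rw [ctL, ContinuousLinearMap.adjoint_inner_right, tenL_apply]

theorem inner_ctR (f : H X) (g : H Y) (ξ : H Ω) :
    inner ℂ f (S.ctR g ξ) = inner ℂ (S.ten f g) ξ := by
  rw [ctR, ContinuousLinearMap.adjoint_inner_right, ContinuousLinearMap.flip_apply, tenL_apply]

theorem inner_ctL_left (f : H X) (g : H Y) (ξ : H Ω) :
    inner ℂ (S.ctL f ξ) g = inner ℂ ξ (S.ten f g) := by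
  rw [← inner_conj_symm, inner_ctL, inner_conj_symm]

theorem ctL_eq (f : H X) (ξ : H Ω) :
    S.ctL f ξ = ContinuousLinearMap.adjoint (tmulL (Y := Y) f) (S.pull.symm ξ) := by
  refine ext_inner_left ℂ fun g => ?_
  rw [inner_ctL, ContinuousLinearMap.adjoint_inner_right, ten, tmulL_apply,
    ← S.pull.inner_map_map, LinearIsometryEquiv.apply_symm_apply]

theorem tsum_ctL_basis {ι : Type*} [Countable ι] (b : HilbertBasis ι ℂ (H X)) (ξ : H Ω) :
    ∑' i, ‖S.ctL (b i) ξ‖ₑ ^ 2 = ‖ξ‖ₑ ^ 2 := by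
  simp_rw [ctL_eq]
  rw [tsum_enorm_sq_adjoint_tmulL_basis, LinearIsometryEquiv.enorm_map]

theorem ctL_ten (f f' : H X) (g : H Y) : S.ctL f (S.ten f' g) = (inner ℂ f f' : ℂ) • g := by
  refine ext_inner_left ℂ fun w => ?_
  rw [inner_ctL, inner_ten_ten, inner_smul_right]

theorem ctR_ten (f : H X) (g g' : H Y) : S.ctR g (S.ten f g') = (inner ℂ g g' : ℂ) • f := by
  refine ext_inner_left ℂ fun w => ?_
  rw [inner_ctR, inner_ten_ten, inner_smul_right, mul_comm]

variable [SecondCountableTopology (H X)]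

theorem ext_ctL {ξ η : H Ω} (h : ∀ f, S.ctL f ξ = S.ctL f η) : ξ = η := by
  have h1 := S.tsum_ctL_basis (hbasis (H X)) (ξ - η)
  have h2 : ∀ f, S.ctL f (ξ - η) = 0 := fun f => by rw [map_sub, h, sub_self]
  simp only [h2] at h1
  rw [← sub_eq_zero]
  simpa using h1.symm

theorem ext_ten {ξ η : H Ω} (h : ∀ f g, inner ℂ (S.ten f g) ξ = inner ℂ (S.ten f g) η) : ξ = η :=
  S.ext_ctL fun f => ext_inner_left ℂ fun g => by rw [inner_ctL, inner_ctL, h]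

variable (Y) in
/-- The partial coefficients of `ξ` as an element of a Hilbert sum of copies of `L²(X)`. -/
theorem isHilbertSum : IsHilbertSum ℂ (fun _ : BasisIndex (H Y) => H X) fun l =>
    ({ toLinearMap := (S.tenL.flip (hbasis (H Y) l)).toLinearMap
       norm_map' := fun f => by
        change ‖S.ten f (hbasis (H Y) l)‖ = ‖f‖
        rw [S.norm_ten, (hbasis (H Y)).orthonormal.1, mul_one] } : H X →ₗᵢ[ℂ] H Ω) := by
  refine IsHilbertSum.mk ?_ ?_
  · intro l l' hl f f'
    change inner ℂ (S.ten f _) (S.ten f' _) = 0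
    rw [inner_ten_ten, (hbasis (H Y)).orthonormal.2 hl, mul_zero]
  · rw [top_le_iff, Submodule.topologicalClosure_eq_top_iff, Submodule.eq_bot_iff]
    intro ξ hξ
    have h0 : ∀ f l, inner ℂ (S.ten f (hbasis (H Y) l)) ξ = 0 := fun f l =>
      (Submodule.mem_orthogonal _ _).1 hξ _ ((le_iSup (fun l => LinearMap.range
        (S.tenL.flip (hbasis (H Y) l)).toLinearMap) l) ⟨f, rfl⟩)
    refine S.ext_ctL fun f => ?_
    refine (hbasis (H Y)).repr.injective ?_
    ext l
    rw [(hbasis (H Y)).repr_apply_apply, inner_ctL, h0, map_zero, map_zero]; rfl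

/-- `L²(Ω)` as a Hilbert sum of copies of `L²(X)`. -/
def coeffs : H Ω ≃ₗᵢ[ℂ] lp (fun _ : BasisIndex (H Y) => H X) 2 :=
  (S.isHilbertSum Y).linearIsometryEquiv

theorem coeffs_apply (ξ : H Ω) (l : BasisIndex (H Y)) :
    S.coeffs ξ l = S.ctR (hbasis (H Y) l) ξ := by
  classical
  refine ext_inner_left ℂ fun f => ?_
  have h := lp.inner_single_left (𝕜 := ℂ) (G := fun _ : BasisIndex (H Y) => H X) l f (S.coeffs ξ)
  rw [inner_ctR, ← h, ← S.coeffs.symm.inner_map_map, LinearIsometryEquiv.symm_apply_apply]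
  congr 1
  exact (S.isHilbertSum Y).linearIsometryEquiv_symm_apply_single f

end Split

section Slot

variable {Ω Ω' Ω'' X X' X'' Y : Type} [MeasureSpace Ω] [MeasureSpace Ω'] [MeasureSpace Ω'']
  [MeasureSpace X] [MeasureSpace X'] [MeasureSpace X''] [MeasureSpace Y]
  [SFinite (volume : Measure X)] [SFinite (volume : Measure X')] [SFinite (volume : Measure X'')]
  [SFinite (volume : Measure Y)] [SecondCountableTopology (H X)] [SecondCountableTopology (H X')]
  [SecondCountableTopology (H X'')]
  (S : Split Ω X Y) (S' : Split Ω' X' Y) (S'' : Split Ω'' X'' Y)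

/-- The operator `T ⊗ 1` from `L²(Ω)` to `L²(Ω')`. -/
def slot (T : H X →L[ℂ] H X') : H Ω →L[ℂ] H Ω' :=
  S'.coeffs.symm.toLinearIsometry.toContinuousLinearMap ∘L lpMap T ∘L
    S.coeffs.toLinearIsometry.toContinuousLinearMap

theorem slot_apply (T : H X →L[ℂ] H X') (ξ : H Ω) :
    slot S S' T ξ = S'.coeffs.symm (lpMap T (S.coeffs ξ)) := rfl

theorem coeffs_slot (T : H X →L[ℂ] H X') (ξ : H Ω) :
    S'.coeffs (slot S S' T ξ) = lpMap T (S.coeffs ξ) := by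
  rw [slot_apply, LinearIsometryEquiv.apply_symm_apply]

theorem norm_slot_le {T : H X →L[ℂ] H X'} {C : ℝ} (hC : 0 ≤ C) (hT : ∀ u, ‖T u‖ ≤ C * ‖u‖)
    (ξ : H Ω) : ‖slot S S' T ξ‖ ≤ C * ‖ξ‖ := by
  rw [slot_apply, LinearIsometryEquiv.norm_map, ← S.coeffs.norm_map ξ]
  exact norm_lpMap_le hC hT _

theorem hasSum_inner_slot (T : H X →L[ℂ] H X') (η : H Ω') (ξ : H Ω) :
    HasSum (fun l => inner ℂ (S'.ctR (hbasis (H Y) l) η) (T (S.ctR (hbasis (H Y) l) ξ)))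
      (inner ℂ η (slot S S' T ξ)) := by
  have h := lp.hasSum_inner (𝕜 := ℂ) (S'.coeffs η) (S'.coeffs (slot S S' T ξ))
  rw [LinearIsometryEquiv.inner_map_map] at h
  simpa only [coeffs_slot, lpMap_apply, Split.coeffs_apply] using h

theorem slot_slot (T : H X →L[ℂ] H X') (T' : H X' →L[ℂ] H X'') (ξ : H Ω) :
    slot S' S'' T' (slot S S' T ξ) = slot S S'' (T' ∘L T) ξ := by
  apply S''.coeffs.injective
  rw [coeffs_slot, coeffs_slot, coeffs_slot]
  exact Subtype.ext (funext fun l => rfl)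

theorem slot_sub (T T' : H X →L[ℂ] H X') (ξ : H Ω) :
    slot S S' (T - T') ξ = slot S S' T ξ - slot S S' T' ξ := by
  apply S'.coeffs.injective
  rw [map_sub, coeffs_slot, coeffs_slot, coeffs_slot]
  exact Subtype.ext (funext fun l => rfl)

theorem slot_add (T T' : H X →L[ℂ] H X') (ξ : H Ω) :
    slot S S' (T + T') ξ = slot S S' T ξ + slot S S' T' ξ := by
  apply S'.coeffs.injective
  rw [map_add, coeffs_slot, coeffs_slot, coeffs_slot]
  exact Subtype.ext (funext fun l => rfl)

theorem slot_smul (c : ℂ) (T : H X →L[ℂ] H X') (ξ : H Ω) :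
    slot S S' (c • T) ξ = c • slot S S' T ξ := by
  apply S'.coeffs.injective
  rw [map_smul, coeffs_slot, coeffs_slot]
  exact Subtype.ext (funext fun l => rfl)

theorem slot_id (ξ : H Ω) : slot S S (ContinuousLinearMap.id ℂ _) ξ = ξ := by
  apply S.coeffs.injective
  rw [coeffs_slot]
  exact Subtype.ext (funext fun l => rfl)

theorem inner_slot (T : H X →L[ℂ] H X') (η : H Ω') (ξ : H Ω) :
    inner ℂ η (slot S S' T ξ) = inner ℂ (slot S' S (ContinuousLinearMap.adjoint T) η) ξ := by
  have h1 := hasSum_inner_slot S S' T η ξ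
  have h := lp.hasSum_inner (𝕜 := ℂ) (S.coeffs (slot S' S (ContinuousLinearMap.adjoint T) η))
    (S.coeffs ξ)
  rw [LinearIsometryEquiv.inner_map_map] at h
  have he : ∀ l, inner ℂ (S.coeffs (slot S' S (ContinuousLinearMap.adjoint T) η) l) (S.coeffs ξ l) =
      inner ℂ (S'.ctR (hbasis (H Y) l) η) (T (S.ctR (hbasis (H Y) l) ξ)) := fun l => by
    rw [coeffs_slot, lpMap_apply, Split.coeffs_apply, Split.coeffs_apply,
      ContinuousLinearMap.adjoint_inner_left]
  simp_rw [he] at h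
  exact h1.unique h

theorem slot_ten (T : H X →L[ℂ] H X') (f : H X) (g : H Y) :
    slot S S' T (S.ten f g) = S'.ten (T f) g := by
  apply S'.coeffs.injective
  rw [coeffs_slot]
  ext1; funext l
  rw [lpMap_apply, Split.coeffs_apply, Split.coeffs_apply, Split.ctR_ten, Split.ctR_ten, map_smul]

theorem ctL_slot (T : H X →L[ℂ] H X') (f : H X') (ξ : H Ω) :
    S'.ctL f (slot S S' T ξ) = S.ctL (ContinuousLinearMap.adjoint T f) ξ := by
  refine ext_inner_left ℂ fun g => ?_
  rw [Split.inner_ctL, Split.inner_ctL, inner_slot, slot_ten]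

/-- Strong continuity of `T ↦ T ⊗ 1` on bounded sets. -/
theorem tendsto_slot {T : ℕ → H X →L[ℂ] H X'} {T' : H X →L[ℂ] H X'} {C : ℝ}
    (hb : ∀ n u, ‖T n u‖ ≤ C * ‖u‖) (ht : ∀ u, Tendsto (fun n => T n u) atTop (𝓝 (T' u))) (ξ : H Ω) :
    Tendsto (fun n => slot S S' (T n) ξ) atTop (𝓝 (slot S S' T' ξ)) := by
  rw [tendsto_iff_norm_sub_tendsto_zero]
  have hT' : ∀ u, ‖T' u‖ ≤ C * ‖u‖ := fun u =>
    le_of_tendsto (ht u).norm (Eventually.of_forall fun n => hb n u)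
  have hsum : ∀ n, ‖slot S S' (T n) ξ - slot S S' T' ξ‖ ^ 2 =
      ∑' l, ‖(T n - T') (S.coeffs ξ l)‖ ^ 2 := by
    intro n
    rw [← slot_sub, ← S'.coeffs.norm_map, coeffs_slot, ← (lp_norm_sq _).tsum_eq]
    rfl
  have hlim : Tendsto (fun n => ‖slot S S' (T n) ξ - slot S S' T' ξ‖ ^ 2) atTop (𝓝 0) := by
    simp_rw [hsum]
    have : (0 : ℝ) = ∑' l : BasisIndex (H Y), 0 := by simp
    rw [this]
    -- The norm is a sum over coefficients: every term tends to zero by strong convergence, and the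
    -- uniform bound C supplies a summable majorant.
    refine tendsto_tsum_of_dominated_convergence
      (bound := fun l => (2 * C) ^ 2 * ‖S.coeffs ξ l‖ ^ 2)
      ((summable_of_memℓp_two _).mul_left _) ?_ ?_
    · intro l
      have h := ((ht (S.coeffs ξ l)).sub_const (T' (S.coeffs ξ l))).norm.pow 2
      simpa using h
    · refine Eventually.of_forall fun n l => ?_
      rw [Real.norm_of_nonneg (sq_nonneg _), ← mul_pow]
      gcongr
      rw [sub_apply]
      refine (norm_sub_le _ _).trans ?_
      linarith [hb n (S.coeffs ξ l), hT' (S.coeffs ξ l)]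
  have := hlim.sqrt
  simpa using this

end Slot

/-- If the weighted contractions of `ξ` are square summable, then `ξ` has `j` derivatives in the
first variable. -/
theorem exists_slot_resolv {d j : ℕ} {Ω Y : Type} [MeasureSpace Ω] [MeasureSpace Y]
    [SFinite (volume : Measure Y)] [SecondCountableTopology (H (Pt d))] (S : Split Ω (Pt d) Y)
    (B : SobBasis d j) {ξ : H Ω} (h : ∑' a, ‖S.ctL (sobM d j (B.f a)).l2 ξ‖ₑ ^ 2 < ⊤) :
    ∃ χ : H Ω, ξ = slot S S (resolv d j) χ ∧
      ‖χ‖ₑ ^ 2 = ∑' a, ‖S.ctL (sobM d j (B.f a)).l2 ξ‖ₑ ^ 2 := by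
  -- Exchanging two sums of squares: the weighted contractions measure the H^j norms of all
  -- coefficients of ξ in a basis of the other variables. Each coefficient is therefore R of a
  -- vector, and these vectors are again square summable.
  have hsum : ∑' l, B.sobSq (S.ctR (hbasis (H Y) l) ξ) =
      ∑' a, ‖S.ctL (sobM d j (B.f a)).l2 ξ‖ₑ ^ 2 := by
    simp_rw [← tsum_enorm_sq_hilbertBasis (hbasis (H Y)) (S.ctL _ ξ), SobBasis.sobSq,
      Split.inner_ctL, Split.inner_ctR]
    exact ENNReal.tsum_comm
  have hfin : ∀ l, B.sobSq (S.ctR (hbasis (H Y) l) ξ) < ⊤ := fun l =>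
    (ENNReal.le_tsum l).trans_lt (hsum ▸ h)
  choose c hc hcn using fun l => B.exists_of_sobSq (hfin l)
  have hs : Summable fun l => ‖c l‖ ^ 2 := by
    have h2 : ∑' l, ‖c l‖ₑ ^ 2 ≠ ⊤ := by simp_rw [hcn]; rw [hsum]; exact h.ne
    simpa using ENNReal.summable_toReal h2
  let x : lp (fun _ : BasisIndex (H Y) => H (Pt d)) 2 := ⟨c, memℓp_two hs⟩
  have hxn : ‖x‖ₑ ^ 2 = ∑' l, ‖c l‖ₑ ^ 2 := by
    have h1 := lp_norm_sq x
    have h2 : ∀ l, ‖c l‖ₑ ^ 2 = ENNReal.ofReal (‖c l‖ ^ 2) := fun l => by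
      rw [ENNReal.ofReal_pow (norm_nonneg _), ofReal_norm]
    simp_rw [h2]
    rw [← ENNReal.ofReal_tsum_of_nonneg (fun l => sq_nonneg _) hs, ← ofReal_norm,
      ← ENNReal.ofReal_pow (norm_nonneg _), ← h1.tsum_eq]
  refine ⟨S.coeffs.symm x, ?_, ?_⟩
  · apply S.coeffs.injective
    rw [coeffs_slot, LinearIsometryEquiv.apply_symm_apply]
    ext1; funext l
    rw [lpMap_apply, Split.coeffs_apply]
    exact hc l
  · rw [LinearIsometryEquiv.enorm_map, hxn, ← hsum]
    exact tsum_congr hcn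

end HFB
end

/-! ### Configuration spaces, symmetrization and components of the field operators. -/

noncomputable section

namespace HFB

instance sigmaFinite_volume_pair (d : ℕ) : SigmaFinite (volume : Measure (Pt d × Pt d)) :=
  inferInstanceAs (SigmaFinite (volume.prod volume))

/-! ### Splittings of the configuration space -/

variable {d : ℕ}

/-- Splitting off the first particle. -/
def split₁ (d n : ℕ) : Split (Fin (n + 1) → Pt d) (Pt d) (Fin n → Pt d) where
  e := MeasurableEquiv.piFinSuccAbove (fun _ => Pt d) 0
  mp := volume_preserving_piFinSuccAbove (fun _ => Pt d) 0

@[simp] theorem split₁_e {n : ℕ} (x : Fin (n + 1) → Pt d) :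
    (split₁ d n).e x = (x 0, fun k => x k.succ) := by
  simp [split₁, MeasurableEquiv.piFinSuccAbove, Fin.insertNthEquiv]
  rfl

/-- The two factors of the two-particle space. -/
def splitProd (X Y : Type) [MeasureSpace X] [MeasureSpace Y] : Split (X × Y) X Y where
  e := MeasurableEquiv.refl _
  mp := MeasurePreserving.id _

@[simp] theorem splitProd_e {X Y : Type} [MeasureSpace X] [MeasureSpace Y] (x : X × Y) :
    (splitProd X Y).e x = x := rfl

/-- Splitting off the first two particles. -/
def split₂ (d n : ℕ) : Split (Fin (n + 2) → Pt d) (Pt d × Pt d) (Fin n → Pt d) where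
  e := ((split₁ d (n + 1)).e.trans
    ((MeasurableEquiv.refl (Pt d)).prodCongr (split₁ d n).e)).trans MeasurableEquiv.prodAssoc.symm
  mp := by
    have h1 := (split₁ d (n + 1)).mp
    have h2 : MeasurePreserving ((MeasurableEquiv.refl (Pt d)).prodCongr (split₁ d n).e)
        (volume.prod volume) (volume.prod (volume.prod volume)) :=
      (MeasurePreserving.id volume).prod (split₁ d n).mp
    have h3 := (volume_preserving_prodAssoc (α₁ := Pt d) (β₁ := Pt d) (γ₁ := Fin n → Pt d)).symm
    exact h3.comp (h2.comp h1)

@[simp] theorem split₂_e {n : ℕ} (x : Fin (n + 2) → Pt d) :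
    (split₂ d n).e x = ((x 0, x 1), fun k => x k.succ.succ) := by
  change MeasurableEquiv.prodAssoc.symm (((split₁ d (n + 1)).e x).1,
    (split₁ d n).e ((split₁ d (n + 1)).e x).2) = _
  rw [split₁_e]
  simp only
  rw [split₁_e]
  rfl

/-- Splitting off no particle. -/
def split₀ (d n : ℕ) : Split (Fin n → Pt d) PUnit (Fin n → Pt d) where
  e := MeasurableEquiv.punitProd.symm
  mp := by
    refine ⟨MeasurableEquiv.measurable _, ?_⟩
    change Measure.map (Prod.mk PUnit.unit) volume = (Measure.dirac _).prod volume
    rw [Measure.dirac_prod]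

@[simp] theorem split₀_e {n : ℕ} (x : Fin n → Pt d) : (split₀ d n).e x = (PUnit.unit, x) := rfl

/-! ### Permutations -/

theorem measurePreserving_perm {n : ℕ} (π : Equiv.Perm (Fin n)) :
    MeasurePreserving (fun x : Fin n → Pt d => fun i => x (π i)) volume volume := by
  have h := (volume_measurePreserving_piCongrLeft (fun _ : Fin n => Pt d) π⁻¹)
  convert h using 1
  funext x i
  have h2 := MeasurableEquiv.piCongrLeft_apply_apply (β := fun _ : Fin n => Pt d) π⁻¹ x (π i)
  simpa using h2.symm

/-- The action `(U π ξ)(x) = ξ (x ∘ π)` of permutations. -/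
def U {n : ℕ} (π : Equiv.Perm (Fin n)) : H (Fin n → Pt d) →ₗᵢ[ℂ] H (Fin n → Pt d) :=
  Lp.compMeasurePreservingₗᵢ ℂ _ (measurePreserving_perm π)

theorem U_coe {n : ℕ} (π : Equiv.Perm (Fin n)) (ξ : H (Fin n → Pt d)) :
    U π ξ =ᵐ[volume] fun x => ξ fun i => x (π i) :=
  Lp.coeFn_compMeasurePreserving ξ (measurePreserving_perm π)

theorem U_mul {n : ℕ} (π ρ : Equiv.Perm (Fin n)) (ξ : H (Fin n → Pt d)) :
    U (π * ρ) ξ = U π (U ρ ξ) := by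
  apply Lp.ext
  filter_upwards [U_coe (π * ρ) ξ, U_coe π (U ρ ξ), (quasiMeasurePreserving_perm π).ae (U_coe ρ ξ)]
    with x h1 h2 h3
  rw [h1, h2, h3]; rfl

theorem U_one {n : ℕ} (ξ : H (Fin n → Pt d)) : U 1 ξ = ξ := by
  apply Lp.ext
  filter_upwards [U_coe 1 ξ] with x h1
  rw [h1]; rfl

theorem inner_U {n : ℕ} (π : Equiv.Perm (Fin n)) (ξ η : H (Fin n → Pt d)) :
    inner ℂ ξ (U π η) = inner ℂ (U π⁻¹ ξ) η := by
  rw [← (U π).inner_map_map (U π⁻¹ ξ), ← U_mul, mul_inv_cancel, U_one]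

/-- The symmetric functions in `L²((ℝ^d)ⁿ)`. -/
def Sym (d n : ℕ) : Submodule ℂ (H (Fin n → Pt d)) where
  carrier := {ξ | ∀ π, U π ξ = ξ}
  zero_mem' π := map_zero _
  add_mem' := fun h h' π => by rw [map_add, h π, h' π]
  smul_mem' := fun c ξ h π => by rw [map_smul, h π]

theorem isClosed_sym (d n : ℕ) : IsClosed (Sym d n : Set (H (Fin n → Pt d))) := by
  have : (Sym d n : Set (H (Fin n → Pt d))) = ⋂ π, {ξ | U π ξ = ξ} := by
    ext ξ; simp [Sym]
  rw [this]
  exact isClosed_iInter fun π => isClosed_eq (U π).continuous continuous_id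

instance completeSpace_sym (d n : ℕ) : CompleteSpace (Sym d n) :=
  (isClosed_sym d n).completeSpace_coe

/-- The orthogonal projection onto the symmetric functions. -/
def P (d n : ℕ) : H (Fin n → Pt d) →L[ℂ] H (Fin n → Pt d) := (Sym d n).starProjection

theorem P_mem {n : ℕ} (ξ : H (Fin n → Pt d)) : P d n ξ ∈ Sym d n :=
  (Sym d n).starProjection_apply_mem ξ

theorem P_of_mem {n : ℕ} {ξ : H (Fin n → Pt d)} (h : ξ ∈ Sym d n) : P d n ξ = ξ :=
  Submodule.starProjection_eq_self_iff.2 h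

theorem inner_P {n : ℕ} (ξ η : H (Fin n → Pt d)) : inner ℂ ξ (P d n η) = inner ℂ (P d n ξ) η :=
  ((Sym d n).inner_starProjection_left_eq_right ξ η).symm

theorem norm_P_le {n : ℕ} (ξ : H (Fin n → Pt d)) : ‖P d n ξ‖ ≤ ‖ξ‖ :=
  (Sym d n).norm_starProjection_apply_le ξ

theorem inner_P_of_mem {n : ℕ} {ξ : H (Fin n → Pt d)} (h : ξ ∈ Sym d n) (η : H (Fin n → Pt d)) :
    inner ℂ ξ (P d n η) = inner ℂ ξ η := by rw [inner_P, P_of_mem h]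

/-- This is how symmetrized vectors are recognized below: only pairings with symmetric vectors have
to be compared. -/
theorem eq_P_of_inner {n : ℕ} {ξ η : H (Fin n → Pt d)} (hξ : ξ ∈ Sym d n)
    (h : ∀ s ∈ Sym d n, inner ℂ s ξ = inner ℂ s η) : ξ = P d n η := by
  rw [← P_of_mem hξ]
  refine ext_inner_left ℂ fun s => ?_
  rw [inner_P, inner_P, h _ (P_mem s)]

theorem Fock.mem_sym (ξ : Fock d) (n : ℕ) : (ξ : FullFock d) n ∈ Sym d n := fun π => by
  apply Lp.ext
  exact (U_coe π _).trans (ξ.2 n π)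

theorem mem_boseFock {ξ : FullFock d} (h : ∀ n, ξ n ∈ Sym d n) : ξ ∈ boseFock d := fun n π => by
  have h1 := U_coe π (ξ n)
  rw [h n π] at h1
  exact h1.symm

theorem isClosed_boseFock (d : ℕ) : IsClosed (boseFock d : Set (FullFock d)) := by
  have : (boseFock d : Set (FullFock d)) = ⋂ n, {ξ | ξ n ∈ Sym d n} := by
    ext ξ
    simp only [Set.mem_iInter, Set.mem_ofPred_eq, SetLike.mem_coe]
    exact ⟨fun h n => Fock.mem_sym ⟨ξ, h⟩ n, mem_boseFock⟩
  rw [this]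
  refine isClosed_iInter fun n => (isClosed_sym d n).preimage ?_
  exact (lp.evalCLM ℂ (fun n : ℕ => H (Fin n → Pt d)) 2 n).continuous

instance completeSpace_fock (d : ℕ) : CompleteSpace (Fock d) :=
  (isClosed_boseFock d).completeSpace_coe

/-! ### Product functions -/

/-- The product function `f₁ ⊗ ⋯ ⊗ fₙ` in `L²`. -/
def pten : {n : ℕ} → (Fin n → L2 d) → H (Fin n → Pt d)
  | 0, _ => (memLp_const (1 : ℂ)).toLp _
  | n + 1, F => (split₁ d n).ten (F 0) (pten fun k => F k.succ)

theorem pten_coe : {n : ℕ} → (F : Fin n → L2 d) → pten F =ᵐ[volume] tens fun i => ⇑(F i)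
  | 0, F => by
    refine (MemLp.coeFn_toLp _).trans ?_
    filter_upwards with x
    simp [tens]
  | n + 1, F => by
    have h := pten_coe fun k => F k.succ
    refine ((split₁ d n).ten_coe _ _).trans ?_
    filter_upwards [(split₁ d n).mp.quasiMeasurePreserving.ae (ae_prod_snd h)] with x hx
    rw [hx]
    simp [tens, Fin.prod_univ_succ]

theorem pten_succ {n : ℕ} (F : Fin (n + 1) → L2 d) :
    pten F = (split₁ d n).ten (F 0) (pten fun k => F k.succ) := rfl

theorem tens_ae_congr {n : ℕ} {F G : Fin n → Pt d → ℂ} (h : ∀ i, F i =ᵐ[volume] G i) :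
    tens F =ᵐ[volume] tens G := by
  have h2 : ∀ i, ∀ᵐ x : Fin n → Pt d, F i (x i) = G i (x i) := fun i =>
    (Measure.quasiMeasurePreserving_eval (fun _ : Fin n => (volume : Measure (Pt d))) i).ae (h i)
  filter_upwards [ae_all_iff.2 h2] with x hx
  simp only [tens, hx]

theorem pten_test_coe {n : ℕ} (F : Fin n → Test d) :
    pten (fun i => (F i).l2) =ᵐ[volume] tensT F :=
  (pten_coe _).trans (tens_ae_congr fun i => (F i).coeFn_l2)

theorem U_pten {n : ℕ} (π : Equiv.Perm (Fin n)) (F : Fin n → L2 d) :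
    U π (pten F) = pten fun i => F (π⁻¹ i) := by
  apply Lp.ext
  filter_upwards [U_coe π (pten F), (quasiMeasurePreserving_perm π).ae (pten_coe F),
    pten_coe fun i => F (π⁻¹ i)] with x h1 h2 h3
  rw [h1, h2, h3]
  simp only [tens]
  rw [← Equiv.prod_comp π fun i => F (π⁻¹ i) (x i)]
  simp

theorem inner_pten_U {n : ℕ} (π : Equiv.Perm (Fin n)) (F : Fin n → L2 d) (ξ : H (Fin n → Pt d)) :
    inner ℂ (pten F) (U π ξ) = inner ℂ (pten fun i => F (π i)) ξ := by
  rw [inner_U, U_pten, inv_inv]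

theorem pair_eq_inner {n : ℕ} {G : (Fin n → Pt d) → ℂ} {g : H (Fin n → Pt d)} (h : g =ᵐ[volume] G)
    (ξ : H (Fin n → Pt d)) : pair G ξ = inner ℂ g ξ := by
  rw [H.inner_eq, pair]
  refine integral_congr_ae ?_
  filter_upwards [h] with x hx
  rw [hx]

theorem pair_tensT {n : ℕ} (F : Fin n → Test d) (ξ : Fock d) :
    pair (tensT F) (ξ.comp n) = inner ℂ (pten fun i => (F i).l2) ((ξ : FullFock d) n) :=
  pair_eq_inner (pten_test_coe F) _

/-- Products of test functions are total. -/
theorem ext_pten : {n : ℕ} → {ξ η : H (Fin n → Pt d)} →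
    (∀ F : Fin n → Test d, inner ℂ (pten fun i => (F i).l2) ξ = inner ℂ (pten fun i => (F i).l2) η) →
      ξ = η
  | 0, ξ, η, h => by
    have h1 := h Fin.elim0
    have h2 : ∀ ζ : H (Fin 0 → Pt d), inner ℂ (pten fun i => (Fin.elim0 i : Test d).l2) ζ =
        ζ default := by
      intro ζ
      rw [H.inner_eq]
      have h3 : ∀ᵐ x : Fin 0 → Pt d, conj ((pten fun i => (Fin.elim0 i : Test d).l2 :
          H (Fin 0 → Pt d)) x) * ζ x = ζ default := by
        filter_upwards [pten_coe fun i => (Fin.elim0 i : Test d).l2] with x hx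
        rw [hx, Subsingleton.elim x default]
        simp [tens]
      rw [integral_congr_ae h3]
      have hv : (volume : Measure (Fin 0 → Pt d)).real Set.univ = 1 := by
        rw [Measure.volume_pi_eq_dirac (default : Fin 0 → Pt d)]; simp
      rw [integral_const, hv, one_smul]
    rw [h2, h2] at h1
    apply Lp.ext
    filter_upwards with x
    rw [Subsingleton.elim x default, h1]
  | n + 1, ξ, η, h => by
    refine (split₁ d n).ext_ten fun f g => ?_
    rw [← Split.inner_ctR, ← Split.inner_ctR]
    congr 1
    refine ext_inner_test fun f => ?_
    rw [Split.inner_ctR, Split.inner_ctR, ← Split.inner_ctL, ← Split.inner_ctL]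
    congr 1
    refine ext_pten fun F => ?_
    rw [Split.inner_ctL, Split.inner_ctL]
    have := h (Fin.cons f F)
    rw [pten_succ] at this
    simpa using this

/-- The permutation moving `0` to `i` and preserving the order of the other elements. -/
def toFront {n : ℕ} (i : Fin (n + 1)) : Equiv.Perm (Fin (n + 1)) := (Fin.cycleRange i).symm

@[simp] theorem toFront_zero {n : ℕ} (i : Fin (n + 1)) : toFront i 0 = i :=
  Fin.cycleRange_symm_zero i

@[simp] theorem toFront_succ {n : ℕ} (i : Fin (n + 1)) (k : Fin n) :
    toFront i k.succ = i.succAbove k := Fin.cycleRange_symm_succ i k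

theorem inner_pten_toFront {n : ℕ} (i : Fin (n + 1)) (F : Fin (n + 1) → L2 d) (f : L2 d)
    (ξ : H (Fin n → Pt d)) :
    inner ℂ (pten F) (U (toFront i) ((split₁ d n).ten f ξ)) =
      inner ℂ (F i) f * inner ℂ (pten fun k => F (i.succAbove k)) ξ := by
  rw [inner_pten_U, pten_succ, Split.inner_ten_ten]
  simp

/-! ### Components of creation and annihilation operators -/

theorem annTerm_eq {f : Pt d → ℂ} {f' : L2 d} (h : f' =ᵐ[volume] f) (ξ : Fock d) (n : ℕ)
    (F : Fin n → Test d) : annTerm f ξ n F = (Real.sqrt (n + 1) : ℂ) *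
      inner ℂ (pten fun i => (F i).l2) ((split₁ d n).ctL f' ((ξ : FullFock d) (n + 1))) := by
  rw [annTerm, Split.inner_ctL]
  congr 1
  refine pair_eq_inner ?_ _
  refine ((split₁ d n).ten_coe _ _).trans ?_
  have hq := (split₁ d n).mp.quasiMeasurePreserving
  filter_upwards [hq.ae (ae_prod_snd (pten_test_coe F)), hq.ae (ae_prod_fst h)] with x h1 h2
  rw [h1, h2]
  simp [tensT, tens]

theorem creTerm_zero (f : Pt d → ℂ) (ξ : Fock d) (F : Fin 0 → Test d) : creTerm f ξ 0 F = 0 := rfl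

theorem creTerm_succ {f : Pt d → ℂ} {f' : L2 d} (h : f' =ᵐ[volume] f) (ξ : Fock d) (n : ℕ)
    (F : Fin (n + 1) → Test d) : creTerm f ξ (n + 1) F = (Real.sqrt (n + 1) : ℂ)⁻¹ *
      inner ℂ (pten fun i => (F i).l2)
        (∑ i, U (toFront i) ((split₁ d n).ten f' ((ξ : FullFock d) n))) := by
  rw [creTerm, inner_sum]
  congr 1
  refine Finset.sum_congr rfl fun i _ => ?_
  rw [inner_pten_toFront, H.inner_eq, pair_tensT]
  congr 1
  refine integral_congr_ae ?_
  filter_upwards [h, (F i).coeFn_l2] with x h1 h2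
  rw [h1, h2]

/-- Products of test functions are total, so the weak definition is equivalent to an explicit
formula for the components. -/
theorem annOp_iff {f : Pt d → ℂ} {f' : L2 d} (h : f' =ᵐ[volume] f) (ξ η : Fock d) :
    annOp f ξ η ↔ ∀ n, (η : FullFock d) n =
      (Real.sqrt (n + 1) : ℂ) • (split₁ d n).ctL f' ((ξ : FullFock d) (n + 1)) := by
  refine forall_congr' fun n => ⟨fun hn => ext_pten fun F => ?_, fun hn F => ?_⟩
  · rw [inner_smul_right, ← annTerm_eq h, ← hn F, pair_tensT]
  · rw [annTerm_eq h, pair_tensT, hn, inner_smul_right]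

theorem creOp.zero_comp {f : Pt d → ℂ} {ξ η : Fock d} (h : creOp f ξ η) : (η : FullFock d) 0 = 0 :=
  ext_pten fun F => by
    rw [← pair_tensT, h 0 F, creTerm_zero, inner_zero_right]

/-- Tested against a symmetric vector, each of the n + 1 insertions of f contributes the same
amount; the factor n + 1 turns (n+1)^{-1/2} into (n+1)^{1/2}. -/
theorem creOp.succ_comp {f : Pt d → ℂ} {f' : L2 d} (hf : f' =ᵐ[volume] f) {ξ η : Fock d}
    (h : creOp f ξ η) (n : ℕ) : (η : FullFock d) (n + 1) =
      (Real.sqrt (n + 1) : ℂ) • P d (n + 1) ((split₁ d n).ten f' ((ξ : FullFock d) n)) := by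
  have h1 : (η : FullFock d) (n + 1) = (Real.sqrt (n + 1) : ℂ)⁻¹ •
      ∑ i, U (toFront i) ((split₁ d n).ten f' ((ξ : FullFock d) n)) :=
    ext_pten fun F => by rw [← pair_tensT, h, creTerm_succ hf, inner_smul_right]
  rw [← map_smul]
  refine eq_P_of_inner (Fock.mem_sym _ _) fun s hs => ?_
  rw [h1, inner_smul_right, inner_smul_right, inner_sum]
  have h2 : ∀ i, inner ℂ s (U (toFront i) ((split₁ d n).ten f' ((ξ : FullFock d) n))) =
      inner ℂ s ((split₁ d n).ten f' ((ξ : FullFock d) n)) := fun i => by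
    rw [inner_U, hs]
  simp_rw [h2]
  rw [Finset.sum_const, Finset.card_univ, Fintype.card_fin, nsmul_eq_mul, ← mul_assoc]
  congr 1
  have h3 : (Real.sqrt (n + 1) : ℂ) * Real.sqrt (n + 1) = n + 1 := by
    rw [← Complex.ofReal_mul, Real.mul_self_sqrt (by positivity)]; push_cast; rfl
  have h4 : (Real.sqrt (n + 1) : ℂ) ≠ 0 := by
    rw [Complex.ofReal_ne_zero, Real.sqrt_ne_zero']; positivity
  field_simp
  rw [sq, h3]; push_cast; ring

end HFB
end

/-! ### The state as a vector, monomials and Wick's theorem. -/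

noncomputable section

namespace HFB

variable {d : ℕ}

instance innerFock (d : ℕ) : Inner ℂ (Fock d) := InnerProductSpace.toInner

/-! ### Words in the field operators -/

theorem FieldOp.op_unique {b : FieldOp d} {ξ η η' : Fock d} (h : b.op ξ η) (h' : b.op ξ η') :
    η = η' := by
  apply Subtype.ext
  apply lp.ext
  funext n
  refine ext_pten fun F => ?_
  rw [← pair_tensT, ← pair_tensT]
  rw [FieldOp.op] at h h'
  split_ifs at h h' <;> rw [h n F, h' n F]

theorem wordOp_unique {L : List (FieldOp d)} {ξ η η' : Fock d} (h : wordOp L ξ η)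
    (h' : wordOp L ξ η') : η = η' := by
  induction L generalizing η η' with
  | nil => exact h.trans h'.symm
  | cons b L ih =>
    obtain ⟨ζ, h1, h2⟩ := h
    obtain ⟨ζ', h1', h2'⟩ := h'
    obtain rfl := ih h1 h1'
    exact FieldOp.op_unique h2 h2'

theorem wordOp_append {A B : List (FieldOp d)} {ξ η : Fock d} :
    wordOp (A ++ B) ξ η ↔ ∃ ζ, wordOp B ξ ζ ∧ wordOp A ζ η := by
  induction A generalizing η with
  | nil => exact ⟨fun h => ⟨η, h, rfl⟩, fun ⟨ζ, h1, h2⟩ => by rw [h2]; exact h1⟩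
  | cons b A ih =>
    constructor
    · rintro ⟨ζ, h1, h2⟩
      obtain ⟨θ, h3, h4⟩ := ih.1 h1
      exact ⟨θ, h3, ζ, h4, h2⟩
    · rintro ⟨θ, h3, ζ, h4, h2⟩
      exact ⟨ζ, ih.2 ⟨θ, h3, h4⟩, h2⟩

theorem Fock.hasSum_inner (ξ η : Fock d) :
    HasSum (fun n => inner ℂ ((ξ : FullFock d) n) ((η : FullFock d) n)) (inner ℂ ξ η) :=
  lp.hasSum_inner (𝕜 := ℂ) (ξ : FullFock d) (η : FullFock d)

/-- No domain condition is needed: both sides are the sum over n of √(n+1) ⟨f ⊗ ζ'_n, ζ_{n+1}⟩. The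
index shift by one is harmless because a created vector has no vacuum component. -/
theorem inner_annOp {f : Test d} {ζ η ζ' η' : Fock d} (h : annOp f ζ η) (h' : creOp f ζ' η') :
    inner ℂ ζ' η = inner ℂ η' ζ := by
  have h1 := Fock.hasSum_inner ζ' η
  have h2 := Fock.hasSum_inner η' ζ
  rw [← hasSum_nat_add_iff' 1] at h2
  simp only [Finset.range_one, Finset.sum_singleton, h'.zero_comp, inner_zero_left, sub_zero] at h2
  refine h1.unique (Eq.mp ?_ h2)
  congr 1
  funext n
  rw [h'.succ_comp f.coeFn_l2, (annOp_iff f.coeFn_l2 _ _).1 h n, inner_smul_left, inner_smul_right,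
    Complex.conj_ofReal, ← inner_P, P_of_mem (Fock.mem_sym _ _), Split.inner_ctL]

theorem FieldOp.adj_adj (b : FieldOp d) : b.adj.adj = b := by
  cases b; simp [FieldOp.adj]

theorem FieldOp.inner_op {b : FieldOp d} {ζ η ζ' η' : Fock d} (h : b.op ζ η) (h' : b.adj.op ζ' η') :
    inner ℂ ζ' η = inner ℂ η' ζ := by
  obtain ⟨f, c⟩ := b
  cases c
  · exact inner_annOp h h'
  · have := inner_annOp h' h
    rw [← inner_conj_symm, ← this, inner_conj_symm]

@[simp] theorem adjWord_nil : adjWord ([] : List (FieldOp d)) = [] := rfl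

theorem adjWord_cons (b : FieldOp d) (L : List (FieldOp d)) :
    adjWord (b :: L) = adjWord L ++ [b.adj] := by simp [adjWord]

theorem adjWord_append (A B : List (FieldOp d)) : adjWord (A ++ B) = adjWord B ++ adjWord A := by
  simp [adjWord]

theorem adjWord_adjWord (L : List (FieldOp d)) : adjWord (adjWord L) = L := by
  induction L with
  | nil => rfl
  | cons b L ih => rw [adjWord_cons, adjWord_append, ih, adjWord_cons, FieldOp.adj_adj]; rfl

/-- The factors are moved to the other side one at a time, from the left. -/
theorem inner_wordOp {L : List (FieldOp d)} {ζ η ζ' η' : Fock d} (h : wordOp L ζ η)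
    (h' : wordOp (adjWord L) ζ' η') : inner ℂ ζ' η = inner ℂ η' ζ := by
  induction L generalizing η ζ' with
  | nil => obtain rfl := h; obtain rfl := h'; rfl
  | cons b L ih =>
    rw [adjWord_cons, wordOp_append] at h'
    obtain ⟨θ', h1', h2'⟩ := h'
    obtain ⟨θ, h1, h2⟩ := h
    obtain ⟨_, rfl, h1'⟩ := h1'
    rw [FieldOp.inner_op h2 h1', ih h1 h2']

/-! ### Sums over contractions -/

/-- The sum `∑ᵢ f(Lᵢ, L without Lᵢ)`. -/
def wsum : List (FieldOp d) → (FieldOp d → List (FieldOp d) → ℂ) → ℂ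
  | [], _ => 0
  | b :: L, f => f b L + wsum L fun c L' => f c (b :: L')

theorem sum_eraseIdx (L : List (FieldOp d)) (f : FieldOp d → List (FieldOp d) → ℂ) :
    ∑ i : Fin L.length, f (L.get i) (L.eraseIdx i) = wsum L f := by
  induction L generalizing f with
  | nil => rfl
  | cons b L ih =>
    rw [wsum, ← ih]
    exact Fin.sum_univ_succ (n := L.length) fun i => f ((b :: L).get i) ((b :: L).eraseIdx i)

theorem wsum_append (A B : List (FieldOp d)) (f : FieldOp d → List (FieldOp d) → ℂ) :
    wsum (A ++ B) f = wsum A (fun c L => f c (L ++ B)) + wsum B fun c L => f c (A ++ L) := by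
  induction A generalizing f with
  | nil => simp [wsum]
  | cons b A ih => simp [wsum, ih, add_assoc]

theorem wsum_adjWord (L : List (FieldOp d)) (f : FieldOp d → List (FieldOp d) → ℂ) :
    wsum (adjWord L) f = wsum L fun c L' => f c.adj (adjWord L') := by
  induction L generalizing f with
  | nil => rfl
  | cons b L ih =>
    rw [adjWord_cons, wsum_append, ih]
    simp only [wsum, adjWord_cons, List.append_nil, add_zero]
    rw [add_comm]

theorem wsum_ofFn {m : ℕ} (b : Fin (m + 1) → FieldOp d)
    (f : FieldOp d → List (FieldOp d) → ℂ) :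
    wsum (List.ofFn b) f = ∑ i, f (b i) (List.ofFn fun k => b (i.succAbove k)) := by
  induction m generalizing f with
  | zero => simp [wsum]
  | succ m ih =>
    rw [List.ofFn_succ, wsum, ih, Fin.sum_univ_succ]
    rw [Fin.sum_univ_succ, Fin.sum_univ_succ]
    simp [List.ofFn_succ]

/-! ### Vectors obtained by applying words to a quasifree state -/

/-- The Hilbert space of sequences of Fock vectors. -/
abbrev G (d : ℕ) : Type := lp (fun _ : ℕ => Fock d) 2

instance innerG (d : ℕ) : Inner ℂ (G d) := InnerProductSpace.toInner

/-- The component of a sequence of Fock vectors with given index and particle number. -/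
def G.comp (X : G d) (k n : ℕ) : H (Fin n → Pt d) := (X k : FullFock d) n

/-- The moments of a quasifree state and the vectors obtained from monomials. -/
structure Quasifree (ω : State d) where
  m : List (FieldOp d) → ℂ
  W : List (FieldOp d) → G d
  word : ∀ L k, wordOp L (ω.vec k) (W L k)
  inner_W : ∀ L L', inner ℂ (W L) (W L') = m (adjWord L ++ L')
  wick : ∀ b L, m (b :: L) = m [b] * m L + wsum L fun c L' => (m [b, c] - m [b] * m [c]) * m L'

/-- Since ‖L ξ_k‖² = ⟨ξ_k, L* L ξ_k⟩, existence of the moment of L* L makes the sequence (L ξ_k)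
square summable, hence an element of `G`. -/
theorem State.IsQuasifree.nonempty {ω : State d} (h : ω.IsQuasifree) : Nonempty (Quasifree ω) := by
  obtain ⟨m, h1, h2⟩ := h
  choose η hη hsum using h1
  have key : ∀ L L' k, inner ℂ (η L k) (η L' k) = inner ℂ (ω.vec k) (η (adjWord L ++ L') k) := by
    intro L L' k
    obtain ⟨ζ, h3, h4⟩ := wordOp_append.1 (hη (adjWord L ++ L') k)
    obtain rfl := wordOp_unique h3 (hη L' k)
    rw [← inner_conj_symm, ← inner_conj_symm (ω.vec k)]
    congr 1
    have := inner_wordOp (L := adjWord L) h4 (by rw [adjWord_adjWord]; exact hη L k)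
    rw [← inner_conj_symm, ← this, inner_conj_symm]
  have hs : ∀ L, Summable fun k => ‖η L k‖ ^ 2 := by
    intro L
    have h3 := (hsum (adjWord L ++ L)).mapL Complex.reCLM
    refine h3.summable.congr fun k => ?_
    rw [Complex.reCLM_apply, ← key, inner_self_eq_norm_sq_to_K]
    norm_cast
  refine ⟨⟨m, fun L => ⟨η L, memℓp_two (hs L)⟩, fun L k => hη L k, fun L L' => ?_, fun b L => ?_⟩⟩
  · have h3 := lp.hasSum_inner (𝕜 := ℂ) (⟨η L, memℓp_two (hs L)⟩ : G d) ⟨η L', memℓp_two (hs L')⟩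
    refine h3.unique (Eq.mp ?_ (hsum (adjWord L ++ L')))
    congr 1
    funext k
    exact (key L L' k).symm
  · rw [h2, ← sum_eraseIdx]

namespace Quasifree

variable {ω : State d} (Q : Quasifree ω)

theorem W_nil (k : ℕ) : Q.W [] k = ω.vec k := Q.word [] k

theorem norm_W_nil : ‖Q.W []‖ = 1 := by
  have h := lp_norm_sq (Q.W [])
  simp only [W_nil] at h
  have h2 := h.unique ω.hasSum_norm
  nlinarith [norm_nonneg (Q.W [])]

theorem m_eq (L : List (FieldOp d)) : Q.m L = inner ℂ (Q.W []) (Q.W L) := (Q.inner_W [] L).symm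

theorem m_adjWord (L : List (FieldOp d)) : Q.m (adjWord L) = conj (Q.m L) := by
  rw [m_eq Q L, inner_conj_symm, Q.inner_W, List.append_nil]

theorem m_nil : Q.m [] = 1 := by
  rw [m_eq, inner_self_eq_norm_sq_to_K, norm_W_nil]; simp

/-- Monomials are single-valued as operators, so every witness of the expectation uses the vectors
`Q.W L`. -/
theorem eq_m {L : List (FieldOp d)} {z : ℂ} (h : HasExp ω (wordOp L) z) : z = Q.m L := by
  obtain ⟨η, h1, h2⟩ := h
  have h3 := lp.hasSum_inner (𝕜 := ℂ) (Q.W []) (Q.W L)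
  rw [← Q.m_eq] at h3
  refine h2.unique (Eq.mp ?_ h3)
  congr 1
  funext k
  rw [wordOp_unique (h1 k) (Q.word L k), W_nil]

theorem W_cons (b : FieldOp d) (L : List (FieldOp d)) (k : ℕ) : b.op (Q.W L k) (Q.W (b :: L) k) := by
  obtain ⟨ζ, h1, h2⟩ := Q.word (b :: L) k
  rwa [wordOp_unique (Q.word L k) h1]

theorem comp_ann (f : Test d) (L : List (FieldOp d)) (k n : ℕ) :
    (Q.W (.ann f :: L)).comp k n =
      (Real.sqrt (n + 1) : ℂ) • (split₁ d n).ctL f.l2 ((Q.W L).comp k (n + 1)) :=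
  (annOp_iff f.coeFn_l2 _ _).1 (Q.W_cons (.ann f) L k) n

theorem comp_cre_zero (f : Test d) (L : List (FieldOp d)) (k : ℕ) :
    (Q.W (.cre f :: L)).comp k 0 = 0 :=
  creOp.zero_comp (Q.W_cons (.cre f) L k)

theorem comp_cre_succ (f : Test d) (L : List (FieldOp d)) (k n : ℕ) :
    (Q.W (.cre f :: L)).comp k (n + 1) =
      (Real.sqrt (n + 1) : ℂ) • P d (n + 1) ((split₁ d n).ten f.l2 ((Q.W L).comp k n)) :=
  creOp.succ_comp f.coeFn_l2 (Q.W_cons (.cre f) L k) n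

/-- Truncated two-point function. -/
def κ (b c : FieldOp d) : ℂ := Q.m [b, c] - Q.m [b] * Q.m [c]

/-! ### Finite-dimensional moment bounds -/

section Bounds

variable {K : Type} [Fintype K] (u g : K → Test d)

/-- The monomial `a(u_{α 0}) a(u_{α 1}) ⋯`. -/
def annWord {m : ℕ} {K : Type} (u : K → Test d) (α : Fin m → K) : List (FieldOp d) :=
  List.ofFn fun i => .ann (u (α i))

/-- With u running through an orthonormal basis this becomes the factorial moment ω(N(N-1)⋯(N-m+1)).
-/
def A (m : ℕ) : ℝ := ∑ α : Fin m → K, ‖Q.W (annWord u α)‖ ^ 2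

/-- The additional innermost annihilator carries g. With g = M^j u this is a factorial moment of
order m + 1 in which one particle is weighted by M^{2j}. -/
def B (m : ℕ) : ℝ := ∑ α : Fin m → K, ∑ a, ‖Q.W (annWord u α ++ [.ann (g a)])‖ ^ 2

/-- Wick's theorem applied to the leftmost factor a*(g) of the squared norm. It is left alone, or
contracted with one of the creators, with one of the annihilators a(u), or with a(g). -/
theorem wick_norm_sq {m : ℕ} (α : Fin (m + 1) → K) (a : K) :
    inner ℂ (Q.W (annWord u α ++ [.ann (g a)])) (Q.W (annWord u α ++ [.ann (g a)])) =
      Q.m [.cre (g a)] * inner ℂ (Q.W (annWord u α)) (Q.W (annWord u α ++ [.ann (g a)])) +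
      ((∑ i, Q.κ (.cre (g a)) (.cre (u (α i))) *
        inner ℂ (Q.W (annWord u (i.removeNth α))) (Q.W (annWord u α ++ [.ann (g a)]))) +
      ((∑ i, Q.κ (.cre (g a)) (.ann (u (α i))) *
        inner ℂ (Q.W (annWord u α)) (Q.W (annWord u (i.removeNth α) ++ [.ann (g a)]))) +
      Q.κ (.cre (g a)) (.ann (g a)) * inner ℂ (Q.W (annWord u α)) (Q.W (annWord u α)))) := by
  simp only [Q.inner_W]
  have h1 : adjWord (annWord u α ++ [FieldOp.ann (g a)]) ++ (annWord u α ++ [.ann (g a)]) =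
      .cre (g a) :: (adjWord (annWord u α) ++ (annWord u α ++ [.ann (g a)])) := by
    rw [adjWord_append]; rfl
  rw [h1, Q.wick, wsum_append, wsum_append, wsum_adjWord]
  congr 2
  · rw [annWord, wsum_ofFn]; rfl
  · congr 1
    · conv_lhs => enter [1]; rw [annWord]
      rw [wsum_ofFn]; rfl
    · simp [wsum, κ]

theorem wick_norm_sq_zero (α : Fin 0 → K) (a : K) :
    inner ℂ (Q.W (annWord u α ++ [.ann (g a)])) (Q.W (annWord u α ++ [.ann (g a)])) =
      Q.m [.cre (g a)] * inner ℂ (Q.W (annWord u α)) (Q.W (annWord u α ++ [.ann (g a)])) +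
      Q.κ (.cre (g a)) (.ann (g a)) * inner ℂ (Q.W (annWord u α)) (Q.W (annWord u α)) := by
  simp only [Q.inner_W]
  have h1 : adjWord (annWord u α ++ [FieldOp.ann (g a)]) ++ (annWord u α ++ [.ann (g a)]) =
      [.cre (g a), .ann (g a)] := by
    simp [annWord, adjWord, FieldOp.adj, FieldOp.ann, FieldOp.cre]
  rw [h1, Q.wick]
  simp [annWord, wsum, κ, Q.m_nil]

end Bounds

end Quasifree

end HFB
end

/-! ### The Wick recursion for finite families of modes. -/

noncomputable section

namespace HFB

variable {d : ℕ}

theorem sum_sum_mul_le_sqrt {S T : Type*} [Fintype S] [Fintype T] (f h : S → T → ℝ) :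
    ∑ s, ∑ t, f s t * h s t ≤
      Real.sqrt (∑ s, ∑ t, f s t ^ 2) * Real.sqrt (∑ s, ∑ t, h s t ^ 2) := by
  have := Real.sum_mul_le_sqrt_mul_sqrt (Finset.univ : Finset (S × T)) (fun p => f p.1 p.2)
    fun p => h p.1 p.2
  simpa only [Fintype.sum_prod_type] using this

theorem sqrt_mul_sq_le {R a p : ℝ} (hR : 0 ≤ R) (ha : 0 ≤ a) (hp : p ≤ R ^ 2) :
    √(p * a) ≤ R * √a := by
  rw [Real.sqrt_le_left (by positivity), mul_pow, Real.sq_sqrt ha]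
  gcongr

namespace Quasifree

variable {ω : State d} (Q : Quasifree ω) {K : Type} [Fintype K] (u g : K → Test d)

theorem norm_sq_le {m : ℕ} (α : Fin (m + 1) → K) (a : K) :
    ‖Q.W (annWord u α ++ [.ann (g a)])‖ ^ 2 ≤
      (‖Q.m [.cre (g a)]‖ * ‖Q.W (annWord u α)‖) * ‖Q.W (annWord u α ++ [.ann (g a)])‖ +
      ((∑ i, (‖Q.κ (.cre (g a)) (.cre (u (α i)))‖ * ‖Q.W (annWord u (i.removeNth α))‖) *
        ‖Q.W (annWord u α ++ [.ann (g a)])‖) +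
      ((∑ i, ‖Q.κ (.cre (g a)) (.ann (u (α i)))‖ *
        (‖Q.W (annWord u α)‖ * ‖Q.W (annWord u (i.removeNth α) ++ [.ann (g a)])‖)) +
      ‖Q.κ (.cre (g a)) (.ann (g a))‖ * ‖Q.W (annWord u α)‖ ^ 2)) := by
  have h := congrArg norm (Q.wick_norm_sq u g α a)
  have h0 : ∀ x : G d, ‖(inner ℂ x x : ℂ)‖ = ‖x‖ ^ 2 := fun x => by
    rw [inner_self_eq_norm_sq_to_K]; simp
  rw [h0] at h
  conv_lhs => rw [h]
  refine (norm_add_le _ _).trans (add_le_add ?_ ((norm_add_le _ _).trans (add_le_add ?_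
    ((norm_add_le _ _).trans (add_le_add ?_ ?_)))))
  · rw [norm_mul, mul_assoc]; gcongr; exact norm_inner_le_norm _ _
  · refine (norm_sum_le _ _).trans (Finset.sum_le_sum fun i _ => ?_)
    rw [norm_mul, mul_assoc]; gcongr; exact norm_inner_le_norm _ _
  · refine (norm_sum_le _ _).trans (Finset.sum_le_sum fun i _ => ?_)
    rw [norm_mul]; gcongr; exact norm_inner_le_norm _ _
  · rw [norm_mul, h0]

theorem sum_removeNth {m : ℕ} (i : Fin (m + 1)) (F : K → (Fin m → K) → (Fin (m + 1) → K) → ℝ) :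
    ∑ α : Fin (m + 1) → K, F (α i) (i.removeNth α) α =
      ∑ β : Fin m → K, ∑ b, F b β (i.insertNth b β) := by
  rw [← (Fin.insertNthEquiv (fun _ => K) i).sum_comp, Fintype.sum_prod_type, Finset.sum_comm]
  simp [Fin.insertNthEquiv]

/-- The four terms of the Wick expansion are summed by Cauchy-Schwarz, using square summability of
the one-point function and of the two-point functions against g, and absolute summability of the
diagonal part. On the right `B` of order m + 1 occurs only under a square root, so the inequality
bounds it by the remaining quantities. -/
theorem B_succ_le {R : ℝ} (hR : 0 ≤ R)
    (h1 : ∑ a, ‖Q.m [.cre (g a)]‖ ^ 2 ≤ R ^ 2)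
    (h2 : ∑ a, ∑ b, ‖Q.κ (.cre (g a)) (.cre (u b))‖ ^ 2 ≤ R ^ 2)
    (h3 : ∑ a, ∑ b, ‖Q.κ (.cre (g a)) (.ann (u b))‖ ^ 2 ≤ R ^ 2)
    (h4 : ∑ a, ‖Q.κ (.cre (g a)) (.ann (g a))‖ ≤ R) (m : ℕ) :
    Q.B u g (m + 1) ≤ R * √(Q.A u (m + 1)) * √(Q.B u g (m + 1)) +
      ((m + 1) * (R * √(Q.A u m) * √(Q.B u g (m + 1))) +
      ((m + 1) * (R * (√(Q.A u (m + 1)) * √(Q.B u g m))) + R * Q.A u (m + 1))) := by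
  classical
  have hA : ∀ m, 0 ≤ Q.A u m := fun m => by unfold A; positivity
  have hB : ∀ m, 0 ≤ Q.B u g m := fun m => by unfold B; positivity
  conv_lhs => rw [B]
  refine (Finset.sum_le_sum fun α _ => Finset.sum_le_sum fun a _ => Q.norm_sq_le u g α a).trans ?_
  simp only [Finset.sum_add_distrib]
  refine add_le_add ?_ (add_le_add ?_ (add_le_add ?_ ?_))
  · refine (sum_sum_mul_le_sqrt _ _).trans ?_
    rw [B]
    gcongr
    have : ∑ α : Fin (m + 1) → K, ∑ a, (‖Q.m [.cre (g a)]‖ * ‖Q.W (annWord u α)‖) ^ 2 =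
        (∑ a, ‖Q.m [.cre (g a)]‖ ^ 2) * Q.A u (m + 1) := by
      simp_rw [mul_pow]
      rw [Finset.sum_comm, A, Finset.sum_mul_sum]
    rw [this]
    exact sqrt_mul_sq_le hR (by unfold A; positivity) h1
  · have : ∑ α : Fin (m + 1) → K, ∑ a, ∑ i,
        ‖Q.κ (.cre (g a)) (.cre (u (α i)))‖ * ‖Q.W (annWord u (i.removeNth α))‖ *
          ‖Q.W (annWord u α ++ [.ann (g a)])‖ = ∑ i, ∑ α : Fin (m + 1) → K, ∑ a,
        ‖Q.κ (.cre (g a)) (.cre (u (α i)))‖ * ‖Q.W (annWord u (i.removeNth α))‖ *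
          ‖Q.W (annWord u α ++ [.ann (g a)])‖ := by
      rw [Finset.sum_comm]
      simp_rw [Finset.sum_comm (s := (Finset.univ : Finset (Fin (m + 1) → K)))
        (t := (Finset.univ : Finset (Fin (m + 1))))]
      rw [Finset.sum_comm]
      refine Finset.sum_congr rfl fun i _ => ?_
      rw [Finset.sum_comm]
    rw [this]
    have hi : ∀ i ∈ (Finset.univ : Finset (Fin (m + 1))), ∑ α : Fin (m + 1) → K, ∑ a,
        ‖Q.κ (.cre (g a)) (.cre (u (α i)))‖ * ‖Q.W (annWord u (i.removeNth α))‖ *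
          ‖Q.W (annWord u α ++ [.ann (g a)])‖ ≤ R * √(Q.A u m) * √(Q.B u g (m + 1)) := by
      intro i _
      refine (sum_sum_mul_le_sqrt _ _).trans ?_
      rw [B]
      gcongr
      have : ∑ α : Fin (m + 1) → K, ∑ a, (‖Q.κ (.cre (g a)) (.cre (u (α i)))‖ *
          ‖Q.W (annWord u (i.removeNth α))‖) ^ 2 =
          (∑ a, ∑ b, ‖Q.κ (.cre (g a)) (.cre (u b))‖ ^ 2) * Q.A u m := by
        rw [sum_removeNth i fun b β α => ∑ a, (‖Q.κ (.cre (g a)) (.cre (u b))‖ *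
          ‖Q.W (annWord u β)‖) ^ 2]
        simp_rw [mul_pow, ← Finset.sum_mul]
        rw [← Finset.mul_sum, Finset.sum_comm, A]
      rw [this]
      exact sqrt_mul_sq_le hR (hA _) h2
    refine (Finset.sum_le_sum hi).trans (le_of_eq ?_)
    simp
  · have : ∑ α : Fin (m + 1) → K, ∑ a, ∑ i,
        ‖Q.κ (.cre (g a)) (.ann (u (α i)))‖ * (‖Q.W (annWord u α)‖ *
          ‖Q.W (annWord u (i.removeNth α) ++ [.ann (g a)])‖) = ∑ i, ∑ α : Fin (m + 1) → K, ∑ a,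
        ‖Q.κ (.cre (g a)) (.ann (u (α i)))‖ * (‖Q.W (annWord u α)‖ *
          ‖Q.W (annWord u (i.removeNth α) ++ [.ann (g a)])‖) := by
      rw [Finset.sum_comm]
      simp_rw [Finset.sum_comm (s := (Finset.univ : Finset (Fin (m + 1) → K)))
        (t := (Finset.univ : Finset (Fin (m + 1))))]
      rw [Finset.sum_comm]
      refine Finset.sum_congr rfl fun i _ => ?_
      rw [Finset.sum_comm]
    rw [this]
    have hi : ∀ i ∈ (Finset.univ : Finset (Fin (m + 1))), ∑ α : Fin (m + 1) → K, ∑ a,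
        ‖Q.κ (.cre (g a)) (.ann (u (α i)))‖ * (‖Q.W (annWord u α)‖ *
          ‖Q.W (annWord u (i.removeNth α) ++ [.ann (g a)])‖) ≤
          R * (√(Q.A u (m + 1)) * √(Q.B u g m)) := by
      intro i _
      rw [sum_removeNth i fun b β α => ∑ a, ‖Q.κ (.cre (g a)) (.ann (u b))‖ *
        (‖Q.W (annWord u α)‖ * ‖Q.W (annWord u β ++ [FieldOp.ann (g a)])‖)]
      -- The index tuple is split into the contracted entry b and the rest β. For fixed β
      -- Cauchy-Schwarz in (a, b) separates the Hilbert-Schmidt norm of the two-point function; a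
      -- second Cauchy-Schwarz in β follows.
      have hβ : ∀ β ∈ (Finset.univ : Finset (Fin m → K)), ∑ b, ∑ a,
          ‖Q.κ (.cre (g a)) (.ann (u b))‖ * (‖Q.W (annWord u (i.insertNth b β : Fin (m + 1) → K))‖ *
          ‖Q.W (annWord u β ++ [.ann (g a)])‖) ≤
          R * (√(∑ b, ‖Q.W (annWord u (i.insertNth b β : Fin (m + 1) → K))‖ ^ 2) *
            √(∑ a, ‖Q.W (annWord u β ++ [.ann (g a)])‖ ^ 2)) := by
        intro β _
        refine (sum_sum_mul_le_sqrt _ _).trans ?_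
        rw [← Real.sqrt_mul (x := ∑ b, ‖Q.W (annWord u (i.insertNth b β : Fin (m + 1) → K))‖ ^ 2)
          (by positivity)]
        refine mul_le_mul ?_ (le_of_eq ?_) (Real.sqrt_nonneg _) hR
        · rw [Finset.sum_comm]
          exact Real.sqrt_le_iff.2 ⟨hR, h3⟩
        · simp_rw [mul_pow]
          rw [Finset.sum_mul_sum]
      refine (Finset.sum_le_sum hβ).trans ?_
      rw [← Finset.mul_sum]
      gcongr
      refine (Real.sum_sqrt_mul_sqrt_le _ (fun _ => by positivity) fun _ => by positivity).trans ?_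
      rw [← sum_removeNth i fun b β α => ‖Q.W (annWord u α)‖ ^ 2]
      rfl
    refine (Finset.sum_le_sum hi).trans (le_of_eq ?_)
    simp
  · simp_rw [← Finset.sum_mul]
    rw [← Finset.mul_sum]
    exact mul_le_mul_of_nonneg_right h4 (hA _)

theorem B_zero_le {R : ℝ} (hR : 0 ≤ R)
    (h1 : ∑ a, ‖Q.m [.cre (g a)]‖ ^ 2 ≤ R ^ 2)
    (h4 : ∑ a, ‖Q.κ (.cre (g a)) (.ann (g a))‖ ≤ R) :
    Q.B u g 0 ≤ R * √(Q.A u 0) * √(Q.B u g 0) + R * Q.A u 0 := by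
  have hA : 0 ≤ Q.A u 0 := by unfold A; positivity
  have h0 : ∀ x : G d, ‖(inner ℂ x x : ℂ)‖ = ‖x‖ ^ 2 := fun x => by
    rw [inner_self_eq_norm_sq_to_K]; simp
  have hle : ∀ (α : Fin 0 → K) (a : K), ‖Q.W (annWord u α ++ [.ann (g a)])‖ ^ 2 ≤
      (‖Q.m [.cre (g a)]‖ * ‖Q.W (annWord u α)‖) * ‖Q.W (annWord u α ++ [.ann (g a)])‖ +
      ‖Q.κ (.cre (g a)) (.ann (g a))‖ * ‖Q.W (annWord u α)‖ ^ 2 := by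
    intro α a
    have h := congrArg norm (Q.wick_norm_sq_zero u g α a)
    rw [h0] at h
    conv_lhs => rw [h]
    refine (norm_add_le _ _).trans (add_le_add ?_ ?_)
    · rw [norm_mul, mul_assoc]; gcongr; exact norm_inner_le_norm _ _
    · rw [norm_mul, h0]
  conv_lhs => rw [B]
  refine (Finset.sum_le_sum fun α _ => Finset.sum_le_sum fun a _ => hle α a).trans ?_
  simp only [Finset.sum_add_distrib]
  refine add_le_add ?_ ?_
  · refine (sum_sum_mul_le_sqrt _ _).trans ?_
    rw [B]
    gcongr
    have : ∑ α : Fin 0 → K, ∑ a, (‖Q.m [.cre (g a)]‖ * ‖Q.W (annWord u α)‖) ^ 2 =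
        (∑ a, ‖Q.m [.cre (g a)]‖ ^ 2) * Q.A u 0 := by
      simp_rw [mul_pow]
      rw [Finset.sum_comm, A, Finset.sum_mul_sum]
    rw [this]
    exact sqrt_mul_sq_le hR (by unfold A; positivity) h1
  · simp_rw [← Finset.sum_mul]
    rw [← Finset.mul_sum]
    exact mul_le_mul_of_nonneg_right h4 hA

end Quasifree

end HFB
end

/-! ### Two-point functions controlled by the norm of X^j. -/

noncomputable section

namespace HFB

variable {d : ℕ}

/-! ### Bounds for truncated expectations in `X^j` -/

theorem enorm_le_ofReal_iff {E : Type*} [NormedAddCommGroup E] {x : E} {R : ℝ} (hR : 0 ≤ R) :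
    ‖x‖ₑ ≤ ENNReal.ofReal R ↔ ‖x‖ ≤ R := by
  rw [← ofReal_norm, ENNReal.ofReal_le_ofReal_iff hR]

theorem norm_inner_sobM_le {j : ℕ} {φ : L2 d} {R : ℝ} (hR : 0 ≤ R)
    (h : sobNorm j φ ≤ ENNReal.ofReal R) (u : Test d) :
    ‖(inner ℂ (sobM d j u).l2 φ : ℂ)‖ ≤ R * ‖u.l2‖ := by
  have h1 : ∀ u : Test d, ‖u.l2‖ ≤ 1 → ‖(inner ℂ (sobM d j u).l2 φ : ℂ)‖ ≤ R := fun u hu => by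
    rw [← enorm_le_ofReal_iff hR]
    exact (le_iSup₂ (f := fun (u : Test d) (_ : ‖u.l2‖ ≤ 1) =>
      ‖(inner ℂ (sobM d j u).l2 φ : ℂ)‖ₑ) u hu).trans h
  rcases eq_or_ne ‖u.l2‖ 0 with h0 | h0
  · have : u = 0 := Test.l2_injective (by
      change u.l2 = (0 : Test d).l2
      rw [norm_eq_zero.1 h0]
      have := Test.l2_smul (0 : ℂ) u
      rw [zero_smul, zero_smul] at this
      exact this.symm)
    rw [h0, this, map_zero]
    have := Test.l2_smul (0 : ℂ) u
    rw [zero_smul, zero_smul] at this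
    rw [this]; simp
  · have h2 := h1 ((‖u.l2‖⁻¹ : ℂ) • u) (by
      rw [Test.l2_smul, norm_smul]; simp [h0])
    rw [map_smul, Test.l2_smul, inner_smul_left, norm_mul] at h2
    have h3 : 0 < ‖u.l2‖ := lt_of_le_of_ne (norm_nonneg _) h0.symm
    simp only [map_inv₀, Complex.conj_ofReal, norm_inv, Complex.norm_real, norm_norm] at h2
    rwa [inv_mul_le_iff₀ h3, mul_comm] at h2

theorem Test.l2_sum {ι : Type*} (s : Finset ι) (f : ι → Test d) :
    (∑ i ∈ s, f i).l2 = ∑ i ∈ s, (f i).l2 := by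
  simp_rw [← Test.toL2_apply, map_sum]

section Families

variable {K : Type} [Fintype K] {u : K → Test d} (hu : Orthonormal ℂ fun i => (u i).l2)
include hu

/-- Duality: testing with w = Σ c_i u_i, where c_i are the coefficients themselves, gives ‖c‖² ≤ R
‖c‖. -/
theorem sum_sobNorm_le {j : ℕ} {φ : L2 d} {R : ℝ} (hR : 0 ≤ R)
    (h : sobNorm j φ ≤ ENNReal.ofReal R) :
    ∑ i, ‖(inner ℂ (sobM d j (u i)).l2 φ : ℂ)‖ ^ 2 ≤ R ^ 2 := by
  set c : K → ℂ := fun i => inner ℂ (sobM d j (u i)).l2 φ with hc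
  set w : Test d := ∑ i, c i • u i
  set N : ℝ := ∑ i, ‖c i‖ ^ 2 with hN
  have hN0 : 0 ≤ N := by positivity
  have h1 : ‖w.l2‖ ^ 2 = N := by
    have : w.l2 = ∑ i, c i • (u i).l2 := by
      rw [Test.l2_sum]; simp_rw [Test.l2_smul]
    have h2 := hu.inner_sum c c Finset.univ
    rw [this]
    have h3 : ((‖∑ i, c i • (u i).l2‖ ^ 2 : ℝ) : ℂ) = (N : ℝ) := by
      rw [Complex.ofReal_pow]
      refine (inner_self_eq_norm_sq_to_K (𝕜 := ℂ) _).symm.trans (h2.trans ?_)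
      rw [hN, Complex.ofReal_sum]
      refine Finset.sum_congr rfl fun i _ => ?_
      rw [mul_comm, Complex.mul_conj, Complex.normSq_eq_norm_sq]
    exact_mod_cast h3
  have h2 := norm_inner_sobM_le hR h w
  have h3 : (inner ℂ (sobM d j w).l2 φ : ℂ) = (N : ℝ) := by
    have : (sobM d j w).l2 = ∑ i, c i • (sobM d j (u i)).l2 := by
      rw [map_sum, Test.l2_sum]; simp_rw [map_smul, Test.l2_smul]
    rw [this, sum_inner, hN, Complex.ofReal_sum]
    refine Finset.sum_congr rfl fun i _ => ?_
    rw [inner_smul_left]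
    change conj (c i) * c i = _
    rw [mul_comm, Complex.mul_conj, Complex.normSq_eq_norm_sq]
  rw [h3, Complex.norm_real, Real.norm_of_nonneg hN0] at h2
  have h4 : 0 ≤ ‖w.l2‖ := norm_nonneg _
  rw [← h1] at h2 ⊢
  rcases eq_or_lt_of_le h4 with h5 | h5
  · rw [← h5, zero_pow two_ne_zero]; positivity
  · have : ‖w.l2‖ ≤ R := by nlinarith
    gcongr

theorem sum_traceNorm_le {j : ℕ} {γ : L2 d →L[ℂ] L2 d} {R : ℝ} (hR : 0 ≤ R)
    (h : traceNorm j γ ≤ ENNReal.ofReal R) :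
    ∑ i, ‖(inner ℂ (sobM d j (u i)).l2 (γ (sobM d j (u i)).l2) : ℂ)‖ ≤ R := by
  let e := Fintype.equivFin K
  have hu' : Orthonormal ℂ fun i => (u (e.symm i)).l2 := hu.comp _ e.symm.injective
  have h1 : ∑ i, ‖(inner ℂ (sobM d j (u (e.symm i))).l2 (γ (sobM d j (u (e.symm i))).l2) : ℂ)‖ₑ ≤
      ENNReal.ofReal R := by
    refine le_trans ?_ h
    rw [traceNorm]
    exact le_iSup_of_le (Fintype.card K) (le_iSup_of_le (fun i => u (e.symm i))
      (le_iSup_of_le (fun i => u (e.symm i)) (le_iSup_of_le hu' (le_iSup_of_le hu' le_rfl))))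
  rw [e.symm.sum_comp fun i => ‖(inner ℂ (sobM d j (u i)).l2 (γ (sobM d j (u i)).l2) : ℂ)‖ₑ] at h1
  simp_rw [← ofReal_norm] at h1
  rw [← ENNReal.ofReal_sum_of_nonneg (fun _ _ => norm_nonneg _),
    ENNReal.ofReal_le_ofReal_iff hR] at h1
  exact h1

theorem sum_hsNorm_le {j : ℕ} {σ : L2 d →L[ℂ] L2 d} {R : ℝ} (hR : 0 ≤ R)
    (h : hsNorm j σ ≤ ENNReal.ofReal R) : ∑ i, ‖σ (sobM d j (u i)).l2‖ ^ 2 ≤ R ^ 2 := by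
  let e := Fintype.equivFin K
  have hu' : Orthonormal ℂ fun i => (u (e.symm i)).l2 := hu.comp _ e.symm.injective
  have h0 : (⨆ (n : ℕ) (w : Fin n → Test d) (_ : Orthonormal ℂ fun i => (w i).l2),
    ∑ i, ‖σ (sobM d j (w i)).l2‖ₑ ^ 2) ≤ ENNReal.ofReal R ^ 2 := by
    have h1 := pow_le_pow_left' h 2
    rwa [hsNorm, ← ENNReal.rpow_natCast, ← ENNReal.rpow_mul, Nat.cast_ofNat,
      one_div_mul_cancel two_ne_zero, ENNReal.rpow_one] at h1
  have h1 : ∑ i, ‖σ (sobM d j (u (e.symm i))).l2‖ₑ ^ 2 ≤ ENNReal.ofReal R ^ 2 := by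
    refine le_trans ?_ h0
    exact le_iSup_of_le (Fintype.card K) (le_iSup_of_le (fun i => u (e.symm i))
      (le_iSup_of_le hu' le_rfl))
  rw [e.symm.sum_comp fun i => ‖σ (sobM d j (u i)).l2‖ₑ ^ 2] at h1
  simp_rw [← ofReal_norm, ← ENNReal.ofReal_pow (norm_nonneg _)] at h1
  rw [← ENNReal.ofReal_sum_of_nonneg (fun _ _ => by positivity), ← ENNReal.ofReal_pow hR,
    ENNReal.ofReal_le_ofReal_iff (by positivity)] at h1
  exact h1

end Families

theorem inner_star_star (u w : L2 d) : inner ℂ (star u) (star w) = inner ℂ w u := by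
  rw [H.inner_eq, H.inner_eq]
  refine integral_congr_ae ?_
  filter_upwards [Lp.coeFn_star u, Lp.coeFn_star w] with x h1 h2
  rw [h1, h2]
  simp [mul_comm]

theorem norm_star_l2 (u : L2 d) : ‖star u‖ = ‖u‖ := by
  have h := inner_star_star u u
  rw [inner_self_eq_norm_sq_to_K, inner_self_eq_norm_sq_to_K] at h
  have h2 : ‖star u‖ ^ 2 = ‖u‖ ^ 2 := by exact_mod_cast h
  exact (sq_eq_sq₀ (norm_nonneg _) (norm_nonneg _)).1 h2

/-- A single normalized test function is an orthonormal family, which bounds the form of M^j γ M^j.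
Inserting M^{-j} f, whose norm is at most ‖f‖, bounds the form of γ, and density extends this to L².
-/
theorem re_inner_le_of_traceNorm {j : ℕ} {γ : L2 d →L[ℂ] L2 d} {R : ℝ}
    (hR : 0 ≤ R) (h : traceNorm j γ ≤ ENNReal.ofReal R) (x : L2 d) :
    ‖(inner ℂ x (γ x) : ℂ)‖ ≤ R * ‖x‖ ^ 2 := by
  have h1 : ∀ w : Test d, ‖(inner ℂ (sobM d j w).l2 (γ (sobM d j w).l2) : ℂ)‖ ≤ R * ‖w.l2‖ ^ 2 := by
    intro w
    rcases eq_or_ne w.l2 0 with h0 | h0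
    · have : w = 0 := Test.l2_injective (by
        change w.l2 = (0 : Test d).l2
        rw [h0, ← Test.toL2_apply, map_zero])
      have h2 : (sobM d j w).l2 = 0 := by rw [this, map_zero, ← Test.toL2_apply, map_zero]
      rw [h2]; simp [h0]
    · set c : ℂ := ((‖w.l2‖⁻¹ : ℝ) : ℂ) with hc
      have h3 : ‖w.l2‖ ≠ 0 := norm_ne_zero_iff.2 h0
      have ho : Orthonormal ℂ fun _ : Unit => (c • w).l2 := by
        refine ⟨fun _ => ?_, fun i k hik => absurd rfl hik⟩
        rw [Test.l2_smul, norm_smul, hc]; simp [h3]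
      have h2 := sum_traceNorm_le ho hR h
      simp only [Finset.univ_unique, Finset.sum_singleton, map_smul, Test.l2_smul, inner_smul_left,
        inner_smul_right, norm_mul] at h2
      rw [hc] at h2
      simp only [Complex.conj_ofReal, Complex.norm_real, norm_inv, norm_norm] at h2
      have h4 : 0 < ‖w.l2‖ := lt_of_le_of_ne (norm_nonneg _) h3.symm
      rw [← mul_assoc, ← sq, inv_pow, inv_mul_le_iff₀ (by positivity), mul_comm] at h2
      exact h2
  have h2 : ∀ f : Test d, ‖(inner ℂ f.l2 (γ f.l2) : ℂ)‖ ≤ R * ‖f.l2‖ ^ 2 := by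
    intro f
    have h3 := h1 (besselM d (-j) f)
    rw [sobM_besselM_neg, ← resolv_test] at h3
    refine h3.trans ?_
    gcongr
    exact norm_resolv_le _
  have hd := Test.denseRange_l2 d
  refine hd.induction_on (p := fun x => ‖(inner ℂ x (γ x) : ℂ)‖ ≤ R * ‖x‖ ^ 2) x
    (isClosed_le (by fun_prop) (by fun_prop)) h2

open scoped ComplexOrder in
-- The operator inequality γ² ≤ Rγ for 0 ≤ γ ≤ R. It lets the trace norm of M^j γ M^j control Σ ‖γ
-- M^j u_i‖².
theorem norm_sq_le_of_isPositive {γ : L2 d →L[ℂ] L2 d} (hγ : γ.IsPositive) {R : ℝ}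
    (h : ∀ x, ‖(inner ℂ x (γ x) : ℂ)‖ ≤ R * ‖x‖ ^ 2) (x : L2 d) :
    ‖γ x‖ ^ 2 ≤ R * ‖(inner ℂ x (γ x) : ℂ)‖ := by
  have hs : ∀ a b, inner ℂ (γ a) b = inner ℂ a (γ b) := fun a b =>
    hγ.isSelfAdjoint.isSymmetric a b
  have hre : ∀ a, ((inner ℂ a (γ a) : ℂ)).re = ‖(inner ℂ a (γ a) : ℂ)‖ ∧
      (inner ℂ a (γ a) : ℂ) = ((‖(inner ℂ a (γ a) : ℂ)‖ : ℝ) : ℂ) := by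
    intro a
    have h1 : 0 ≤ (inner ℂ a (γ a) : ℂ) := hγ.inner_nonneg_right a
    have h2 := Complex.norm_of_nonneg' h1
    exact ⟨by rw [← h2]; simp, h2.symm⟩
  set A := ‖(inner ℂ x (γ x) : ℂ)‖
  set N := ‖γ x‖ ^ 2
  set Bq := ‖(inner ℂ (γ x) (γ (γ x)) : ℂ)‖
  have hB : Bq ≤ R * N := h (γ x)
  -- Positivity of γ on t x - γ x gives a nonnegative quadratic polynomial in t.
  have hq : ∀ t : ℝ, 0 ≤ t ^ 2 * A - 2 * t * N + Bq := by
    intro t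
    have h1 : 0 ≤ (inner ℂ ((t : ℂ) • x - γ x) (γ ((t : ℂ) • x - γ x)) : ℂ) :=
      hγ.inner_nonneg_right _
    have h2 : (inner ℂ ((t : ℂ) • x - γ x) (γ ((t : ℂ) • x - γ x)) : ℂ) =
        ((t ^ 2 * A - 2 * t * N + Bq : ℝ) : ℂ) := by
      simp only [map_sub, map_smul, inner_sub_left, inner_sub_right, inner_smul_left,
        inner_smul_right, Complex.conj_ofReal]
      rw [(hre x).2, (hre (γ x)).2, ← hs x (γ x), inner_self_eq_norm_sq_to_K]
      push_cast
      simp only [A, N, Bq]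
      push_cast
      have : (RCLike.ofReal ‖γ x‖ : ℂ) = Complex.ofReal ‖γ x‖ := rfl
      rw [this]
      ring
    rw [h2] at h1
    exact_mod_cast h1
  have hA : 0 ≤ A := norm_nonneg _
  have hN : 0 ≤ N := sq_nonneg _
  rcases eq_or_lt_of_le hN with h0 | h0
  · rw [← h0]
    have := h x
    rcases le_or_gt 0 R with hR | hR
    · positivity
    · have h3 : A = 0 := by
        have : A ≤ 0 := this.trans (mul_nonpos_of_nonpos_of_nonneg hR.le (sq_nonneg _))
        linarith
      rw [h3, mul_zero]
  · have hR : 0 ≤ R := by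
      by_contra hR
      have : Bq ≤ R * N := hB
      have h2 : 0 ≤ Bq := norm_nonneg _
      nlinarith
    rcases eq_or_lt_of_le hR with h2 | h2
    · have h3 : A ≤ 0 := (h x).trans (by rw [← h2, zero_mul])
      have h4 := hq 1
      rw [← h2] at hB
      linarith
    -- With t = R, the inequality Bq ≤ R N leaves R N ≤ R² A, and R can be cancelled.
    · have h1 := hq R
      have h3 : R * N ≤ R * (R * A) := by nlinarith
      exact le_of_mul_le_mul_left h3 h2

/-! ### Two-point functions -/

namespace Quasifree

variable {ω : State d} (Q : Quasifree ω) {μ : Triple d} (hμ : ω.HasMoments μ)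
include hμ

theorem m_ann (f : Test d) : Q.m [.ann f] = inner ℂ f.l2 μ.1 := (Q.eq_m (hμ f f).1).symm

theorem m_cre (f : Test d) : Q.m [.cre f] = inner ℂ μ.1 f.l2 := by
  have h := Q.m_adjWord [.ann f]
  rw [Q.m_ann hμ, inner_conj_symm] at h
  exact h

theorem κ_cre_ann (f g : Test d) : Q.κ (.cre g) (.ann f) = inner ℂ f.l2 (μ.2.1 g.l2) := by
  rw [κ, ← Q.eq_m (hμ f g).2.1, Q.m_cre hμ, Q.m_ann hμ]; ring

theorem κ_cre_cre (f g : Test d) :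
    Q.κ (.cre g) (.cre f) = conj (inner ℂ f.l2 (μ.2.2 (star g.l2)) : ℂ) := by
  have h : Q.m [.cre g, .cre f] = conj (Q.m [.ann f, .ann g]) := Q.m_adjWord [.ann f, .ann g]
  rw [κ, h, ← Q.eq_m (hμ f g).2.2, Q.m_cre hμ, Q.m_cre hμ, map_add, map_mul, inner_conj_symm,
    inner_conj_symm, inner_conj_symm]
  ring

end Quasifree

end HFB
end

/-! ### From finite families of modes to moments of particle number and Sobolev weight. -/

noncomputable section

namespace HFB

variable {d : ℕ}

/-! ### Moments of the number operator and of the kinetic energy -/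

theorem lp_enorm_sq {ι : Type*} {E : ι → Type*} [∀ i, NormedAddCommGroup (E i)] (x : lp E 2) :
    ‖x‖ₑ ^ 2 = ∑' i, ‖x i‖ₑ ^ 2 := by
  have h1 := lp_norm_sq x
  have h2 : ∀ l, ‖x l‖ₑ ^ 2 = ENNReal.ofReal (‖x l‖ ^ 2) := fun l => by
    rw [ENNReal.ofReal_pow (norm_nonneg _), ofReal_norm]
  simp_rw [h2]
  rw [← ENNReal.ofReal_tsum_of_nonneg (fun l => sq_nonneg _) h1.summable, h1.tsum_eq,
    ENNReal.ofReal_pow (norm_nonneg _), ofReal_norm]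

theorem G.enorm_sq (X : G d) : ‖X‖ₑ ^ 2 = ∑' k, ∑' n, ‖X.comp k n‖ₑ ^ 2 := by
  rw [lp_enorm_sq]
  refine tsum_congr fun k => ?_
  exact lp_enorm_sq (X k : FullFock d)

theorem enorm_smul_sqrt_sq {E : Type*} [NormedAddCommGroup E] [NormedSpace ℂ E] (n : ℕ) (x : E) :
    ‖(Real.sqrt (n + 1) : ℂ) • x‖ₑ ^ 2 = ((n + 1 : ℕ) : ℝ≥0∞) * ‖x‖ₑ ^ 2 := by
  rw [enorm_smul, mul_pow]
  congr 1
  rw [← ofReal_norm, Complex.norm_real, Real.norm_of_nonneg (Real.sqrt_nonneg _),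
    ← ENNReal.ofReal_pow (Real.sqrt_nonneg _), Real.sq_sqrt (by positivity)]
  rw [← Nat.cast_succ, ENNReal.ofReal_natCast]

/-- `‖(M^j ⊗ 1) ξₙ‖²`, where `M^j` acts on the first variable. -/
def sobWeight (j : ℕ) (X : G d) (k : ℕ) : ℕ → ℝ≥0∞
  | 0 => ‖X.comp k 0‖ₑ ^ 2
  | n + 1 => ∑' a, ‖(split₁ d n).ctL (sobM d j ((basis d j).f a)).l2 (X.comp k (n + 1))‖ₑ ^ 2

/-- If the weight is finite, the component is (R ⊗ 1)χ with ‖χ‖² the weight, and R is a contraction.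
-/
theorem enorm_sq_le_sobWeight (j : ℕ) (X : G d) (k : ℕ) :
    ∀ n, ‖X.comp k n‖ₑ ^ 2 ≤ sobWeight j X k n
  | 0 => le_rfl
  | n + 1 => by
    rcases eq_or_ne (sobWeight j X k (n + 1)) ⊤ with h | h
    · rw [h]; exact le_top
    · obtain ⟨χ, h1, h2⟩ := exists_slot_resolv (split₁ d n) (basis d j) (lt_top_iff_ne_top.2 h)
      change _ ≤ ∑' a, _
      rw [← h2]
      gcongr
      rw [h1, ← ofReal_norm, ← ofReal_norm]
      refine ENNReal.ofReal_le_ofReal ?_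
      have := norm_slot_le (split₁ d n) (split₁ d n) zero_le_one
        (fun u => (norm_resolv_le (d := d) (j := j) u).trans (one_mul _).ge) χ
      rwa [one_mul] at this

namespace Quasifree

variable {ω : State d} (Q : Quasifree ω)

/-- Summing one annihilator over an orthonormal basis is Parseval's identity in one variable. The
factors √(n+1) of successive annihilators combine to a rising factorial. -/
theorem tsum_annWord {ι : Type} [Countable ι] (b : HilbertBasis ι ℂ (L2 d)) (u : ι → Test d)
    (hu : ∀ i, (u i).l2 = b i) (L : List (FieldOp d)) (k : ℕ) : ∀ m n : ℕ,
    ∑' α : Fin m → ι, ‖(Q.W (annWord u α ++ L)).comp k n‖ₑ ^ 2 =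
      ((n + 1).ascFactorial m : ℝ≥0∞) * ‖(Q.W L).comp k (n + m)‖ₑ ^ 2
  | 0, n => by simp [annWord]
  | m + 1, n => by
    have h1 : ∑' α : Fin (m + 1) → ι, ‖(Q.W (annWord u α ++ L)).comp k n‖ₑ ^ 2 =
        ∑' p : ι × (Fin m → ι), ((n + 1 : ℕ) : ℝ≥0∞) * ‖(split₁ d n).ctL (b p.1)
          ((Q.W (annWord u p.2 ++ L)).comp k (n + 1))‖ₑ ^ 2 := by
      rw [← (Fin.consEquiv fun _ => ι).tsum_eq]
      refine tsum_congr fun p => ?_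
      have : annWord u (Fin.consEquiv (fun _ : Fin (m + 1) => ι) p) ++ L =
          .ann (u p.1) :: (annWord u p.2 ++ L) := by
        simp [annWord, List.ofFn_succ, Fin.consEquiv]
      rw [this, comp_ann, enorm_smul_sqrt_sq, hu]
    rw [h1, ENNReal.tsum_prod', ENNReal.tsum_comm]
    simp_rw [ENNReal.tsum_mul_left, (split₁ d n).tsum_ctL_basis b]
    rw [tsum_annWord b u hu L k m (n + 1), ← mul_assoc, ← Nat.cast_mul,
      Nat.succ_ascFactorial, Nat.ascFactorial_succ, show n + 1 + m = n + (m + 1) by ring]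

theorem tsum_A (j m : ℕ) :
    ∑' α : Fin m → (basis d j).ι, ‖Q.W (annWord (basis d j).f α)‖ₑ ^ 2 =
      ∑' k, ∑' n, ((n + 1).ascFactorial m : ℝ≥0∞) * ‖(Q.W []).comp k (n + m)‖ₑ ^ 2 := by
  have := (basis d j).countable
  simp_rw [G.enorm_sq]
  rw [ENNReal.tsum_comm]
  refine tsum_congr fun k => ?_
  rw [ENNReal.tsum_comm]
  refine tsum_congr fun n => ?_
  rw [← Q.tsum_annWord (basis d j).b (basis d j).f (basis d j).hf]
  simp

/-- The m outer annihilators give a rising factorial. The innermost one acts directly on the state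
and gives the remaining factor together with the Sobolev weight. -/
theorem tsum_B (j m : ℕ) :
    ∑' α : Fin m → (basis d j).ι, ∑' a,
      ‖Q.W (annWord (basis d j).f α ++ [.ann (sobM d j ((basis d j).f a))])‖ₑ ^ 2 =
      ∑' k, ∑' n, ((n + 1).ascFactorial (m + 1) : ℝ≥0∞) * sobWeight j (Q.W []) k (n + (m + 1)) := by
  have := (basis d j).countable
  simp_rw [G.enorm_sq]
  rw [ENNReal.tsum_comm]
  have h1 : ∀ a, ∑' α : Fin m → (basis d j).ι, ∑' k, ∑' n,
      ‖(Q.W (annWord (basis d j).f α ++ [.ann (sobM d j ((basis d j).f a))])).comp k n‖ₑ ^ 2 =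
      ∑' k, ∑' n, ((n + 1).ascFactorial (m + 1) : ℝ≥0∞) * ‖(split₁ d (n + m)).ctL
        (sobM d j ((basis d j).f a)).l2 ((Q.W []).comp k (n + m + 1))‖ₑ ^ 2 := by
    intro a
    rw [ENNReal.tsum_comm]
    refine tsum_congr fun k => ?_
    rw [ENNReal.tsum_comm]
    refine tsum_congr fun n => ?_
    rw [Q.tsum_annWord (basis d j).b (basis d j).f (basis d j).hf, comp_ann, enorm_smul_sqrt_sq,
      ← mul_assoc, ← Nat.cast_mul]
    congr 2
    rw [Nat.ascFactorial_succ, mul_comm]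
    congr 1; ring
  simp_rw [h1]
  rw [ENNReal.tsum_comm]
  refine tsum_congr fun k => ?_
  rw [ENNReal.tsum_comm]
  refine tsum_congr fun n => ?_
  rw [ENNReal.tsum_mul_left]
  rfl

theorem A_succ_le_B (j m : ℕ) :
    ∑' α : Fin (m + 1) → (basis d j).ι, ‖Q.W (annWord (basis d j).f α)‖ₑ ^ 2 ≤
    ∑' α : Fin m → (basis d j).ι, ∑' a,
      ‖Q.W (annWord (basis d j).f α ++ [.ann (sobM d j ((basis d j).f a))])‖ₑ ^ 2 := by
  rw [tsum_A, tsum_B]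
  gcongr
  exact enorm_sq_le_sobWeight _ _ _ _

theorem ofReal_norm_sq {E : Type*} [NormedAddCommGroup E] (x : E) :
    ENNReal.ofReal (‖x‖ ^ 2) = ‖x‖ₑ ^ 2 := by
  rw [ENNReal.ofReal_pow (norm_nonneg _), ofReal_norm]

theorem sum_comp_le_tsum {S T : Type*} [Fintype S] {φ : S → T} (hφ : Function.Injective φ)
    (f : T → ℝ≥0∞) : ∑ x, f (φ x) ≤ ∑' y, f y := by
  rw [← tsum_fintype (L := .unconditional _)]
  exact ENNReal.tsum_comp_le_tsum_of_injective hφ f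

theorem A_le {ι : Type} (u : ι → Test d) (s : Finset ι) (m : ℕ) :
    ENNReal.ofReal (Q.A (K := s) (fun i => u i) m) ≤
      ∑' α : Fin m → ι, ‖Q.W (annWord u α)‖ₑ ^ 2 := by
  rw [A, ENNReal.ofReal_sum_of_nonneg fun _ _ => by positivity]
  simp_rw [ofReal_norm_sq]
  rw [← tsum_fintype (L := .unconditional _)]
  have hinj : Function.Injective fun (α : Fin m → s) (i : Fin m) => (α i : ι) := by
    intro α β h
    funext i
    exact Subtype.ext (congrFun h i)
  exact ENNReal.tsum_comp_le_tsum_of_injective hinj fun α : Fin m → ι => ‖Q.W (annWord u α)‖ₑ ^ 2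

theorem B_le {ι : Type} (u g : ι → Test d) (s : Finset ι) (m : ℕ) :
    ENNReal.ofReal (Q.B (K := s) (fun i => u i) (fun i => g i) m) ≤
      ∑' α : Fin m → ι, ∑' a, ‖Q.W (annWord u α ++ [.ann (g a)])‖ₑ ^ 2 := by
  set f : (Fin m → ι) → ι → ℝ≥0∞ := fun α a => ‖Q.W (annWord u α ++ [.ann (g a)])‖ₑ ^ 2 with hf
  have hinj : Function.Injective fun (α : Fin m → s) (i : Fin m) => (α i : ι) := by
    intro α β h
    funext i
    exact Subtype.ext (congrFun h i)
  have h0 : ENNReal.ofReal (Q.B (K := s) (fun i => u i) (fun i => g i) m) =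
      ∑ α : Fin m → s, ∑ a : s, f (fun i => (α i : ι)) a := by
    rw [B, ENNReal.ofReal_sum_of_nonneg fun _ _ => by positivity]
    refine Finset.sum_congr rfl fun α _ => ?_
    rw [ENNReal.ofReal_sum_of_nonneg fun _ _ => by positivity]
    refine Finset.sum_congr rfl fun a _ => ?_
    rw [ofReal_norm_sq]; rfl
  have h1 : ∀ α, ∑ a : s, f α a ≤ ∑' a, f α a := fun α =>
    sum_comp_le_tsum Subtype.val_injective (f α)
  have h2 := sum_comp_le_tsum hinj fun α => ∑' a, f α a
  rw [h0]
  exact (Finset.sum_le_sum fun α _ => h1 _).trans h2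

/-- Every finite set of pairs (α, a) lies in the product set built from one finite index set s,
which collects all values of α and a; so uniform bounds on finite families suffice. -/
theorem tsum_B_le {ι : Type} (u g : ι → Test d) (m : ℕ) {C : ℝ}
    (h : ∀ s : Finset ι, Q.B (K := s) (fun i => u i) (fun i => g i) m ≤ C) :
    ∑' α : Fin m → ι, ∑' a, ‖Q.W (annWord u α ++ [.ann (g a)])‖ₑ ^ 2 ≤ ENNReal.ofReal C := by
  classical
  have hprod := ENNReal.tsum_prod (f := fun (α : Fin m → ι) a =>
    ‖Q.W (annWord u α ++ [FieldOp.ann (g a)])‖ₑ ^ 2)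
  rw [← hprod, ENNReal.tsum_eq_iSup_sum]
  refine iSup_le fun T => ?_
  let s : Finset ι := T.image Prod.snd ∪ T.biUnion fun p => Finset.univ.image p.1
  refine le_trans ?_ (ENNReal.ofReal_le_ofReal (h s))
  rw [B, ENNReal.ofReal_sum_of_nonneg fun _ _ => by positivity]
  simp_rw [ENNReal.ofReal_sum_of_nonneg (fun _ _ => sq_nonneg _), ofReal_norm_sq]
  rw [← Fintype.sum_prod_type']
  let φ : (Fin m → s) × s → (Fin m → ι) × ι := fun p => (fun i => p.1 i, p.2)
  have hinj : Function.Injective φ := by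
    rintro ⟨α, a⟩ ⟨β, b⟩ h
    simp only [φ, Prod.mk.injEq] at h
    exact Prod.ext (funext fun i => Subtype.ext (congrFun h.1 i)) (Subtype.ext h.2)
  have hsub : T ⊆ Finset.univ.image φ := by
    intro p hp
    rw [Finset.mem_image]
    refine ⟨(fun i => ⟨p.1 i, ?_⟩, ⟨p.2, ?_⟩), Finset.mem_univ _, rfl⟩
    · exact Finset.mem_union_right _ (Finset.mem_biUnion.2 ⟨p, hp, Finset.mem_image_of_mem _
        (Finset.mem_univ _)⟩)
    · exact Finset.mem_union_left _ (Finset.mem_image_of_mem _ hp)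
  refine (Finset.sum_le_sum_of_subset hsub).trans ?_
  rw [Finset.sum_image hinj.injOn]
  rfl

end Quasifree

/-- Solves the inequality produced by the recursion: 2c√x ≤ c² + x. -/
theorem le_of_le_mul_sqrt_add {x c e : ℝ} (hx : 0 ≤ x) (h : x ≤ c * √x + e) :
    x ≤ c ^ 2 + 2 * e := by
  have h1 := Real.sq_sqrt hx
  nlinarith [sq_nonneg (√x - c)]

/-- Square summability of the two-point functions on finite subsets of the basis. -/
theorem Quasifree.sums_le {j : ℕ} {R : ℝ} (hR : 0 ≤ R) {ω : State d} (Q : Quasifree ω) {μ : Triple d}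
    (hμ : ω.HasMoments μ) (hX : MemX j μ) (hN : XNorm j μ ≤ ENNReal.ofReal R)
    (s : Finset (basis d j).ι) :
    (∑ a : s, ‖Q.m [.cre (sobM d j ((basis d j).f a))]‖ ^ 2 ≤ R ^ 2) ∧
    (∑ a : s, ∑ b : s, ‖Q.κ (.cre (sobM d j ((basis d j).f a))) (.cre ((basis d j).f b))‖ ^ 2 ≤
      R ^ 2) ∧
    (∑ a : s, ∑ b : s, ‖Q.κ (.cre (sobM d j ((basis d j).f a))) (.ann ((basis d j).f b))‖ ^ 2 ≤
      R ^ 2) ∧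
    (∑ a : s, ‖Q.κ (.cre (sobM d j ((basis d j).f a))) (.ann (sobM d j ((basis d j).f a)))‖ ≤ R) := by
  set u := (basis d j).f
  have hu : Orthonormal ℂ fun i : s => (u i).l2 := by
    have := (basis d j).b.orthonormal.comp (fun i : s => (i : (basis d j).ι))
      Subtype.val_injective
    convert this using 2 with i
    exact (basis d j).hf i
  have n1 : sobNorm j μ.1 ≤ ENNReal.ofReal R := le_trans (by
    rw [XNorm, add_assoc, add_assoc]; exact le_self_add) hN
  have n2 : traceNorm j μ.2.1 ≤ ENNReal.ofReal R := le_trans (by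
    rw [XNorm, add_assoc]; exact (le_add_left le_rfl).trans le_self_add) hN
  have n3 : hsNorm j (ContinuousLinearMap.adjoint μ.2.2) ≤ ENNReal.ofReal R := le_trans (by
    rw [XNorm]; exact le_self_add.trans' (le_add_left le_rfl)) hN
  refine ⟨?_, ?_, ?_, ?_⟩
  · refine le_trans (le_of_eq ?_) (sum_sobNorm_le hu hR n1)
    refine Finset.sum_congr rfl fun a _ => ?_
    rw [Q.m_cre hμ, ← norm_inner_symm]
  -- For fixed a Bessel's inequality sums over b; the relation σ* = σ̄ turns the remaining norms
  -- into ‖σ* M^j u_a‖.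
  · refine le_trans (Finset.sum_le_sum fun a _ => ?_) (sum_hsNorm_le hu hR n3)
    simp_rw [Q.κ_cre_cre hμ, RCLike.norm_conj]
    refine (hu.sum_inner_products_le (s := Finset.univ)
      (x := μ.2.2 (star (sobM d j (u a)).l2))).trans (le_of_eq ?_)
    rw [hX.2.2, norm_star_l2]
  · have hg := re_inner_le_of_traceNorm hR n2
    have h1 : ∀ a : s, ∑ b : s, ‖Q.κ (.cre (sobM d j (u a))) (.ann (u b))‖ ^ 2 ≤
        R * ‖(inner ℂ (sobM d j (u a)).l2 (μ.2.1 (sobM d j (u a)).l2) : ℂ)‖ := by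
      intro a
      simp_rw [Q.κ_cre_ann hμ]
      exact (hu.sum_inner_products_le (s := Finset.univ) _).trans
        (norm_sq_le_of_isPositive hX.2.1 hg _)
    refine (Finset.sum_le_sum fun a _ => h1 a).trans ?_
    rw [← Finset.mul_sum, sq]
    gcongr
    exact sum_traceNorm_le hu hR n2
  · simp_rw [Q.κ_cre_ann hμ]
    exact sum_traceNorm_le hu hR n2

/-- The moments are bounded in terms of the norm of the truncated expectations. -/
theorem exists_moment_bound (d j : ℕ) {R : ℝ} (hR : 0 ≤ R) (m : ℕ) : ∃ C : ℝ, 0 ≤ C ∧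
    ∀ (ω : State d) (Q : Quasifree ω) (μ : Triple d), ω.HasMoments μ → MemX j μ →
      XNorm j μ ≤ ENNReal.ofReal R →
      (∑' α : Fin m → (basis d j).ι, ‖Q.W (Quasifree.annWord (basis d j).f α)‖ₑ ^ 2 ≤ ENNReal.ofReal C) ∧
      (∑' α : Fin (m + 1) → (basis d j).ι, ‖Q.W (Quasifree.annWord (basis d j).f α)‖ₑ ^ 2 ≤
        ENNReal.ofReal C) ∧
      ∑' α : Fin m → (basis d j).ι, ∑' a,
        ‖Q.W (Quasifree.annWord (basis d j).f α ++ [.ann (sobM d j ((basis d j).f a))])‖ₑ ^ 2 ≤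
          ENNReal.ofReal C := by
  set u := (basis d j).f
  have hbounds := fun ω Q μ hμ hX hN s => Quasifree.sums_le (d := d) (j := j) hR (ω := ω) Q (μ := μ) hμ hX hN s
  induction m with
  | zero =>
    refine ⟨max 1 (R ^ 2 + 2 * R), by positivity, fun ω Q μ hμ hX hN => ?_⟩
    have hA0 : ∑' α : Fin 0 → (basis d j).ι, ‖Q.W (Quasifree.annWord u α)‖ₑ ^ 2 = 1 := by
      rw [tsum_fintype]
      simp only [Quasifree.annWord, List.ofFn_zero, Finset.univ_unique, Finset.sum_const,
        Finset.card_singleton, one_smul]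
      rw [← Quasifree.ofReal_norm_sq, Q.norm_W_nil]; simp
    have hB : ∑' α : Fin 0 → (basis d j).ι, ∑' a,
        ‖Q.W (Quasifree.annWord u α ++ [.ann (sobM d j (u a))])‖ₑ ^ 2 ≤ ENNReal.ofReal (R ^ 2 + 2 * R) := by
      refine Q.tsum_B_le u (fun a => sobM d j (u a)) 0 fun s => ?_
      obtain ⟨h1, h2, h3, h4⟩ := hbounds ω Q μ hμ hX hN s
      have hA : Q.A (K := s) (fun i => u i) 0 = 1 := by
        simp [Quasifree.A, Quasifree.annWord, Q.norm_W_nil]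
      have h5 := Q.B_zero_le (fun i : s => u i) (fun a => sobM d j (u a)) hR h1 h4
      rw [hA, Real.sqrt_one, mul_one] at h5
      exact le_of_le_mul_sqrt_add (by unfold Quasifree.B; positivity) h5
    have hle : ENNReal.ofReal (R ^ 2 + 2 * R) ≤ ENNReal.ofReal (max 1 (R ^ 2 + 2 * R)) :=
      ENNReal.ofReal_le_ofReal (le_max_right _ _)
    refine ⟨?_, ((Q.A_succ_le_B j 0).trans hB).trans hle, hB.trans hle⟩
    rw [hA0, ← ENNReal.ofReal_one]
    exact ENNReal.ofReal_le_ofReal (le_max_left _ _)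
  | succ m ih =>
    obtain ⟨C, hC, ih⟩ := ih
    -- The constant obtained by solving the inequality of `B_succ_le` with the quantities of order m
    -- and the plain moment of order m + 1 bounded by C.
    set D : ℝ := (R * √C + (m + 1) * (R * √C)) ^ 2 +
      2 * ((m + 1) * (R * (√C * √C)) + R * C) with hD
    refine ⟨max C D, le_max_of_le_left hC, fun ω Q μ hμ hX hN => ?_⟩
    obtain ⟨i1, i2, i3⟩ := ih ω Q μ hμ hX hN
    have hB : ∑' α : Fin (m + 1) → (basis d j).ι, ∑' a,
        ‖Q.W (Quasifree.annWord u α ++ [.ann (sobM d j (u a))])‖ₑ ^ 2 ≤ ENNReal.ofReal D := by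
      refine Q.tsum_B_le u (fun a => sobM d j (u a)) (m + 1) fun s => ?_
      obtain ⟨h1, h2, h3, h4⟩ := hbounds ω Q μ hμ hX hN s
      have a1 : Q.A (K := s) (fun i => u i) m ≤ C :=
        (ENNReal.ofReal_le_ofReal_iff hC).1 ((Q.A_le u s m).trans i1)
      have a2 : Q.A (K := s) (fun i => u i) (m + 1) ≤ C :=
        (ENNReal.ofReal_le_ofReal_iff hC).1 ((Q.A_le u s (m + 1)).trans i2)
      have b1 : Q.B (K := s) (fun i => u i) (fun a => sobM d j (u a)) m ≤ C := by
        rw [← ENNReal.ofReal_le_ofReal_iff hC]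
        exact (Q.B_le u (fun a => sobM d j (u a)) s m).trans i3
      have h5 := Q.B_succ_le (fun i : s => u i) (fun a => sobM d j (u a)) hR h1 h2 h3 h4 m
      refine le_of_le_mul_sqrt_add (by unfold Quasifree.B; positivity) (h5.trans ?_)
      generalize hb : Q.B (K := s) (fun i => u i) (fun a => sobM d j (u a)) (m + 1) = b
      have e1 : R * √(Q.A (K := s) (fun i => u i) (m + 1)) * √b ≤ R * √C * √b := by gcongr
      have e2 : ((m : ℝ) + 1) * (R * √(Q.A (K := s) (fun i => u i) m) * √b) ≤
          (m + 1) * (R * √C * √b) := by gcongr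
      have e3 : ((m : ℝ) + 1) * (R * (√(Q.A (K := s) (fun i => u i) (m + 1)) *
          √(Q.B (K := s) (fun i => u i) (fun a => sobM d j (u a)) m))) ≤
          (m + 1) * (R * (√C * √C)) := by gcongr
      have e4 : R * Q.A (K := s) (fun i => u i) (m + 1) ≤ R * C := by gcongr
      linarith
    have hle : ENNReal.ofReal D ≤ ENNReal.ofReal (max C D) :=
      ENNReal.ofReal_le_ofReal (le_max_right _ _)
    exact ⟨i2.trans (ENNReal.ofReal_le_ofReal (le_max_left _ _)),
      ((Q.A_succ_le_B j (m + 1)).trans hB).trans hle, hB.trans hle⟩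

end HFB
end

/-! ### Weighted summability of quasifree states, and the spaces of at most two particles. -/

noncomputable section

namespace HFB

variable {d : ℕ}

/-- The sum of the sobolev weights with the weight `(1 + n)^4`. -/
def totalWeight (j : ℕ) (X : G d) : ℝ≥0∞ :=
  ∑' k, ∑' n : ℕ, ((1 + n) ^ 4 : ℕ) * sobWeight j X k n

theorem tsum_descFactorial (m : ℕ) (s : ℕ → ℝ≥0∞) :
    ∑' n : ℕ, (n.descFactorial m : ℝ≥0∞) * s n =
      ∑' n : ℕ, ((n + 1).ascFactorial m : ℝ≥0∞) * s (n + m) := by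
  rw [← (ENNReal.summable).sum_add_tsum_nat_add' (k := m)]
  rw [Finset.sum_eq_zero, zero_add]
  · simp_rw [Nat.add_descFactorial_eq_ascFactorial]
  · intro i hi
    rw [Nat.descFactorial_of_lt (Finset.mem_range.1 hi)]; simp

/-- The coefficients 1, 6, 7, 1 are the Stirling numbers expressing n^4 in falling factorials. For n
≥ 1 one has 1 + n ≤ 2n, whence 16; n = 0 is covered by the first term. -/
theorem one_add_pow_four_le (n : ℕ) : (1 + n) ^ 4 ≤ n.descFactorial 0 + 16 * (n.descFactorial 4 +
    6 * n.descFactorial 3 + 7 * n.descFactorial 2 + n.descFactorial 1) := by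
  have h : n.descFactorial 4 + 6 * n.descFactorial 3 + 7 * n.descFactorial 2 +
      n.descFactorial 1 = n ^ 4 := by
    rcases n with _ | _ | _ | _ | n <;> simp [Nat.descFactorial]
    ring
  rw [h]
  rcases n with _ | n
  · simp
  · have : 1 + (n + 1) ≤ 2 * (n + 1) := by omega
    calc (1 + (n + 1)) ^ 4 ≤ (2 * (n + 1)) ^ 4 := Nat.pow_le_pow_left this 4
      _ = 16 * (n + 1) ^ 4 := by ring
      _ ≤ _ := Nat.le_add_left _ _

/-- The fourth power is expanded in falling factorials, whose weighted sums are the quantities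
bounded by `exists_moment_bound`. The constant depends on the state only through the bound R. -/
theorem exists_totalWeight_bound (d j : ℕ) {R : ℝ} (hR : 0 ≤ R) : ∃ C : ℝ≥0,
    ∀ (ω : State d) (Q : Quasifree ω) (μ : Triple d), ω.HasMoments μ → MemX j μ →
      XNorm j μ ≤ ENNReal.ofReal R → totalWeight j (Q.W []) ≤ C := by
  choose C hC h using exists_moment_bound d j hR
  refine ⟨(Real.toNNReal (C 0)) + 1 + 16 * (Real.toNNReal (C 3) + 6 * Real.toNNReal (C 2) +
    7 * Real.toNNReal (C 1) + Real.toNNReal (C 0)), fun ω Q μ hμ hX hN => ?_⟩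
  have hm : ∀ m, ∑' k, ∑' n : ℕ, (n.descFactorial (m + 1) : ℝ≥0∞) * sobWeight j (Q.W []) k n ≤
      Real.toNNReal (C m) := by
    intro m
    simp_rw [tsum_descFactorial]
    rw [← Q.tsum_B]
    exact (h m ω Q μ hμ hX hN).2.2
  have h0 : ∑' k, ∑' n : ℕ, (n.descFactorial 0 : ℝ≥0∞) * sobWeight j (Q.W []) k n ≤
      Real.toNNReal (C 0) + 1 := by
    -- The vacuum component does not enter the moments of positive order; there the weight is the
    -- plain norm, and ‖Ψ‖ = 1 controls it.
    have h1 : ∀ k n, (n.descFactorial 0 : ℝ≥0∞) * sobWeight j (Q.W []) k n ≤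
        (n.descFactorial 1 : ℝ≥0∞) * sobWeight j (Q.W []) k n + ‖(Q.W []).comp k n‖ₑ ^ 2 := by
      intro k n
      rcases n with _ | n
      · simp [sobWeight]
      · simp only [Nat.descFactorial_zero, Nat.cast_one, one_mul, Nat.descFactorial_one]
        refine le_add_right ?_
        exact le_mul_of_one_le_left (zero_le) (by exact_mod_cast Nat.succ_pos n)
    refine (ENNReal.tsum_le_tsum fun k => ENNReal.tsum_le_tsum fun n => h1 k n).trans ?_
    simp_rw [ENNReal.tsum_add]
    refine add_le_add (hm 0) (le_of_eq ?_)
    rw [← G.enorm_sq, ← Quasifree.ofReal_norm_sq, Q.norm_W_nil]; simp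
  have hle : totalWeight j (Q.W []) ≤ ∑' k, ∑' n : ℕ, ((n.descFactorial 0 : ℝ≥0∞) + 16 *
      ((n.descFactorial 4 : ℝ≥0∞) + 6 * n.descFactorial 3 + 7 * n.descFactorial 2 +
        n.descFactorial 1)) * sobWeight j (Q.W []) k n := by
    refine ENNReal.tsum_le_tsum fun k => ENNReal.tsum_le_tsum fun n => ?_
    gcongr
    exact_mod_cast one_add_pow_four_le n
  refine hle.trans ?_
  simp_rw [add_mul, mul_assoc, add_mul, mul_assoc, ENNReal.tsum_add, ENNReal.tsum_mul_left,
    ENNReal.tsum_add, ENNReal.tsum_mul_left]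
  push_cast
  gcongr
  · exact hm 3
  · exact hm 2
  · exact hm 1
  · exact hm 0

/-! ### The spaces of zero, one and two particles -/

/-- The monomial `ψ*(F₀) ψ*(F₁) ⋯`. -/
def creWord {p : ℕ} (F : Fin p → Test d) : List (FieldOp d) := List.ofFn fun i => .cre (F i)

/-- The adjoint of `creWord F`. -/
def annWord' {p : ℕ} (F : Fin p → Test d) : List (FieldOp d) := adjWord (creWord F)

/-- The factor `√((n+1)⋯(n+p))`. -/
def weight (p n : ℕ) : ℝ := √((n + 1).ascFactorial p)

/-- The `p`-particle space together with the data needed for normal ordered polynomials of degree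
`p` in the creation operators. -/
structure Cell (d j : ℕ) where
  p : ℕ
  hp : p ≤ 2
  Z : Type
  [ms : MeasureSpace Z]
  [sf : SFinite (volume : Measure Z)]
  [sc : SecondCountableTopology (H Z)]
  split : ∀ n, Split (Fin (n + p) → Pt d) Z (Fin n → Pt d)
  R : H Z →L[ℂ] H Z
  adjoint_R : ContinuousLinearMap.adjoint R = R
  reg : ∃ D : ℕ → H Z →L[ℂ] H Z, (∀ n, ContinuousLinearMap.adjoint (D n) = D n) ∧
    (∀ n u, R (D n u) = D n (R u)) ∧ (∀ n u, ‖D n (R u)‖ ≤ ‖u‖) ∧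
    ∀ u, Tendsto (fun n => D n (R u)) atTop (𝓝 u)
  prod : (Fin p → Test d) → H Z
  total : ∀ x : H Z, (∀ F, inner ℂ (prod F) x = 0) → x = 0
  sob : ∀ (X : G d) (k n : ℕ), sobWeight j X k (n + p) < ⊤ → ∃ χ : H (Fin (n + p) → Pt d),
    X.comp k (n + p) = slot (split n) (split n) R χ ∧ ‖χ‖ₑ ^ 2 ≤ sobWeight j X k (n + p)
  comp_ann : ∀ {ω : State d} (Q : Quasifree ω) (F : Fin p → Test d) (L : List (FieldOp d))
    (k n : ℕ), (Q.W (annWord' F ++ L)).comp k n =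
      (weight p n : ℂ) • (split n).ctL (prod F) ((Q.W L).comp k (n + p))
  comp_cre : ∀ {ω : State d} (Q : Quasifree ω) (F : Fin p → Test d) (L : List (FieldOp d))
    (k n : ℕ), (Q.W (creWord F ++ L)).comp k (n + p) =
      (weight p n : ℂ) • P d (n + p) ((split n).ten (prod F) ((Q.W L).comp k n))
  comp_cre_lt : ∀ {ω : State d} (Q : Quasifree ω) (F : Fin p → Test d) (L : List (FieldOp d))
    (k m : ℕ), m < p → (Q.W (creWord F ++ L)).comp k m = 0

attribute [instance] Cell.ms Cell.sf Cell.sc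

theorem weight_zero (n : ℕ) : weight 0 n = 1 := by simp [weight]

theorem weight_one (n : ℕ) : weight 1 n = √(n + 1) := by simp [weight, Nat.ascFactorial]

theorem weight_two (n : ℕ) : weight 2 n = √(n + 1) * √(n + 2) := by
  rw [weight, ← Real.sqrt_mul (by positivity)]
  congr 1
  simp [Nat.ascFactorial]
  ring

instance isFiniteMeasure_punit : IsFiniteMeasure (volume : Measure PUnit) :=
  inferInstanceAs (IsFiniteMeasure (Measure.dirac PUnit.unit))

/-- The function `1` of zero variables. -/
def unitVec : H PUnit := (memLp_const (1 : ℂ)).toLp _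

theorem ten_unitVec {n : ℕ} (ξ : H (Fin n → Pt d)) : (split₀ d n).ten unitVec ξ = ξ := by
  apply Lp.ext
  have h1 : (unitVec : PUnit → ℂ) =ᵐ[volume] fun _ => 1 := MemLp.coeFn_toLp _
  filter_upwards [(split₀ d n).ten_coe unitVec ξ,
    (split₀ d n).mp.quasiMeasurePreserving.ae (ae_prod_fst h1)] with x h2 h3
  rw [h2, h3]; simp

theorem inner_unitVec (x : H PUnit) : inner ℂ unitVec x = x PUnit.unit := by
  have h1 : (unitVec : PUnit → ℂ) =ᵐ[volume] fun _ => 1 := MemLp.coeFn_toLp _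
  rw [H.inner_eq]
  have h2 : ∀ᵐ y : PUnit, conj (unitVec y) * x y = x PUnit.unit := by
    filter_upwards [h1] with y hy
    rw [hy]; simp
  rw [integral_congr_ae h2, integral_const]
  have : (volume : Measure PUnit).real Set.univ = 1 := by
    change (Measure.dirac PUnit.unit).real Set.univ = 1
    simp
  rw [this, one_smul]

/-- No particle. -/
def cell₀ (d j : ℕ) : Cell d j where
  p := 0
  hp := by norm_num
  Z := PUnit
  split n := split₀ d n
  R := ContinuousLinearMap.id ℂ _
  adjoint_R := ContinuousLinearMap.adjoint_id
  reg := ⟨fun _ => ContinuousLinearMap.id ℂ _, fun _ => ContinuousLinearMap.adjoint_id,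
    fun _ _ => rfl, fun _ _ => le_rfl, fun _ => tendsto_const_nhds⟩
  prod _ := unitVec
  total x h := by
    have h1 := h Fin.elim0
    rw [inner_unitVec] at h1
    apply Lp.ext
    filter_upwards [Lp.coeFn_zero ℂ 2 (volume : Measure PUnit)] with y hy
    rw [hy, h1]; rfl
  sob X k n _ := ⟨X.comp k n, (slot_id _ _).symm, enorm_sq_le_sobWeight j X k n⟩
  comp_ann Q F L k n := by
    rw [weight_zero, Complex.ofReal_one, one_smul]
    change (Q.W L).comp k n = _
    refine ext_inner_left ℂ fun g => ?_
    rw [Split.inner_ctL, ten_unitVec]; rfl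
  comp_cre Q F L k n := by
    rw [weight_zero, Complex.ofReal_one, one_smul, ten_unitVec]
    change (Q.W L).comp k n = _
    exact (P_of_mem (Fock.mem_sym _ _)).symm
  comp_cre_lt Q F L k m h := absurd h (Nat.not_lt_zero _)

/-- One particle. -/
def cell₁ (d j : ℕ) : Cell d j where
  p := 1
  hp := by norm_num
  Z := Pt d
  split n := split₁ d n
  R := resolv d j
  adjoint_R := adjoint_resolv d j
  reg := exists_regularization d j
  prod F := (F 0).l2
  total x h := ext_inner_test fun f => by rw [h fun _ => f, inner_zero_right]
  sob X k n h := by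
    obtain ⟨χ, h1, h2⟩ := exists_slot_resolv (split₁ d n) (basis d j) h
    exact ⟨χ, h1, h2.le⟩
  comp_ann Q F L k n := by
    rw [weight_one]
    exact Q.comp_ann (F 0) L k n
  comp_cre Q F L k n := by
    rw [weight_one]
    exact Q.comp_cre_succ (F 0) L k n
  comp_cre_lt Q F L k m h := by
    obtain rfl : m = 0 := by omega
    exact Q.comp_cre_zero (F 0) L k

theorem splitProd_ten {X Y : Type} [MeasureSpace X] [MeasureSpace Y]
    [SFinite (volume : Measure X)] [SFinite (volume : Measure Y)] (f : H X) (g : H Y) :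
    (splitProd X Y).ten f g = tmul f g :=
  Lp.ext (((splitProd X Y).ten_coe f g).trans (tmul_coe f g).symm)

theorem split₂_ten {n : ℕ} (f g : L2 d) (ξ : H (Fin n → Pt d)) :
    (split₂ d n).ten (tmul f g) ξ = (split₁ d (n + 1)).ten f ((split₁ d n).ten g ξ) := by
  apply Lp.ext
  filter_upwards [(split₂ d n).ten_coe (tmul f g) ξ,
    (split₁ d (n + 1)).ten_coe f ((split₁ d n).ten g ξ),
    (split₂ d n).mp.quasiMeasurePreserving.ae (ae_prod_fst (tmul_coe f g)),
    (split₁ d (n + 1)).mp.quasiMeasurePreserving.ae (ae_prod_snd ((split₁ d n).ten_coe g ξ))]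
    with x h1 h2 h3 h4
  rw [h1, h2, h3, h4]
  simp [mul_assoc]

theorem adjoint_slot {Ω Ω' X X' Y : Type} [MeasureSpace Ω] [MeasureSpace Ω'] [MeasureSpace X]
    [MeasureSpace X'] [MeasureSpace Y] [SFinite (volume : Measure X)]
    [SFinite (volume : Measure X')] [SFinite (volume : Measure Y)]
    [SecondCountableTopology (H X)] [SecondCountableTopology (H X')] (S : Split Ω X Y)
    (S' : Split Ω' X' Y) (T : H X →L[ℂ] H X') :
    ContinuousLinearMap.adjoint (slot S S' T) = slot S' S (ContinuousLinearMap.adjoint T) := by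
  refine ContinuousLinearMap.ext fun ξ => ext_inner_right ℂ fun η => ?_
  rw [ContinuousLinearMap.adjoint_inner_left, inner_slot]

/-- `R ⊗ 1` on the two-particle space. -/
def pairResolv (d j : ℕ) : H (Pt d × Pt d) →L[ℂ] H (Pt d × Pt d) :=
  slot (splitProd _ _) (splitProd _ _) (resolv d j)

theorem pairResolv_tmul {j : ℕ} (f g : L2 d) :
    pairResolv d j (tmul f g) = tmul (resolv d j f) g := by
  rw [← splitProd_ten, pairResolv, slot_ten, splitProd_ten]

theorem adjoint_pairResolv (d j : ℕ) :
    ContinuousLinearMap.adjoint (pairResolv d j) = pairResolv d j := by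
  rw [pairResolv, adjoint_slot, adjoint_resolv]

instance secondCountable_pair (d : ℕ) : SecondCountableTopology (H (Pt d × Pt d)) := by
  have h0 : MeasurableSpace.CountablyGenerated (Pt d × Pt d) := inferInstance
  have h1 : SFinite (volume.prod volume : Measure (Pt d × Pt d)) := inferInstance
  have h : IsSeparable (volume : Measure (Pt d × Pt d)) := inferInstance
  infer_instance

/-- On the two-particle space the resolvent acts on the first variable only, so no derivatives in
the second variable are ever required. -/
theorem slot_pairResolv {j n : ℕ} (χ : H (Fin (n + 2) → Pt d)) :
    slot (split₂ d n) (split₂ d n) (pairResolv d j) χ =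
      slot (split₁ d (n + 1)) (split₁ d (n + 1)) (resolv d j) χ := by
  refine ext_pten fun F => ?_
  rw [inner_slot, inner_slot, adjoint_pairResolv, adjoint_resolv]
  congr 1
  have h : pten (fun i => (F i).l2) = (split₂ d n).ten (tmul (F 0).l2 (F 1).l2)
      (pten fun i => (F i.succ.succ).l2) := by
    rw [split₂_ten]; rfl
  rw [h, slot_ten, pairResolv_tmul, split₂_ten, split₂_ten, slot_ten]

theorem ext_tmul_test {x y : H (Pt d × Pt d)}
    (h : ∀ f g : Test d, inner ℂ (tmul f.l2 g.l2) x = inner ℂ (tmul f.l2 g.l2) y) : x = y := by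
  refine (splitProd (Pt d) (Pt d)).ext_ten fun f g => ?_
  rw [← Split.inner_ctR, ← Split.inner_ctR]
  congr 1
  refine ext_inner_test fun f => ?_
  rw [Split.inner_ctR, Split.inner_ctR, ← Split.inner_ctL, ← Split.inner_ctL]
  congr 1
  refine ext_inner_test fun g => ?_
  rw [Split.inner_ctL, Split.inner_ctL, splitProd_ten, h]

/-- A permutation of the remaining variables extends to one fixing the first variable, under which s
is invariant. -/
theorem ctL_mem_sym {n : ℕ} (f : L2 d) {s : H (Fin (n + 1) → Pt d)} (hs : s ∈ Sym d (n + 1)) :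
    (split₁ d n).ctL f s ∈ Sym d n := fun π => by
  refine ext_inner_left ℂ fun g => ?_
  have h : (split₁ d n).ten f (U π⁻¹ g) =
      U (Equiv.Perm.decomposeFin.symm (0, π⁻¹)) ((split₁ d n).ten f g) := by
    apply Lp.ext
    filter_upwards [(split₁ d n).ten_coe f (U π⁻¹ g),
      U_coe (Equiv.Perm.decomposeFin.symm (0, π⁻¹)) ((split₁ d n).ten f g),
      (quasiMeasurePreserving_perm (Equiv.Perm.decomposeFin.symm (0, π⁻¹))).ae
        ((split₁ d n).ten_coe f g),
      (split₁ d n).mp.quasiMeasurePreserving.ae (ae_prod_snd (U_coe π⁻¹ g))] with x h1 h2 h3 h4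
    rw [h1, h2, h3, h4]
    simp
  rw [inner_U, Split.inner_ctL, Split.inner_ctL, h, ← inv_inv (Equiv.Perm.decomposeFin.symm _),
    ← inner_U, hs]

/-- Two particles. -/
def cell₂ (d j : ℕ) : Cell d j where
  p := 2
  hp := le_rfl
  Z := Pt d × Pt d
  split n := split₂ d n
  R := pairResolv d j
  adjoint_R := adjoint_pairResolv d j
  reg := by
    obtain ⟨D, h1, h2, h3, h4⟩ := exists_regularization d j
    refine ⟨fun n => slot (splitProd _ _) (splitProd _ _) (D n), fun n => ?_, fun n u => ?_,
      fun n u => ?_, fun u => ?_⟩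
    · rw [adjoint_slot, h1]
    · rw [pairResolv, slot_slot, slot_slot]
      congr 2
      exact ContinuousLinearMap.ext (h2 n)
    · rw [pairResolv, slot_slot]
      have := norm_slot_le (splitProd (Pt d) (Pt d)) (splitProd (Pt d) (Pt d)) zero_le_one
        (T := D n ∘L resolv d j) (fun u => (h3 n u).trans (one_mul _).ge) u
      rwa [one_mul] at this
    · have := tendsto_slot (splitProd (Pt d) (Pt d)) (splitProd (Pt d) (Pt d))
        (T := fun n => D n ∘L resolv d j) (T' := ContinuousLinearMap.id ℂ _) (C := 1)
        (fun n u => (h3 n u).trans (one_mul _).ge) h4 u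
      rw [slot_id] at this
      refine this.congr fun n => ?_
      rw [pairResolv, slot_slot]
  prod F := tmul (F 0).l2 (F 1).l2
  total x h := ext_tmul_test fun f g => by
    have := h ![f, g]
    simp only [Matrix.cons_val_zero, Matrix.cons_val_one] at this
    rw [this, inner_zero_right]
  sob X k n h := by
    obtain ⟨χ, h1, h2⟩ := exists_slot_resolv (split₁ d (n + 1)) (basis d j) h
    exact ⟨χ, by rw [slot_pairResolv]; exact h1, h2.le⟩
  comp_ann Q F L k n := by
    have h : annWord' F ++ L = .ann (F 1) :: .ann (F 0) :: L := by
      simp [annWord', creWord, adjWord, FieldOp.adj, FieldOp.ann, FieldOp.cre]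
    rw [h, Q.comp_ann, Q.comp_ann, map_smul, smul_smul, weight_two]
    push_cast
    congr 1
    · congr 3; ring_nf
    · refine ext_inner_left ℂ fun g => ?_
      rw [Split.inner_ctL, Split.inner_ctL, Split.inner_ctL, split₂_ten]
  comp_cre Q F L k n := by
    have h : creWord F ++ L = .cre (F 0) :: .cre (F 1) :: L := by
      simp [creWord]
    rw [h]
    refine (Q.comp_cre_succ _ _ k (n + 1)).trans ?_
    rw [Q.comp_cre_succ, weight_two]
    rw [← Split.tenL_apply, map_smul, map_smul, smul_smul, Split.tenL_apply, split₂_ten]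
    push_cast
    congr 1
    · rw [mul_comm]; congr 3; ring_nf
    -- The inner symmetrization is absorbed by the outer one: contracting a symmetric vector in its
    -- first variable leaves a symmetric vector.
    · refine eq_P_of_inner (P_mem _) fun s hs => ?_
      rw [inner_P_of_mem hs, ← Split.inner_ctL_left, inner_P_of_mem (ctL_mem_sym _ hs),
        Split.inner_ctL_left]
  comp_cre_lt Q F L k m hm := by
    have h : creWord F ++ L = .cre (F 0) :: .cre (F 1) :: L := by
      simp [creWord]
    rw [h]
    rcases m with _ | _ | m
    · exact Q.comp_cre_zero _ _ k
    · refine (Q.comp_cre_succ _ _ k 0).trans ?_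
      rw [Q.comp_cre_zero, ← Split.tenL_apply, map_zero, map_zero, smul_zero]
    · omega

end HFB
end

/-! ### Normal ordered operators with kernel B R^{-1} applied to a state. -/

noncomputable section

namespace HFB

variable {d j : ℕ}

/-! ### Sequences of Fock vectors given by their components -/

/-- The sequence of Fock vectors with given components. -/
def G.ofComp (x : ∀ _k m : ℕ, H (Fin m → Pt d)) (hx : ∀ k m, x k m ∈ Sym d m)
    (h : ∑' k, ∑' m, ‖x k m‖ₑ ^ 2 < ⊤) : G d :=
  have hs : ∀ k, Summable fun m => ‖x k m‖ ^ 2 := fun k =>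
    (ENNReal.summable_toReal (ENNReal.ne_top_of_tsum_ne_top h.ne k)).congr fun m => by simp
  ⟨fun k => ⟨⟨x k, memℓp_two (hs k)⟩, mem_boseFock (hx k)⟩, memℓp_two <|
    (ENNReal.summable_toReal h.ne).congr fun k => by
      have := lp_enorm_sq (⟨x k, memℓp_two (hs k)⟩ : FullFock d)
      change (∑' m, ‖x k m‖ₑ ^ 2).toReal = ‖(⟨x k, memℓp_two (hs k)⟩ : FullFock d)‖ ^ 2
      rw [← toReal_enorm, ← ENNReal.toReal_pow, this]⟩

theorem G.comp_ofComp (x : ∀ _k m : ℕ, H (Fin m → Pt d)) (hx : ∀ k m, x k m ∈ Sym d m)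
    (h : ∑' k, ∑' m, ‖x k m‖ₑ ^ 2 < ⊤) (k m : ℕ) : (G.ofComp x hx h).comp k m = x k m := rfl

theorem G.ext_comp {X Y : G d} (h : ∀ k m, X.comp k m = Y.comp k m) : X = Y := by
  apply lp.ext
  funext k
  apply Subtype.ext
  apply lp.ext
  funext m
  exact h k m

@[simp] theorem G.comp_add (X Y : G d) (k m : ℕ) : (X + Y).comp k m = X.comp k m + Y.comp k m := rfl

@[simp] theorem G.comp_sub (X Y : G d) (k m : ℕ) : (X - Y).comp k m = X.comp k m - Y.comp k m := rfl

@[simp] theorem G.comp_smul (c : ℂ) (X : G d) (k m : ℕ) : (c • X).comp k m = c • X.comp k m := rfl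

theorem G.comp_mem (X : G d) (k m : ℕ) : X.comp k m ∈ Sym d m := Fock.mem_sym _ _

theorem G.hasSum_inner (X Y : G d) :
    HasSum (fun k => inner ℂ (X k) (Y k)) (inner ℂ X Y) := lp.hasSum_inner (𝕜 := ℂ) X Y

/-- Dominated convergence for the counting measure on the pairs (k, m). -/
theorem G.tendsto_zero_of_dominated {X : ℕ → G d} {b : ℕ → ℕ → ℝ≥0∞}
    (hb : ∀ i k m, ‖(X i).comp k m‖ₑ ^ 2 ≤ b k m) (hs : ∑' k, ∑' m, b k m ≠ ⊤)
    (ht : ∀ k m, Tendsto (fun i => (X i).comp k m) atTop (𝓝 0)) :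
    Tendsto X atTop (𝓝 0) := by
  rw [← ENNReal.tsum_prod (f := b), ← lintegral_count] at hs
  have key := tendsto_lintegral_of_dominated_convergence (μ := Measure.count)
    (F := fun i (p : ℕ × ℕ) => ‖(X i).comp p.1 p.2‖ₑ ^ 2) (f := fun _ => 0) (fun p => b p.1 p.2)
    (fun i => Measurable.of_discrete) (fun i => Eventually.of_forall fun p => hb i p.1 p.2) hs
    (Eventually.of_forall fun p => by
      have h1 := (ht p.1 p.2).enorm
      have h2 := ENNReal.Tendsto.pow (n := 2) h1
      simpa using h2)
  simp only [lintegral_count, lintegral_zero] at key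
  have h3 : ∀ i, ∑' p : ℕ × ℕ, ‖(X i).comp p.1 p.2‖ₑ ^ 2 = ‖X i‖ₑ ^ 2 := fun i => by
    rw [G.enorm_sq, ENNReal.tsum_prod (f := fun k n => ‖(X i).comp k n‖ₑ ^ 2)]
  simp_rw [h3] at key
  rw [tendsto_zero_iff_norm_tendsto_zero]
  have h4 := (ENNReal.tendsto_toReal ENNReal.zero_ne_top).comp key
  have h5 := h4.sqrt
  simpa [Function.comp_def] using h5

/-- The family that is `f n` in degree `n + p` and zero in degrees below `p`. -/
def place : (_p : ℕ) → (E : ℕ → Type) → [∀ m, Zero (E m)] → (∀ n, E (n + _p)) → ∀ m, E m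
  | 0, _, _, f => f
  | p + 1, E, _, f => fun m => Nat.casesOn m 0 fun m => place p (fun m => E (m + 1)) f m

theorem place_add : ∀ (p : ℕ) (E : ℕ → Type) [∀ m, Zero (E m)] (f : ∀ n, E (n + p)) (n : ℕ),
    place p E f (n + p) = f n
  | 0, _, _, _, _ => rfl
  | p + 1, E, _, f, n => place_add p (fun m => E (m + 1)) f n

theorem place_lt : ∀ (p : ℕ) (E : ℕ → Type) [∀ m, Zero (E m)] (f : ∀ n, E (n + p)) {m : ℕ},
    m < p → place p E f m = 0
  | 0, _, _, _, _, h => absurd h (Nat.not_lt_zero _)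
  | p + 1, _, _, _, 0, _ => rfl
  | p + 1, E, _, f, m + 1, h => place_lt p (fun m => E (m + 1)) f (Nat.lt_of_succ_lt_succ h)

theorem forall_ge_or_lt {p : ℕ} {Q : ℕ → Prop} (h1 : ∀ m < p, Q m) (h2 : ∀ n, Q (n + p)) (m : ℕ) :
    Q m := by
  rcases lt_or_ge m p with h | h
  · exact h1 m h
  · obtain ⟨n, rfl⟩ := Nat.exists_eq_add_of_le' h
    exact h2 n

theorem tsum_of_lt_zero (p : ℕ) {f : ℕ → ℝ≥0∞} (h : ∀ m < p, f m = 0) :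
    ∑' m, f m = ∑' n, f (n + p) := by
  rw [← (ENNReal.summable).sum_add_tsum_nat_add' (k := p),
    Finset.sum_eq_zero fun i hi => h i (Finset.mem_range.1 hi), zero_add]

/-! ### Normal ordered operators applied to a state -/

theorem ofReal_weight_sq (p n : ℕ) : ENNReal.ofReal (weight p n ^ 2) = (n + 1).ascFactorial p := by
  rw [weight, Real.sq_sqrt (by positivity), ENNReal.ofReal_natCast]

/-- This fixes the power four in the total weight: p creators and q annihilators, each at most two,
cost at most (1 + particle number)^4 in the squared norm. -/
theorem ascFactorial_mul_le {p q : ℕ} (hp : p ≤ 2) (hq : q ≤ 2) (n : ℕ) :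
    (n + 1).ascFactorial p * (n + 1).ascFactorial q ≤ 16 * (1 + (n + q)) ^ 4 := by
  have h : ∀ p ≤ 2, (n + 1).ascFactorial p ≤ (2 * (1 + (n + q))) ^ 2 := by
    intro p hp
    interval_cases p
    · exact Nat.one_le_pow _ _ (by omega)
    all_goals simp only [Nat.ascFactorial]; nlinarith
  calc _ ≤ (2 * (1 + (n + q))) ^ 2 * (2 * (1 + (n + q))) ^ 2 := Nat.mul_le_mul (h p hp) (h q hq)
    _ = _ := by ring

namespace Cell

variable (c c' : Cell d j) {X : G d}

open Classical in
/-- The vector `χ` with `X = (R ⊗ 1) χ` in the `p`-particle components. -/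
def chi (X : G d) (k n : ℕ) : H (Fin (n + c.p) → Pt d) :=
  if h : sobWeight j X k (n + c.p) < ⊤ then (c.sob X k n h).choose else 0

theorem enorm_chi_sq_le (X : G d) (k n : ℕ) : ‖c.chi X k n‖ₑ ^ 2 ≤ sobWeight j X k (n + c.p) := by
  rw [chi]
  split_ifs with h
  · exact (c.sob X k n h).choose_spec.2
  · simp

theorem slot_chi (h : totalWeight j X ≠ ⊤) (k n : ℕ) :
    slot (c.split n) (c.split n) c.R (c.chi X k n) = X.comp k (n + c.p) := by
  have h1 : sobWeight j X k (n + c.p) < ⊤ := by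
    have h2 := ENNReal.ne_top_of_tsum_ne_top (ENNReal.ne_top_of_tsum_ne_top h k) (n + c.p)
    refine lt_of_le_of_lt ?_ (lt_top_iff_ne_top.2 h2)
    exact le_mul_of_one_le_left (zero_le) (by exact_mod_cast Nat.one_le_pow _ _ (by omega))
  rw [chi, dif_pos h1]
  exact (c.sob X k n h1).choose_spec.1.symm

/-- The components of the normal ordered operator with kernel `B R⁻¹` applied to `X`. -/
def raw (B : H c'.Z →L[ℂ] H c.Z) (X : G d) (k : ℕ) : ∀ m, H (Fin m → Pt d) :=
  place c.p (fun m => H (Fin m → Pt d)) fun n => ((weight c.p n * weight c'.p n : ℝ) : ℂ) •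
    P d (n + c.p) (slot (c'.split n) (c.split n) B (c'.chi X k n))

theorem raw_add (B : H c'.Z →L[ℂ] H c.Z) (X : G d) (k n : ℕ) : c.raw c' B X k (n + c.p) =
    ((weight c.p n * weight c'.p n : ℝ) : ℂ) •
      P d (n + c.p) (slot (c'.split n) (c.split n) B (c'.chi X k n)) := place_add _ _ _ _

theorem raw_lt (B : H c'.Z →L[ℂ] H c.Z) (X : G d) (k : ℕ) {m : ℕ} (h : m < c.p) :
    c.raw c' B X k m = 0 := place_lt _ _ _ h

theorem raw_mem (B : H c'.Z →L[ℂ] H c.Z) (X : G d) (k : ℕ) : ∀ m, c.raw c' B X k m ∈ Sym d m :=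
  forall_ge_or_lt (p := c.p) (fun m h => by rw [raw_lt _ _ _ _ _ h]; exact zero_mem _)
    fun n => by rw [raw_add]; exact (Sym d _).smul_mem _ (P_mem _)

theorem enorm_raw_sq_le {B : H c'.Z →L[ℂ] H c.Z} {C : ℝ≥0} (hB : ∀ u, ‖B u‖ ≤ C * ‖u‖) (X : G d)
    (k n : ℕ) : ‖c.raw c' B X k (n + c.p)‖ₑ ^ 2 ≤
      (16 * C ^ 2 : ℝ≥0) * (((1 + (n + c'.p)) ^ 4 : ℕ) * sobWeight j X k (n + c'.p)) := by
  rw [raw_add, ← Quasifree.ofReal_norm_sq]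
  have h1 : ‖((weight c.p n * weight c'.p n : ℝ) : ℂ) •
      P d (n + c.p) (slot (c'.split n) (c.split n) B (c'.chi X k n))‖ ^ 2 ≤
      weight c.p n ^ 2 * weight c'.p n ^ 2 * (C ^ 2 * ‖c'.chi X k n‖ ^ 2) := by
    rw [norm_smul, Complex.norm_real, mul_pow, Real.norm_eq_abs, sq_abs, mul_pow (weight c.p n), ← mul_pow (C : ℝ)]
    gcongr
    exact (norm_P_le _).trans (norm_slot_le _ _ C.2 hB _)
  refine (ENNReal.ofReal_le_ofReal h1).trans ?_
  rw [ENNReal.ofReal_mul (by positivity), ENNReal.ofReal_mul (by positivity), ofReal_weight_sq,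
    ofReal_weight_sq, ENNReal.ofReal_mul (by positivity), Quasifree.ofReal_norm_sq,
    ENNReal.ofReal_pow (by positivity), ENNReal.ofReal_coe_nnreal]
  have h2 : (((n + 1).ascFactorial c.p : ℝ≥0∞) * ((n + 1).ascFactorial c'.p : ℝ≥0∞)) ≤
      ((16 * (1 + (n + c'.p)) ^ 4 : ℕ) : ℝ≥0∞) := by
    exact_mod_cast ascFactorial_mul_le c.hp c'.hp n
  calc _ ≤ ((16 * (1 + (n + c'.p)) ^ 4 : ℕ) : ℝ≥0∞) *
        ((C : ℝ≥0∞) ^ 2 * sobWeight j X k (n + c'.p)) := by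
        gcongr
        exact c'.enorm_chi_sq_le X k n
    _ = _ := by push_cast; ring

/-- Only the annihilated variables need derivatives. The weight is read off at particle number n +
q, and the shift by q loses nothing as all terms are nonnegative. -/
theorem tsum_raw_le {B : H c'.Z →L[ℂ] H c.Z} {C : ℝ≥0} (hB : ∀ u, ‖B u‖ ≤ C * ‖u‖) (X : G d) :
    ∑' k, ∑' m, ‖c.raw c' B X k m‖ₑ ^ 2 ≤ (16 * C ^ 2 : ℝ≥0) * totalWeight j X := by
  rw [totalWeight, ← ENNReal.tsum_mul_left]
  refine ENNReal.tsum_le_tsum fun k => ?_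
  rw [tsum_of_lt_zero c.p fun m h => by rw [raw_lt _ _ _ _ _ h]; simp, ← ENNReal.tsum_mul_left]
  refine (ENNReal.tsum_le_tsum fun n => c.enorm_raw_sq_le c' hB X k n).trans ?_
  exact ENNReal.tsum_comp_le_tsum_of_injective (add_left_injective c'.p)
    fun n => ((16 * C ^ 2 : ℝ≥0) : ℝ≥0∞) * (((1 + n) ^ 4 : ℕ) * sobWeight j X k n)

theorem tsum_raw_lt_top (h : totalWeight j X ≠ ⊤) (B : H c'.Z →L[ℂ] H c.Z) :
    ∑' k, ∑' m, ‖c.raw c' B X k m‖ₑ ^ 2 < ⊤ :=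
  (c.tsum_raw_le c' (C := ‖B‖₊) B.le_opNorm X).trans_lt
    (ENNReal.mul_lt_top ENNReal.coe_lt_top (lt_top_iff_ne_top.2 h))

/-- The normal ordered operator with kernel `B R⁻¹` applied to the state `X`. -/
def nvec (h : totalWeight j X ≠ ⊤) : (H c'.Z →L[ℂ] H c.Z) →ₗ[ℂ] G d where
  toFun B := G.ofComp (c.raw c' B X) (c.raw_mem c' B X) (c.tsum_raw_lt_top c' h B)
  map_add' B B' := G.ext_comp fun k => forall_ge_or_lt (p := c.p)
    (fun m hm => by simp only [G.comp_add, G.comp_ofComp, raw_lt _ _ _ _ _ hm, add_zero])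
    fun n => by simp only [G.comp_add, G.comp_ofComp, raw_add, slot_add, map_add, smul_add]
  map_smul' z B := G.ext_comp fun k => forall_ge_or_lt (p := c.p)
    (fun m hm => by simp only [G.comp_smul, G.comp_ofComp, raw_lt _ _ _ _ _ hm, smul_zero])
    fun n => by
      simp only [G.comp_smul, G.comp_ofComp, raw_add, slot_smul, map_smul, RingHom.id_apply]
      rw [smul_comm]

theorem comp_nvec (h : totalWeight j X ≠ ⊤) (B : H c'.Z →L[ℂ] H c.Z) (k n : ℕ) :
    (c.nvec c' h B).comp k (n + c.p) = ((weight c.p n * weight c'.p n : ℝ) : ℂ) •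
      P d (n + c.p) (slot (c'.split n) (c.split n) B (c'.chi X k n)) := raw_add _ _ _ _ _ _

theorem comp_nvec_lt (h : totalWeight j X ≠ ⊤) (B : H c'.Z →L[ℂ] H c.Z) (k : ℕ) {m : ℕ}
    (hm : m < c.p) : (c.nvec c' h B).comp k m = 0 := raw_lt _ _ _ _ _ hm

theorem enorm_nvec_sq_le (h : totalWeight j X ≠ ⊤) {B : H c'.Z →L[ℂ] H c.Z} {C : ℝ≥0}
    (hB : ∀ u, ‖B u‖ ≤ C * ‖u‖) :
    ‖c.nvec c' h B‖ₑ ^ 2 ≤ (16 * C ^ 2 : ℝ≥0) * totalWeight j X := by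
  rw [G.enorm_sq]
  exact c.tsum_raw_le c' hB X

theorem norm_nvec_le (h : totalWeight j X ≠ ⊤) {B : H c'.Z →L[ℂ] H c.Z} {C D : ℝ≥0}
    (hB : ∀ u, ‖B u‖ ≤ C * ‖u‖) (hD : totalWeight j X ≤ D) :
    ‖c.nvec c' h B‖ ≤ √(16 * C ^ 2 * D) := by
  refine Real.le_sqrt_of_sq_le ?_
  have h1 := (c.enorm_nvec_sq_le c' h hB).trans (mul_le_mul_right hD _)
  rw [← Quasifree.ofReal_norm_sq, ← ENNReal.coe_mul, ENNReal.ofReal_le_coe] at h1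
  simpa using h1

/-- Componentwise convergence is strong continuity of B ↦ B ⊗ 1. The bound on the squared norms of
the components is uniform along the sequence and summable by finiteness of the total weight. -/
theorem tendsto_nvec (h : totalWeight j X ≠ ⊤) {B : ℕ → H c'.Z →L[ℂ] H c.Z}
    {B' : H c'.Z →L[ℂ] H c.Z} {C : ℝ≥0} (hb : ∀ n u, ‖B n u‖ ≤ C * ‖u‖)
    (ht : ∀ u, Tendsto (fun n => B n u) atTop (𝓝 (B' u))) :
    Tendsto (fun n => c.nvec c' h (B n)) atTop (𝓝 (c.nvec c' h B')) := by
  rw [← tendsto_sub_nhds_zero_iff]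
  simp_rw [← map_sub]
  have hB' : ∀ u, ‖B' u‖ ≤ C * ‖u‖ := fun u =>
    le_of_tendsto (ht u).norm (Eventually.of_forall fun n => hb n u)
  have hb2 : ∀ n u, ‖(B n - B') u‖ ≤ (C + C : ℝ≥0) * ‖u‖ := fun n u => by
    rw [sub_apply, NNReal.coe_add, add_mul]
    exact (norm_sub_le _ _).trans (add_le_add (hb n u) (hB' u))
  refine G.tendsto_zero_of_dominated (b := fun k => place c.p (fun _ => ℝ≥0∞) fun n =>
    (16 * (C + C) ^ 2 : ℝ≥0) * (((1 + (n + c'.p)) ^ 4 : ℕ) * sobWeight j X k (n + c'.p)))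
    (fun i k => forall_ge_or_lt (p := c.p) (fun m hm => ?_) fun n => ?_) ?_
    fun k => forall_ge_or_lt (p := c.p) (fun m hm => ?_) fun n => ?_
  · rw [comp_nvec_lt _ _ _ _ _ hm]; simp
  · rw [place_add]
    exact c.enorm_raw_sq_le c' (hb2 i) X k n
  · refine ne_top_of_le_ne_top (ENNReal.mul_ne_top (ENNReal.coe_ne_top (r := 16 * (C + C) ^ 2)) h) ?_
    rw [totalWeight, ← ENNReal.tsum_mul_left]
    refine ENNReal.tsum_le_tsum fun k => ?_
    rw [tsum_of_lt_zero c.p fun m h => place_lt _ _ _ h, ← ENNReal.tsum_mul_left]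
    simp_rw [place_add]
    exact ENNReal.tsum_comp_le_tsum_of_injective (add_left_injective c'.p)
      fun n => ((16 * (C + C) ^ 2 : ℝ≥0) : ℝ≥0∞) * (((1 + n) ^ 4 : ℕ) * sobWeight j X k n)
  · simp_rw [comp_nvec_lt _ _ _ _ _ hm]; exact tendsto_const_nhds
  · simp_rw [comp_nvec, slot_sub]
    have h1 := tendsto_slot (c'.split n) (c.split n) hb ht (c'.chi X k n)
    have h2 := (((P d (n + c.p)).continuous.tendsto _).comp
      (tendsto_sub_nhds_zero_iff.2 h1)).const_smul ((weight c.p n * weight c'.p n : ℝ) : ℂ)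
    simpa [Function.comp_def] using h2

theorem slot_rankOne {Ω Ω' X X' Y : Type} [MeasureSpace Ω] [MeasureSpace Ω'] [MeasureSpace X]
    [MeasureSpace X'] [MeasureSpace Y] [SFinite (volume : Measure X)]
    [SFinite (volume : Measure X')] [SFinite (volume : Measure Y)]
    [SecondCountableTopology (H X)] [SecondCountableTopology (H X')] (S : Split Ω X Y)
    (S' : Split Ω' X' Y) (e : H X') (f : H X) (ξ : H Ω) :
    slot S S' (InnerProductSpace.rankOne ℂ e f) ξ = S'.ten e (S.ctL f ξ) := by
  refine S'.ext_ten fun a b => ?_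
  rw [inner_slot, slot_ten, InnerProductSpace.adjoint_rankOne, InnerProductSpace.rankOne_apply,
    Split.inner_ten_ten, ← S.tenL_apply, map_smul, smul_apply, inner_smul_left, S.tenL_apply,
    inner_conj_symm, S.inner_ctL]

/-- The normal ordered words are normal ordered operators with kernels of rank one. -/
theorem word_eq_nvec {ω : State d} (Q : Quasifree ω) (h : totalWeight j (Q.W []) ≠ ⊤)
    (E : Fin c.p → Test d) (F : Fin c'.p → Test d) :
    Q.W (creWord E ++ annWord' F) =
      c.nvec c' h (InnerProductSpace.rankOne ℂ (c.prod E) (c'.R (c'.prod F))) := by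
  refine G.ext_comp fun k => forall_ge_or_lt (p := c.p) (fun m hm => ?_) fun n => ?_
  · rw [comp_nvec_lt _ _ _ _ _ hm, c.comp_cre_lt Q E _ k m hm]
  · rw [comp_nvec, c.comp_cre, slot_rankOne]
    have h1 := c'.comp_ann Q F [] k n
    rw [List.append_nil] at h1
    rw [h1, ← c'.slot_chi h, ctL_slot, c'.adjoint_R, ← Split.tenL_apply, map_smul, map_smul,
      smul_smul, Split.tenL_apply]
    push_cast
    rfl

end Cell

end HFB
end

/-! ### Extension from monomials to all kernels. -/

noncomputable section

namespace HFB

variable {d j : ℕ}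

open InnerProductSpace in
-- K is the strong limit of the finite-rank operators Σ |K b⟩⟨b|.
theorem tendsto_comp_partialSum {E F : Type} [NormedAddCommGroup E] [InnerProductSpace ℂ E]
    [CompleteSpace E] {s : ℕ → Finset (BasisIndex E)} (hs : Tendsto s atTop atTop)
    [NormedAddCommGroup F] [InnerProductSpace ℂ F] (K : E →L[ℂ] F) (x : E) :
    Tendsto (fun n => (∑ b ∈ s n, rankOne ℂ (K (hbasis E b)) (hbasis E b)) x) atTop (𝓝 (K x)) := by
  have h := (((hbasis E).hasSum_repr x).mapL K).comp hs
  refine h.congr fun n => ?_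
  simp [rankOne_apply, HilbertBasis.repr_apply_apply]

/-- Uniform boundedness principle; strong convergence alone therefore suffices as hypothesis in all
later limits. -/
theorem exists_bound_of_tendsto {E F : Type} [NormedAddCommGroup E] [InnerProductSpace ℂ E]
    [CompleteSpace E] [NormedAddCommGroup F] [InnerProductSpace ℂ F] {B : ℕ → E →L[ℂ] F}
    {B' : E →L[ℂ] F} (h : ∀ u, Tendsto (fun n => B n u) atTop (𝓝 (B' u))) :
    ∃ C : ℝ≥0, ∀ n u, ‖B n u‖ ≤ C * ‖u‖ := by
  obtain ⟨C, hC⟩ := banach_steinhaus (g := B) fun u => by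
    obtain ⟨C, hC⟩ := (h u).norm.bddAbove_range
    exact ⟨C, fun n => hC ⟨n, rfl⟩⟩
  refine ⟨Real.toNNReal C, fun n u => (B n).le_of_opNorm_le ((hC n).trans (Real.le_coe_toNNReal C)) u⟩

namespace Cell

variable (c c' : Cell d j)

theorem span_prod_eq_top : (Submodule.span ℂ (Set.range c.prod)).topologicalClosure = ⊤ := by
  rw [Submodule.topologicalClosure_eq_top_iff, Submodule.eq_bot_iff]
  intro x hx
  exact c.total x fun F => (Submodule.mem_orthogonal _ _).1 hx _ (Submodule.subset_span ⟨F, rfl⟩)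

theorem closed_submodule_eq_top {S : Submodule ℂ (H c.Z)}
    (hS : ∀ (x : ℕ → H c.Z) (y : H c.Z), (∀ n, x n ∈ S) → Tendsto x atTop (𝓝 y) → y ∈ S)
    (h : ∀ F, c.prod F ∈ S) (x : H c.Z) : x ∈ S := by
  have hc : IsClosed (S : Set (H c.Z)) :=
    IsSeqClosed.isClosed fun u y hu hy => hS u y hu hy
  have h1 : (Submodule.span ℂ (Set.range c.prod)).topologicalClosure ≤ S :=
    Submodule.topologicalClosure_minimal _
      (Submodule.span_le.2 (by rintro _ ⟨F, rfl⟩; exact h F)) hc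
  rw [c.span_prod_eq_top] at h1
  exact h1 trivial

open InnerProductSpace in
/-- A property of pairs of kernels of an operator and its adjoint that holds for words, and is stable
under linear combinations and strong limits, holds for all pairs. -/
theorem pair_induction {p : (H c'.Z →L[ℂ] H c.Z) → (H c.Z →L[ℂ] H c'.Z) → Prop}
    (hadd : ∀ B B' C C', p B B' → p C C' → p (B + C) (B' + C'))
    (hsmul : ∀ (z : ℂ) B B', p B B' → p (z • B) (conj z • B'))
    (hlim : ∀ (B : ℕ → H c'.Z →L[ℂ] H c.Z) (B' : ℕ → H c.Z →L[ℂ] H c'.Z) C C',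
      (∀ n, p (B n) (B' n)) → (∀ u, Tendsto (fun n => B n u) atTop (𝓝 (C u))) →
      (∀ u, Tendsto (fun n => B' n u) atTop (𝓝 (C' u))) → p C C')
    (hbase : ∀ E F, p (rankOne ℂ (c.prod E) (c'.R (c'.prod F)))
      (rankOne ℂ (c'.prod F) (c.R (c.prod E))))
    {B : H c'.Z →L[ℂ] H c.Z} {B' : H c.Z →L[ℂ] H c'.Z}
    (hBB : ∀ u w, inner ℂ (c.R u) (B w) = inner ℂ (B' u) (c'.R w)) : p B B' := by
  have hzero : p 0 0 := by simpa using hsmul 0 _ _ (hbase default default)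
  -- Linearity, limits and totality of the products replace the creation part by an arbitrary
  -- vector; the same is done next for the annihilation part.
  have h1 : ∀ e F, p (rankOne ℂ e (c'.R (c'.prod F))) (rankOne ℂ (c'.prod F) (c.R e)) := by
    intro e F
    let S : Submodule ℂ (H c.Z) :=
      { carrier := {e | p (rankOne ℂ e (c'.R (c'.prod F))) (rankOne ℂ (c'.prod F) (c.R e))}
        zero_mem' := by simpa using hzero
        add_mem' := fun h h' => by simpa using hadd _ _ _ _ h h'
        smul_mem' := fun z x h => by
          have := hsmul z _ _ h
          simpa using this }
    refine c.closed_submodule_eq_top (S := S) (fun x y hx hy => ?_) (fun E => hbase E F) e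
    refine hlim _ _ _ _ hx (fun u => ?_) fun u => ?_
    · simp only [rankOne_apply]
      exact tendsto_const_nhds.smul hy
    · simp only [rankOne_apply]
      exact ((((c.R.continuous.tendsto _).comp hy).inner tendsto_const_nhds)).smul tendsto_const_nhds
  have h2 : ∀ e f, p (rankOne ℂ e (c'.R f)) (rankOne ℂ f (c.R e)) := by
    intro e f
    let S : Submodule ℂ (H c'.Z) :=
      { carrier := {f | p (rankOne ℂ e (c'.R f)) (rankOne ℂ f (c.R e))}
        zero_mem' := by simpa using hzero
        add_mem' := fun h h' => by simpa using hadd _ _ _ _ h h'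
        smul_mem' := fun z x h => by
          have := hsmul (conj z) _ _ h
          simpa using this }
    refine c'.closed_submodule_eq_top (S := S) (fun x y hx hy => ?_) (fun F => h1 e F) f
    refine hlim _ _ _ _ hx (fun u => ?_) fun u => ?_
    · simp only [rankOne_apply]
      exact (((c'.R.continuous.tendsto _).comp hy).inner tendsto_const_nhds).smul tendsto_const_nhds
    · simp only [rankOne_apply]
      exact tendsto_const_nhds.smul hy
  have hsum : ∀ {ι : Type} (s : Finset ι) (b : ι → H c'.Z →L[ℂ] H c.Z)
      (b' : ι → H c.Z →L[ℂ] H c'.Z), (∀ i, p (b i) (b' i)) → p (∑ i ∈ s, b i) (∑ i ∈ s, b' i) := by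
    intro ι s b b' h
    classical
    induction s using Finset.induction_on with
    | empty => simpa using hzero
    | insert i s hi ih => rw [Finset.sum_insert hi, Finset.sum_insert hi]; exact hadd _ _ _ _ (h i) ih
  -- A bounded kernel K corresponds to K R' here, with partner K* R. Expanding K over a Hilbert
  -- basis gives finite sums of rank-one kernels converging strongly, together with their partners.
  have h3 : ∀ K : H c'.Z →L[ℂ] H c.Z, p (K ∘L c'.R) (ContinuousLinearMap.adjoint K ∘L c.R) := by
    intro K
    obtain ⟨s, hs⟩ := exists_seq_tendsto (atTop : Filter (Finset (BasisIndex (H c'.Z))))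
    refine hlim (fun n => ∑ b ∈ s n, rankOne ℂ (K (hbasis _ b)) (c'.R (hbasis _ b)))
      (fun n => ∑ b ∈ s n, rankOne ℂ (hbasis _ b) (c.R (K (hbasis _ b)))) _ _
      (fun n => hsum _ _ _ fun b => h2 _ _) (fun u => ?_) fun u => ?_
    · refine (tendsto_comp_partialSum hs K (c'.R u)).congr fun n => ?_
      simp only [sum_apply, rankOne_apply]
      refine Finset.sum_congr rfl fun b _ => ?_
      rw [← ContinuousLinearMap.adjoint_inner_left, c'.adjoint_R]
    · refine (tendsto_comp_partialSum hs (ContinuousLinearMap.id ℂ _)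
        (ContinuousLinearMap.adjoint K (c.R u))).congr fun n => ?_
      simp only [sum_apply, rankOne_apply]
      refine Finset.sum_congr rfl fun b _ => ?_
      rw [ContinuousLinearMap.adjoint_inner_right, ← ContinuousLinearMap.adjoint_inner_left c.R,
        c.adjoint_R]
      rfl
  -- A general B need not factor through R'. It is approximated by D_n R B D'_n R', which does; its
  -- partner D'_n R' B' D_n R converges to B' as well. This is where the formal adjoint B' is
  -- needed.
  obtain ⟨D, hD1, hD2, hD3, hD4⟩ := c.reg
  obtain ⟨D', hD1', hD2', hD3', hD4'⟩ := c'.reg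
  have key : ∀ {E F : Type} [NormedAddCommGroup E] [InnerProductSpace ℂ E] [CompleteSpace E]
      [NormedAddCommGroup F] [InnerProductSpace ℂ F] (K : E →L[ℂ] F) (A : ℕ → E → E)
      (A' : ℕ → F → F) (u : E), (∀ u, Tendsto (fun n => A n u) atTop (𝓝 u)) →
      (∀ n u w, A' n (u - w) = A' n u - A' n w) → (∀ n u, ‖A' n u‖ ≤ ‖u‖) →
      (∀ u, Tendsto (fun n => A' n u) atTop (𝓝 u)) →
      Tendsto (fun n => A' n (K (A n u))) atTop (𝓝 (K u)) := by
    intro E F _ _ _ _ _ K A A' u h1 h2 h3 h4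
    have h5 : Tendsto (fun n => A' n (K (A n u)) - A' n (K u)) atTop (𝓝 0) := by
      have h6 := tendsto_iff_norm_sub_tendsto_zero.1 ((K.continuous.tendsto _).comp (h1 u))
      refine squeeze_zero_norm (fun n => ?_) h6
      rw [← h2]
      exact h3 _ _
    simpa using h5.add (h4 (K u))
  refine hlim (fun n => (D n ∘L c.R ∘L B ∘L D' n) ∘L c'.R) _ _ _ (fun n => h3 _) (fun u => ?_)
    fun u => ?_
  · exact key B (fun n u => D' n (c'.R u)) (fun n u => D n (c.R u)) u hD4'
      (fun n u w => by rw [map_sub, map_sub]) hD3 hD4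
  · have h4 : ∀ w, ContinuousLinearMap.adjoint B (c.R w) = c'.R (B' w) := by
      intro w
      refine ext_inner_right ℂ fun x => ?_
      rw [ContinuousLinearMap.adjoint_inner_left, hBB, ← ContinuousLinearMap.adjoint_inner_left,
        c'.adjoint_R]
    have h5 : ∀ n, (ContinuousLinearMap.adjoint (D n ∘L c.R ∘L B ∘L D' n) ∘L c.R) u =
        D' n (c'.R (B' (D n (c.R u)))) := by
      intro n
      simp only [ContinuousLinearMap.adjoint_comp, ContinuousLinearMap.comp_apply, hD1, hD1',
        c.adjoint_R]
      rw [h4]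
    simp_rw [h5]
    exact key B' (fun n u => D n (c.R u)) (fun n u => D' n (c'.R u)) u hD4
      (fun n u w => by rw [map_sub, map_sub]) hD3' hD4'

variable {X : G d}

/-- Writing the component as (R ⊗ 1)χ, the pairing becomes a real factor times ⟨χ, (R B ⊗ 1)χ⟩, and
the hypothesis says that R B is self-adjoint. -/
theorem inner_comp_nvec_self (h : totalWeight j X ≠ ⊤) {B : H c.Z →L[ℂ] H c.Z}
    (hB : ∀ u w, inner ℂ (c.R u) (B w) = inner ℂ (B u) (c.R w)) (k m : ℕ) :
    conj (inner ℂ (X.comp k m) ((c.nvec c h B).comp k m)) =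
      inner ℂ (X.comp k m) ((c.nvec c h B).comp k m) := by
  revert m
  refine forall_ge_or_lt (p := c.p) (fun m hm => ?_) fun n => ?_
  · rw [comp_nvec_lt _ _ _ _ _ hm]; simp
  · rw [comp_nvec, inner_smul_right, map_mul, Complex.conj_ofReal, inner_P_of_mem (X.comp_mem _ _),
      ← c.slot_chi h]
    congr 1
    have hT : ContinuousLinearMap.adjoint (c.R ∘L B) = c.R ∘L B := by
      refine ContinuousLinearMap.ext fun u => ext_inner_right ℂ fun w => ?_
      rw [ContinuousLinearMap.adjoint_inner_left, ContinuousLinearMap.comp_apply,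
        ContinuousLinearMap.comp_apply, ← ContinuousLinearMap.adjoint_inner_left c.R, c.adjoint_R,
        hB, ← ContinuousLinearMap.adjoint_inner_left c.R, c.adjoint_R]
    have h1 : inner ℂ (slot (c.split n) (c.split n) c.R (c.chi X k n))
        (slot (c.split n) (c.split n) B (c.chi X k n)) =
        inner ℂ (c.chi X k n) (slot (c.split n) (c.split n) (c.R ∘L B) (c.chi X k n)) := by
      rw [← slot_slot (S' := c.split n), inner_slot _ _ c.R, c.adjoint_R]
    rw [h1, inner_conj_symm, inner_slot, hT]

end Cell

end HFB
end

/-! ### The one-body and two-body parts of the Hamiltonian as kernels. -/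

noncomputable section

namespace HFB

variable {d j : ℕ}

/-! ### One-particle operators of order `j` -/

/-- `B = T M^{-j}` for an operator `T` that is bounded from `H^j` to `L²`, with formal adjoint. -/
theorem exists_kernel_of_bound {T T' : Test d →ₗ[ℂ] L2 d}
    (hadj : ∀ u w : Test d, inner ℂ u.l2 (T w) = inner ℂ (T' u) w.l2)
    (hb : ∃ C : ℝ, ∀ u : Test d, ‖T u‖ ≤ C * ‖(sobM d j u).l2‖) :
    ∃ B : L2 d →L[ℂ] L2 d, (∀ u, B (sobM d j u).l2 = T u) ∧
      ∀ u : Test d, ContinuousLinearMap.adjoint B u.l2 = resolv d j (T' u) := by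
  obtain ⟨C, hC⟩ := hb
  obtain ⟨B, hB, -⟩ := exists_extension (T ∘ₗ (besselM d (-j)).toLinearMap) C fun f => by
    have := hC (besselM d (-j) f)
    rwa [sobM_besselM_neg] at this
  refine ⟨B, fun u => ?_, fun u => ?_⟩
  · rw [hB]
    change T (besselM d (-j) (sobM d j u)) = _
    rw [besselM_neg_sobM]
  · refine ext_inner_test fun f => ?_
    rw [ContinuousLinearMap.adjoint_inner_right, hB, ← inner_conj_symm, ← inner_conj_symm f.l2]
    congr 1
    change inner ℂ u.l2 (T (besselM d (-j) f)) = _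
    rw [hadj, ← resolv_test, inner_resolv]

/-- For u = M^j f this is the formal adjoint relation; such u are dense, and all operators involved
are bounded. -/
theorem kernel_pair {T' : Test d →ₗ[ℂ] L2 d} {B B' : L2 d →L[ℂ] L2 d}
    (hB : ∀ u : Test d, ContinuousLinearMap.adjoint B u.l2 = resolv d j (T' u))
    (hB' : ∀ u, B' (sobM d j u).l2 = T' u) (u w : L2 d) :
    inner ℂ (resolv d j u) (B w) = inner ℂ (B' u) (resolv d j w) := by
  refine (Test.denseRange_l2 d).induction_on (p := fun u : L2 d =>
    inner ℂ (resolv d j u) (B w) = inner ℂ (B' u) (resolv d j w)) u ?_ ?_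
  · exact isClosed_eq (by fun_prop) (by fun_prop)
  · intro g
    obtain ⟨f, rfl⟩ : ∃ f, g = sobM d j f := ⟨_, (sobM_besselM_neg g).symm⟩
    rw [resolv_sobM, ← ContinuousLinearMap.adjoint_inner_left, hB, hB', inner_resolv]

theorem inner_laplacian (f g : Test d) :
    ∫ x, conj (f x) * (Δ g : Test d) x = ∫ x, conj ((Δ f : Test d) x) * g x :=
  SchwartzMap.integral_bilinear_laplacian_right_eq_left f g
    ((ContinuousLinearMap.mul ℝ ℂ).comp (Complex.conjCLE : ℂ →L[ℝ] ℂ))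

theorem memLp_mul_of_bound {U : Pt d → ℝ} (hU : Measurable U) {C : ℝ≥0}
    (h : ∀ f : Test d, eLpNorm (fun x => (U x : ℂ) * f x) 2 volume ≤ C * ‖(sobM d j f).l2‖ₑ)
    (f : Test d) : MemLp (fun x => (U x : ℂ) * f x) 2 volume :=
  ⟨(Complex.measurable_ofReal.comp hU).aestronglyMeasurable.mul f.continuous.aestronglyMeasurable,
    (h f).trans_lt (ENNReal.mul_lt_top ENNReal.coe_lt_top enorm_lt_top)⟩

/-- The one-particle Hamiltonian on test functions. -/
theorem exists_hamiltonian (hj : 2 ≤ j) {V : Pt d → ℝ} (hVm : Measurable V)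
    (hV : InfinitesimallyLaplaceBounded V) : ∃ T : Test d →ₗ[ℂ] L2 d,
      (∀ f, (T f : Pt d → ℂ) =ᵐ[volume] fun x => -(Δ f : Test d) x + (V x : ℂ) * f x) ∧
      (∀ u w : Test d, inner ℂ u.l2 (T w) = inner ℂ (T u) w.l2) ∧
      ∃ C : ℝ, ∀ u : Test d, ‖T u‖ ≤ C * ‖(sobM d j u).l2‖ := by
  obtain ⟨C, hC⟩ := hV.exists_bound hVm hj
  have hC0 : ∀ f : Test d, eLpNorm (fun x => (V x : ℂ) * f x) 2 volume ≤ C * ‖(sobM d j f).l2‖ₑ :=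
    fun f => by simpa using hC 0 f
  have hm := memLp_mul_of_bound hVm hC0
  let T : Test d →ₗ[ℂ] L2 d :=
    { toFun := fun f => -(Δ f : Test d).l2 + (hm f).toLp _
      map_add' := fun f g => by
        have h1 : (Δ (f + g) : Test d) = Δ f + Δ g := by
          simp only [← SchwartzMap.laplacianCLM_eq (𝕜 := ℂ)]; exact map_add _ f g
        have h2 : (hm (f + g)).toLp _ = (hm f).toLp _ + (hm g).toLp _ := by
          rw [← MemLp.toLp_add]
          congr 1
          funext x
          simp [mul_add]
        rw [h1, h2, Test.l2_add]
        abel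
      map_smul' := fun c f => by
        have h1 : (Δ (c • f) : Test d) = c • Δ f := by
          simp only [← SchwartzMap.laplacianCLM_eq (𝕜 := ℂ)]; exact map_smul _ c f
        have h2 : (hm (c • f)).toLp _ = c • (hm f).toLp _ := by
          rw [← MemLp.toLp_const_smul]
          congr 1
          funext x
          simp [mul_left_comm]
        rw [h1, h2, Test.l2_smul, RingHom.id_apply, smul_add, smul_neg] }
  have hT : ∀ f, (T f : Pt d → ℂ) =ᵐ[volume] fun x => -(Δ f : Test d) x + (V x : ℂ) * f x := by
    intro f
    filter_upwards [Lp.coeFn_add (-(Δ f : Test d).l2) ((hm f).toLp _),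
      Lp.coeFn_neg (Δ f : Test d).l2, (Δ f : Test d).coeFn_l2, (hm f).coeFn_toLp] with x h1 h2 h3 h4
    change (-(Δ f : Test d).l2 + (hm f).toLp _ : L2 d) x = _
    rw [h1, Pi.add_apply, h2, Pi.neg_apply, h3, h4]
  have hin : ∀ u w : Test d, inner ℂ u.l2 (T w) =
      -(∫ x, conj (u x) * (Δ w : Test d) x) + ∫ x, conj (u x) * ((V x : ℂ) * w x) := by
    intro u w
    change inner ℂ u.l2 (-(Δ w : Test d).l2 + (hm w).toLp _) = _
    rw [inner_add_right, inner_neg_right, Test.inner_l2]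
    congr 1
    exact inner_toLp (u.memLp 2 volume) (hm w)
  refine ⟨T, hT, fun u w => ?_, 1 + C, fun u => ?_⟩
  · rw [← inner_conj_symm (T u), hin, hin, map_add, map_neg, ← integral_conj, ← integral_conj,
      inner_laplacian]
    congr 2
    · congr 1
      funext x
      simp [mul_comm]
    · funext x
      simp [mul_comm, mul_left_comm]
  · refine (norm_add_le _ _).trans ?_
    rw [norm_neg, add_mul, one_mul]
    have b1 : ‖(Δ u : Test d).l2‖ ≤ ‖(sobM d j u).l2‖ :=
      (norm_laplacian_le u).trans (norm_besselM_mono (by exact_mod_cast hj) u)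
    refine add_le_add b1 ?_
    rw [Lp.norm_toLp]
    refine ENNReal.toReal_le_of_le_ofReal (by positivity) ?_
    rw [ENNReal.ofReal_mul (by positivity), ofReal_norm, ENNReal.ofReal_coe_nnreal]
    exact hC0 u

/-! ### Two-particle potentials -/

theorem ctL_splitProd (f : L2 d) (ξ : H (Pt d × Pt d)) :
    (splitProd (Pt d) (Pt d)).ctL f ξ = ContinuousLinearMap.adjoint (tmulL (Y := Pt d) f) ξ := by
  refine ext_inner_left ℂ fun g => ?_
  rw [Split.inner_ctL, ContinuousLinearMap.adjoint_inner_right, splitProd_ten, tmulL_apply]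

/-- Multiplication with `v(x - y)` after `R ⊗ 1` is bounded. -/
theorem lintegral_pair_potential_le {v : Pt d → ℝ} (hvm : Measurable v) {C : ℝ≥0}
    (h : ∀ (p : Pt d) (f : Test d),
      eLpNorm (fun x => (v (x - p) : ℂ) * f x) 2 volume ≤ C * ‖(sobM d j f).l2‖ₑ)
    (χ : H (Pt d × Pt d)) :
    ∫⁻ p : Pt d × Pt d, ‖(v (p.1 - p.2) : ℂ) * pairResolv d j χ p‖ₑ ^ 2 ≤
      ((C + 1 : ℝ≥0) : ℝ≥0∞) ^ 2 * ‖χ‖ₑ ^ 2 := by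
  have := (basis d j).countable
  set ξ := pairResolv d j χ with hξ
  obtain ⟨s, hs, hsum⟩ := tsum_enorm_sq_adjoint_tmulL (Y := Pt d)
    (fun a => (sobM d j ((basis d j).f a)).l2) ξ
  have h1 : ∑' a, ‖ContinuousLinearMap.adjoint
      (tmulL (Y := Pt d) (sobM d j ((basis d j).f a)).l2) ξ‖ₑ ^ 2 = ‖χ‖ₑ ^ 2 := by
    rw [← (splitProd (Pt d) (Pt d)).tsum_ctL_basis (basis d j).b χ]
    refine tsum_congr fun a => ?_
    -- Contracting (R ⊗ 1)χ with M^j f_a cancels R, so the weighted contractions of ξ are the plain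
    -- contractions of χ, whose squares sum to ‖χ‖².
    rw [← ctL_splitProd, hξ, pairResolv, ctL_slot, adjoint_resolv, resolv_sobM, (basis d j).hf]
  have hmeas : AEStronglyMeasurable (fun p : Pt d × Pt d => (v (p.1 - p.2) : ℂ) * ξ p) volume :=
    (Complex.measurable_ofReal.comp
      (hvm.comp (measurable_fst.sub measurable_snd))).aestronglyMeasurable.mul
      (Lp.aestronglyMeasurable ξ)
  rw [lintegral_volume_prod_symm (hmeas.enorm.pow_const 2), ← h1, hsum,
    ← lintegral_const_mul' _ _ (by simp)]
  refine lintegral_mono_ae ?_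
  filter_upwards [hs] with y hy
  have h2 : ∫⁻ x, ‖(v (x - y) : ℂ) * ξ (x, y)‖ₑ ^ 2 =
      eLpNorm (fun x => (v (x - y) : ℂ) * (s y : Pt d → ℂ) x) 2 volume ^ 2 := by
    rw [eLpNorm_two_sq]
    refine lintegral_congr_ae ?_
    filter_upwards [hy] with x hx
    rw [hx]
  change ∫⁻ x, ‖(v (x - y) : ℂ) * ξ (x, y)‖ₑ ^ 2 ≤ _
  rw [h2]
  -- If the Sobolev norm of a slice is infinite the bound is trivial, provided the constant is
  -- nonzero; hence C + 1 in place of C. The other slices use the relative bound, which is uniform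
  -- in the translation by y.
  rcases eq_or_ne ((basis d j).sobSq (s y)) ⊤ with htop | htop
  · change _ ≤ _ * (basis d j).sobSq (s y)
    rw [htop, ENNReal.mul_top (by simp)]
    exact le_top
  · refine (basis d j).eLpNorm_translate_mul_le hvm (fun p f => (h p f).trans ?_) y (s y)
      (lt_top_iff_ne_top.2 htop)
    gcongr
    exact le_self_add

theorem exists_pair_potential (hj : 2 ≤ j) {v : Pt d → ℝ} (hvm : Measurable v)
    (hv : InfinitesimallyLaplaceBounded v) : ∃ B : H (Pt d × Pt d) →L[ℂ] H (Pt d × Pt d),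
      ∀ χ, (B χ : Pt d × Pt d → ℂ) =ᵐ[volume]
        fun p => (v (p.1 - p.2) : ℂ) * pairResolv d j χ p := by
  obtain ⟨C, hC⟩ := hv.exists_bound hvm hj
  have hb := lintegral_pair_potential_le hvm hC
  have hm : ∀ χ : H (Pt d × Pt d),
      MemLp (fun p : Pt d × Pt d => (v (p.1 - p.2) : ℂ) * pairResolv d j χ p) 2 volume := fun χ =>
    memLp_two_of_lintegral ((Complex.measurable_ofReal.comp
      (hvm.comp (measurable_fst.sub measurable_snd))).aestronglyMeasurable.mul
      (Lp.aestronglyMeasurable _)) ((hb χ).trans_lt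
        (ENNReal.mul_lt_top (by simp) (by simp)))
  let B : H (Pt d × Pt d) →ₗ[ℂ] H (Pt d × Pt d) :=
    { toFun := fun χ => (hm χ).toLp _
      map_add' := fun χ χ' => by
        rw [← MemLp.toLp_add]
        refine MemLp.toLp_congr _ _ ?_
        filter_upwards [Lp.coeFn_add (pairResolv d j χ) (pairResolv d j χ')] with p hp
        rw [map_add, hp, Pi.add_apply, Pi.add_apply, mul_add]
      map_smul' := fun c χ => by
        rw [RingHom.id_apply, ← MemLp.toLp_const_smul]
        refine MemLp.toLp_congr _ _ ?_
        filter_upwards [Lp.coeFn_smul c (pairResolv d j χ)] with p hp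
        rw [map_smul, hp, Pi.smul_apply, Pi.smul_apply, smul_eq_mul, smul_eq_mul, mul_left_comm] }
  refine ⟨B.mkContinuous (C + 1 : ℝ≥0) fun χ => ?_, fun χ => (hm χ).coeFn_toLp⟩
  refine le_of_sq_le_sq ?_ (by positivity)
  rw [← ENNReal.ofReal_le_ofReal_iff (by positivity), Quasifree.ofReal_norm_sq, H.enorm_sq, mul_pow,
    ENNReal.ofReal_mul (by positivity), Quasifree.ofReal_norm_sq, ENNReal.ofReal_pow (by positivity),
    ENNReal.ofReal_coe_nnreal]
  refine le_trans (le_of_eq ?_) (hb χ)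
  refine lintegral_congr_ae ?_
  filter_upwards [(hm χ).coeFn_toLp] with p hp
  rw [← hp]; rfl

theorem pair_potential_symm {v : Pt d → ℝ} {B : H (Pt d × Pt d) →L[ℂ] H (Pt d × Pt d)}
    (hB : ∀ χ, (B χ : Pt d × Pt d → ℂ) =ᵐ[volume]
      fun p => (v (p.1 - p.2) : ℂ) * pairResolv d j χ p) (u w : H (Pt d × Pt d)) :
    inner ℂ (pairResolv d j u) (B w) = inner ℂ (B u) (pairResolv d j w) := by
  rw [H.inner_eq, H.inner_eq]
  refine integral_congr_ae ?_
  filter_upwards [hB u, hB w] with p h1 h2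
  rw [h1, h2, map_mul, Complex.conj_ofReal]
  ring

end HFB
end

/-! ### Symmetrization sums and the weak form of normal ordered operators. -/

noncomputable section

namespace HFB

variable {d j : ℕ}

/-! ### Sums over permutations -/

/-- The permutation of `0, …, n` that moves `i` to the front, and acts as `e` on the rest. -/
def consPerm {n : ℕ} (i : Fin (n + 1)) (e : Equiv.Perm (Fin n)) : Equiv.Perm (Fin (n + 1)) :=
  toFront i * Equiv.Perm.decomposeFin.symm (0, e)

@[simp] theorem consPerm_zero {n : ℕ} (i : Fin (n + 1)) (e : Equiv.Perm (Fin n)) :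
    consPerm i e 0 = i := by simp [consPerm]

@[simp] theorem consPerm_succ {n : ℕ} (i : Fin (n + 1)) (e : Equiv.Perm (Fin n)) (k : Fin n) :
    consPerm i e k.succ = i.succAbove (e k) := by simp [consPerm]

/-- A permutation is determined by the image of 0 and the induced permutation of the rest;
injectivity and a count show that every permutation arises once. -/
theorem sum_perm {M : Type*} [AddCommMonoid M] {n : ℕ} (f : Equiv.Perm (Fin (n + 1)) → M) :
    ∑ π, f π = ∑ i, ∑ e, f (consPerm i e) := by
  rw [← Fintype.sum_prod_type']
  refine (Function.Bijective.sum_comp ((Fintype.bijective_iff_injective_and_card _).2 ⟨?_, ?_⟩) f).symm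
  · rintro ⟨i, e⟩ ⟨i', e'⟩ h
    have h0 : i = i' := by simpa using DFunLike.congr_fun h 0
    subst h0
    refine Prod.ext rfl (Equiv.ext fun k => ?_)
    have := DFunLike.congr_fun h k.succ
    simpa using this
  · simp [Fintype.card_perm, Nat.factorial_succ]

theorem factorial_smul_P {n : ℕ} (Y : H (Fin n → Pt d)) :
    (n.factorial : ℂ) • P d n Y = ∑ π, U π Y := by
  rw [← map_smul]
  symm
  refine eq_P_of_inner (fun ρ => ?_) fun s hs => ?_
  · rw [map_sum]
    simp_rw [← U_mul]
    exact Fintype.sum_equiv (Equiv.mulLeft ρ) _ _ fun _ => rfl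
  · rw [inner_sum, inner_smul_right, ← nsmul_eq_mul]
    simp_rw [inner_U, hs _]
    simp [Fintype.card_perm]

/-- Permutations are grouped by the particle moved to the front. The n! permutations of the others
act trivially, since contracting Y in its first variable gives a symmetric vector although Y itself
need not be symmetric. -/
theorem inner_pten_P₁ {n : ℕ} {Y : H (Fin (n + 1) → Pt d)}
    (h : ∀ f : Test d, (split₁ d n).ctL f.l2 Y ∈ Sym d n) (F : Fin (n + 1) → Test d) :
    (n + 1 : ℂ) * inner ℂ (pten fun i => (F i).l2) (P d (n + 1) Y) =
      ∑ i, inner ℂ (pten fun k => (F (i.succAbove k)).l2) ((split₁ d n).ctL (F i).l2 Y) := by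
  have hn : (n.factorial : ℂ) ≠ 0 := by exact_mod_cast n.factorial_ne_zero
  have h1 := congrArg (inner ℂ (pten fun i => (F i).l2)) (factorial_smul_P Y)
  rw [inner_smul_right, inner_sum, sum_perm] at h1
  have h2 : ∀ i e, inner ℂ (pten fun i => (F i).l2) (U (consPerm i e) Y) =
      inner ℂ (pten fun k => (F (i.succAbove k)).l2) ((split₁ d n).ctL (F i).l2 Y) := by
    intro i e
    rw [inner_pten_U, pten_succ, ← Split.inner_ctL]
    simp only [consPerm_zero, consPerm_succ]
    rw [← inner_pten_U e fun k => (F (i.succAbove k)).l2, h (F i) e]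
  simp only [h2, Finset.sum_const, Finset.card_univ, Fintype.card_perm, Fintype.card_fin,
    nsmul_eq_mul, ← Finset.mul_sum] at h1
  rw [Nat.factorial_succ] at h1
  push_cast at h1
  apply mul_left_cancel₀ hn
  rw [← h1]
  ring

theorem pten_succ_succ {n : ℕ} (F : Fin (n + 2) → L2 d) :
    pten F = (split₂ d n).ten (tmul (F 0) (F 1)) (pten fun i => F i.succ.succ) := by
  rw [split₂_ten]; rfl

theorem inner_pten_P₂ {n : ℕ} {Y : H (Fin (n + 2) → Pt d)}
    (h : ∀ f g : Test d, (split₂ d n).ctL (tmul f.l2 g.l2) Y ∈ Sym d n)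
    (F : Fin (n + 2) → Test d) :
    ((n + 1) * (n + 2) : ℂ) * inner ℂ (pten fun i => (F i).l2) (P d (n + 2) Y) =
      ∑ i, ∑ k, inner ℂ (pten fun l => (F (i.succAbove (k.succAbove l))).l2)
        ((split₂ d n).ctL (tmul (F i).l2 (F (i.succAbove k)).l2) Y) := by
  have hn : (n.factorial : ℂ) ≠ 0 := by exact_mod_cast n.factorial_ne_zero
  have h1 := congrArg (inner ℂ (pten fun i => (F i).l2)) (factorial_smul_P Y)
  rw [inner_smul_right, inner_sum, sum_perm] at h1
  simp_rw [sum_perm] at h1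
  have h2 : ∀ i k e, inner ℂ (pten fun i => (F i).l2) (U (consPerm i (consPerm k e)) Y) =
      inner ℂ (pten fun l => (F (i.succAbove (k.succAbove l))).l2)
        ((split₂ d n).ctL (tmul (F i).l2 (F (i.succAbove k)).l2) Y) := by
    intro i k e
    rw [inner_pten_U, pten_succ_succ, ← Split.inner_ctL]
    rw [← Fin.succ_zero_eq_one]
    simp only [consPerm_zero, consPerm_succ]
    rw [← inner_pten_U e fun l => (F (i.succAbove (k.succAbove l))).l2, h]
  simp only [h2, Finset.sum_const, Finset.card_univ, Fintype.card_perm, Fintype.card_fin,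
    nsmul_eq_mul, ← Finset.mul_sum] at h1
  rw [Nat.factorial_succ, Nat.factorial_succ] at h1
  push_cast at h1
  apply mul_left_cancel₀ hn
  rw [← h1]
  ring

theorem ctL₂_mem_sym {n : ℕ} (f : H (Pt d × Pt d)) {s : H (Fin (n + 2) → Pt d)}
    (hs : s ∈ Sym d (n + 2)) : (split₂ d n).ctL f s ∈ Sym d n := fun π => by
  refine ext_inner_left ℂ fun g => ?_
  have h : (split₂ d n).ten f (U π⁻¹ g) =
      U (consPerm 0 (consPerm 0 π⁻¹)) ((split₂ d n).ten f g) := by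
    apply Lp.ext
    filter_upwards [(split₂ d n).ten_coe f (U π⁻¹ g),
      U_coe (consPerm 0 (consPerm 0 π⁻¹)) ((split₂ d n).ten f g),
      (quasiMeasurePreserving_perm (consPerm 0 (consPerm 0 π⁻¹))).ae
        ((split₂ d n).ten_coe f g),
      (split₂ d n).mp.quasiMeasurePreserving.ae (ae_prod_snd (U_coe π⁻¹ g))] with x h1 h2 h3 h4
    rw [h1, h2, h3, h4]
    have e1 : consPerm 0 (consPerm 0 π⁻¹) (1 : Fin (n + 2)) = 1 := consPerm_succ _ _ 0
    simp [e1]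
  rw [inner_U, Split.inner_ctL, Split.inner_ctL, h, ← inv_inv (consPerm _ _), ← inner_U, hs]

theorem inner_U_sym {n : ℕ} (π : Equiv.Perm (Fin n)) (g : H (Fin n → Pt d)) {s : H (Fin n → Pt d)}
    (hs : s ∈ Sym d n) : inner ℂ (U π g) s = inner ℂ g s := by
  rw [← inv_inv π, ← inner_U, hs]

theorem prod_erase_eq {M : Type*} [CommMonoid M] {n : ℕ} (i : Fin (n + 1)) (f : Fin (n + 1) → M) :
    ∏ k ∈ Finset.univ.erase i, f k = ∏ k, f (i.succAbove k) := by
  rw [← Finset.compl_singleton, ← Fin.image_succAbove_univ,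
    Finset.prod_image fun _ _ _ _ h => Fin.succAbove_right_injective h]

theorem sum_erase_eq {M : Type*} [AddCommMonoid M] {n : ℕ} (i : Fin (n + 1)) (f : Fin (n + 1) → M) :
    ∑ k ∈ Finset.univ.erase i, f k = ∑ k, f (i.succAbove k) := by
  rw [← Finset.compl_singleton, ← Fin.image_succAbove_univ,
    Finset.sum_image fun _ _ _ _ h => Fin.succAbove_right_injective h]

theorem U_toFront_ten_coe {n : ℕ} (i : Fin (n + 1)) (u : L2 d) {u' : Pt d → ℂ}
    (hu : u =ᵐ[volume] u') (F : Fin (n + 1) → Test d) :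
    U (toFront i) ((split₁ d n).ten u (pten fun k => (F (i.succAbove k)).l2)) =ᵐ[volume]
      fun x => u' (x i) * ∏ k ∈ Finset.univ.erase i, F k (x k) := by
  filter_upwards [U_coe (toFront i) ((split₁ d n).ten u (pten fun k => (F (i.succAbove k)).l2)),
    (quasiMeasurePreserving_perm (toFront i)).ae ((split₁ d n).ten_coe u _),
    (quasiMeasurePreserving_perm (toFront i)).ae
      ((split₁ d n).mp.quasiMeasurePreserving.ae (ae_prod_fst hu)),
    (quasiMeasurePreserving_perm (toFront i)).ae ((split₁ d n).mp.quasiMeasurePreserving.ae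
      (ae_prod_snd (pten_test_coe fun k => F (i.succAbove k))))] with x h1 h2 h3 h4
  rw [h1, h2, h3, h4, prod_erase_eq]
  simp [tensT, tens]

theorem U_consPerm_ten_coe {n : ℕ} (i : Fin (n + 2)) (k : Fin (n + 1)) (u : H (Pt d × Pt d))
    {u' : Pt d × Pt d → ℂ} (hu : u =ᵐ[volume] u') (F : Fin (n + 2) → Test d) :
    U (consPerm i (toFront k))
      ((split₂ d n).ten u (pten fun l => (F (i.succAbove (k.succAbove l))).l2)) =ᵐ[volume]
      fun x => u' (x i, x (i.succAbove k)) *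
        ∏ l, F (i.succAbove (k.succAbove l)) (x (i.succAbove (k.succAbove l))) := by
  set π := consPerm i (toFront k)
  filter_upwards [U_coe π ((split₂ d n).ten u
      (pten fun l => (F (i.succAbove (k.succAbove l))).l2)),
    (quasiMeasurePreserving_perm π).ae ((split₂ d n).ten_coe u _),
    (quasiMeasurePreserving_perm π).ae
      ((split₂ d n).mp.quasiMeasurePreserving.ae (ae_prod_fst hu)),
    (quasiMeasurePreserving_perm π).ae ((split₂ d n).mp.quasiMeasurePreserving.ae
      (ae_prod_snd (pten_test_coe fun l => F (i.succAbove (k.succAbove l)))))] with x h1 h2 h3 h4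
  rw [h1, h2, h3, h4]
  have e1 : π 1 = i.succAbove k :=
    (consPerm_succ i (toFront k) 0).trans (by rw [toFront_zero])
  have e2 : ∀ l : Fin n, π l.succ.succ = i.succAbove (k.succAbove l) := fun l => by simp [π]
  simp only [split₂_e, tensT, tens, e1, e2]
  simp [π]

/-! ### Weak formulas for normal ordered operators -/

variable {X : G d}

theorem exists_chi₁ (h : totalWeight j X ≠ ⊤) (k n : ℕ) : ∃ χ : H (Fin (n + 1) → Pt d),
    slot (split₁ d n) (split₁ d n) (resolv d j) χ = X.comp k (n + 1) ∧
    ‖χ‖ₑ ^ 2 ≤ sobWeight j X k (n + 1) ∧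
    ∀ B : L2 d →L[ℂ] L2 d, ((cell₁ d j).nvec (cell₁ d j) h B).comp k (n + 1) =
      (n + 1 : ℂ) • P d (n + 1) (slot (split₁ d n) (split₁ d n) B χ) := by
  refine ⟨(cell₁ d j).chi X k n, (cell₁ d j).slot_chi h k n, (cell₁ d j).enorm_chi_sq_le X k n,
    fun B => ((cell₁ d j).comp_nvec (cell₁ d j) h B k n).trans ?_⟩
  have hw : ((weight 1 n * weight 1 n : ℝ) : ℂ) = n + 1 := by
    rw [weight_one, Real.mul_self_sqrt (by positivity)]; push_cast; rfl
  rw [← hw]; rfl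

theorem exists_chi₂ (h : totalWeight j X ≠ ⊤) (k n : ℕ) : ∃ χ : H (Fin (n + 2) → Pt d),
    slot (split₂ d n) (split₂ d n) (pairResolv d j) χ = X.comp k (n + 2) ∧
    ‖χ‖ₑ ^ 2 ≤ sobWeight j X k (n + 2) ∧
    ∀ B : H (Pt d × Pt d) →L[ℂ] H (Pt d × Pt d),
      ((cell₂ d j).nvec (cell₂ d j) h B).comp k (n + 2) =
      ((n + 1) * (n + 2) : ℂ) • P d (n + 2) (slot (split₂ d n) (split₂ d n) B χ) := by
  refine ⟨(cell₂ d j).chi X k n, (cell₂ d j).slot_chi h k n, (cell₂ d j).enorm_chi_sq_le X k n,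
    fun B => ((cell₂ d j).comp_nvec (cell₂ d j) h B k n).trans ?_⟩
  have hw : ((weight 2 n * weight 2 n : ℝ) : ℂ) = (n + 1) * (n + 2) := by
    rw [weight, Real.mul_self_sqrt (by positivity)]; simp [Nat.ascFactorial]; ring
  rw [← hw]; rfl

/-- Contracting (B ⊗ 1)χ with f means contracting χ with B*f = R T'f, and R moves back to χ to
recover the state. So the kernel acts on the state through the formal adjoint T' on test functions.
-/
theorem inner_nvec₁ (h : totalWeight j X ≠ ⊤) {B : L2 d →L[ℂ] L2 d} {T' : Test d → L2 d}
    (hB : ∀ u : Test d, ContinuousLinearMap.adjoint B u.l2 = resolv d j (T' u)) (k n : ℕ)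
    (F : Fin (n + 1) → Test d) :
    inner ℂ (pten fun i => (F i).l2) (((cell₁ d j).nvec (cell₁ d j) h B).comp k (n + 1)) =
      inner ℂ (∑ i, U (toFront i)
        ((split₁ d n).ten (T' (F i)) (pten fun k => (F (i.succAbove k)).l2))) (X.comp k (n + 1)) := by
  obtain ⟨χ, h2, -, h1⟩ := exists_chi₁ h k n
  have hct : ∀ f : Test d, (split₁ d n).ctL f.l2 (slot (split₁ d n) (split₁ d n) B χ) = (split₁ d n).ctL (T' f) (X.comp k (n + 1)) := by
    intro f
    rw [ctL_slot, hB, ← h2]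
    rw [ctL_slot, adjoint_resolv]
  rw [h1, inner_smul_right, inner_pten_P₁ (fun f => by
    rw [hct]; exact ctL_mem_sym _ (X.comp_mem _ _)), sum_inner]
  refine Finset.sum_congr rfl fun i _ => ?_
  rw [hct, Split.inner_ctL, inner_U_sym _ _ (X.comp_mem _ _)]

theorem inner_nvec₂ (h : totalWeight j X ≠ ⊤) {B : H (Pt d × Pt d) →L[ℂ] H (Pt d × Pt d)}
    {T' : Test d → Test d → H (Pt d × Pt d)}
    (hB : ∀ u w : Test d, ContinuousLinearMap.adjoint B (tmul u.l2 w.l2) = pairResolv d j (T' u w))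
    (k n : ℕ) (F : Fin (n + 2) → Test d) :
    inner ℂ (pten fun i => (F i).l2) (((cell₂ d j).nvec (cell₂ d j) h B).comp k (n + 2)) =
      inner ℂ (∑ i, ∑ l, U (consPerm i (toFront l)) ((split₂ d n).ten (T' (F i) (F (i.succAbove l)))
        (pten fun m => (F (i.succAbove (l.succAbove m))).l2))) (X.comp k (n + 2)) := by
  obtain ⟨χ, h2, -, h1⟩ := exists_chi₂ h k n
  have hct : ∀ f g : Test d, (split₂ d n).ctL (tmul f.l2 g.l2) (slot (split₂ d n) (split₂ d n) B χ) = (split₂ d n).ctL (T' f g) (X.comp k (n + 2)) := by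
    intro f g
    rw [ctL_slot, hB, ← h2]
    rw [ctL_slot, adjoint_pairResolv]
  rw [h1, inner_smul_right, inner_pten_P₂ (fun f g => by
    rw [hct]; exact ctL₂_mem_sym _ (X.comp_mem _ _)), sum_inner]
  refine Finset.sum_congr rfl fun i _ => ?_
  rw [sum_inner]
  refine Finset.sum_congr rfl fun l _ => ?_
  rw [hct, Split.inner_ctL, inner_U_sym _ _ (X.comp_mem _ _)]

end HFB
end

/-! ### The Hamiltonian, the number operator and quadratic observables applied to a state. -/

noncomputable section

namespace HFB

variable {d j : ℕ} {X : G d}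

theorem H.coeFn_sum_congr {Y ι : Type} [MeasureSpace Y] [Fintype ι] {f : ι → H Y} {g : ι → Y → ℂ}
    (h : ∀ i, f i =ᵐ[volume] g i) : (∑ i, f i : H Y) =ᵐ[volume] fun y => ∑ i, g i y := by
  filter_upwards [Lp.coeFn_finsetSum Finset.univ f, ae_all_iff.2 h] with y h1 h2
  rw [h1, Finset.sum_apply]
  exact Finset.sum_congr rfl fun i _ => h2 i

/-! ### The Hamiltonian applied to a state -/

/-- The many-body Hamiltonian applied to a state, in terms of its one- and two-particle kernels. -/
def hamVec (h : totalWeight j X ≠ ⊤) (B : L2 d →L[ℂ] L2 d)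
    (B₂ : H (Pt d × Pt d) →L[ℂ] H (Pt d × Pt d)) : G d :=
  (cell₁ d j).nvec (cell₁ d j) h B + (1 / 2 : ℂ) • (cell₂ d j).nvec (cell₂ d j) h B₂

theorem hamOp_unique {V v : Pt d → ℝ} {ξ η η' : Fock d} (h : hamOp V v ξ η) (h' : hamOp V v ξ η') :
    η = η' := by
  apply Subtype.ext
  apply lp.ext
  funext n
  refine ext_pten fun F => ?_
  rw [← pair_tensT, ← pair_tensT, h n F, h' n F]

/-- Inserting f = R M^j f brings the test function into the range of R, where symmetry of the
potential applies. -/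
theorem adjoint_pair_potential {v : Pt d → ℝ} {B : H (Pt d × Pt d) →L[ℂ] H (Pt d × Pt d)}
    (hB : ∀ χ, (B χ : Pt d × Pt d → ℂ) =ᵐ[volume]
      fun p => (v (p.1 - p.2) : ℂ) * pairResolv d j χ p) (f g : Test d) :
    ContinuousLinearMap.adjoint B (tmul f.l2 g.l2) =
      pairResolv d j (B (tmul (sobM d j f).l2 g.l2)) := by
  refine ext_inner_right ℂ fun w => ?_
  have h1 : tmul f.l2 g.l2 = pairResolv d j (tmul (sobM d j f).l2 g.l2) := by
    rw [pairResolv_tmul, resolv_sobM]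
  rw [ContinuousLinearMap.adjoint_inner_left, h1, pair_potential_symm hB,
    ← ContinuousLinearMap.adjoint_inner_left, adjoint_pairResolv]

theorem pair_potential_test_coe {v : Pt d → ℝ} {B : H (Pt d × Pt d) →L[ℂ] H (Pt d × Pt d)}
    (hB : ∀ χ, (B χ : Pt d × Pt d → ℂ) =ᵐ[volume]
      fun p => (v (p.1 - p.2) : ℂ) * pairResolv d j χ p) (f g : Test d) :
    B (tmul (sobM d j f).l2 g.l2) =ᵐ[volume]
      fun p => (v (p.1 - p.2) : ℂ) * (f p.1 * g p.2) := by
  filter_upwards [hB (tmul (sobM d j f).l2 g.l2), tmul_coe f.l2 g.l2, ae_prod_fst f.coeFn_l2,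
    ae_prod_snd g.coeFn_l2] with p h1 h2 h3 h4
  rw [h1, pairResolv_tmul, resolv_sobM, h2, h3, h4]

theorem comp_nvec₁_zero (h : totalWeight j X ≠ ⊤) (B : L2 d →L[ℂ] L2 d) (k : ℕ) :
    ((cell₁ d j).nvec (cell₁ d j) h B).comp k 0 = 0 :=
  (cell₁ d j).comp_nvec_lt (cell₁ d j) h B k Nat.zero_lt_one

theorem comp_nvec₂_lt (h : totalWeight j X ≠ ⊤) (B : H (Pt d × Pt d) →L[ℂ] H (Pt d × Pt d))
    (k : ℕ) {m : ℕ} (hm : m < 2) : ((cell₂ d j).nvec (cell₂ d j) h B).comp k m = 0 :=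
  (cell₂ d j).comp_nvec_lt (cell₂ d j) h B k hm

/-- This verifies that the state lies in the weak domain of the Hamiltonian. The one-body and
two-body weak formulas reproduce the Hamiltonian on products of test functions, with no one-body
term for zero particles and no pair term below two. -/
theorem hamOp_hamVec {V v : Pt d → ℝ} {T : Test d →ₗ[ℂ] L2 d} {B : L2 d →L[ℂ] L2 d}
    {B₂ : H (Pt d × Pt d) →L[ℂ] H (Pt d × Pt d)}
    (hT : ∀ f, (T f : Pt d → ℂ) =ᵐ[volume] fun x => -(Δ f : Test d) x + (V x : ℂ) * f x)
    (hB : ∀ u : Test d, ContinuousLinearMap.adjoint B u.l2 = resolv d j (T u))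
    (hB₂ : ∀ χ, (B₂ χ : Pt d × Pt d → ℂ) =ᵐ[volume]
      fun p => (v (p.1 - p.2) : ℂ) * pairResolv d j χ p) (h : totalWeight j X ≠ ⊤) (k : ℕ) :
    hamOp V v (X k) (hamVec h B B₂ k) := by
  intro n F
  rw [pair_tensT]
  change inner ℂ _ ((hamVec h B B₂).comp k n) = _
  rw [hamVec, G.comp_add, G.comp_smul, inner_add_right, inner_smul_right]
  rcases n with _ | _ | n
  · rw [comp_nvec₁_zero, comp_nvec₂_lt _ _ _ Nat.zero_lt_two, inner_zero_right]
    simp [pair, hamTest]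
  · rw [comp_nvec₂_lt _ _ _ Nat.one_lt_two, inner_zero_right, mul_zero, add_zero, inner_nvec₁ h hB]
    symm
    refine pair_eq_inner ?_ _
    filter_upwards [H.coeFn_sum_congr fun i => U_toFront_ten_coe i (T (F i)) (hT (F i)) F] with x h1
    rw [h1, hamTest]
    simp
  · have e2 := inner_nvec₂ h (adjoint_pair_potential hB₂) k n F
    rw [inner_nvec₁ h hB, e2]
    have e3 : (1 / 2 : ℂ) = conj (1 / 2 : ℂ) := by
      rw [map_div₀, map_one, Complex.conj_ofNat]
    rw [e3, ← inner_smul_left, ← inner_add_left]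
    symm
    refine pair_eq_inner ?_ _
    refine (Lp.coeFn_add _ _).trans ?_
    filter_upwards [H.coeFn_sum_congr fun i => U_toFront_ten_coe i (T (F i)) (hT (F i)) F,
      Lp.coeFn_smul (1 / 2 : ℂ) (∑ i, ∑ l, U (consPerm i (toFront l))
        ((split₂ d n).ten (B₂ (tmul (sobM d j (F i)).l2 (F (i.succAbove l)).l2))
        (pten fun m => (F (i.succAbove (l.succAbove m))).l2))),
      H.coeFn_sum_congr fun i => H.coeFn_sum_congr fun l => U_consPerm_ten_coe i l _
        (pair_potential_test_coe hB₂ (F i) (F (i.succAbove l))) F] with x h1 h2 h3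
    rw [Pi.add_apply, h1, h2, Pi.smul_apply, h3, hamTest, smul_eq_mul, mul_assoc (1 / 2 : ℂ),
      Finset.sum_mul]
    congr 2
    refine Finset.sum_congr rfl fun i _ => ?_
    rw [sum_erase_eq, Finset.sum_mul]
    refine Finset.sum_congr rfl fun l _ => ?_
    rw [tensT, tens, Fin.prod_univ_succAbove _ i, Fin.prod_univ_succAbove _ l]
    ring

/-! ### Observables applied to a state -/

theorem weight_mul_weight_zero (p n : ℕ) : ((weight p n * weight 0 n : ℝ) : ℂ) = weight p n := by
  rw [weight_zero, mul_one]

theorem comp_nvec_ann (c : Cell d j) (h : totalWeight j X ≠ ⊤) (b : H c.Z) (k n : ℕ) :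
    ((cell₀ d j).nvec c h (InnerProductSpace.rankOne ℂ unitVec (c.R b))).comp k n =
      (weight c.p n : ℂ) • P d n ((c.split n).ctL b (X.comp k (n + c.p))) := by
  refine ((cell₀ d j).comp_nvec c h _ k n).trans ?_
  rw [mul_comm]
  change ((weight c.p n * weight 0 n : ℝ) : ℂ) • P d n (slot (c.split n) (split₀ d n)
    (InnerProductSpace.rankOne ℂ unitVec (c.R b)) (c.chi X k n)) = _
  rw [weight_mul_weight_zero, Cell.slot_rankOne, ten_unitVec, ← c.slot_chi h, ctL_slot, c.adjoint_R]

theorem comp_nvec_cre (c : Cell d j) (h : totalWeight j X ≠ ⊤) (b : H c.Z) (k n : ℕ) :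
    (c.nvec (cell₀ d j) h (InnerProductSpace.rankOne ℂ b unitVec)).comp k (n + c.p) =
      (weight c.p n : ℂ) • P d (n + c.p) ((c.split n).ten b (X.comp k n)) := by
  refine (c.comp_nvec (cell₀ d j) h _ k n).trans ?_
  obtain ⟨χ, hχ, h1⟩ : ∃ χ : H (Fin n → Pt d), χ = (cell₀ d j).chi X k n ∧ χ = X.comp k n :=
    ⟨_, rfl, (slot_id _ _).symm.trans ((cell₀ d j).slot_chi h k n)⟩
  change ((weight c.p n * weight 0 n : ℝ) : ℂ) • P d (n + c.p) (slot (split₀ d n) (c.split n)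
    (InnerProductSpace.rankOne ℂ b unitVec) ((cell₀ d j).chi X k n)) = _
  have h2 : (split₀ d n).ctL unitVec χ = χ := ext_inner_left ℂ fun g => by
    rw [Split.inner_ctL, ten_unitVec]
  have h3 : slot (split₀ d n) (c.split n) (InnerProductSpace.rankOne ℂ b unitVec)
      ((cell₀ d j).chi X k n) = (c.split n).ten b (X.comp k n) := by
    rw [← h1]
    refine Eq.trans ?_ (congrArg _ h2)
    rw [← Cell.slot_rankOne, hχ]
  rw [weight_mul_weight_zero, h3]

theorem weight_two' (n : ℕ) : weight 2 n = √((n + 1) * (n + 2)) := by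
  rw [weight]; congr 1; simp [Nat.ascFactorial]; ring

/-- An observable that is at most quadratic in the fields, applied to a state. -/
def QuadObs.vec (A : QuadObs d j) (B : L2 d →L[ℂ] L2 d) (h : totalWeight j X ≠ ⊤) : G d :=
  A.c • X + (cell₀ d j).nvec (cell₁ d j) h (InnerProductSpace.rankOne ℂ unitVec (resolv d j A.f)) +
    (cell₁ d j).nvec (cell₀ d j) h (InnerProductSpace.rankOne ℂ A.g unitVec) +
    (cell₁ d j).nvec (cell₁ d j) h B +
    (cell₀ d j).nvec (cell₂ d j) h (InnerProductSpace.rankOne ℂ unitVec (pairResolv d j A.b)) +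
    (cell₂ d j).nvec (cell₀ d j) h (InnerProductSpace.rankOne ℂ A.b' unitVec)

theorem inner_nvec_annTerm (h : totalWeight j X ≠ ⊤) (f : L2 d) (k n : ℕ) (F : Fin n → Test d) :
    inner ℂ (pten fun i => (F i).l2) (((cell₀ d j).nvec (cell₁ d j) h
      (InnerProductSpace.rankOne ℂ unitVec (resolv d j f))).comp k n) = annTerm f (X k) n F := by
  rw [annTerm_eq (Filter.EventuallyEq.refl _ _)]
  have h1 := comp_nvec_ann (cell₁ d j) h f k n
  change _ = (weight 1 n : ℂ) • P d n ((split₁ d n).ctL f (X.comp k (n + 1))) at h1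
  rw [P_of_mem (ctL_mem_sym _ (X.comp_mem _ _)), weight_one] at h1
  exact (congrArg _ h1).trans (inner_smul_right _ _ _)

theorem inner_nvec_pairAnnTerm (h : totalWeight j X ≠ ⊤) (b : H (Pt d × Pt d)) (k n : ℕ)
    (F : Fin n → Test d) : inner ℂ (pten fun i => (F i).l2) (((cell₀ d j).nvec (cell₂ d j) h
      (InnerProductSpace.rankOne ℂ unitVec (pairResolv d j b))).comp k n) =
      pairAnnTerm b (X k) n F := by
  have h1 := comp_nvec_ann (cell₂ d j) h b k n
  change _ = (weight 2 n : ℂ) • P d n ((split₂ d n).ctL b (X.comp k (n + 2))) at h1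
  rw [P_of_mem (ctL₂_mem_sym _ (X.comp_mem _ _)), weight_two'] at h1
  refine (congrArg _ h1).trans ((inner_smul_right _ _ _).trans ?_)
  rw [pairAnnTerm, Split.inner_ctL]
  congr 1
  symm
  refine pair_eq_inner ?_ _
  filter_upwards [(split₂ d n).ten_coe b (pten fun i => (F i).l2),
    (split₂ d n).mp.quasiMeasurePreserving.ae (ae_prod_snd (pten_test_coe F))] with x h2 h3
  rw [h2, h3]
  simp [tensT, tens]

theorem inv_sqrt_mul {a : ℝ} (ha : 0 < a) : (√a : ℂ)⁻¹ * a = √a := by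
  have h : (√a : ℂ) ≠ 0 := by exact_mod_cast (Real.sqrt_pos.2 ha).ne'
  have h2 : (a : ℂ) = √a * √a := by rw [← Complex.ofReal_mul, Real.mul_self_sqrt ha.le]
  rw [h2, ← mul_assoc, inv_mul_cancel₀ h, one_mul]

theorem inner_nvec_creTerm (h : totalWeight j X ≠ ⊤) (f : L2 d) (k n : ℕ) (F : Fin n → Test d) :
    inner ℂ (pten fun i => (F i).l2) (((cell₁ d j).nvec (cell₀ d j) h
      (InnerProductSpace.rankOne ℂ f unitVec)).comp k n) = creTerm f (X k) n F := by
  rcases n with _ | n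
  · rw [creTerm]
    exact (congrArg _ ((cell₁ d j).comp_nvec_lt (cell₀ d j) h _ k Nat.zero_lt_one)).trans
      (inner_zero_right _)
  · have h1 := comp_nvec_cre (cell₁ d j) h f k n
    change _ = (weight 1 n : ℂ) • P d (n + 1) ((split₁ d n).ten f (X.comp k n)) at h1
    refine (congrArg _ h1).trans ((inner_smul_right _ _ _).trans ?_)
    have h2 := inner_pten_P₁ (Y := (split₁ d n).ten f (X.comp k n)) (fun g => by
      rw [Split.ctL_ten]; exact (Sym d n).smul_mem _ (X.comp_mem _ _)) F
    rw [weight_one, ← inv_sqrt_mul (by positivity), mul_assoc, creTerm]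
    push_cast
    rw [h2]
    congr 1
    refine Finset.sum_congr rfl fun i _ => ?_
    rw [Split.ctL_ten, inner_smul_right]
    congr 1
    · rw [H.inner_eq]
      refine integral_congr_ae ?_
      filter_upwards [(F i).coeFn_l2] with x hx
      rw [hx]
    · exact (pair_tensT _ _).symm

theorem inner_nvec_pairCreTerm (h : totalWeight j X ≠ ⊤) (b : H (Pt d × Pt d)) (k n : ℕ)
    (F : Fin n → Test d) : inner ℂ (pten fun i => (F i).l2) (((cell₂ d j).nvec (cell₀ d j) h
      (InnerProductSpace.rankOne ℂ b unitVec)).comp k n) = pairCreTerm b (X k) n F := by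
  rcases n with _ | _ | n
  · rw [pairCreTerm]
    exact (congrArg _ ((cell₂ d j).comp_nvec_lt (cell₀ d j) h _ k Nat.zero_lt_two)).trans
      (inner_zero_right _)
  · rw [pairCreTerm]
    exact (congrArg _ ((cell₂ d j).comp_nvec_lt (cell₀ d j) h _ k Nat.one_lt_two)).trans
      (inner_zero_right _)
  · have h1 := comp_nvec_cre (cell₂ d j) h b k n
    change _ = (weight 2 n : ℂ) • P d (n + 2) ((split₂ d n).ten b (X.comp k n)) at h1
    refine (congrArg _ h1).trans ((inner_smul_right _ _ _).trans ?_)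
    have h2 := inner_pten_P₂ (Y := (split₂ d n).ten b (X.comp k n)) (fun g g' => by
      rw [Split.ctL_ten]; exact (Sym d n).smul_mem _ (X.comp_mem _ _)) F
    rw [weight_two', ← inv_sqrt_mul (by positivity), mul_assoc, pairCreTerm]
    push_cast
    rw [h2]
    congr 1
    refine Finset.sum_congr rfl fun i _ => Finset.sum_congr rfl fun l _ => ?_
    rw [Split.ctL_ten, inner_smul_right]
    congr 1
    · rw [H.inner_eq]
      refine integral_congr_ae ?_
      filter_upwards [tmul_coe (F i).l2 (F (i.succAbove l)).l2, ae_prod_fst (F i).coeFn_l2,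
        ae_prod_snd (F (i.succAbove l)).coeFn_l2] with x hx h3 h4
      rw [hx, h3, h4]
    · exact (pair_tensT _ _).symm

theorem inner_nvec_oneBodyTerm (h : totalWeight j X ≠ ⊤) {B : L2 d →L[ℂ] L2 d}
    {T' : Test d →ₗ[ℂ] L2 d}
    (hB : ∀ u : Test d, ContinuousLinearMap.adjoint B u.l2 = resolv d j (T' u)) (k n : ℕ)
    (F : Fin n → Test d) : inner ℂ (pten fun i => (F i).l2)
      (((cell₁ d j).nvec (cell₁ d j) h B).comp k n) = oneBodyTerm T' (X k) n F := by
  rcases n with _ | n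
  · rw [oneBodyTerm, Finset.univ_eq_empty, Finset.sum_empty]
    exact (congrArg _ (comp_nvec₁_zero h B k)).trans
      (inner_zero_right _)
  · rw [inner_nvec₁ h hB, sum_inner, oneBodyTerm]
    refine Finset.sum_congr rfl fun i _ => ?_
    exact (pair_eq_inner (U_toFront_ten_coe i (T' (F i)) (EventuallyEq.refl _ _) F) _).symm

/-- The six terms of the observable are matched with the weak formulas one by one; in particular the
state is in the domain of every such observable. -/
theorem QuadObs.op_vec (A : QuadObs d j) {B : L2 d →L[ℂ] L2 d}
    (hB : ∀ u : Test d, ContinuousLinearMap.adjoint B u.l2 = resolv d j (A.Tadj u))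
    (h : totalWeight j X ≠ ⊤) (k : ℕ) : A.op (X k) (A.vec B h k) := by
  intro n F
  rw [pair_tensT, pair_tensT]
  change inner ℂ _ ((A.vec B h).comp k n) = _
  rw [QuadObs.vec]
  simp only [G.comp_add, G.comp_smul, inner_add_right, inner_smul_right]
  rw [inner_nvec_annTerm, inner_nvec_creTerm, inner_nvec_oneBodyTerm h hB, inner_nvec_pairAnnTerm,
    inner_nvec_pairCreTerm]
  rfl

/-- For the kernel R the factor R^{-1} is cancelled, leaving the identity on one particle, whose
second quantization counts particles. -/
theorem comp_nvec_resolv (h : totalWeight j X ≠ ⊤) (k : ℕ) : ∀ n,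
    ((cell₁ d j).nvec (cell₁ d j) h (resolv d j)).comp k n = (n : ℂ) • X.comp k n
  | 0 => by
    rw [Nat.cast_zero, zero_smul]
    exact comp_nvec₁_zero h _ k
  | n + 1 => by
    obtain ⟨χ, h1, -, h2⟩ := exists_chi₁ h k n
    rw [h2, h1, P_of_mem (X.comp_mem _ _)]
    push_cast; rfl

theorem numberOp_nvec (h : totalWeight j X ≠ ⊤) (k : ℕ) :
    numberOp d (X k) ((cell₁ d j).nvec (cell₁ d j) h (resolv d j) k) :=
  fun n => comp_nvec_resolv h k n

end HFB
end

/-! ### Projection onto quadratic polynomials and the evolution law. -/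

noncomputable section

namespace HFB

variable {d j : ℕ}

/-! ### Projection onto quadratic polynomials and Wick's theorem -/

namespace Quasifree

variable {ω : State d} (Q : Quasifree ω)

/-- The closed span of the vectors obtained from monomials of degree at most two. -/
def low : Submodule ℂ (G d) :=
  (Submodule.span ℂ {x | ∃ w : List (FieldOp d), w.length ≤ 2 ∧ x = Q.W w}).topologicalClosure

theorem isClosed_low : IsClosed (Q.low : Set (G d)) := Submodule.isClosed_topologicalClosure _

instance completeSpace_low : CompleteSpace Q.low := Q.isClosed_low.completeSpace_coe

theorem W_mem_low {w : List (FieldOp d)} (h : w.length ≤ 2) : Q.W w ∈ Q.low :=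
  Submodule.le_topologicalClosure _ (Submodule.subset_span ⟨w, h, rfl⟩)

/-- The orthogonal projection onto `Q.low`. -/
def Pl : G d →L[ℂ] G d := Q.low.starProjection

theorem Pl_of_mem {x : G d} (h : x ∈ Q.low) : Q.Pl x = x := Submodule.starProjection_eq_self_iff.2 h

theorem inner_Pl (x y : G d) : inner ℂ x (Q.Pl y) = inner ℂ (Q.Pl x) y :=
  (Q.low.inner_starProjection_left_eq_right x y).symm

theorem norm_Pl_le (x : G d) : ‖Q.Pl x‖ ≤ ‖x‖ := Q.low.norm_starProjection_apply_le x

theorem Pl_eq {x y : G d} (hy : y ∈ Q.low)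
    (h : ∀ w : List (FieldOp d), w.length ≤ 2 → inner ℂ (Q.W w) x = inner ℂ (Q.W w) y) :
    Q.Pl x = y := by
  refine Submodule.eq_starProjection_of_mem_of_inner_eq_zero (K := Q.low) hy fun w hw => ?_
  have h1 : Q.low ≤ (Submodule.span ℂ {x - y})ᗮ := by
    refine Submodule.topologicalClosure_minimal _ (Submodule.span_le.2 ?_)
      (Submodule.isClosed_orthogonal _)
    rintro _ ⟨w, hw, rfl⟩
    rw [SetLike.mem_coe, Submodule.mem_orthogonal_singleton_iff_inner_left, inner_sub_right, h w hw,
      sub_self]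
  exact (Submodule.mem_orthogonal_singleton_iff_inner_right.1 (h1 hw))

theorem m_three (a b c : FieldOp d) : Q.m [a, b, c] =
    Q.m [a] * Q.m [b, c] + (Q.m [a, b] - Q.m [a] * Q.m [b]) * Q.m [c] +
      (Q.m [a, c] - Q.m [a] * Q.m [c]) * Q.m [b] := by
  rw [Q.wick]
  simp only [wsum]
  ring

theorem m_four (a b c e : FieldOp d) : Q.m [a, b, c, e] =
    Q.m [a, b] * Q.m [c, e] + Q.m [a, c] * Q.m [b, e] + Q.m [a, e] * Q.m [b, c] -
      2 * (Q.m [a] * Q.m [b] * Q.m [c] * Q.m [e]) := by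
  rw [Q.wick]
  simp only [wsum, m_three]
  ring

theorem m_five (a b c e f : FieldOp d) : Q.m [a, b, c, e, f] =
    Q.m [a] * Q.m [b, c, e, f] + (Q.m [a, b] - Q.m [a] * Q.m [b]) * Q.m [c, e, f] +
      (Q.m [a, c] - Q.m [a] * Q.m [c]) * Q.m [b, e, f] +
      (Q.m [a, e] - Q.m [a] * Q.m [e]) * Q.m [b, c, f] +
      (Q.m [a, f] - Q.m [a] * Q.m [f]) * Q.m [b, c, e] := by
  rw [Q.wick]
  simp only [wsum]
  ring

theorem m_six (a b c e f g : FieldOp d) : Q.m [a, b, c, e, f, g] =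
    Q.m [a] * Q.m [b, c, e, f, g] + (Q.m [a, b] - Q.m [a] * Q.m [b]) * Q.m [c, e, f, g] +
      (Q.m [a, c] - Q.m [a] * Q.m [c]) * Q.m [b, e, f, g] +
      (Q.m [a, e] - Q.m [a] * Q.m [e]) * Q.m [b, c, f, g] +
      (Q.m [a, f] - Q.m [a] * Q.m [f]) * Q.m [b, c, e, g] +
      (Q.m [a, g] - Q.m [a] * Q.m [g]) * Q.m [b, c, e, f] := by
  rw [Q.wick]
  simp only [wsum]
  ring

/-- The projection of a quartic monomial onto quadratic polynomials. -/
def hfb (a b c e : FieldOp d) : G d :=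
  (Q.m [c, e] • Q.W [a, b] + Q.m [b, e] • Q.W [a, c] + Q.m [b, c] • Q.W [a, e] +
    Q.m [a, e] • Q.W [b, c] + Q.m [a, c] • Q.W [b, e] + Q.m [a, b] • Q.W [c, e]) +
  ((-2 * (Q.m [b] * Q.m [c] * Q.m [e])) • Q.W [a] + (-2 * (Q.m [a] * Q.m [c] * Q.m [e])) • Q.W [b] +
    (-2 * (Q.m [a] * Q.m [b] * Q.m [e])) • Q.W [c] + (-2 * (Q.m [a] * Q.m [b] * Q.m [c])) • Q.W [e]) +
  (6 * (Q.m [a] * Q.m [b] * Q.m [c] * Q.m [e]) - (Q.m [a, b] * Q.m [c, e] +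
    Q.m [a, c] * Q.m [b, e] + Q.m [a, e] * Q.m [b, c])) • Q.W []

/-- In `hfb` each quadratic or linear vector carries the partial derivative of the Wick polynomial
for ω(abce) with respect to its moment, plus a multiple of the state. That the difference to the
quartic vector is orthogonal to all words of length at most two is an identity between moments of
order at most six. -/
theorem Pl_four (a b c e : FieldOp d) : Q.Pl (Q.W [a, b, c, e]) = Q.hfb a b c e := by
  refine Q.Pl_eq ?_ fun w hw => ?_
  · unfold hfb
    have h : ∀ (z : ℂ) {w : List (FieldOp d)}, w.length ≤ 2 → z • Q.W w ∈ Q.low :=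
      fun z w hw => Q.low.smul_mem z (Q.W_mem_low hw)
    refine add_mem (add_mem (add_mem (add_mem (add_mem (add_mem (add_mem ?_ ?_) ?_) ?_) ?_) ?_)
      (add_mem (add_mem (add_mem ?_ ?_) ?_) ?_)) ?_ <;> exact h _ (by simp)
  · have h1 : (adjWord w).length ≤ 2 := by simpa [adjWord] using hw
    simp only [hfb, inner_add_right, inner_smul_right, inner_W]
    generalize adjWord w = u at h1
    match u, h1 with
    | [], _ =>
      simp only [List.nil_append, m_four, m_nil]
      ring
    | [x], _ =>
      simp only [List.cons_append, List.nil_append, m_five, m_four, m_three]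
      ring
    | [x, y], _ =>
      simp only [List.cons_append, List.nil_append, m_six, m_five, m_four, m_three]
      ring

theorem m_adj_one (a : FieldOp d) : Q.m [a.adj] = conj (Q.m [a]) := Q.m_adjWord [a]

theorem m_adj_two (a b : FieldOp d) : Q.m [b.adj, a.adj] = conj (Q.m [a, b]) := Q.m_adjWord [a, b]

end Quasifree

/-! ### Families of observables whose expectations follow the flow -/

section Flow

variable {ω : ℝ → State d} (Q : ∀ r, Quasifree (ω r)) (η : ℝ → G d)

/-- The expectation of the commutator, with an observable given by the vectors `X = A Ψ`, `Y = A* Ψ`. -/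
def brk (X Y : ℝ → G d) (r : ℝ) : ℂ :=
  inner ℂ ((Q r).Pl (Y r)) (η r) - inner ℂ (η r) ((Q r).Pl (X r))

/-- The expectation of the observable given by `X = A Ψ`, `Y = A* Ψ` changes between the times `s`
and `t` according to the projected commutator with the Hamiltonian. -/
structure Follows (s t : ℝ) (X Y : ℝ → G d) : Prop where
  int : IntervalIntegrable (brk Q η X Y) volume s t
  eq : inner ℂ ((Q t).W []) (X t) - inner ℂ ((Q s).W []) (X s) =
    ∫ r in s..t, -Complex.I * brk Q η X Y r

variable {Q η} {s t : ℝ}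

theorem Follows.add {X Y X' Y' : ℝ → G d} (h : Follows Q η s t X Y) (h' : Follows Q η s t X' Y') :
    Follows Q η s t (fun r => X r + X' r) (fun r => Y r + Y' r) := by
  have e : brk Q η (fun r => X r + X' r) (fun r => Y r + Y' r) =
      fun r => brk Q η X Y r + brk Q η X' Y' r := by
    funext r
    simp only [brk, map_add, inner_add_left, inner_add_right]
    ring
  refine ⟨?_, ?_⟩
  · rw [e]; exact h.int.add h'.int
  · rw [e]
    simp only [mul_add]
    rw [intervalIntegral.integral_add (h.int.const_mul _) (h'.int.const_mul _), ← h.eq, ← h'.eq,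
      inner_add_right, inner_add_right]
    ring

theorem Follows.smul {X Y : ℝ → G d} (h : Follows Q η s t X Y) (c : ℂ) :
    Follows Q η s t (fun r => c • X r) (fun r => conj c • Y r) := by
  have e : brk Q η (fun r => c • X r) (fun r => conj c • Y r) = fun r => c * brk Q η X Y r := by
    funext r
    simp only [brk, map_smul, inner_smul_left, inner_smul_right, Complex.conj_conj]
    ring
  refine ⟨?_, ?_⟩
  · rw [e]; exact h.int.const_mul _
  · rw [e]
    simp only [mul_left_comm _ c]
    rw [intervalIntegral.integral_const_mul, ← h.eq, inner_smul_right, inner_smul_right, mul_sub]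

theorem norm_brk_le {X Y : ℝ → G d} {C D r : ℝ} (hX : ‖X r‖ ≤ C) (hY : ‖Y r‖ ≤ C)
    (hη : ‖η r‖ ≤ D) : ‖brk Q η X Y r‖ ≤ C * D + D * C := by
  have hC := (norm_nonneg _).trans hX
  have hD := (norm_nonneg _).trans hη
  refine (norm_sub_le _ _).trans (add_le_add ?_ ?_)
  · exact (norm_inner_le_norm _ _).trans
      (mul_le_mul (((Q r).norm_Pl_le _).trans hY) hη (norm_nonneg _) hC)
  · exact (norm_inner_le_norm _ _).trans
      (mul_le_mul hη (((Q r).norm_Pl_le _).trans hX) (norm_nonneg _) hD)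

/-- The bracket converges pointwise in time and is bounded uniformly, so dominated convergence
passes to the limit in the integrated law; no differentiability of the limit is needed. -/
theorem Follows.lim {X Y : ℕ → ℝ → G d} {X' Y' : ℝ → G d} (hst : s ≤ t)
    (h : ∀ n, Follows Q η s t (X n) (Y n)) {C D : ℝ} (hη : ∀ r ∈ Set.Icc s t, ‖η r‖ ≤ D)
    (hX : ∀ n, ∀ r ∈ Set.Icc s t, ‖X n r‖ ≤ C) (hY : ∀ n, ∀ r ∈ Set.Icc s t, ‖Y n r‖ ≤ C)
    (hX' : ∀ r ∈ Set.Icc s t, Tendsto (fun n => X n r) atTop (𝓝 (X' r)))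
    (hY' : ∀ r ∈ Set.Icc s t, Tendsto (fun n => Y n r) atTop (𝓝 (Y' r))) :
    Follows Q η s t X' Y' := by
  have hsub : Set.uIoc s t ⊆ Set.Icc s t := by
    rw [Set.uIoc_of_le hst]; exact Set.Ioc_subset_Icc_self
  have hlim : ∀ r ∈ Set.Icc s t,
      Tendsto (fun n => brk Q η (X n) (Y n) r) atTop (𝓝 (brk Q η X' Y' r)) := fun r hr => by
    refine Tendsto.sub ?_ ?_
    · exact ((((Q r).Pl.continuous.tendsto _).comp (hY' r hr)).inner tendsto_const_nhds)
    · exact (tendsto_const_nhds.inner (((Q r).Pl.continuous.tendsto _).comp (hX' r hr)))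
  have hbound : ∀ n, ∀ r ∈ Set.Icc s t, ‖brk Q η (X n) (Y n) r‖ ≤ C * D + D * C := fun n r hr =>
    norm_brk_le (hX n r hr) (hY n r hr) (hη r hr)
  have hint : IntervalIntegrable (brk Q η X' Y') volume s t := by
    refine (intervalIntegrable_const (c := C * D + D * C)).mono_fun ?_ ?_
    · refine aestronglyMeasurable_of_tendsto_ae atTop
        (fun n => (h n).int.aestronglyMeasurable_restrict_uIoc) ?_
      filter_upwards [ae_restrict_mem measurableSet_uIoc] with r hr
      exact hlim r (hsub hr)
    · filter_upwards [ae_restrict_mem measurableSet_uIoc] with r hr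
      refine (le_of_tendsto (hlim r (hsub hr)).norm
        (Eventually.of_forall fun n => hbound n r (hsub hr))).trans (le_abs_self _)
  refine ⟨hint, ?_⟩
  have h1 : Tendsto (fun n => ∫ r in s..t, -Complex.I * brk Q η (X n) (Y n) r) atTop
      (𝓝 (∫ r in s..t, -Complex.I * brk Q η X' Y' r)) := by
    refine intervalIntegral.tendsto_integral_filter_of_dominated_convergence
      (fun _ => C * D + D * C) (Eventually.of_forall fun n =>
        ((h n).int.const_mul _).aestronglyMeasurable_restrict_uIoc) (Eventually.of_forall fun n =>
        Eventually.of_forall fun r hr => ?_) intervalIntegrable_const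
        (Eventually.of_forall fun r hr => (hlim r (hsub hr)).const_mul _)
    rw [norm_mul, norm_neg, Complex.norm_I, one_mul]
    exact hbound n r (hsub hr)
  have h2 : Tendsto (fun n => inner ℂ ((Q t).W []) (X n t) - inner ℂ ((Q s).W []) (X n s)) atTop
      (𝓝 (inner ℂ ((Q t).W []) (X' t) - inner ℂ ((Q s).W []) (X' s))) :=
    (tendsto_const_nhds.inner (hX' t ⟨hst, le_rfl⟩)).sub
      (tendsto_const_nhds.inner (hX' s ⟨le_rfl, hst⟩))
  refine tendsto_nhds_unique h2 (h1.congr fun n => ((h n).eq).symm)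

/-- The fundamental theorem of calculus for a bounded derivative. -/
theorem Follows.of_hasDerivWithinAt {X Y : ℝ → G d} (hst : s ≤ t) {D : ℝ}
    (hD : ∀ r ∈ Set.Icc s t, ‖brk Q η X Y r‖ ≤ D)
    (h : ∀ r ∈ Set.Icc s t, HasDerivWithinAt (fun r => inner ℂ ((Q r).W []) (X r))
      (-Complex.I * brk Q η X Y r) (Set.Icc s t) r) : Follows Q η s t X Y := by
  set F : ℝ → ℂ := fun r => inner ℂ ((Q r).W []) (X r) with hF
  have hderiv : ∀ r ∈ Set.Ioo s t, HasDerivAt F (-Complex.I * brk Q η X Y r) r := fun r hr =>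
    (h r (Set.Ioo_subset_Icc_self hr)).hasDerivAt (Icc_mem_nhds hr.1 hr.2)
  have hint : IntervalIntegrable (brk Q η X Y) volume s t := by
    rw [intervalIntegrable_iff_integrableOn_Ioo_of_le hst]
    refine ⟨?_, .restrict_of_bounded (C := D) (by simp) ?_⟩
    -- Measurability of the bracket comes from its being i times a derivative on the open interval.
    · refine ((measurable_deriv F).const_mul Complex.I).aestronglyMeasurable.congr ?_
      filter_upwards [ae_restrict_mem measurableSet_Ioo] with r hr
      rw [(hderiv r hr).deriv, ← mul_assoc]
      simp
    · filter_upwards [ae_restrict_mem measurableSet_Ioo] with r hr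
      exact hD r (Set.Ioo_subset_Icc_self hr)
  refine ⟨hint, ?_⟩
  rw [intervalIntegral.integral_eq_sub_of_hasDeriv_right_of_le hst
    (fun r hr => (h r hr).continuousWithinAt) (fun r hr => (hderiv r hr).hasDerivWithinAt)
    (hint.const_mul _)]

/-- A word, its expectation having the derivative given by the commutator. -/
def WordDeriv (Q : ∀ r, Quasifree (ω r)) (η : ℝ → G d) (s t : ℝ) (w : List (FieldOp d)) : Prop :=
  ∀ r ∈ Set.Icc s t, HasDerivWithinAt (fun r => (Q r).m w)
    (-Complex.I * (inner ℂ ((Q r).W (adjWord w)) (η r) - inner ℂ (η r) ((Q r).W w))) (Set.Icc s t) r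

/-- Conjugation exchanges the two terms of the bracket, so the equations for ψ and ψψ imply those
for ψ* and ψ*ψ*. -/
theorem WordDeriv.adj {w : List (FieldOp d)} (h : WordDeriv Q η s t w) :
    WordDeriv Q η s t (adjWord w) := by
  intro r hr
  have h1 := (Complex.conjCLE : ℂ →L[ℝ] ℂ).hasFDerivAt.comp_hasDerivWithinAt r (h r hr)
  have h2 : (fun r => (Q r).m (adjWord w)) = ⇑(Complex.conjCLE : ℂ →L[ℝ] ℂ) ∘ fun r => (Q r).m w := by
    funext r
    rw [(Q r).m_adjWord]; rfl
  rw [h2]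
  refine h1.congr_deriv ?_
  change conj (-Complex.I * (inner ℂ ((Q r).W (adjWord w)) (η r) - inner ℂ (η r) ((Q r).W w))) = _
  rw [map_mul, map_sub, inner_conj_symm, inner_conj_symm, adjWord_adjWord, map_neg, Complex.conj_I]
  ring

theorem WordDeriv.follows {w : List (FieldOp d)} (hst : s ≤ t) (h : WordDeriv Q η s t w)
    (hw : w.length ≤ 2) {C D : ℝ} (hη : ∀ r ∈ Set.Icc s t, ‖η r‖ ≤ D)
    (hC : ∀ r ∈ Set.Icc s t, ‖(Q r).W w‖ ≤ C) (hC' : ∀ r ∈ Set.Icc s t, ‖(Q r).W (adjWord w)‖ ≤ C) :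
    Follows Q η s t (fun r => (Q r).W w) (fun r => (Q r).W (adjWord w)) := by
  have hw' : (adjWord w).length ≤ 2 := by simpa [adjWord] using hw
  refine Follows.of_hasDerivWithinAt hst (fun r hr => norm_brk_le (hC r hr) (hC' r hr) (hη r hr)) ?_
  intro r hr
  simp_rw [← Quasifree.m_eq]
  refine (h r hr).congr_deriv ?_
  rw [brk, (Q r).Pl_of_mem ((Q r).W_mem_low hw), (Q r).Pl_of_mem ((Q r).W_mem_low hw')]

/-- The product rule applied to the Wick polynomial for ω(abce) gives the linear combination of
lower brackets encoded in `hfb`. The multiple of the state in `hfb` drops out because ⟨Ψ, ℍΨ⟩ is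
real. -/
theorem WordDeriv.follows_four {a b c e : FieldOp d} (hst : s ≤ t)
    (ha : WordDeriv Q η s t [a]) (hb : WordDeriv Q η s t [b]) (hc : WordDeriv Q η s t [c])
    (he : WordDeriv Q η s t [e]) (hab : WordDeriv Q η s t [a, b]) (hac : WordDeriv Q η s t [a, c])
    (hae : WordDeriv Q η s t [a, e]) (hbc : WordDeriv Q η s t [b, c])
    (hbe : WordDeriv Q η s t [b, e]) (hce : WordDeriv Q η s t [c, e])
    (h0 : ∀ r ∈ Set.Icc s t, inner ℂ ((Q r).W []) (η r) = inner ℂ (η r) ((Q r).W [])) {C D : ℝ}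
    (hη : ∀ r ∈ Set.Icc s t, ‖η r‖ ≤ D) (hC : ∀ r ∈ Set.Icc s t, ‖(Q r).W [a, b, c, e]‖ ≤ C)
    (hC' : ∀ r ∈ Set.Icc s t, ‖(Q r).W (adjWord [a, b, c, e])‖ ≤ C) :
    Follows Q η s t (fun r => (Q r).W [a, b, c, e]) (fun r => (Q r).W (adjWord [a, b, c, e])) := by
  refine Follows.of_hasDerivWithinAt hst (fun r hr => norm_brk_le (hC r hr) (hC' r hr) (hη r hr)) ?_
  intro r hr
  simp_rw [← Quasifree.m_eq, Quasifree.m_four]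
  have h1 := ((((hab r hr).mul (hce r hr)).add ((hac r hr).mul (hbe r hr))).add
    ((hae r hr).mul (hbc r hr))).sub
    (((((ha r hr).mul (hb r hr)).mul (hc r hr)).mul (he r hr)).const_mul (2 : ℂ))
  refine h1.congr_deriv ?_
  have e1 : adjWord [a, b, c, e] = [e.adj, c.adj, b.adj, a.adj] := rfl
  have e2 : ∀ x y : FieldOp d, adjWord [x, y] = [y.adj, x.adj] := fun _ _ => rfl
  have e3 : ∀ x : FieldOp d, adjWord [x] = [x.adj] := fun _ => rfl
  rw [brk, e1, Quasifree.Pl_four, Quasifree.Pl_four]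
  simp only [Quasifree.hfb, Pi.mul_apply, inner_add_left, inner_add_right, inner_smul_left, inner_smul_right,
    Quasifree.m_adj_one, Quasifree.m_adj_two, e2, e3, map_mul, map_neg, map_sub, map_add,
    Complex.conj_conj, map_ofNat, h0 r hr]
  ring

end Flow

end HFB
end

/-! ### Conservation laws for expectations written as inner products. -/

noncomputable section

namespace HFB

variable {d j : ℕ}

/-! ### Inner products by components -/

theorem G.inner_congr {X Y X' Y' : G d}
    (h : ∀ k m, inner ℂ (X.comp k m) (Y.comp k m) = inner ℂ (X'.comp k m) (Y'.comp k m)) :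
    inner ℂ X Y = inner ℂ X' Y' := by
  have h1 : ∀ k, inner ℂ (X k) (Y k) = inner ℂ (X' k) (Y' k) := fun k => by
    have a := Fock.hasSum_inner (X k) (Y k)
    have b := Fock.hasSum_inner (X' k) (Y' k)
    refine a.unique (Eq.mp ?_ b)
    congr 1
    funext m
    exact (h k m).symm
  have a := G.hasSum_inner X Y
  have b := G.hasSum_inner X' Y'
  refine a.unique (Eq.mp ?_ b)
  congr 1
  funext k
  exact (h1 k).symm

/-- The Hamiltonian preserves the particle number and its kernels are symmetric, so it is symmetric
in each component separately; this is stronger than symmetry of the total expectation. -/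
theorem inner_comp_hamVec {X : G d} (h : totalWeight j X ≠ ⊤) {B : L2 d →L[ℂ] L2 d}
    {B₂ : H (Pt d × Pt d) →L[ℂ] H (Pt d × Pt d)}
    (hB : ∀ u w, inner ℂ (resolv d j u) (B w) = inner ℂ (B u) (resolv d j w))
    (hB₂ : ∀ u w, inner ℂ (pairResolv d j u) (B₂ w) = inner ℂ (B₂ u) (pairResolv d j w))
    (k m : ℕ) : inner ℂ (X.comp k m) ((hamVec h B B₂).comp k m) =
      inner ℂ ((hamVec h B B₂).comp k m) (X.comp k m) := by
  rw [hamVec, G.comp_add, G.comp_smul, inner_add_right, inner_add_left, inner_smul_right,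
    inner_smul_left, map_div₀, map_one, Complex.conj_ofNat]
  congr 1
  · rw [← inner_conj_symm ((((cell₁ d j).nvec (cell₁ d j) h) B).comp k m)]
    exact ((cell₁ d j).inner_comp_nvec_self h hB k m).symm
  · congr 1
    rw [← inner_conj_symm ((((cell₂ d j).nvec (cell₂ d j) h) B₂).comp k m)]
    exact ((cell₂ d j).inner_comp_nvec_self h hB₂ k m).symm

/-! ### The flow of normal ordered observables -/

theorem creWord_one (E : Fin 1 → Test d) : creWord E = [.cre (E 0)] := by simp [creWord]

theorem creWord_two (E : Fin 2 → Test d) : creWord E = [.cre (E 0), .cre (E 1)] := by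
  simp [creWord]

theorem creWord_zero (E : Fin 0 → Test d) : creWord E = [] := by simp [creWord]

theorem annWord'_zero (E : Fin 0 → Test d) : annWord' E = [] := by
  simp [annWord', creWord, adjWord]

theorem annWord'_one (E : Fin 1 → Test d) : annWord' E = [.ann (E 0)] := by
  simp [annWord', creWord, adjWord, FieldOp.adj, FieldOp.ann, FieldOp.cre]

theorem annWord'_two (E : Fin 2 → Test d) : annWord' E = [.ann (E 1), .ann (E 0)] := by
  simp [annWord', creWord, adjWord, FieldOp.adj, FieldOp.ann, FieldOp.cre]

theorem adjWord_creWord_append {p q : ℕ} (E : Fin p → Test d) (F : Fin q → Test d) :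
    adjWord (creWord E ++ annWord' F) = creWord F ++ annWord' E := by
  rw [adjWord_append, annWord', annWord', adjWord_adjWord]

namespace Cell

/-- Words of total degree at most two lie in the closed subspace by definition, and `pair_induction`
carries this to all kernels. -/
theorem nvec_mem_low {ω : State d} (Q : Quasifree ω) (c c' : Cell d j) (hp : c.p + c'.p ≤ 2)
    (h : totalWeight j (Q.W []) ≠ ⊤) {B : H c'.Z →L[ℂ] H c.Z} {B' : H c.Z →L[ℂ] H c'.Z}
    (hBB : ∀ u w, inner ℂ (c.R u) (B w) = inner ℂ (B' u) (c'.R w)) : c.nvec c' h B ∈ Q.low := by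
  refine c.pair_induction c' (p := fun B _ => c.nvec c' h B ∈ Q.low) ?_ ?_ ?_ ?_ hBB
  · intro B B' C C' h1 h2
    rw [map_add]
    exact add_mem h1 h2
  · intro z B B' h1
    rw [map_smul]
    exact Q.low.smul_mem _ h1
  · intro B B' C C' h1 h2 h3
    obtain ⟨b, hb⟩ := exists_bound_of_tendsto h2
    exact Q.isClosed_low.mem_of_tendsto (c.tendsto_nvec c' h hb h2) (Eventually.of_forall h1)
  · intro E F
    rw [← c.word_eq_nvec c' Q h]
    refine Q.W_mem_low ?_
    simpa [creWord, annWord', adjWord] using hp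

variable {ω : ℝ → State d} {Q : ∀ r, Quasifree (ω r)} {η : ℝ → G d} {s t : ℝ}
  (h : ∀ r, totalWeight j ((Q r).W []) ≠ ⊤) {D : ℝ≥0}
  (hD : ∀ r ∈ Set.Icc s t, totalWeight j ((Q r).W []) ≤ D) {M : ℝ}
  (hη : ∀ r ∈ Set.Icc s t, ‖η r‖ ≤ M)

include h hD in
theorem exists_word_bound (c c' : Cell d j) (E : Fin c.p → Test d) (F : Fin c'.p → Test d) :
    ∃ C : ℝ, ∀ r ∈ Set.Icc s t, ‖(Q r).W (creWord E ++ annWord' F)‖ ≤ C := by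
  refine ⟨√(16 * (‖InnerProductSpace.rankOne ℂ (c.prod E) (c'.R (c'.prod F))‖₊ : ℝ) ^ 2 * D),
    fun r hr => ?_⟩
  rw [c.word_eq_nvec c' (Q r) (h r)]
  exact c.norm_nvec_le c' (h r) (ContinuousLinearMap.le_opNorm _) (hD r hr)

include hD hη in
-- The law is linear in the pair of kernels and stable under strong limits, the weights and ℍΨ being
-- bounded on the time interval; `pair_induction` reduces it to words.
theorem follows_nvec (hst : s ≤ t) (c c' : Cell d j)
    (hbase : ∀ (E : Fin c.p → Test d) (F : Fin c'.p → Test d),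
      Follows Q η s t (fun r => (Q r).W (creWord E ++ annWord' F))
        (fun r => (Q r).W (creWord F ++ annWord' E)))
    {B : H c'.Z →L[ℂ] H c.Z} {B' : H c.Z →L[ℂ] H c'.Z}
    (hBB : ∀ u w, inner ℂ (c.R u) (B w) = inner ℂ (B' u) (c'.R w)) :
    Follows Q η s t (fun r => c.nvec c' (h r) B) (fun r => c'.nvec c (h r) B') := by
  refine c.pair_induction c' (p := fun B B' =>
    Follows Q η s t (fun r => c.nvec c' (h r) B) (fun r => c'.nvec c (h r) B')) ?_ ?_ ?_ ?_ hBB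
  · intro B B' C C' h1 h2
    simpa only [map_add] using h1.add h2
  · intro z B B' h1
    simpa only [map_smul] using h1.smul z
  · intro B B' C C' h1 h2 h3
    obtain ⟨b, hb⟩ := exists_bound_of_tendsto h2
    obtain ⟨b', hb'⟩ := exists_bound_of_tendsto h3
    exact Follows.lim hst h1 hη (C := max √(16 * b ^ 2 * D) √(16 * b' ^ 2 * D))
      (fun n r hr => (c.norm_nvec_le c' (h r) (hb n) (hD r hr)).trans (le_max_left _ _))
      (fun n r hr => (c'.norm_nvec_le c (h r) (hb' n) (hD r hr)).trans (le_max_right _ _))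
      (fun r _ => c.tendsto_nvec c' (h r) hb h2) (fun r _ => c'.tendsto_nvec c (h r) hb' h3)
  · intro E F
    have h1 := hbase E F
    simpa only [c.word_eq_nvec c' _ (h _), c'.word_eq_nvec c _ (h _)] using h1

include h hD hη in
theorem follows_word (hst : s ≤ t) (c c' : Cell d j) (hp : c.p + c'.p ≤ 2) (E : Fin c.p → Test d)
    (F : Fin c'.p → Test d) (hw : WordDeriv Q η s t (creWord E ++ annWord' F)) :
    Follows Q η s t (fun r => (Q r).W (creWord E ++ annWord' F))
        (fun r => (Q r).W (creWord F ++ annWord' E)) := by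
  obtain ⟨C, hC⟩ := exists_word_bound h hD c c' E F
  obtain ⟨C', hC'⟩ := exists_word_bound h hD c' c F E
  rw [← adjWord_creWord_append E F]
  exact hw.follows hst (by simpa [creWord, annWord', adjWord] using hp) hη
    (C := max C C') (fun r hr => (hC r hr).trans (le_max_left _ _)) fun r hr => by
      rw [adjWord_creWord_append]
      exact (hC' r hr).trans (le_max_right _ _)

end Cell

namespace Cell

theorem inner_unit_rankOne (c : Cell d j) (b : H c.Z) (u : H PUnit) (w : H c.Z) :
    inner ℂ ((cell₀ d j).R u) (InnerProductSpace.rankOne ℂ unitVec (c.R b) w) =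
      inner ℂ (InnerProductSpace.rankOne ℂ b unitVec u) (c.R w) := by
  rw [InnerProductSpace.rankOne_apply, InnerProductSpace.rankOne_apply, inner_smul_left,
    inner_conj_symm]
  change inner ℂ u _ = _
  rw [inner_smul_right, ← ContinuousLinearMap.adjoint_inner_left, c.adjoint_R, mul_comm]

theorem inner_rankOne_unit (c : Cell d j) (b : H c.Z) (u : H c.Z) (w : H PUnit) :
    inner ℂ (c.R u) (InnerProductSpace.rankOne ℂ b unitVec w) =
      inner ℂ (InnerProductSpace.rankOne ℂ unitVec (c.R b) u) ((cell₀ d j).R w) := by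
  refine ((inner_conj_symm _ _).symm.trans (congrArg conj (c.inner_unit_rankOne b w u).symm)).trans ?_
  exact inner_conj_symm _ _

end Cell

theorem QuadObs.adjoint_vec {X : G d} (A : QuadObs d j) (h : totalWeight j X ≠ ⊤)
    (K : L2 d →L[ℂ] L2 d) : A.adjoint.vec K h = conj A.c • X +
      (cell₁ d j).nvec (cell₀ d j) h (InnerProductSpace.rankOne ℂ A.f unitVec) +
      (cell₀ d j).nvec (cell₁ d j) h (InnerProductSpace.rankOne ℂ unitVec (resolv d j A.g)) +
      (cell₁ d j).nvec (cell₁ d j) h K +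
      (cell₂ d j).nvec (cell₀ d j) h (InnerProductSpace.rankOne ℂ A.b unitVec) +
      (cell₀ d j).nvec (cell₂ d j) h
        (InnerProductSpace.rankOne ℂ unitVec (pairResolv d j A.b')) := by
  have e : ∀ x a b k e f : G d, x + a + b + k + e + f = x + b + a + k + f + e := fun _ _ _ _ _ _ => by
    abel
  exact e _ _ _ _ _ _

theorem QuadObs.vec_mem_low {ω : State d} (Q : Quasifree ω) (A : QuadObs d j)
    (h : totalWeight j (Q.W []) ≠ ⊤) {K K' : L2 d →L[ℂ] L2 d}
    (hK : ∀ u w, inner ℂ (resolv d j u) (K w) = inner ℂ (K' u) (resolv d j w)) :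
    A.vec K h ∈ Q.low := by
  refine add_mem (add_mem (add_mem (add_mem (add_mem ?_ ?_) ?_) ?_) ?_) ?_
  · exact Q.low.smul_mem _ (Q.W_mem_low (by simp))
  · exact Cell.nvec_mem_low Q (cell₀ d j) (cell₁ d j) (by simp [cell₀, cell₁]) h
      ((cell₁ d j).inner_unit_rankOne A.f)
  · exact Cell.nvec_mem_low Q (cell₁ d j) (cell₀ d j) (by simp [cell₀, cell₁]) h
      ((cell₁ d j).inner_rankOne_unit A.g)
  · exact Cell.nvec_mem_low Q (cell₁ d j) (cell₁ d j) le_rfl h hK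
  · exact Cell.nvec_mem_low Q (cell₀ d j) (cell₂ d j) (by simp [cell₀, cell₂]) h
      ((cell₂ d j).inner_unit_rankOne A.b)
  · exact Cell.nvec_mem_low Q (cell₂ d j) (cell₀ d j) (by simp [cell₀, cell₂]) h
      ((cell₂ d j).inner_rankOne_unit A.b')

section Flow

variable {ω : ℝ → State d} {Q : ∀ r, Quasifree (ω r)} {s t : ℝ}
  {h : ∀ r, totalWeight j ((Q r).W []) ≠ ⊤} {D : ℝ≥0} {B : L2 d →L[ℂ] L2 d}
  {B₂ : H (Pt d × Pt d) →L[ℂ] H (Pt d × Pt d)}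

/-- A quasifree flow on a time interval, with Hamiltonian given by the kernels `B` and `B₂`. -/
structure QuasifreeFlow (Q : ∀ r, Quasifree (ω r)) (h : ∀ r, totalWeight j ((Q r).W []) ≠ ⊤)
    (B : L2 d →L[ℂ] L2 d) (B₂ : H (Pt d × Pt d) →L[ℂ] H (Pt d × Pt d)) (D : ℝ≥0) (s t : ℝ) :
    Prop where
  le : s ≤ t
  bound : ∀ r ∈ Set.Icc s t, totalWeight j ((Q r).W []) ≤ D
  symm : ∀ u w, inner ℂ (resolv d j u) (B w) = inner ℂ (B u) (resolv d j w)
  symm₂ : ∀ u w, inner ℂ (pairResolv d j u) (B₂ w) = inner ℂ (B₂ u) (pairResolv d j w)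
  deriv : ∀ w ∈ quadraticMonomials d, WordDeriv Q (fun r => hamVec (h r) B B₂) s t w

namespace QuasifreeFlow

variable (S : QuasifreeFlow Q h B B₂ D s t)

include S

theorem exists_ham_bound : ∃ M : ℝ, ∀ r ∈ Set.Icc s t, ‖hamVec (h r) B B₂‖ ≤ M := by
  refine ⟨√(16 * (‖B‖₊ : ℝ) ^ 2 * D) + √(16 * (‖B₂‖₊ : ℝ) ^ 2 * D), fun r hr => ?_⟩
  rw [hamVec]
  refine (norm_add_le _ _).trans (add_le_add ?_ ?_)
  · exact (cell₁ d j).norm_nvec_le (cell₁ d j) (h r) B.le_opNorm (S.bound r hr)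
  · rw [norm_smul]
    have h1 := (cell₂ d j).norm_nvec_le (cell₂ d j) (h r) (C := ‖B₂‖₊) B₂.le_opNorm (S.bound r hr)
    refine (mul_le_of_le_one_left (norm_nonneg _) ?_).trans h1
    norm_num

theorem inner_comp_symm (r : ℝ) (k m : ℕ) :
    inner ℂ (((Q r).W []).comp k m) ((hamVec (h r) B B₂).comp k m) =
      inner ℂ ((hamVec (h r) B B₂).comp k m) (((Q r).W []).comp k m) :=
  inner_comp_hamVec (h r) S.symm S.symm₂ k m

theorem inner_symm (r : ℝ) : inner ℂ ((Q r).W []) (hamVec (h r) B B₂) =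
    inner ℂ (hamVec (h r) B B₂) ((Q r).W []) :=
  G.inner_congr fun k m => S.inner_comp_symm r k m

theorem deriv_nil : WordDeriv Q (fun r => hamVec (h r) B B₂) s t [] := by
  intro r _
  simp only [Quasifree.m_nil, adjWord_nil, S.inner_symm, sub_self, mul_zero]
  exact hasDerivWithinAt_const _ _ _

theorem deriv_ann (f : Test d) : WordDeriv Q (fun r => hamVec (h r) B B₂) s t [.ann f] :=
  S.deriv _ ⟨f, f, Or.inl rfl⟩

theorem deriv_cre (f : Test d) : WordDeriv Q (fun r => hamVec (h r) B B₂) s t [.cre f] :=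
  (S.deriv_ann f).adj

theorem deriv_cre_ann (f g : Test d) :
    WordDeriv Q (fun r => hamVec (h r) B B₂) s t [.cre f, .ann g] :=
  S.deriv _ ⟨g, f, Or.inr (Or.inl rfl)⟩

theorem deriv_ann_ann (f g : Test d) :
    WordDeriv Q (fun r => hamVec (h r) B B₂) s t [.ann f, .ann g] :=
  S.deriv _ ⟨f, g, Or.inr (Or.inr rfl)⟩

theorem deriv_cre_cre (f g : Test d) :
    WordDeriv Q (fun r => hamVec (h r) B B₂) s t [.cre f, .cre g] :=
  (S.deriv_ann_ann g f).adj

theorem follows_nil : Follows Q (fun r => hamVec (h r) B B₂) s t (fun r => (Q r).W [])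
    (fun r => (Q r).W []) := by
  obtain ⟨M, hM⟩ := S.exists_ham_bound
  exact S.deriv_nil.follows S.le (by simp) hM (C := 1) (fun r _ => (Q r).norm_W_nil.le)
    fun r _ => (Q r).norm_W_nil.le

theorem follows_nvec (c c' : Cell d j) (hp : c.p + c'.p ≤ 2)
    (hw : ∀ (E : Fin c.p → Test d) (F : Fin c'.p → Test d),
      WordDeriv Q (fun r => hamVec (h r) B B₂) s t (creWord E ++ annWord' F))
    {K : H c'.Z →L[ℂ] H c.Z} {K' : H c.Z →L[ℂ] H c'.Z}
    (hK : ∀ u w, inner ℂ (c.R u) (K w) = inner ℂ (K' u) (c'.R w)) :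
    Follows Q (fun r => hamVec (h r) B B₂) s t (fun r => c.nvec c' (h r) K)
      (fun r => c'.nvec c (h r) K') := by
  obtain ⟨M, hM⟩ := S.exists_ham_bound
  exact Cell.follows_nvec h S.bound hM S.le c c'
    (fun E F => Cell.follows_word h S.bound hM S.le c c' hp E F (hw E F)) hK

theorem follows₁₁ {K K' : L2 d →L[ℂ] L2 d}
    (hK : ∀ u w, inner ℂ (resolv d j u) (K w) = inner ℂ (K' u) (resolv d j w)) :
    Follows Q (fun r => hamVec (h r) B B₂) s t
      (fun r => (cell₁ d j).nvec (cell₁ d j) (h r) K)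
      (fun r => (cell₁ d j).nvec (cell₁ d j) (h r) K') :=
  S.follows_nvec (cell₁ d j) (cell₁ d j) le_rfl (show ∀ E F : Fin 1 → Test d,
    WordDeriv Q (fun r => hamVec (h r) B B₂) s t (creWord E ++ annWord' F) from fun E F => by
      rw [creWord_one, annWord'_one]
      exact S.deriv_cre_ann (E 0) (F 0)) hK

theorem follows_word₂₂ (E F : Fin 2 → Test d) :
    Follows Q (fun r => hamVec (h r) B B₂) s t (fun r => (Q r).W (creWord E ++ annWord' F))
      (fun r => (Q r).W (creWord F ++ annWord' E)) := by
  obtain ⟨M, hM⟩ := S.exists_ham_bound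
  obtain ⟨C, hC⟩ := Cell.exists_word_bound h S.bound (cell₂ d j) (cell₂ d j) E F
  obtain ⟨C', hC'⟩ := Cell.exists_word_bound h S.bound (cell₂ d j) (cell₂ d j) F E
  have e : creWord F ++ annWord' E = adjWord (creWord E ++ annWord' F) :=
    (adjWord_creWord_append E F).symm
  replace hC' : ∀ r ∈ Set.Icc s t, ‖(Q r).W (creWord F ++ annWord' E)‖ ≤ C' := hC'
  replace hC : ∀ r ∈ Set.Icc s t, ‖(Q r).W (creWord E ++ annWord' F)‖ ≤ C := hC
  rw [e] at hC' ⊢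
  rw [creWord_two, annWord'_two] at hC hC' ⊢
  exact WordDeriv.follows_four S.le (S.deriv_cre _) (S.deriv_cre _) (S.deriv_ann _) (S.deriv_ann _)
    (S.deriv_cre_cre _ _) (S.deriv_cre_ann _ _) (S.deriv_cre_ann _ _) (S.deriv_cre_ann _ _)
    (S.deriv_cre_ann _ _) (S.deriv_ann_ann _ _) (fun r _ => S.inner_symm r) hM
    (C := max C C') (fun r hr => (hC r hr).trans (le_max_left _ _))
    fun r hr => (hC' r hr).trans (le_max_right _ _)

theorem follows₂₂ {K K' : H (Pt d × Pt d) →L[ℂ] H (Pt d × Pt d)}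
    (hK : ∀ u w, inner ℂ (pairResolv d j u) (K w) = inner ℂ (K' u) (pairResolv d j w)) :
    Follows Q (fun r => hamVec (h r) B B₂) s t
      (fun r => (cell₂ d j).nvec (cell₂ d j) (h r) K)
      (fun r => (cell₂ d j).nvec (cell₂ d j) (h r) K') := by
  obtain ⟨M, hM⟩ := S.exists_ham_bound
  exact Cell.follows_nvec h S.bound hM S.le (cell₂ d j) (cell₂ d j)
    (fun E F => S.follows_word₂₂ E F) hK

omit S in
theorem eq_of_follows {η X Y : ℝ → G d} (hf : Follows Q η s t X Y) (h0 : ∀ r, brk Q η X Y r = 0) :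
    inner ℂ ((Q t).W []) (X t) = inner ℂ ((Q s).W []) (X s) := by
  have h3 := hf.eq
  simp only [h0, mul_zero, intervalIntegral.integral_zero] at h3
  exact sub_eq_zero.1 h3

/-- The Hamiltonian itself is a combination of normal ordered observables obeying the law. Its
bracket is ⟨ΠℍΨ, ℍΨ⟩ - ⟨ℍΨ, ΠℍΨ⟩, zero by self-adjointness of the projection. -/
theorem energy_const : inner ℂ ((Q t).W []) (hamVec (h t) B B₂) =
    inner ℂ ((Q s).W []) (hamVec (h s) B B₂) := by
  have h1 : Follows Q (fun r => hamVec (h r) B B₂) s t (fun r => hamVec (h r) B B₂)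
      (fun r => hamVec (h r) B B₂) := by
    have h2 := (S.follows₁₁ S.symm).add ((S.follows₂₂ S.symm₂).smul (1 / 2))
    rw [map_div₀, map_one, Complex.conj_ofNat] at h2
    exact h2
  have h4 : ∀ r, brk Q (fun r => hamVec (h r) B B₂) (fun r => hamVec (h r) B B₂)
      (fun r => hamVec (h r) B B₂) r = 0 := fun r => by
    rw [brk, Quasifree.inner_Pl, sub_self]
  exact eq_of_follows (X := fun r => hamVec (h r) B B₂) h1 h4

/-- N is quadratic, so the projection does nothing. On the n-particle component N is multiplication
by n, and the bracket vanishes by the componentwise symmetry of the Hamiltonian. -/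
theorem number_const :
    inner ℂ ((Q t).W []) ((cell₁ d j).nvec (cell₁ d j) (h t) (resolv d j)) =
    inner ℂ ((Q s).W []) ((cell₁ d j).nvec (cell₁ d j) (h s) (resolv d j)) := by
  have h1 := S.follows₁₁ (K := resolv d j) (K' := resolv d j) fun u w => by rfl
  have h4 : ∀ r, brk Q (fun r => hamVec (h r) B B₂)
      (fun r => (cell₁ d j).nvec (cell₁ d j) (h r) (resolv d j))
      (fun r => (cell₁ d j).nvec (cell₁ d j) (h r) (resolv d j)) r = 0 := fun r => by
    rw [brk, (Q r).Pl_of_mem (Cell.nvec_mem_low (Q r) (cell₁ d j) (cell₁ d j) le_rfl (h r)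
      (B := resolv d j) (B' := resolv d j) fun u w => rfl), sub_eq_zero]
    refine G.inner_congr fun k m => ?_
    rw [comp_nvec_resolv, inner_smul_left, inner_smul_right, S.inner_comp_symm, Complex.conj_natCast]
  exact eq_of_follows (X := fun r => (cell₁ d j).nvec (cell₁ d j) (h r) (resolv d j)) h1 h4

/-- All six terms of the observable obey the law, and the projection acts trivially on quadratic
vectors, so the bracket is the commutator expectation assumed to vanish. -/
theorem quadObs_const (A : QuadObs d j) {K K' : L2 d →L[ℂ] L2 d}
    (hK : ∀ u w, inner ℂ (resolv d j u) (K w) = inner ℂ (K' u) (resolv d j w))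
    (hcomm : ∀ r, inner ℂ (A.adjoint.vec K' (h r)) (hamVec (h r) B B₂) =
      inner ℂ (hamVec (h r) B B₂) (A.vec K (h r))) :
    inner ℂ ((Q t).W []) (A.vec K (h t)) = inner ℂ ((Q s).W []) (A.vec K (h s)) := by
  have hK' : ∀ u w, inner ℂ (resolv d j u) (K' w) = inner ℂ (K u) (resolv d j w) := fun u w => by
    rw [← inner_conj_symm, ← hK, inner_conj_symm]
  have f₁ := S.follows_nvec (cell₀ d j) (cell₁ d j) (by simp [cell₀, cell₁]) (show ∀ (E : Fin 0 → Test d)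
    (F : Fin 1 → Test d), WordDeriv Q (fun r => hamVec (h r) B B₂) s t (creWord E ++ annWord' F)
    from fun E F => by
      rw [creWord_zero, annWord'_one]
      exact S.deriv_ann (F 0)) ((cell₁ d j).inner_unit_rankOne A.f)
  have f₂ := S.follows_nvec (cell₁ d j) (cell₀ d j) (by simp [cell₀, cell₁]) (show ∀ (E : Fin 1 → Test d)
    (F : Fin 0 → Test d), WordDeriv Q (fun r => hamVec (h r) B B₂) s t (creWord E ++ annWord' F)
    from fun E F => by
      rw [creWord_one, annWord'_zero]
      exact S.deriv_cre (E 0)) ((cell₁ d j).inner_rankOne_unit A.g)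
  have f₃ := S.follows₁₁ hK
  have f₄ := S.follows_nvec (cell₀ d j) (cell₂ d j) (by simp [cell₀, cell₂]) (show ∀ (E : Fin 0 → Test d)
    (F : Fin 2 → Test d), WordDeriv Q (fun r => hamVec (h r) B B₂) s t (creWord E ++ annWord' F)
    from fun E F => by
      rw [creWord_zero, annWord'_two]
      exact S.deriv_ann_ann _ _) ((cell₂ d j).inner_unit_rankOne A.b)
  have f₅ := S.follows_nvec (cell₂ d j) (cell₀ d j) (by simp [cell₀, cell₂]) (show ∀ (E : Fin 2 → Test d)
    (F : Fin 0 → Test d), WordDeriv Q (fun r => hamVec (h r) B B₂) s t (creWord E ++ annWord' F)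
    from fun E F => by
      rw [creWord_two, annWord'_zero]
      exact S.deriv_cre_cre _ _) ((cell₂ d j).inner_rankOne_unit A.b')
  have f := (((((S.follows_nil.smul A.c).add f₁).add f₂).add f₃).add f₄).add f₅
  exact eq_of_follows (X := fun r => A.vec K (h r)) (Y := fun r => A.adjoint.vec K' (h r)) (by
    simp only [QuadObs.adjoint_vec]
    exact f) fun r => by
    rw [brk, (Q r).Pl_of_mem (A.vec_mem_low (Q r) (h r) hK),
      (Q r).Pl_of_mem (A.adjoint.vec_mem_low (Q r) (h r) hK'), hcomm, sub_self]

end QuasifreeFlow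

end Flow

end HFB
end

/-! ### Local bounds in time and passage to expectations. -/

noncomputable section

namespace HFB

variable {d j : ℕ}

/-! ### Local bounds for continuous families -/

theorem sobNorm_add_le (φ ψ : L2 d) : sobNorm j (φ + ψ) ≤ sobNorm j φ + sobNorm j ψ := by
  refine iSup₂_le fun u hu => ?_
  rw [inner_add_right]
  refine (enorm_add_le _ _).trans (add_le_add ?_ ?_)
  · exact le_iSup₂ (f := fun (u : Test d) (_ : ‖u.l2‖ ≤ 1) => ‖inner ℂ (sobM d j u).l2 φ‖ₑ) u hu
  · exact le_iSup₂ (f := fun (u : Test d) (_ : ‖u.l2‖ ≤ 1) => ‖inner ℂ (sobM d j u).l2 ψ‖ₑ) u hu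

theorem le_traceNorm (γ : L2 d →L[ℂ] L2 d) {n : ℕ} {u w : Fin n → Test d}
    (hu : Orthonormal ℂ fun i => (u i).l2) (hw : Orthonormal ℂ fun i => (w i).l2) :
    ∑ i, ‖inner ℂ (sobM d j (u i)).l2 (γ (sobM d j (w i)).l2)‖ₑ ≤ traceNorm j γ :=
  (le_iSup₂ (f := fun (_ : Orthonormal ℂ fun i => (u i).l2) (_ : Orthonormal ℂ fun i => (w i).l2) =>
    ∑ i, ‖inner ℂ (sobM d j (u i)).l2 (γ (sobM d j (w i)).l2)‖ₑ) hu hw).trans <|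
  (le_iSup₂ (f := fun (u w : Fin n → Test d) => ⨆ (_ : Orthonormal ℂ fun i => (u i).l2)
    (_ : Orthonormal ℂ fun i => (w i).l2),
    ∑ i, ‖inner ℂ (sobM d j (u i)).l2 (γ (sobM d j (w i)).l2)‖ₑ) u w).trans <|
  le_iSup (fun n : ℕ => ⨆ (u : Fin n → Test d) (w : Fin n → Test d)
    (_ : Orthonormal ℂ fun i => (u i).l2) (_ : Orthonormal ℂ fun i => (w i).l2),
    ∑ i, ‖inner ℂ (sobM d j (u i)).l2 (γ (sobM d j (w i)).l2)‖ₑ) n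

theorem traceNorm_add_le (γ δ : L2 d →L[ℂ] L2 d) :
    traceNorm j (γ + δ) ≤ traceNorm j γ + traceNorm j δ := by
  refine iSup_le fun n => iSup₂_le fun u w => iSup₂_le fun hu hw => ?_
  refine le_trans (Finset.sum_le_sum fun i _ => ?_)
    (Finset.sum_add_distrib.trans_le (add_le_add (le_traceNorm γ hu hw) (le_traceNorm δ hu hw)))
  rw [add_apply, inner_add_right]
  exact enorm_add_le _ _

/-- A triangle inequality with a factor 2 follows directly from the elementary inequality for
squares and is sufficient for local boundedness. -/
theorem hsNorm_add_le (σ τ : L2 d →L[ℂ] L2 d) :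
    hsNorm j (σ + τ) ≤ 2 * (hsNorm j σ + hsNorm j τ) := by
  set A : (L2 d →L[ℂ] L2 d) → ℝ≥0∞ := fun σ => ⨆ (n : ℕ) (w : Fin n → Test d)
    (_ : Orthonormal ℂ fun i => (w i).l2), ∑ i, ‖σ (sobM d j (w i)).l2‖ₑ ^ 2 with hA
  have le_A : ∀ (σ : L2 d →L[ℂ] L2 d) (n : ℕ) (w : Fin n → Test d)
      (_ : Orthonormal ℂ fun i => (w i).l2), ∑ i, ‖σ (sobM d j (w i)).l2‖ₑ ^ 2 ≤ A σ :=
    fun σ n w hw => (le_iSup₂ (f := fun (w : Fin n → Test d)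
      (_ : Orthonormal ℂ fun i => (w i).l2) => ∑ i, ‖σ (sobM d j (w i)).l2‖ₑ ^ 2) w hw).trans
        (le_iSup (fun n : ℕ => ⨆ (w : Fin n → Test d)
    (_ : Orthonormal ℂ fun i => (w i).l2), ∑ i, ‖σ (sobM d j (w i)).l2‖ₑ ^ 2) n)
  have h1 : A (σ + τ) ≤ 2 ^ (2 : ℝ) * (A σ + A τ) := by
    refine iSup_le fun n => iSup₂_le fun w hw => ?_
    refine le_trans ?_ (mul_le_mul_right (add_le_add (le_A σ n w hw) (le_A τ n w hw)) _)
    rw [← Finset.sum_add_distrib, Finset.mul_sum]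
    refine Finset.sum_le_sum fun i _ => ?_
    rw [add_apply]
    refine (pow_le_pow_left' (enorm_add_le _ _) 2).trans ?_
    have := ENNReal.rpow_add_le_mul_rpow_add_rpow (‖σ (sobM d j (w i)).l2‖ₑ)
      (‖τ (sobM d j (w i)).l2‖ₑ) (p := 2) (by norm_num)
    simp only [ENNReal.rpow_ofNat] at this ⊢
    refine this.trans ?_
    gcongr
    rw [← ENNReal.rpow_ofNat]
    exact ENNReal.rpow_le_rpow_of_exponent_le (by norm_num) (by norm_num)
  refine (ENNReal.rpow_le_rpow h1 (by norm_num : (0 : ℝ) ≤ 1 / 2)).trans ?_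
  rw [ENNReal.mul_rpow_of_nonneg _ _ (by norm_num), ← ENNReal.rpow_mul]
  norm_num
  gcongr
  have := ENNReal.rpow_add_le_add_rpow (A σ) (A τ) (by norm_num : (0 : ℝ) ≤ 1 / 2) (by norm_num)
  simpa [hsNorm] using this

theorem XNorm_add_le (μ ν : Triple d) : XNorm j (μ + ν) ≤ 2 * (XNorm j μ + XNorm j ν) := by
  have h1 := sobNorm_add_le (j := j) μ.1 ν.1
  have h2 := traceNorm_add_le (j := j) μ.2.1 ν.2.1
  have h3 := hsNorm_add_le (j := j) μ.2.2 ν.2.2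
  have h4 := hsNorm_add_le (j := j) (ContinuousLinearMap.adjoint μ.2.2)
    (ContinuousLinearMap.adjoint ν.2.2)
  rw [← map_add] at h4
  have two : ∀ x : ℝ≥0∞, x ≤ 2 * x := fun x => by rw [two_mul]; exact le_self_add
  refine (add_le_add (add_le_add (add_le_add (h1.trans (two _)) (h2.trans (two _))) h4) h3).trans
    (le_of_eq ?_)
  rw [XNorm, XNorm]
  ring

/-- Continuity bounds the norm near each time, and compactness of the interval makes the bound
uniform. -/
theorem exists_XNorm_bound {I : Set ℝ} (hI : I.OrdConnected) {μ : ℝ → Triple d}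
    (hX : MemXFamily j I μ) {s t : ℝ} (hs : s ∈ I) (ht : t ∈ I) :
    ∃ R : ℝ, 0 ≤ R ∧ ∀ r ∈ Set.Icc s t, XNorm j (μ r) ≤ ENNReal.ofReal R := by
  have hsub : Set.Icc s t ⊆ I := hI.out hs ht
  refine (isCompact_Icc (a := s) (b := t)).induction_on (p := fun S => ∃ R : ℝ, 0 ≤ R ∧ ∀ r ∈ S,
    XNorm j (μ r) ≤ ENNReal.ofReal R) ⟨0, le_rfl, by simp⟩ ?_ ?_ ?_
  · rintro S S' hS ⟨R, hR, h⟩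
    exact ⟨R, hR, fun r hr => h r (hS hr)⟩
  · rintro S S' ⟨R, hR, h⟩ ⟨R', hR', h'⟩
    refine ⟨max R R', le_max_of_le_left hR, fun r hr => ?_⟩
    rcases hr with hr | hr
    · exact (h r hr).trans (ENNReal.ofReal_le_ofReal (le_max_left _ _))
    · exact (h' r hr).trans (ENNReal.ofReal_le_ofReal (le_max_right _ _))
  · intro r hr
    obtain ⟨⟨h1, -⟩, h2⟩ := hX.1 r (hsub hr)
    have h3 : ∀ᶠ q in 𝓝[Set.Icc s t] r, XNorm j (μ q - μ r) < 1 :=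
      (h2.mono_left (nhdsWithin_mono _ hsub)).eventually (gt_mem_nhds zero_lt_one)
    refine ⟨_, h3, (2 * (1 + XNorm j (μ r))).toReal, ENNReal.toReal_nonneg, fun q hq => ?_⟩
    rw [ENNReal.ofReal_toReal (ENNReal.mul_ne_top (by simp)
      (ENNReal.add_ne_top.2 ⟨by simp, h1.ne⟩))]
    have h4 := XNorm_add_le (j := j) (μ q - μ r) (μ r)
    rw [sub_add_cancel] at h4
    refine h4.trans ?_
    gcongr
    exact le_of_lt hq

/-! ### Expectations -/

theorem Quasifree.hasExp {ω : State d} (Q : Quasifree ω) {B : Op d} {Y : G d}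
    (hY : ∀ k, B (Q.W [] k) (Y k)) : HasExp ω B (inner ℂ (Q.W []) Y) := by
  refine ⟨fun k => Y k, fun k => ?_, ?_⟩
  · rw [← Q.W_nil]; exact hY k
  · have h := G.hasSum_inner (Q.W []) Y
    simp only [Q.W_nil] at h
    exact h

theorem HasExp.unique {ω : State d} {B : Op d} (hB : ∀ ξ η η', B ξ η → B ξ η' → η = η') {z z' : ℂ}
    (h : HasExp ω B z) (h' : HasExp ω B z') : z = z' := by
  obtain ⟨η, h1, h2⟩ := h
  obtain ⟨η', h3, h4⟩ := h'
  obtain rfl : η = η' := funext fun k => hB _ _ _ (h1 k) (h3 k)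
  exact h2.unique h4

/-- Weakly defined operators have unique values, so any witness of the commutator expectation
consists of the vectors already constructed. -/
theorem Quasifree.commExp_eq {ω : State d} (Q : Quasifree ω) {V v : Pt d → ℝ} {η : G d}
    (hη : ∀ k, hamOp V v (Q.W [] k) (η k)) {w : List (FieldOp d)} {z : ℂ}
    (hz : HasCommExp ω (wordOp w) (wordOp (adjWord w)) (hamOp V v) z) :
    z = inner ℂ (Q.W (adjWord w)) η - inner ℂ η (Q.W w) := by
  obtain ⟨α, α', η', h1, h2, h3, h4⟩ := hz
  have e1 : ∀ k, α k = Q.W w k := fun k => wordOp_unique (h1 k) (Q.word w k)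
  have e2 : ∀ k, α' k = Q.W (adjWord w) k := fun k => wordOp_unique (h2 k) (Q.word _ k)
  have e3 : ∀ k, η' k = η k := fun k => hamOp_unique (h3 k) (by rw [← Q.W_nil]; exact hη k)
  simp only [e1, e2, e3] at h4
  exact h4.unique ((G.hasSum_inner _ _).sub (G.hasSum_inner _ _))

theorem exists_quasifreeFlow {V v : Pt d → ℝ} {I : Set ℝ} (hI : I.OrdConnected)
    {ω : ℝ → State d} {μ : ℝ → Triple d} (hμ : ∀ t ∈ I, (ω t).HasMoments (μ t))
    (hX : MemXFamily j I μ) (hω : SolvesQuasifreeEq V v I ω) (Q : ∀ r, Quasifree (ω r))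
    (h : ∀ r, totalWeight j ((Q r).W []) ≠ ⊤) {B : L2 d →L[ℂ] L2 d}
    {B₂ : H (Pt d × Pt d) →L[ℂ] H (Pt d × Pt d)}
    (symm : ∀ u w, inner ℂ (resolv d j u) (B w) = inner ℂ (B u) (resolv d j w))
    (symm₂ : ∀ u w, inner ℂ (pairResolv d j u) (B₂ w) = inner ℂ (B₂ u) (pairResolv d j w))
    (hη : ∀ r k, hamOp V v ((Q r).W [] k) (hamVec (h r) B B₂ k)) {s t : ℝ} (hs : s ∈ I) (ht : t ∈ I)
    (hst : s ≤ t) : ∃ D : ℝ≥0, QuasifreeFlow Q h B B₂ D s t := by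
  obtain ⟨R, hR, hR'⟩ := exists_XNorm_bound hI hX hs ht
  have hsub : Set.Icc s t ⊆ I := hI.out hs ht
  obtain ⟨D, hD⟩ := exists_totalWeight_bound d j hR
  refine ⟨D, hst, fun r hr => hD _ _ _ (hμ r (hsub hr)) (hX.1 r (hsub hr)).1 (hR' r hr), symm, symm₂,
    fun w hw r hr => ?_⟩
  obtain ⟨m, hm, hm'⟩ := hω w hw
  obtain ⟨z, hz, hz'⟩ := hm' r (hsub hr)
  rw [(Q r).commExp_eq (hη r) hz] at hz'
  exact (hz'.mono hsub).congr (fun q hq => ((Q q).eq_m (hm q (hsub hq))).symm)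
    ((Q r).eq_m (hm r (hsub hr))).symm

theorem eq_of_flow {I : Set ℝ} {ω : ℝ → State d} {Q : ∀ r, Quasifree (ω r)}
    {h : ∀ r, totalWeight j ((Q r).W []) ≠ ⊤} {B : L2 d →L[ℂ] L2 d}
    {B₂ : H (Pt d × Pt d) →L[ℂ] H (Pt d × Pt d)}
    (hflow : ∀ s ∈ I, ∀ t ∈ I, s ≤ t → ∃ D : ℝ≥0, QuasifreeFlow Q h B B₂ D s t) {F : ℝ → ℂ}
    (hF : ∀ s t D, QuasifreeFlow Q h B B₂ D s t → F t = F s) {s t : ℝ} (hs : s ∈ I) (ht : t ∈ I) :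
    F t = F s := by
  rcases le_total s t with hst | hst
  · obtain ⟨D, hD⟩ := hflow s hs t ht hst
    exact hF s t D hD
  · obtain ⟨D, hD⟩ := hflow t ht s hs hst
    exact (hF t s D hD).symm

theorem exists_real_of_conj_eq {z : ℂ} (h : conj z = z) : ∃ x : ℝ, z = x :=
  ⟨z.re, (Complex.conj_eq_iff_re.1 h).symm⟩

/-- Conservation laws, the expectation of the energy being left in the form of an inner product. -/
theorem conservation (hj : 2 ≤ j) {V v : Pt d → ℝ} (hVm : Measurable V)
    (hV : InfinitesimallyLaplaceBounded V) (hvm : Measurable v) (hv : InfinitesimallyLaplaceBounded v)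
    {I : Set ℝ} (hI : I.OrdConnected) {ω : ℝ → State d} {μ : ℝ → Triple d}
    (hqf : ∀ t ∈ I, (ω t).IsQuasifree) (hμ : ∀ t ∈ I, (ω t).HasMoments (μ t))
    (hX : MemXFamily j I μ) (hω : SolvesQuasifreeEq V v I ω) :
    (∀ A : QuadObs d j, FormCommute A.op A.adjoint.op (hamOp V v) →
      ∃ z : ℂ, ∀ t ∈ I, HasExp (ω t) A.op z) ∧
    (∃ N : ℝ, ∀ t ∈ I, HasExp (ω t) (numberOp d) N) ∧
    (∃ E : ℝ, ∀ t ∈ I, HasExp (ω t) (hamOp V v) E) := by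
  rcases I.eq_empty_or_nonempty with rfl | ⟨t₀, ht₀⟩
  · exact ⟨fun A _ => ⟨0, by simp⟩, ⟨0, by simp⟩, ⟨0, by simp⟩⟩
  classical
  -- Outside I the state is replaced by its value at t₀, so that moments and weights are available
  -- for every real time.
  obtain ⟨ω', hω', hω''⟩ : ∃ ω' : ℝ → State d, (∀ t ∈ I, ω' t = ω t) ∧ ∀ r, ∃ t ∈ I, ω' r = ω t :=
    ⟨fun r => if r ∈ I then ω r else ω t₀, fun t ht => if_pos ht, fun r => by
      by_cases hr : r ∈ I
      · exact ⟨r, hr, if_pos hr⟩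
      · exact ⟨t₀, ht₀, if_neg hr⟩⟩
  have hQ : ∀ r, Nonempty (Quasifree (ω' r)) := fun r => by
    obtain ⟨t, ht, e⟩ := hω'' r
    rw [e]
    exact (hqf t ht).nonempty
  let Q : ∀ r, Quasifree (ω' r) := fun r => (hQ r).some
  have h : ∀ r, totalWeight j ((Q r).W []) ≠ ⊤ := fun r => by
    obtain ⟨t, ht, e⟩ := hω'' r
    obtain ⟨D, hD⟩ := exists_totalWeight_bound d j (ENNReal.toReal_nonneg (a := XNorm j (μ t)))
    have h1 := (hX.1 t ht).1
    exact ((hD _ (Q r) (μ t) (e ▸ hμ t ht) h1 (ENNReal.ofReal_toReal h1.1.ne).ge).trans_lt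
      ENNReal.coe_lt_top).ne
  obtain ⟨T, hT, hTs, hTb⟩ := exists_hamiltonian (d := d) hj hVm hV
  obtain ⟨B, hB, hB'⟩ := exists_kernel_of_bound (j := j) hTs hTb
  obtain ⟨B₂, hB₂⟩ := exists_pair_potential (d := d) hj hvm hv
  have hη : ∀ r k, hamOp V v ((Q r).W [] k) (hamVec (h r) B B₂ k) := fun r k =>
    hamOp_hamVec hT hB' hB₂ (h r) k
  have hflow : ∀ s ∈ I, ∀ t ∈ I, s ≤ t → ∃ D : ℝ≥0, QuasifreeFlow Q h B B₂ D s t :=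
    fun s hs t ht hst => exists_quasifreeFlow hI (fun t ht => (hω' t ht).symm ▸ hμ t ht) hX
      (fun w hw => by
        obtain ⟨m, h1, h2⟩ := hω w hw
        exact ⟨m, fun t ht => (hω' t ht).symm ▸ h1 t ht, fun t ht => (hω' t ht).symm ▸ h2 t ht⟩)
      Q h (kernel_pair hB' hB) (pair_potential_symm hB₂) hη hs ht hst
  obtain ⟨D₀, F₀⟩ := hflow t₀ ht₀ t₀ ht₀ le_rfl
  refine ⟨fun A hA => ?_, ?_, ?_⟩
  · obtain ⟨K, hK, hK'⟩ := exists_kernel_of_bound (j := j) A.adj_eq A.bound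
    obtain ⟨L, hL, hL'⟩ := exists_kernel_of_bound (j := j) A.adjoint.adj_eq A.bound_adj
    -- The commutation hypothesis is used only diagonally, with both vectors equal to ξ_k, and
    -- summed over k.
    have hc : ∀ r, inner ℂ (A.adjoint.vec L (h r)) (hamVec (h r) B B₂) =
        inner ℂ (hamVec (h r) B B₂) (A.vec K (h r)) := fun r => by
      have h1 := G.hasSum_inner (A.adjoint.vec L (h r)) (hamVec (h r) B B₂)
      refine h1.unique (Eq.mp ?_ (G.hasSum_inner (hamVec (h r) B B₂) (A.vec K (h r))))
      congr 1
      funext k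
      exact (hA _ _ _ _ _ _ _ _ (A.op_vec hK' (h r) k) (A.adjoint.op_vec hL' (h r) k) (hη r k)
        (A.op_vec hK' (h r) k) (A.adjoint.op_vec hL' (h r) k) (hη r k)).symm
    refine ⟨inner ℂ ((Q t₀).W []) (A.vec K (h t₀)), fun t ht => ?_⟩
    rw [← eq_of_flow (F := fun r => inner ℂ ((Q r).W []) (A.vec K (h r))) hflow (fun s t D S =>
      S.quadObs_const A (kernel_pair hK' hL) hc) ht₀ ht, ← hω' t ht]
    exact (Q t).hasExp (A.op_vec hK' (h t))
  · obtain ⟨N, hN⟩ : ∃ N : ℝ, inner ℂ ((Q t₀).W []) ((cell₁ d j).nvec (cell₁ d j) (h t₀)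
        (resolv d j)) = (N : ℂ) := by
      refine exists_real_of_conj_eq ?_
      rw [inner_conj_symm]
      refine G.inner_congr fun k m => ?_
      rw [comp_nvec_resolv, inner_smul_left, inner_smul_right, Complex.conj_natCast]
    refine ⟨N, fun t ht => ?_⟩
    rw [← hN, ← eq_of_flow (F := fun r => inner ℂ ((Q r).W []) ((cell₁ d j).nvec (cell₁ d j) (h r)
      (resolv d j))) hflow (fun s t D S => S.number_const) ht₀ ht, ← hω' t ht]
    exact (Q t).hasExp (numberOp_nvec (h t))
  · obtain ⟨E, hE⟩ : ∃ E : ℝ, inner ℂ ((Q t₀).W []) (hamVec (h t₀) B B₂) = (E : ℂ) := by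
      refine exists_real_of_conj_eq ?_
      rw [inner_conj_symm]
      exact (F₀.inner_symm t₀).symm
    refine ⟨E, fun t ht => ?_⟩
    rw [← hE, ← eq_of_flow (F := fun r => inner ℂ ((Q r).W []) (hamVec (h r) B B₂)) hflow
      (fun s t D S => S.energy_const) ht₀ ht, ← hω' t ht]
    exact (Q t).hasExp (hη t)

end HFB
end

/-! ### Square-summable families and factorization of φ, γ and σ through R. -/

noncomputable section

namespace HFB

variable {d j : ℕ}

/-! ### Square-summable families -/

/-- The family is square-summable. -/
def SqSum {ι E : Type*} [NormedAddCommGroup E] (a : ι → E) : Prop := ∑' i, ‖a i‖ₑ ^ 2 ≠ ⊤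

theorem SqSum.map {ι E F : Type*} [NormedAddCommGroup E] [NormedSpace ℂ E] [NormedAddCommGroup F]
    [NormedSpace ℂ F] {a : ι → E} (h : SqSum a) (T : E →L[ℂ] F) : SqSum fun i => T (a i) := by
  refine ne_top_of_le_ne_top (ENNReal.mul_ne_top (a := ‖T‖ₑ ^ 2) (by simp) h) ?_
  rw [← ENNReal.tsum_mul_left]
  refine ENNReal.tsum_le_tsum fun i => ?_
  rw [← mul_pow]
  exact pow_le_pow_left' (T.le_opENorm _) 2

theorem mul_le_sq_add_sq (x y : ℝ≥0∞) : x * y ≤ x ^ 2 + y ^ 2 := by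
  rcases le_total x y with h | h
  · exact (mul_le_mul_left h y).trans ((sq y).ge.trans le_add_self)
  · exact (mul_le_mul_right h x).trans ((sq x).ge.trans le_self_add)

theorem SqSum.mul {ι E F : Type*} [NormedAddCommGroup E] [NormedAddCommGroup F] {a : ι → E}
    {b : ι → F} (ha : SqSum a) (hb : SqSum b) : ∑' i, ‖a i‖ₑ * ‖b i‖ₑ ≠ ⊤ := by
  refine ne_top_of_le_ne_top (ENNReal.add_ne_top.2 ⟨ha, hb⟩) ?_
  rw [← ENNReal.tsum_add]
  exact ENNReal.tsum_le_tsum fun i => mul_le_sq_add_sq _ _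

/-- The sum of squares is the double sum of the squared matrix elements, which is unchanged by
transposition and conjugation. -/
theorem SqSum.adjoint {ι E : Type*} [NormedAddCommGroup E] [InnerProductSpace ℂ E]
    [CompleteSpace E] (b : HilbertBasis ι ℂ E) {D : E →L[ℂ] E} (h : SqSum fun i => D (b i)) :
    SqSum fun i => ContinuousLinearMap.adjoint D (b i) := by
  have e : ∀ D : E →L[ℂ] E, ∑' i, ‖D (b i)‖ₑ ^ 2 = ∑' i, ∑' k, ‖(inner ℂ (b k) (D (b i)) : ℂ)‖ₑ ^ 2 :=
    fun D => by simp_rw [tsum_enorm_sq_hilbertBasis]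
  unfold SqSum at h ⊢
  rw [e] at h ⊢
  rw [ENNReal.tsum_comm]
  convert h using 6 with i k
  rw [ContinuousLinearMap.adjoint_inner_right, ← inner_conj_symm, RCLike.enorm_conj]

/-! ### Trace class operators -/

theorem l2_sobM_zero (u : Test d) : (sobM d 0 u).l2 = u.l2 := by
  have h : (fun k : Pt d => ((sobSymbol d 0 k : ℝ) : ℂ)) = fun _ => 1 := by
    funext k
    simp [sobSymbol]
  rw [sobM, h, SchwartzMap.fourierMultiplierCLM_const]
  simp

theorem sum_enorm_sq_inner_le {n : ℕ} {E : Type*} [NormedAddCommGroup E] [InnerProductSpace ℂ E]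
    {u : Fin n → E} (hu : Orthonormal ℂ u) (x : E) :
    ∑ i, ‖(inner ℂ (u i) x : ℂ)‖ₑ ^ 2 ≤ ‖x‖ₑ ^ 2 := by
  have h := hu.sum_inner_products_le x (s := Finset.univ)
  have h2 := ENNReal.ofReal_le_ofReal h
  rw [ENNReal.ofReal_sum_of_nonneg (fun _ _ => by positivity)] at h2
  simpa [ENNReal.ofReal_pow, ofReal_norm] using h2

/-- A sum of rank-one operators built from square-summable families is trace class. -/
theorem isTrace_of_hasSum {κ : Type*} {a b : κ → L2 d} (ha : SqSum a) (hb : SqSum b)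
    {S : L2 d →L[ℂ] L2 d} (hS : ∀ u, HasSum (fun k => (inner ℂ (b k) u : ℂ) • a k) (S u)) :
    IsTrace S (∑' k, inner ℂ (b k) (a k)) := by
  have hi : ∀ u w, HasSum (fun k => inner ℂ (b k) w * inner ℂ u (a k)) (inner ℂ u (S w)) := fun u w => by
    simpa only [innerSL_apply_apply, inner_smul_right] using (hS w).mapL (innerSL ℂ u)
  have hab : ∑' k, (‖b k‖ₑ ^ 2 + ‖a k‖ₑ ^ 2) ≠ ⊤ := by
    rw [ENNReal.tsum_add]
    exact ENNReal.add_ne_top.2 ⟨hb, ha⟩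
  refine ⟨lt_of_le_of_lt ?_ (lt_top_iff_ne_top.2 hab), fun ι e => ?_⟩
  · refine iSup_le fun n => iSup₂_le fun u w => iSup₂_le fun hu hw => ?_
    simp only [l2_sobM_zero]
    calc ∑ i, ‖inner ℂ (u i).l2 (S (w i).l2)‖ₑ
        ≤ ∑ i, ∑' k, (‖(inner ℂ (w i).l2 (b k) : ℂ)‖ₑ ^ 2 + ‖(inner ℂ (u i).l2 (a k) : ℂ)‖ₑ ^ 2) := by
          refine Finset.sum_le_sum fun i _ => ?_
          rw [← (hi _ _).tsum_eq]
          refine enorm_tsum_le_tsum_enorm.trans (ENNReal.tsum_le_tsum fun k => ?_)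
          rw [enorm_mul, ← inner_conj_symm, RCLike.enorm_conj]
          exact mul_le_sq_add_sq _ _
      _ = ∑' k, ∑ i, (‖(inner ℂ (w i).l2 (b k) : ℂ)‖ₑ ^ 2 + ‖(inner ℂ (u i).l2 (a k) : ℂ)‖ₑ ^ 2) :=
          (Summable.tsum_finsetSum fun _ _ => ENNReal.summable).symm
      _ ≤ _ := by
          refine ENNReal.tsum_le_tsum fun k => ?_
          rw [Finset.sum_add_distrib]
          exact add_le_add (sum_enorm_sq_inner_le hw _) (sum_enorm_sq_inner_le hu _)
  -- Absolute convergence of the double series over the basis and the rank-one decomposition allows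
  -- evaluating it in either order; this makes the trace independent of the basis.
  · have hsum : Summable fun p : ι × κ => inner ℂ (b p.2) (e p.1) * inner ℂ (e p.1) (a p.2) := by
      refine Summable.of_enorm (ne_top_of_le_ne_top hab ?_)
      rw [ENNReal.tsum_prod (f := fun (i : ι) (k : κ) =>
        ‖inner ℂ (b k) (e i) * inner ℂ (e i) (a k)‖ₑ), ENNReal.tsum_comm]
      refine ENNReal.tsum_le_tsum fun k => ?_
      rw [← tsum_enorm_sq_hilbertBasis e (b k), ← tsum_enorm_sq_hilbertBasis e (a k),
        ← ENNReal.tsum_add]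
      refine ENNReal.tsum_le_tsum fun i => ?_
      rw [enorm_mul, ← inner_conj_symm, RCLike.enorm_conj]
      exact mul_le_sq_add_sq _ _
    have h1 := hsum.hasSum.prod_fiberwise fun i => hi (e i) (e i)
    have h2 := ((Equiv.prodComm κ ι).hasSum_iff.2 hsum.hasSum).prod_fiberwise fun k =>
      e.hasSum_inner_mul_inner (b k) (a k)
    rwa [h2.tsum_eq]

theorem IsTrace.add {S S' : L2 d →L[ℂ] L2 d} {τ τ' : ℂ} (h : IsTrace S τ) (h' : IsTrace S' τ') :
    IsTrace (S + S') (τ + τ') := by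
  refine ⟨(traceNorm_add_le S S').trans_lt (ENNReal.add_lt_top.2 ⟨h.1, h'.1⟩), fun ι e => ?_⟩
  simpa only [add_apply, inner_add_right] using (h.2 ι e).add (h'.2 ι e)

/-! ### Regularity of truncated expectations -/

/-- An operator that is Hilbert-Schmidt after composition with `M^j`. -/
theorem exists_hilbertSchmidt {A : L2 d →L[ℂ] L2 d} {R : ℝ}
    (hA : ∀ {K : Type} [Fintype K] {u : K → Test d}, Orthonormal ℂ (fun i => (u i).l2) →
      ∑ i, ‖A (sobM d j (u i)).l2‖ ^ 2 ≤ R) :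
    ∃ D : L2 d →L[ℂ] L2 d, (∀ u, A u = D (resolv d j u)) ∧ SqSum fun i => D ((basis d j).b i) := by
  have hR : 0 ≤ R := by simpa using hA (K := Empty) (u := Empty.elim) (by simp [Orthonormal])
  -- One-element families bound A M^j on test functions, so it extends to a bounded operator D;
  -- larger families then give the Hilbert-Schmidt property.
  obtain ⟨D, hD, -⟩ := exists_extension (A.toLinearMap ∘ₗ Test.toL2 d ∘ₗ (sobM d j).toLinearMap) (√R)
    fun w => by
      change ‖A (sobM d j w).l2‖ ≤ _
      rcases eq_or_ne w.l2 0 with h0 | h0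
      · have : w = 0 := Test.l2_injective (by
          change w.l2 = (0 : Test d).l2
          rw [h0, ← Test.toL2_apply, map_zero])
        rw [this, map_zero, ← Test.toL2_apply, map_zero, map_zero, norm_zero]
        positivity
      · have h3 : 0 < ‖w.l2‖ := norm_pos_iff.2 h0
        have h1 := hA (K := Unit) (u := fun _ => ((‖w.l2‖⁻¹ : ℝ) : ℂ) • w) (by
          refine ⟨fun _ => ?_, fun i k hik => (hik (Subsingleton.elim _ _)).elim⟩
          rw [Test.l2_smul, norm_smul]
          simp [h0])
        simp only [Finset.univ_unique, Finset.sum_singleton, map_smul, Test.l2_smul, norm_smul,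
          Complex.norm_real, norm_inv, norm_norm] at h1
        refine le_of_sq_le_sq ?_ (by positivity)
        rw [mul_pow, inv_pow, inv_mul_le_iff₀ (by positivity)] at h1
        rw [mul_pow, Real.sq_sqrt hR]
        linarith
  refine ⟨D, fun u => ?_, ?_⟩
  · refine (Test.denseRange_l2 d).induction_on (p := fun u : L2 d => A u = D (resolv d j u)) u
      (isClosed_eq (by fun_prop) (by fun_prop)) fun f => ?_
    rw [resolv_test, hD]
    change _ = A (sobM d j (besselM d (-j) f)).l2
    rw [sobM_besselM_neg]
  · refine ne_top_of_le_ne_top (ENNReal.ofReal_ne_top (r := R)) ?_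
    rw [ENNReal.tsum_eq_iSup_sum]
    refine iSup_le fun s => ?_
    have h1 := hA (K := s) (u := fun i => (basis d j).f i) (by
      simp only [(basis d j).hf]
      exact (basis d j).b.orthonormal.comp _ Subtype.val_injective)
    have h2 := ENNReal.ofReal_le_ofReal h1
    rw [ENNReal.ofReal_sum_of_nonneg (fun _ _ => by positivity),
      Finset.sum_coe_sort s fun i => ENNReal.ofReal (‖A (sobM d j ((basis d j).f i)).l2‖ ^ 2)] at h2
    refine le_trans (le_of_eq (Finset.sum_congr rfl fun i _ => ?_)) h2
    rw [ENNReal.ofReal_pow (norm_nonneg _), ofReal_norm]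
    change ‖D ((basis d j).b i)‖ₑ ^ 2 = _
    rw [← (basis d j).hf, hD]
    rfl

theorem exists_sobNorm_resolv {φ : L2 d} (h : sobNorm j φ ≠ ⊤) : ∃ φ', φ = resolv d j φ' := by
  have h1 : (basis d j).sobSq φ < ⊤ := by
    refine lt_of_le_of_lt ?_ (ENNReal.ofReal_lt_top (r := (sobNorm j φ).toReal ^ 2))
    rw [SobBasis.sobSq, ENNReal.tsum_eq_iSup_sum]
    refine iSup_le fun s => ?_
    have h1 := sum_sobNorm_le (u := fun i : s => (basis d j).f i) (j := j) (φ := φ) (by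
      simp only [(basis d j).hf]
      exact (basis d j).b.orthonormal.comp _ Subtype.val_injective) ENNReal.toReal_nonneg
      (ENNReal.ofReal_toReal h).ge
    have h2 := ENNReal.ofReal_le_ofReal h1
    rw [ENNReal.ofReal_sum_of_nonneg (fun _ _ => by positivity), Finset.sum_coe_sort s fun i =>
      ENNReal.ofReal (‖(inner ℂ (sobM d j ((basis d j).f i)).l2 φ : ℂ)‖ ^ 2)] at h2
    refine le_trans (le_of_eq (Finset.sum_congr rfl fun i _ => ?_)) h2
    rw [ENNReal.ofReal_pow (norm_nonneg _), ofReal_norm]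
  obtain ⟨χ, h2, -⟩ := (basis d j).exists_of_sobSq h1
  exact ⟨χ, h2⟩

theorem exists_sqrt {E : Type*} [NormedAddCommGroup E] [InnerProductSpace ℂ E] [CompleteSpace E]
    {T : E →L[ℂ] E} (hT : T.IsPositive) :
    ∃ g : E →L[ℂ] E, ∀ u w, inner ℂ u (T w) = inner ℂ (g u) (g w) := by
  refine ⟨CFC.sqrt T, fun u w => ?_⟩
  have h1 : CFC.sqrt T * CFC.sqrt T = T :=
    CFC.sqrt_mul_sqrt_self T ((ContinuousLinearMap.nonneg_iff_isPositive T).2 hT)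
  have h2 : ContinuousLinearMap.adjoint (CFC.sqrt T) = CFC.sqrt T :=
    ((ContinuousLinearMap.nonneg_iff_isPositive _).1 (CFC.sqrt_nonneg T)).isSelfAdjoint
  conv_lhs => rw [← h1]
  change inner ℂ u (CFC.sqrt T (CFC.sqrt T w)) = _
  rw [← ContinuousLinearMap.adjoint_inner_left, h2]

/-- With g = √γ one has ‖g M^j u‖² = ⟨M^j u, γ M^j u⟩, so the trace norm bound makes D = g M^j
Hilbert-Schmidt, and γ = g² = R D* D R. -/
theorem exists_traceNorm_resolv {γ : L2 d →L[ℂ] L2 d} (hγ : γ.IsPositive) (h : traceNorm j γ ≠ ⊤) :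
    ∃ D : L2 d →L[ℂ] L2 d,
      (∀ u, γ u = resolv d j (ContinuousLinearMap.adjoint D (D (resolv d j u)))) ∧
      SqSum fun i => ContinuousLinearMap.adjoint D ((basis d j).b i) := by
  obtain ⟨g, hgi⟩ := exists_sqrt hγ
  obtain ⟨D, hD, hD'⟩ := exists_hilbertSchmidt (j := j) (A := g) (R := (traceNorm j γ).toReal)
    fun {K} _ {u} hu => by
      refine le_trans (le_of_eq (Finset.sum_congr rfl fun i _ => ?_))
        (sum_traceNorm_le hu ENNReal.toReal_nonneg (ENNReal.ofReal_toReal h).ge)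
      rw [hgi, inner_self_eq_norm_sq_to_K]
      simp
  refine ⟨D, fun u => ext_inner_left ℂ fun w => ?_, SqSum.adjoint _ hD'⟩
  rw [hgi, hD, hD, ← inner_resolv, ContinuousLinearMap.adjoint_inner_right]

/-- The kernel of a Hilbert-Schmidt operator. -/
theorem exists_kernel {D : L2 d →L[ℂ] L2 d} (h : SqSum fun i => D ((basis d j).b i)) :
    ∃ K : H (Pt d × Pt d), ∀ f g : L2 d, inner ℂ (tmul f g) K = inner ℂ f (D (star g)) := by
  set b := (basis d j).b
  have h0 : OrthogonalFamily ℂ (fun _ : (basis d j).ι => L2 d) (fun i =>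
      ({ toLinearMap := (tmulL.flip (star (b i))).toLinearMap
         norm_map' := fun f => by
           change ‖tmul f (star (b i))‖ = ‖f‖
           rw [norm_tmul, norm_star_l2, b.orthonormal.1, mul_one] } :
        L2 d →ₗᵢ[ℂ] H (Pt d × Pt d))) := fun i k hik f g => by
    change inner ℂ (tmul f (star (b i))) (tmul g (star (b k))) = 0
    rw [inner_tmul_tmul, inner_star_star, b.orthonormal.2 hik.symm, mul_zero]
  have h1 : Summable fun i => tmul (D (b i)) (star (b i)) :=
    (h0.summable_iff_norm_sq_summable fun i => D (b i)).2 (by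
      refine (ENNReal.summable_toReal h).congr fun i => ?_
      simp)
  refine ⟨∑' i, tmul (D (b i)) (star (b i)), fun f g => ?_⟩
  have h2 := b.hasSum_inner_mul_inner (ContinuousLinearMap.adjoint D f) (star g)
  rw [ContinuousLinearMap.adjoint_inner_left] at h2
  refine (h1.hasSum.mapL (innerSL ℂ (tmul f g))).unique (Eq.mp ?_ h2)
  congr 1
  funext i
  rw [innerSL_apply_apply, inner_tmul_tmul, ContinuousLinearMap.adjoint_inner_left]
  congr 1
  rw [← inner_star_star, star_star]

/-- σ* M^j extends to a Hilbert-Schmidt operator D. Its adjoint, formally M^j σ, has a kernel K, and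
σ then has the kernel (R ⊗ 1)K. -/
theorem exists_hsNorm_resolv {σ : L2 d →L[ℂ] L2 d}
    (h : hsNorm j (ContinuousLinearMap.adjoint σ) ≠ ⊤) : ∃ K : H (Pt d × Pt d),
      ∀ f g : L2 d, inner ℂ (tmul f g) (pairResolv d j K) = inner ℂ f (σ (star g)) := by
  obtain ⟨D, hD, hD'⟩ := exists_hilbertSchmidt (j := j) (A := ContinuousLinearMap.adjoint σ)
    fun {K} _ {u} hu => sum_hsNorm_le hu ENNReal.toReal_nonneg (ENNReal.ofReal_toReal h).ge
  obtain ⟨K, hK⟩ := exists_kernel (SqSum.adjoint _ hD')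
  refine ⟨K, fun f g => ?_⟩
  rw [← ContinuousLinearMap.adjoint_inner_left, adjoint_pairResolv, pairResolv_tmul, hK,
    ContinuousLinearMap.adjoint_inner_right, ← hD, ContinuousLinearMap.adjoint_inner_left]

end HFB
end

/-! ### Diagonals, kernels and mean fields. -/

noncomputable section

namespace HFB

variable {d j : ℕ}

/-! # Pointwise sums of products of square-summable families -/

section

variable {Ω ι : Type} [MeasureSpace Ω] {a b : ι → H Ω}

theorem tsum_lintegral_ne_top (ha : SqSum a) (hb : SqSum b) :
    ∑' i, ∫⁻ p, ‖conj (a i p) * b i p‖ₑ ≠ ⊤ := by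
  refine ne_top_of_le_ne_top (ENNReal.add_ne_top.2 ⟨ha, hb⟩) ?_
  rw [← ENNReal.tsum_add]
  refine ENNReal.tsum_le_tsum fun i => ?_
  rw [H.enorm_sq, H.enorm_sq,
    ← lintegral_add_left' ((Lp.aestronglyMeasurable (a i)).enorm.pow_const 2)]
  refine lintegral_mono fun p => ?_
  rw [enorm_mul, RCLike.enorm_conj]
  exact mul_le_sq_add_sq _ _

variable [Countable ι]

theorem integrable_tsum_conj_mul (ha : SqSum a) (hb : SqSum b) :
    Integrable fun p => ∑' i, conj (a i p) * b i p := by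
  have hm : ∀ i, AEStronglyMeasurable (fun p => conj (a i p) * b i p) volume := fun i =>
    (H.integrable (a i) (b i)).1
  have h1 : ∫⁻ p, ∑' i, ‖conj (a i p) * b i p‖ₑ ≠ ⊤ := by
    rw [lintegral_tsum fun i => (hm i).enorm]
    exact tsum_lintegral_ne_top ha hb
  refine ⟨?_, lt_of_le_of_lt (lintegral_mono fun p => enorm_tsum_le_tsum_enorm)
    (lt_top_iff_ne_top.2 h1)⟩
  refine aestronglyMeasurable_of_tendsto_ae (atTop : Filter (Finset ι))
    (f := fun s p => ∑ i ∈ s, conj (a i p) * b i p) (fun s => ?_) ?_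
  · exact Finset.aestronglyMeasurable_fun_sum s fun i _ => hm i
  · filter_upwards [ae_lt_top' (AEMeasurable.tsum fun i => (hm i).enorm) h1] with p hp
    exact (Summable.of_enorm hp.ne).hasSum

/-- Square summability of both families bounds the sum of the integrals of the absolute values, so
sum and integral may be exchanged. -/
theorem hasSum_inner_integral (ha : SqSum a) (hb : SqSum b) :
    HasSum (fun i => inner ℂ (a i) (b i)) (∫ p, ∑' i, conj (a i p) * b i p) := by
  have h1 := tsum_lintegral_ne_top ha hb
  rw [integral_tsum (fun i => (H.integrable (a i) (b i)).1) h1]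
  simp_rw [← H.inner_eq]
  refine Summable.hasSum (Summable.of_enorm (ne_top_of_le_ne_top h1 ?_))
  refine ENNReal.tsum_le_tsum fun i => ?_
  rw [H.inner_eq]
  exact enorm_integral_le_lintegral_enorm _

end

theorem exists_mulOp (χ : Test d) : ∃ m : L2 d →L[ℂ] L2 d,
    ∀ u, (m u : Pt d → ℂ) =ᵐ[volume] fun x => χ x * u x := by
  refine ⟨(ContinuousLinearMap.mul ℂ ℂ).holderL volume ⊤ 2 2 (χ.toLp ⊤ volume), fun u => ?_⟩
  filter_upwards [(ContinuousLinearMap.mul ℂ ℂ).coeFn_holder (r := 2) (χ.toLp ⊤ volume) u,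
    χ.coeFn_toLp ⊤ volume] with x h1 h2
  refine h1.trans ?_
  rw [h2]
  rfl

section Family

variable {ι : Type} {x : ι → L2 d} (hx : SqSum x) {α : L2 d →L[ℂ] L2 d}
  (hα : ∀ u, HasSum (fun i => (inner ℂ (x i) u : ℂ) • x i) (α u))

include hx hα in
theorem isTrace_comp (B : L2 d →L[ℂ] L2 d) :
    IsTrace (B ∘L α) (∑' i, inner ℂ (x i) (B (x i))) := by
  refine isTrace_of_hasSum (hx.map B) hx fun u => ?_
  simpa only [map_smul, ContinuousLinearMap.comp_apply] using (hα u).mapL B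

/-- The diagonal of the kernel `∑ᵢ |xᵢ⟩⟨xᵢ|`. -/
def diagonal (x : ι → L2 d) (p : Pt d) : ℂ := ∑' i, conj (x i p) * x i p

include hx hα in
theorem isDiagonal_diagonal [Countable ι] : IsDiagonal α (diagonal x) := by
  refine ⟨integrable_tsum_conj_mul hx hx, fun χ => ?_⟩
  obtain ⟨m, hm⟩ := exists_mulOp χ
  refine ⟨m ∘L α, fun u => hm _, ?_⟩
  have h1 := hasSum_inner_integral hx (hx.map m)
  have h2 : ∫ p, χ p * diagonal x p = ∫ p, ∑' i, conj (x i p) * m (x i) p := by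
    refine integral_congr_ae ?_
    filter_upwards [ae_all_iff.2 fun i => hm (x i)] with p hp
    rw [diagonal, ← tsum_mul_left]
    refine tsum_congr fun i => ?_
    rw [hp]
    ring
  rw [h2, ← h1.tsum_eq]
  exact isTrace_comp hx hα m

theorem summable_tmul_star (hx : SqSum x) : Summable fun i => tmul (x i) (star (x i)) := by
  refine Summable.of_norm_bounded (ENNReal.summable_toReal hx) fun i => ?_
  rw [norm_tmul, norm_star_l2, ← sq]
  simp

/-- The kernel of `∑ᵢ |xᵢ⟩⟨xᵢ|`. -/
def sumKernel (x : ι → L2 d) : H (Pt d × Pt d) := ∑' i, tmul (x i) (star (x i))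

theorem hasSum_inner_sumKernel (hx : SqSum x) (Φ : H (Pt d × Pt d)) :
    HasSum (fun i => inner ℂ Φ (tmul (x i) (star (x i)))) (inner ℂ Φ (sumKernel x)) :=
  (summable_tmul_star hx).hasSum.mapL (innerSL ℂ Φ)

theorem isKernel_of_inner {α : L2 d →L[ℂ] L2 d} {K : H (Pt d × Pt d)}
    (h : ∀ f g : L2 d, inner ℂ (tmul f g) K = inner ℂ f (α (star g))) : IsKernel α K := by
  refine ⟨Lp.memLp K, fun f g => ?_⟩
  rw [← star_star g.l2, ← h, inner_tmul_eq]
  refine integral_congr_ae ?_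
  filter_upwards [ae_prod_fst f.coeFn_l2, ae_prod_snd g.coeFn_l2,
    ae_prod_snd (Lp.coeFn_star g.l2)] with p h1 h2 h3
  rw [h1, h3, Pi.star_apply, h2]
  simp only [map_mul, RCLike.star_def, Complex.conj_conj]
  ring

include hx hα in
theorem isKernel_sumKernel : IsKernel α (sumKernel x) := by
  refine isKernel_of_inner fun f g => (hasSum_inner_sumKernel hx _).unique ?_
  have h1 := (hα (star g)).mapL (innerSL ℂ f)
  refine Eq.mp ?_ h1
  congr 1
  funext i
  rw [innerSL_apply_apply, inner_smul_right, inner_tmul_tmul, mul_comm]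
  congr 1
  rw [← inner_star_star, star_star]

end Family

/-! # Mean field operators -/

/-- Exchange of the two variables. -/
def swapL (d : ℕ) : H (Pt d × Pt d) →L[ℂ] H (Pt d × Pt d) :=
  (Lp.compMeasurePreservingₗᵢ ℂ Prod.swap
    (Measure.measurePreserving_swap (μ := (volume : Measure (Pt d)))
      (ν := (volume : Measure (Pt d))))).toContinuousLinearMap

theorem swapL_coe (ξ : H (Pt d × Pt d)) : swapL d ξ =ᵐ[volume] fun p => ξ p.swap :=
  Lp.coeFn_compMeasurePreserving ξ Measure.measurePreserving_swap

theorem ae_swap {q : Pt d × Pt d → Prop} (h : ∀ᵐ p, q p) : ∀ᵐ p : Pt d × Pt d, q p.swap :=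
  (Measure.measurePreserving_swap (μ := (volume : Measure (Pt d)))
      (ν := (volume : Measure (Pt d)))).quasiMeasurePreserving.ae h

theorem swapL_tmul (f g : L2 d) : swapL d (tmul f g) = tmul g f := by
  apply Lp.ext
  filter_upwards [swapL_coe (tmul f g), ae_swap (tmul_coe f g), tmul_coe g f] with p h1 h2 h3
  rw [h1, h2, h3]
  exact mul_comm _ _

theorem inner_swapL (ξ η : H (Pt d × Pt d)) : inner ℂ (swapL d ξ) (swapL d η) = inner ℂ ξ η :=
  LinearIsometry.inner_map_map _ ξ η

/-- The mean field of the rank-one operator with vector `R y`, for the pair potential `W`. -/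
def meanField (j : ℕ) (W : H (Pt d × Pt d) →L[ℂ] H (Pt d × Pt d)) (y : L2 d) : L2 d →L[ℂ] L2 d :=
  ContinuousLinearMap.adjoint (tmulL.flip (resolv d j y)) ∘L (W + swapL d ∘L W) ∘L tmulL y

variable {W : H (Pt d × Pt d) →L[ℂ] H (Pt d × Pt d)}

theorem inner_meanField (y u w : L2 d) : inner ℂ u (meanField j W y w) =
    inner ℂ (tmul u (resolv d j y)) (W (tmul y w)) +
      inner ℂ (tmul u (resolv d j y)) (swapL d (W (tmul y w))) := by
  change inner ℂ u (ContinuousLinearMap.adjoint (tmulL.flip (resolv d j y))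
    (W (tmul y w) + swapL d (W (tmul y w)))) = _
  rw [ContinuousLinearMap.adjoint_inner_right, inner_add_right]
  rfl

theorem norm_meanField_le (y : L2 d) : ‖meanField j W y‖ ≤ 2 * ‖W‖ * ‖y‖ ^ 2 := by
  have hT : ∀ w : L2 d, ‖tmul w (resolv d j y)‖ ≤ ‖y‖ * ‖w‖ := fun w => by
    rw [norm_tmul, mul_comm]
    exact mul_le_mul_of_nonneg_right (norm_resolv_le y) (norm_nonneg _)
  refine ContinuousLinearMap.opNorm_le_bound _ (by positivity) fun w => ?_
  have h1 : ‖W (tmul y w)‖ ≤ ‖W‖ * (‖y‖ * ‖w‖) := by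
    rw [← norm_tmul]; exact W.le_opNorm _
  have h2 : ‖swapL d (W (tmul y w))‖ = ‖W (tmul y w)‖ := LinearIsometry.norm_map _ _
  have h3 : ‖ContinuousLinearMap.adjoint (tmulL.flip (resolv d j y) : L2 d →L[ℂ] H (Pt d × Pt d))‖ ≤
      ‖y‖ := by
    rw [LinearIsometryEquiv.norm_map]
    exact ContinuousLinearMap.opNorm_le_bound _ (norm_nonneg _) hT
  calc ‖meanField j W y w‖ ≤ ‖y‖ * ‖W (tmul y w) + swapL d (W (tmul y w))‖ :=
        ContinuousLinearMap.le_of_opNorm_le _ h3 _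
    _ ≤ ‖y‖ * (‖W‖ * (‖y‖ * ‖w‖) + ‖W‖ * (‖y‖ * ‖w‖)) := by
        gcongr
        exact (norm_add_le _ _).trans (add_le_add h1 (h2.trans_le h1))
    _ = _ := by ring

theorem summable_meanField {ι : Type} {y : ι → L2 d} (hy : SqSum y) :
    Summable fun i => meanField j W (y i) := by
  refine Summable.of_norm_bounded ((ENNReal.summable_toReal hy).mul_left (2 * ‖W‖)) fun i => ?_
  refine (norm_meanField_le _).trans (le_of_eq ?_)
  simp

theorem hasSum_inner_meanField {ι : Type} {y : ι → L2 d} (hy : SqSum y) (u w : L2 d) :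
    HasSum (fun i => inner ℂ u (meanField j W (y i) w)) (inner ℂ u ((∑' i, meanField j W (y i)) w)) :=
  ((summable_meanField hy).hasSum.mapL (ContinuousLinearMap.apply ℂ (L2 d) w)).mapL (innerSL ℂ u)

section Potential

variable {v : Pt d → ℝ} (hW : ∀ χ, (W χ : Pt d × Pt d → ℂ) =ᵐ[volume]
      fun p => (v (p.1 - p.2) : ℂ) * pairResolv d j χ p)

include hW

theorem potential_tmul_coe (y w : L2 d) : (W (tmul y w) : Pt d × Pt d → ℂ) =ᵐ[volume]
    fun p => (v (p.1 - p.2) : ℂ) * (resolv d j y p.1 * w p.2) := by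
  filter_upwards [hW (tmul y w), tmul_coe (resolv d j y) w] with p h1 h2
  rw [h1, pairResolv_tmul, h2]

theorem potential_swap (hve : ∀ x, v (-x) = v x) (y z : L2 d) :
    W (tmul z (resolv d j y)) = swapL d (W (tmul y (resolv d j z))) := by
  apply Lp.ext
  filter_upwards [potential_tmul_coe hW z (resolv d j y), swapL_coe (W (tmul y (resolv d j z))),
    ae_swap (potential_tmul_coe hW y (resolv d j z))] with p h1 h2 h3
  rw [h1, h2, h3, Prod.fst_swap, Prod.snd_swap, ← neg_sub, hve]
  ring

/-- For even v, exchanging the two particles exchanges the roles of y and z in the direct term and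
in the exchange term. -/
theorem inner_meanField_comm (hve : ∀ x, v (-x) = v x) (y z : L2 d) :
    inner ℂ (resolv d j z) (meanField j W y (resolv d j z)) =
      inner ℂ (resolv d j y) (meanField j W z (resolv d j y)) := by
  have a := potential_swap hW hve y z
  have b := potential_swap hW hve z y
  rw [inner_meanField, inner_meanField, ← a, ← b]
  congr 1
  · rw [b, ← swapL_tmul (resolv d j y), inner_swapL]
  · rw [a, ← swapL_tmul (resolv d j y), inner_swapL]

/-- For each rank-one term the swapped part of `meanField` yields the direct potential v * d(α), and
the other part the exchange kernel v(x-y) α(x,y). Summation under the integral is justified by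
square summability, without sign conditions on v. -/
theorem isMeanField_tsum (hve : ∀ x, v (-x) = v x) {ι : Type} [Countable ι] {y : ι → L2 d}
    (hy : SqSum y) {α : L2 d →L[ℂ] L2 d}
    (hα : ∀ u, HasSum (fun i => (inner ℂ (resolv d j (y i)) u : ℂ) • resolv d j (y i)) (α u)) :
    IsMeanField v α (∑' i, meanField j W (y i)) := by
  set x : ι → L2 d := fun i => resolv d j (y i) with hx'
  have hx : SqSum x := hy.map _
  refine ⟨diagonal x, sumKernel x, isDiagonal_diagonal hx hα, isKernel_sumKernel hx hα,
    fun f g => ?_⟩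
  have ha : SqSum fun i => tmul f.l2 (x i) := hx.map (tmulL f.l2)
  have hb : SqSum fun i => swapL d (W (tmul (y i) g.l2)) :=
    hy.map (swapL d ∘L W ∘L tmulL.flip g.l2)
  have e1 : (fun p : Pt d × Pt d => ∑' i, conj (tmul f.l2 (x i) p) *
      swapL d (W (tmul (y i) g.l2)) p) =ᵐ[volume]
      fun p => conj (f p.1) * ((v (p.1 - p.2) : ℂ) * diagonal x p.2) * g p.1 := by
    filter_upwards [ae_all_iff.2 fun i => tmul_coe f.l2 (x i),
      ae_all_iff.2 fun i => swapL_coe (W (tmul (y i) g.l2)),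
      ae_all_iff.2 fun i => ae_swap (potential_tmul_coe hW (y i) g.l2), ae_prod_fst f.coeFn_l2,
      ae_prod_fst g.coeFn_l2] with p h1 h2 h3 h4 h5
    rw [diagonal, ← tsum_mul_left, ← tsum_mul_left, ← tsum_mul_right]
    refine tsum_congr fun i => ?_
    rw [h1, h2, h3, Prod.fst_swap, Prod.snd_swap, h4, h5, ← neg_sub, hve, map_mul]
    ring
  set Φ := W (tmul (sobM d j f).l2 (star g.l2)) with hΦ
  have e2 : (fun p : Pt d × Pt d => conj (Φ p) * sumKernel x p) =ᵐ[volume]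
      fun p => conj (f p.1) * ((v (p.1 - p.2) : ℂ) * sumKernel x p) * g p.2 := by
    filter_upwards [potential_tmul_coe hW (sobM d j f).l2 (star g.l2), ae_prod_fst f.coeFn_l2,
      ae_prod_snd g.coeFn_l2, ae_prod_snd (Lp.coeFn_star g.l2)] with p h1 h2 h3 h4
    rw [hΦ, h1, resolv_sobM, h2, h4, Pi.star_apply, h3]
    simp only [map_mul, RCLike.star_def, Complex.conj_conj, Complex.conj_ofReal]
    ring
  refine ⟨(integrable_tsum_conj_mul ha hb).congr e1, (H.integrable Φ (sumKernel x)).congr e2, ?_⟩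
  rw [← integral_congr_ae e1, ← integral_congr_ae e2, ← H.inner_eq, add_comm]
  refine (hasSum_inner_meanField hy f.l2 g.l2).unique ?_
  simp only [inner_meanField]
  refine HasSum.add ?_ (hasSum_inner_integral ha hb)
  refine Eq.mp ?_ (hasSum_inner_sumKernel hx Φ)
  congr 1
  funext i
  rw [H.inner_eq, H.inner_eq]
  refine integral_congr_ae ?_
  filter_upwards [potential_tmul_coe hW (sobM d j f).l2 (star g.l2), tmul_coe (x i) (star (x i)),
    ae_prod_snd (Lp.coeFn_star g.l2), ae_prod_snd (Lp.coeFn_star (x i)), tmul_coe f.l2 (x i),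
    potential_tmul_coe hW (y i) g.l2] with p h1 h2 h3 h4 h5 h6
  rw [hΦ, h1, h2, h5, h6, resolv_sobM, h3, h4, Pi.star_apply, Pi.star_apply]
  simp only [map_mul, RCLike.star_def, Complex.conj_conj, Complex.conj_ofReal, hx']
  ring

theorem integrable_potential_sq (χ : H (Pt d × Pt d)) :
    Integrable (fun p : Pt d × Pt d => v (p.1 - p.2) * ‖pairResolv d j χ p‖ ^ 2) ∧
      inner ℂ (pairResolv d j χ) (W χ) =
        ((∫ p : Pt d × Pt d, v (p.1 - p.2) * ‖pairResolv d j χ p‖ ^ 2 : ℝ) : ℂ) := by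
  have e : (fun p => conj (pairResolv d j χ p) * W χ p) =ᵐ[volume]
      fun p => ((v (p.1 - p.2) * ‖pairResolv d j χ p‖ ^ 2 : ℝ) : ℂ) := by
    filter_upwards [hW χ] with p h1
    rw [h1, mul_left_comm, Complex.conj_mul']
    push_cast
    rfl
  refine ⟨?_, ?_⟩
  · have h1 := ((H.integrable (pairResolv d j χ) (W χ)).congr e).re
    exact h1.congr (Eventually.of_forall fun p => Complex.ofReal_re _)
  · rw [H.inner_eq, integral_congr_ae e, integral_complex_ofReal]

end Potential

end HFB
end

/-! ### Strongly continuous functionals of kernels and expectation values. -/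

noncomputable section

namespace HFB

variable {d j : ℕ}

/-! ### Nuclear functionals -/

/-- Continuity of a functional with respect to strong convergence of sequences of operators. -/
def StrongCont {E F : Type} [NormedAddCommGroup E] [InnerProductSpace ℂ E] [NormedAddCommGroup F]
    [InnerProductSpace ℂ F] (g : (E →L[ℂ] F) →ₗ[ℂ] ℂ) : Prop :=
  ∀ (B : ℕ → E →L[ℂ] F) (C : E →L[ℂ] F), (∀ u, Tendsto (fun n => B n u) atTop (𝓝 (C u))) →
    Tendsto (fun n => g (B n)) atTop (𝓝 (g C))

section Nuclear

variable {E F κ : Type} [NormedAddCommGroup E] [InnerProductSpace ℂ E]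
  [NormedAddCommGroup F] [InnerProductSpace ℂ F] {a : κ → F} {b : κ → E}

theorem StrongCont.add {g g' : (E →L[ℂ] F) →ₗ[ℂ] ℂ} (h : StrongCont g) (h' : StrongCont g') :
    StrongCont (g + g') := fun B C hB => (h B C hB).add (h' B C hB)

omit [InnerProductSpace ℂ E] [InnerProductSpace ℂ F] in
theorem SqSum.summable_mul (ha : SqSum a) (hb : SqSum b) : Summable fun k => ‖a k‖ * ‖b k‖ := by
  refine (ENNReal.summable_toReal (ha.mul hb)).congr fun k => ?_
  simp

theorem norm_inner_apply_le {B : E →L[ℂ] F} {C : ℝ} (hB : ∀ u, ‖B u‖ ≤ C * ‖u‖) (x : F) (y : E) :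
    ‖(inner ℂ x (B y) : ℂ)‖ ≤ C * (‖x‖ * ‖y‖) := by
  refine (norm_inner_le_norm _ _).trans ((mul_le_mul_of_nonneg_left (hB _) (norm_nonneg _)).trans ?_)
  rw [mul_left_comm]

theorem summable_inner_apply (h : Summable fun k => ‖a k‖ * ‖b k‖) (B : E →L[ℂ] F) :
    Summable fun k => (inner ℂ (a k) (B (b k)) : ℂ) :=
  Summable.of_norm_bounded (h.mul_left ‖B‖) fun _ => norm_inner_apply_le B.le_opNorm _ _

/-- The functional `B ↦ ∑ₖ ⟨aₖ, B bₖ⟩`. -/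
def nuclear (h : Summable fun k => ‖a k‖ * ‖b k‖) : (E →L[ℂ] F) →ₗ[ℂ] ℂ where
  toFun B := ∑' k, inner ℂ (a k) (B (b k))
  map_add' B B' := by
    simp only [add_apply, inner_add_right]
    exact (summable_inner_apply h B).tsum_add (summable_inner_apply h B')
  map_smul' c B := by
    simp only [smul_apply, inner_smul_right, RingHom.id_apply, smul_eq_mul]
    exact tsum_mul_left

/-- Strong convergence gives convergence of each term, and the uniform bound from Banach-Steinhaus
gives a summable majorant. -/
theorem strongCont_nuclear [CompleteSpace E] (h : Summable fun k => ‖a k‖ * ‖b k‖) : StrongCont (nuclear h) := by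
  intro B C hB
  obtain ⟨M, hM⟩ := exists_bound_of_tendsto hB
  exact tendsto_tsum_of_dominated_convergence (h.mul_left (M : ℝ))
    (fun k => tendsto_const_nhds.inner (hB _))
    (Eventually.of_forall fun n k => norm_inner_apply_le (hM n) _ _)

end Nuclear

namespace Cell

/-- Agreement on the kernels of monomials extends by `pair_induction`, since linear combinations and
strong limits preserve it. -/
theorem functional_ext (c c' : Cell d j) {g g' : (H c'.Z →L[ℂ] H c.Z) →ₗ[ℂ] ℂ} (hg : StrongCont g)
    (hg' : StrongCont g')
    (hbase : ∀ E F, g (InnerProductSpace.rankOne ℂ (c.prod E) (c'.R (c'.prod F))) =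
      g' (InnerProductSpace.rankOne ℂ (c.prod E) (c'.R (c'.prod F))))
    {B : H c'.Z →L[ℂ] H c.Z} {B' : H c.Z →L[ℂ] H c'.Z}
    (hBB : ∀ u w, inner ℂ (c.R u) (B w) = inner ℂ (B' u) (c'.R w)) : g B = g' B := by
  refine c.pair_induction c' (p := fun B _ => g B = g' B) ?_ ?_ ?_ hbase hBB
  · intro B B' C C' h1 h2
    rw [map_add, map_add, h1, h2]
  · intro z B B' h1
    rw [map_smul, map_smul, h1]
  · intro B B' C C' h1 h2 _
    refine tendsto_nhds_unique (hg B C h2) ((hg' B C h2).congr fun n => (h1 n).symm)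

/-- The expectation of the normal ordered operator with a given kernel. -/
def expect {X : G d} (c c' : Cell d j) (h : totalWeight j X ≠ ⊤) : (H c'.Z →L[ℂ] H c.Z) →ₗ[ℂ] ℂ :=
  (innerSL ℂ X).toLinearMap ∘ₗ c.nvec c' h

theorem strongCont_expect {X : G d} (c c' : Cell d j) (h : totalWeight j X ≠ ⊤) :
    StrongCont (c.expect c' h) := by
  intro B C hB
  obtain ⟨M, hM⟩ := exists_bound_of_tendsto hB
  exact ((innerSL ℂ X).continuous.tendsto _).comp (c.tendsto_nvec c' h hM hB)

theorem expect_rankOne {ω : State d} (Q : Quasifree ω) (c c' : Cell d j)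
    (h : totalWeight j (Q.W []) ≠ ⊤) (E : Fin c.p → Test d) (F : Fin c'.p → Test d) :
    c.expect c' h (InnerProductSpace.rankOne ℂ (c.prod E) (c'.R (c'.prod F))) =
      Q.m (creWord E ++ annWord' F) := by
  rw [Q.m_eq, c.word_eq_nvec c' Q h]
  rfl

end Cell

/-! ### The energy as a sum over nuclear decompositions -/

/-- Decomposition of the truncated expectations of a state: `φ = R φ'`, `γ = ∑ᵢ |R yᵢ⟩⟨R yᵢ| = R δ`,
and `K = (R ⊗ 1) K'` for the kernel `K` of `σ`. -/
structure Decomp (j : ℕ) (μ : Triple d) where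
  ι : Type
  countable : Countable ι
  φ' : L2 d
  φ_eq : μ.1 = resolv d j φ'
  y : ι → L2 d
  sq : SqSum y
  δ : L2 d →L[ℂ] L2 d
  hasSum_δ : ∀ u, HasSum (fun i => (inner ℂ (resolv d j (y i)) u : ℂ) • y i) (δ u)
  γ_eq : ∀ u, μ.2.1 u = resolv d j (δ u)
  K' : H (Pt d × Pt d)
  σ_eq : ∀ f g : L2 d, inner ℂ (tmul f g) (pairResolv d j K') = inner ℂ f (μ.2.2 (star g))

theorem MemX.nonempty_decomp {μ : Triple d} (h : MemX j μ) : Nonempty (Decomp j μ) := by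
  have h1 : sobNorm j μ.1 ≠ ⊤ ∧ traceNorm j μ.2.1 ≠ ⊤ ∧
      hsNorm j (ContinuousLinearMap.adjoint μ.2.2) ≠ ⊤ := by
    have := h.1
    rw [XNorm] at this
    simp only [ENNReal.add_lt_top] at this
    exact ⟨this.1.1.1.ne, this.1.1.2.ne, this.1.2.ne⟩
  obtain ⟨φ', hφ'⟩ := exists_sobNorm_resolv h1.1
  obtain ⟨D, hD, hD'⟩ := exists_traceNorm_resolv h.2.1 h1.2.1
  obtain ⟨K', hK'⟩ := exists_hsNorm_resolv h1.2.2
  refine ⟨⟨(basis d j).ι, (basis d j).countable, φ', hφ', _, hD',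
    ContinuousLinearMap.adjoint D ∘L D ∘L resolv d j, fun u => ?_, hD, K', hK'⟩⟩
  have h2 := ((basis d j).b.hasSum_repr (D (resolv d j u))).mapL (ContinuousLinearMap.adjoint D)
  refine Eq.mp ?_ h2
  congr 1
  funext i
  rw [map_smul, HilbertBasis.repr_apply_apply, inner_resolv, ContinuousLinearMap.adjoint_inner_left]

namespace Decomp

variable {μ : Triple d} (𝒟 : Decomp j μ)

/-- The vectors of the decomposition of `γ`. -/
def x (i : 𝒟.ι) : L2 d := resolv d j (𝒟.y i)

theorem sq_x : SqSum 𝒟.x := 𝒟.sq.map _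

theorem hasSum_γ (u : L2 d) : HasSum (fun i => (inner ℂ (𝒟.x i) u : ℂ) • 𝒟.x i) (μ.2.1 u) := by
  rw [𝒟.γ_eq]
  simpa only [map_smul, x] using (𝒟.hasSum_δ u).mapL (resolv d j)

theorem hasSum_inner_γ (f e : L2 d) :
    HasSum (fun i => inner ℂ f (𝒟.x i) * inner ℂ (𝒟.x i) e) (inner ℂ f (μ.2.1 e)) := by
  have h := (𝒟.hasSum_γ e).mapL (innerSL ℂ f)
  refine Eq.mp ?_ h
  congr 1
  funext i
  rw [innerSL_apply_apply, inner_smul_right, mul_comm]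

/-! #### One-body terms -/

theorem summable_one : Summable fun i => ‖𝒟.x i‖ * ‖𝒟.y i‖ := 𝒟.sq_x.summable_mul 𝒟.sq

theorem inner_rankOne_resolv {E : Type} [NormedAddCommGroup E] [InnerProductSpace ℂ E] (e a f b : E) :
    inner ℂ a (InnerProductSpace.rankOne ℂ e f b) = inner ℂ f b * inner ℂ a e := by
  rw [InnerProductSpace.rankOne_apply, inner_smul_right]

theorem summable_unit {E F : Type} [NormedAddCommGroup E] [NormedAddCommGroup F] (a : F) (b : E) :
    Summable fun _ : Unit => ‖a‖ * ‖b‖ := (hasSum_fintype _).summable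

variable {ω : State d} (Q : Quasifree ω) (hμ : ω.HasMoments μ) (h : totalWeight j (Q.W []) ≠ ⊤)

include hμ in
theorem m_cre_ann (f g : Test d) : Q.m [.cre g, .ann f] =
    inner ℂ f.l2 (μ.2.1 g.l2) + inner ℂ μ.1 g.l2 * inner ℂ f.l2 μ.1 := (Q.eq_m (hμ f g).2.1).symm

include hμ in
theorem m_ann_ann (f g : Test d) : Q.m [.ann f, .ann g] =
    inner ℂ f.l2 (μ.2.2 (star g.l2)) + inner ℂ f.l2 μ.1 * inner ℂ g.l2 μ.1 :=
  (Q.eq_m (hμ f g).2.2).symm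

include hμ in
-- Both sides are strongly continuous in the kernel; on the kernel of ψ*ψ they agree by the
-- decomposition of γ and φ.
theorem expect_one {B B' : L2 d →L[ℂ] L2 d}
    (hB : ∀ u w, inner ℂ (resolv d j u) (B w) = inner ℂ (B' u) (resolv d j w)) :
    inner ℂ (Q.W []) ((cell₁ d j).nvec (cell₁ d j) h B) =
      ∑' i, inner ℂ (𝒟.x i) (B (𝒟.y i)) + inner ℂ μ.1 (B 𝒟.φ') := by
  have key : ∀ E F : Fin 1 → Test d, Q.m (creWord E ++ annWord' F) =
      (nuclear 𝒟.summable_one + nuclear (summable_unit μ.1 𝒟.φ'))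
        (InnerProductSpace.rankOne ℂ (E 0).l2 (resolv d j (F 0).l2)) := fun E F => by
    rw [creWord_one, annWord'_one]
    refine (m_cre_ann Q hμ _ _).trans ?_
    rw [LinearMap.add_apply]
    congr 1
    · refine (𝒟.hasSum_inner_γ _ _).tsum_eq.symm.trans (tsum_congr fun i => ?_)
      rw [inner_rankOne_resolv, inner_resolv]; rfl
    · refine Eq.trans ?_ (tsum_fintype (L := .unconditional _) _).symm
      rw [Finset.univ_unique, Finset.sum_singleton, inner_rankOne_resolv, inner_resolv, ← 𝒟.φ_eq,
        mul_comm]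
  have e : inner ℂ (Q.W []) ((cell₁ d j).nvec (cell₁ d j) h B) =
      (nuclear 𝒟.summable_one + nuclear (summable_unit μ.1 𝒟.φ')) B :=
    (cell₁ d j).functional_ext (cell₁ d j) ((cell₁ d j).strongCont_expect (cell₁ d j) h)
    ((strongCont_nuclear 𝒟.summable_one).add (strongCont_nuclear (summable_unit μ.1 𝒟.φ')))
    (fun E F => (Cell.expect_rankOne Q (cell₁ d j) (cell₁ d j) h E F).trans (key E F)) hB
  rw [e, LinearMap.add_apply]
  congr 1
  refine (tsum_fintype (L := .unconditional _) _).trans ?_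
  rw [Finset.univ_unique, Finset.sum_singleton]

/-! #### Two-body terms -/

/-- The symmetrized product. -/
def sym (f g : L2 d) : H (Pt d × Pt d) := tmul f g + tmul g f

theorem norm_sym_le (f g : L2 d) : ‖sym f g‖ ≤ 2 * (‖f‖ * ‖g‖) := by
  refine (norm_add_le _ _).trans ?_
  rw [norm_tmul, norm_tmul]
  linarith [mul_comm ‖f‖ ‖g‖]

/-- The two orderings in the symmetrized product are the direct and the exchange contraction. -/
theorem inner_sym_meanField (W : H (Pt d × Pt d) →L[ℂ] H (Pt d × Pt d)) (y z : L2 d) :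
    inner ℂ (sym (resolv d j y) z) (W (tmul y z)) = inner ℂ z (meanField j W y z) := by
  rw [inner_meanField, sym, inner_add_left, add_comm]
  congr 1
  rw [← swapL_tmul (resolv d j y) z, inner_swapL]

theorem inner_sym_rankOne (y z e₀ e₁ f₀ f₁ : L2 d) :
    inner ℂ (sym (resolv d j y) z)
      (InnerProductSpace.rankOne ℂ (tmul e₀ e₁) (pairResolv d j (tmul f₀ f₁)) (tmul y z)) =
    (inner ℂ f₀ (resolv d j y) * inner ℂ (resolv d j y) e₀) * (inner ℂ f₁ z * inner ℂ z e₁) +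
      (inner ℂ f₀ (resolv d j y) * inner ℂ (resolv d j y) e₁) * (inner ℂ f₁ z * inner ℂ z e₀) := by
  rw [inner_rankOne_resolv, pairResolv_tmul, sym, inner_add_left, inner_tmul_tmul, inner_tmul_tmul,
    inner_tmul_tmul, inner_resolv]
  ring

theorem norm_y_mul (y z : L2 d) : ‖sym (resolv d j y) z‖ * ‖tmul y z‖ ≤ 2 * (‖y‖ ^ 2 * ‖z‖ ^ 2) := by
  rw [norm_tmul]
  have h1 := norm_sym_le (resolv d j y) z
  have h2 := mul_le_mul_of_nonneg_right (norm_resolv_le (j := j) y) (norm_nonneg z)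
  calc _ ≤ 2 * (‖y‖ * ‖z‖) * (‖y‖ * ‖z‖) := by
        gcongr
        exact h1.trans (by linarith)
    _ = _ := by ring

theorem _root_.HFB.SqSum.summable_sq {ι E : Type*} [NormedAddCommGroup E] {a : ι → E} (h : SqSum a) :
    Summable fun i => ‖a i‖ ^ 2 := by
  refine (ENNReal.summable_toReal h).congr fun i => ?_
  simp

theorem summable_dir : Summable fun p : 𝒟.ι × 𝒟.ι =>
    ‖sym (resolv d j (𝒟.y p.1)) (𝒟.x p.2)‖ * ‖tmul (𝒟.y p.1) (𝒟.x p.2)‖ :=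
  Summable.of_nonneg_of_le (fun p => by positivity) (fun p => norm_y_mul _ _)
    ((𝒟.sq.summable_sq.mul_of_nonneg 𝒟.sq_x.summable_sq (fun _ => by positivity)
      fun _ => by positivity).mul_left 2)

theorem summable_left : Summable fun i : 𝒟.ι =>
    ‖sym (resolv d j (𝒟.y i)) μ.1‖ * ‖tmul (𝒟.y i) μ.1‖ :=
  Summable.of_nonneg_of_le (fun p => by positivity) (fun p => norm_y_mul _ _)
    ((𝒟.sq.summable_sq.mul_right _).mul_left 2)

theorem summable_right : Summable fun i : 𝒟.ι =>
    ‖sym (resolv d j 𝒟.φ') (𝒟.x i)‖ * ‖tmul 𝒟.φ' (𝒟.x i)‖ :=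
  Summable.of_nonneg_of_le (fun p => by positivity) (fun p => norm_y_mul _ _)
    ((𝒟.sq_x.summable_sq.mul_left _).mul_left 2)

/-- The kernel of `ω(ψ(x)ψ(y))`, up to the factor `R ⊗ 1`. -/
def pairing : H (Pt d × Pt d) := 𝒟.K' + tmul 𝒟.φ' μ.1

theorem inner_pairing (f g : L2 d) : inner ℂ (tmul f g) (pairResolv d j 𝒟.pairing) =
    inner ℂ f (μ.2.2 (star g)) + inner ℂ f μ.1 * inner ℂ g μ.1 := by
  rw [pairing, map_add, inner_add_right, 𝒟.σ_eq, pairResolv_tmul, inner_tmul_tmul, ← 𝒟.φ_eq]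

theorem nuclear_unit_rankOne (e₀ e₁ f₀ f₁ : L2 d) :
    nuclear (summable_unit (pairResolv d j 𝒟.pairing) 𝒟.pairing)
        (InnerProductSpace.rankOne ℂ (tmul e₀ e₁) (pairResolv d j (tmul f₀ f₁))) =
      (inner ℂ f₀ (μ.2.2 (star f₁)) + inner ℂ f₀ μ.1 * inner ℂ f₁ μ.1) *
        conj (inner ℂ e₀ (μ.2.2 (star e₁)) + inner ℂ e₀ μ.1 * inner ℂ e₁ μ.1) := by
  refine (tsum_fintype (L := .unconditional _) _).trans ?_
  rw [Finset.univ_unique, Finset.sum_singleton, inner_rankOne_resolv,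
    ← ContinuousLinearMap.adjoint_inner_right, adjoint_pairResolv, 𝒟.inner_pairing,
    ← 𝒟.inner_pairing e₀ e₁, inner_conj_symm]

theorem _root_.HFB.tsum_mul_add_mul {ι : Type} {f : ι × ι → ℂ} (hf : Summable f) {A B C D : ι → ℂ}
    (h : ∀ p, f p = A p.1 * B p.2 + C p.1 * D p.2) {a b c e : ℂ} (hA : HasSum A a) (hB : HasSum B b)
    (hC : HasSum C c) (hD : HasSum D e) : ∑' p, f p = a * b + c * e :=
  (hf.hasSum.prod_fiberwise fun i => by
    simpa only [h] using (hB.mul_left (A i)).add (hD.mul_left (C i))).unique ((hA.mul_right b).add (hC.mul_right e))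

theorem nuclear_dir_rankOne (e₀ e₁ f₀ f₁ : L2 d) : nuclear 𝒟.summable_dir
    (InnerProductSpace.rankOne ℂ (tmul e₀ e₁) (pairResolv d j (tmul f₀ f₁))) =
      inner ℂ f₀ (μ.2.1 e₀) * inner ℂ f₁ (μ.2.1 e₁) +
        inner ℂ f₀ (μ.2.1 e₁) * inner ℂ f₁ (μ.2.1 e₀) :=
  tsum_mul_add_mul (summable_inner_apply 𝒟.summable_dir _)
    (fun p => inner_sym_rankOne (𝒟.y p.1) (𝒟.x p.2) e₀ e₁ f₀ f₁) (𝒟.hasSum_inner_γ f₀ e₀)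
    (𝒟.hasSum_inner_γ f₁ e₁) (𝒟.hasSum_inner_γ f₀ e₁) (𝒟.hasSum_inner_γ f₁ e₀)

theorem nuclear_left_rankOne (e₀ e₁ f₀ f₁ : L2 d) : nuclear 𝒟.summable_left
    (InnerProductSpace.rankOne ℂ (tmul e₀ e₁) (pairResolv d j (tmul f₀ f₁))) =
      inner ℂ f₀ (μ.2.1 e₀) * (inner ℂ f₁ μ.1 * inner ℂ μ.1 e₁) +
        inner ℂ f₀ (μ.2.1 e₁) * (inner ℂ f₁ μ.1 * inner ℂ μ.1 e₀) := by
  rw [← (((𝒟.hasSum_inner_γ f₀ e₀).mul_right _).add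
    ((𝒟.hasSum_inner_γ f₀ e₁).mul_right _)).tsum_eq]
  exact tsum_congr fun p => inner_sym_rankOne _ _ _ _ _ _

theorem nuclear_right_rankOne (e₀ e₁ f₀ f₁ : L2 d) : nuclear 𝒟.summable_right
    (InnerProductSpace.rankOne ℂ (tmul e₀ e₁) (pairResolv d j (tmul f₀ f₁))) =
      (inner ℂ f₀ μ.1 * inner ℂ μ.1 e₀) * inner ℂ f₁ (μ.2.1 e₁) +
        (inner ℂ f₀ μ.1 * inner ℂ μ.1 e₁) * inner ℂ f₁ (μ.2.1 e₀) := by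
  rw [← (((𝒟.hasSum_inner_γ f₁ e₁).mul_left _).add
    ((𝒟.hasSum_inner_γ f₁ e₀).mul_left _)).tsum_eq, 𝒟.φ_eq]
  exact tsum_congr fun p => inner_sym_rankOne _ _ _ _ _ _

/-- The expectation of a quartic normal ordered operator, in terms of its kernel. -/
def quartic : (H (Pt d × Pt d) →L[ℂ] H (Pt d × Pt d)) →ₗ[ℂ] ℂ :=
  nuclear (summable_unit (pairResolv d j 𝒟.pairing) 𝒟.pairing) + nuclear 𝒟.summable_dir +
    nuclear 𝒟.summable_left + nuclear 𝒟.summable_right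

theorem strongCont_quartic : StrongCont 𝒟.quartic :=
  (((strongCont_nuclear _).add (strongCont_nuclear _)).add (strongCont_nuclear _)).add
    (strongCont_nuclear _)

theorem quartic_apply (B : H (Pt d × Pt d) →L[ℂ] H (Pt d × Pt d)) : 𝒟.quartic B =
    inner ℂ (pairResolv d j 𝒟.pairing) (B 𝒟.pairing) +
      ∑' p : 𝒟.ι × 𝒟.ι, inner ℂ (𝒟.x p.2) (meanField j B (𝒟.y p.1) (𝒟.x p.2)) +
      ∑' i, inner ℂ μ.1 (meanField j B (𝒟.y i) μ.1) +
      ∑' i, inner ℂ (𝒟.x i) (meanField j B 𝒟.φ' (𝒟.x i)) := by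
  rw [quartic, LinearMap.add_apply, LinearMap.add_apply, LinearMap.add_apply]
  congr 1; congr 1; congr 1
  · refine (tsum_fintype (L := .unconditional _) _).trans ?_
    rw [Finset.univ_unique, Finset.sum_singleton]
  · exact tsum_congr fun p => inner_sym_meanField _ _ _
  · exact tsum_congr fun p => inner_sym_meanField _ _ _
  · exact tsum_congr fun p => inner_sym_meanField _ _ _

include hμ in
-- In Wick's formula the pairing moments give the term with σ + φ ⊗ φ. The two products of moments
-- ω(ψ*ψ) expand into γγ, mixed γφ and two φφφφ terms; the latter cancel the -2 of Wick's formula.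
theorem m_eq_quartic (hσ : ∀ u, ContinuousLinearMap.adjoint μ.2.2 u = star (μ.2.2 (star u)))
    (E F : Fin 2 → Test d) : Q.m (creWord E ++ annWord' F) =
      𝒟.quartic (InnerProductSpace.rankOne ℂ (tmul (E 0).l2 (E 1).l2)
        (pairResolv d j (tmul (F 0).l2 (F 1).l2))) := by
  have hs : ∀ f g : L2 d, inner ℂ f (μ.2.2 (star g)) = inner ℂ g (μ.2.2 (star f)) := fun f g => by
    rw [← ContinuousLinearMap.adjoint_inner_left, hσ, inner_star_star]
  have e1 : Q.m [.cre (E 0), .cre (E 1)] = conj (Q.m [.ann (E 1), .ann (E 0)]) :=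
    Q.m_adjWord [.ann (E 1), .ann (E 0)]
  rw [creWord_two, annWord'_two]
  refine (Q.m_four _ _ _ _).trans ?_
  rw [quartic, LinearMap.add_apply, LinearMap.add_apply, LinearMap.add_apply, nuclear_unit_rankOne,
    nuclear_dir_rankOne, nuclear_left_rankOne, nuclear_right_rankOne, e1, m_ann_ann Q hμ,
    m_ann_ann Q hμ, m_cre_ann Q hμ, m_cre_ann Q hμ, m_cre_ann Q hμ,
    m_cre_ann Q hμ, Q.m_ann hμ, Q.m_ann hμ, Q.m_cre hμ, Q.m_cre hμ, hs (E 1).l2, hs (F 1).l2]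
  simp only [map_add, map_mul]
  ring

include hμ in
theorem expect_two (hσ : ∀ u, ContinuousLinearMap.adjoint μ.2.2 u = star (μ.2.2 (star u)))
    {B B' : H (Pt d × Pt d) →L[ℂ] H (Pt d × Pt d)}
    (hB : ∀ u w, inner ℂ (pairResolv d j u) (B w) = inner ℂ (B' u) (pairResolv d j w)) :
    inner ℂ (Q.W []) ((cell₂ d j).nvec (cell₂ d j) h B) = 𝒟.quartic B :=
  (cell₂ d j).functional_ext (cell₂ d j) ((cell₂ d j).strongCont_expect (cell₂ d j) h)
    𝒟.strongCont_quartic (fun E F => (Cell.expect_rankOne Q (cell₂ d j) (cell₂ d j) h E F).trans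
      (m_eq_quartic 𝒟 Q hμ hσ E F)) hB

end Decomp

end HFB
end

/-! ### Identification of the energy functional. -/

noncomputable section

namespace HFB

variable {d j : ℕ}

/-! ### The energy functional -/

theorem sqSum_const (a : L2 d) : SqSum fun _ : Unit => a := by
  rw [SqSum, tsum_fintype, Finset.univ_unique, Finset.sum_singleton]
  exact ENNReal.pow_ne_top enorm_ne_top

theorem hasSum_proj (φ u : L2 d) : HasSum (fun _ : Unit => inner ℂ φ u • φ) (proj φ u) := by
  simp [proj]

theorem isMeanField_proj {W : H (Pt d × Pt d) →L[ℂ] H (Pt d × Pt d)} {v : Pt d → ℝ}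
    (hW : ∀ χ : H (Pt d × Pt d), (W χ : Pt d × Pt d → ℂ) =ᵐ[volume] fun p =>
      (v (p.1 - p.2) : ℂ) * (pairResolv d j χ : Pt d × Pt d → ℂ) p)
    (hve : ∀ x, v (-x) = v x) {φ φ' : L2 d} (hφ : φ = resolv d j φ') :
    IsMeanField v (proj φ) (meanField j W φ') := by
  have h1 : ∀ u : L2 d, HasSum (fun _ : Unit => inner ℂ (resolv d j φ') u • resolv d j φ')
      (proj φ u) := fun u => hφ ▸ hasSum_proj φ u
  have h := isMeanField_tsum hW hve (sqSum_const φ') h1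
  rwa [tsum_fintype (L := .unconditional _), Finset.univ_unique, Finset.sum_singleton] at h

namespace Decomp

variable {μ : Triple d} (𝒟 : Decomp j μ)

/-- γ + |φ⟩⟨φ| factors through R, so the kernel B of h R gives a bounded operator realizing h(γ +
|φ⟩⟨φ|). -/
theorem oneBodyHam {V : Pt d → ℝ} {T : Test d →ₗ[ℂ] L2 d}
    (hT : ∀ f : Test d, (T f : Pt d → ℂ) =ᵐ[volume] fun x => -(Δ f : Test d) x + (V x : ℂ) * f x)
    {B : L2 d →L[ℂ] L2 d}
    (hB : ∀ u : Test d, ContinuousLinearMap.adjoint B u.l2 = resolv d j (T u)) (u : L2 d) :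
    OneBodyHam V (μ.2.1 u + proj μ.1 u)
      ((B ∘L 𝒟.δ + InnerProductSpace.rankOne ℂ (B 𝒟.φ') μ.1) u) := fun f => by
  have e1 : μ.2.1 u + proj μ.1 u = resolv d j (𝒟.δ u + inner ℂ μ.1 u • 𝒟.φ') := by
    rw [map_add, map_smul, ← 𝒟.γ_eq, ← 𝒟.φ_eq]
    rfl
  have e2 : (B ∘L 𝒟.δ + InnerProductSpace.rankOne ℂ (B 𝒟.φ') μ.1) u =
      B (𝒟.δ u + inner ℂ μ.1 u • 𝒟.φ') := by
    rw [map_add, map_smul]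
    rfl
  rw [e1, e2, ← ContinuousLinearMap.adjoint_inner_left, hB, inner_resolv, L2.inner_def]
  refine integral_congr_ae ?_
  filter_upwards [hT f] with x hx
  rw [hx, RCLike.inner_apply, mul_comm]

theorem isTrace_oneBody (B : L2 d →L[ℂ] L2 d) :
    IsTrace (B ∘L 𝒟.δ + InnerProductSpace.rankOne ℂ (B 𝒟.φ') μ.1)
      (∑' i, inner ℂ (𝒟.x i) (B (𝒟.y i)) + inner ℂ μ.1 (B 𝒟.φ')) := by
  refine IsTrace.add (isTrace_of_hasSum (𝒟.sq.map B) 𝒟.sq_x fun u => ?_) ?_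
  · simpa only [map_smul, ContinuousLinearMap.comp_apply, x] using (𝒟.hasSum_δ u).mapL B
  · have h := isTrace_of_hasSum (sqSum_const (B 𝒟.φ')) (sqSum_const μ.1)
      (S := InnerProductSpace.rankOne ℂ (B 𝒟.φ') μ.1) fun u => by
        simp
    rwa [tsum_fintype (L := .unconditional _), Finset.univ_unique, Finset.sum_singleton] at h

theorem coe_pairing : (pairResolv d j 𝒟.pairing : Pt d × Pt d → ℂ) =ᵐ[volume] fun p =>
    (pairResolv d j 𝒟.K' : Pt d × Pt d → ℂ) p + μ.1 p.1 * μ.1 p.2 := by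
  rw [pairing, map_add, pairResolv_tmul, ← 𝒟.φ_eq]
  filter_upwards [Lp.coeFn_add (pairResolv d j 𝒟.K') (tmul μ.1 μ.1), tmul_coe μ.1 μ.1] with p h1 h2
  rw [h1, Pi.add_apply, h2]

theorem tsum_meanField_prod (W : H (Pt d × Pt d) →L[ℂ] H (Pt d × Pt d)) :
    ∑' p : 𝒟.ι × 𝒟.ι, inner ℂ (𝒟.x p.2) (meanField j W (𝒟.y p.1) (𝒟.x p.2)) =
      ∑' k, inner ℂ (𝒟.x k) ((∑' i, meanField j W (𝒟.y i)) (𝒟.x k)) := by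
  have h : Summable fun p : 𝒟.ι × 𝒟.ι =>
      (inner ℂ (𝒟.x p.2) (meanField j W (𝒟.y p.1) (𝒟.x p.2)) : ℂ) :=
    (summable_inner_apply 𝒟.summable_dir W).congr fun p => inner_sym_meanField W (𝒟.y p.1) (𝒟.x p.2)
  have h1 := (Equiv.prodComm 𝒟.ι 𝒟.ι).hasSum_iff.2 h.hasSum
  exact (h1.prod_fiberwise fun k => hasSum_inner_meanField 𝒟.sq (𝒟.x k) (𝒟.x k)).tsum_eq.symm

/-- The energy in terms of the expectations of the one- and two-body parts of the Hamiltonian. -/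
theorem isEnergy {V v : Pt d → ℝ} {T : Test d →ₗ[ℂ] L2 d}
    (hT : ∀ f : Test d, (T f : Pt d → ℂ) =ᵐ[volume] fun x => -(Δ f : Test d) x + (V x : ℂ) * f x)
    {B : L2 d →L[ℂ] L2 d}
    (hB : ∀ u : Test d, ContinuousLinearMap.adjoint B u.l2 = resolv d j (T u))
    {W : H (Pt d × Pt d) →L[ℂ] H (Pt d × Pt d)}
    (hW : ∀ χ : H (Pt d × Pt d), (W χ : Pt d × Pt d → ℂ) =ᵐ[volume] fun p =>
      (v (p.1 - p.2) : ℂ) * (pairResolv d j χ : Pt d × Pt d → ℂ) p)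
    (hve : ∀ x, v (-x) = v x) {E : ℝ}
    (hE : (E : ℂ) = ∑' i, inner ℂ (𝒟.x i) (B (𝒟.y i)) + inner ℂ μ.1 (B 𝒟.φ') +
      (1 / 2 : ℂ) * 𝒟.quartic W) : IsEnergy V v μ E := by
  have := 𝒟.countable
  have hv : (fun p : Pt d × Pt d =>
      v (p.1 - p.2) * ‖(pairResolv d j 𝒟.pairing : Pt d × Pt d → ℂ) p‖ ^ 2) =ᵐ[volume] fun p =>
      v (p.1 - p.2) * ‖(pairResolv d j 𝒟.K' : Pt d × Pt d → ℂ) p + μ.1 p.1 * μ.1 p.2‖ ^ 2 := by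
    filter_upwards [𝒟.coe_pairing] with p hp
    rw [hp]
  obtain ⟨i1, i2⟩ := integrable_potential_sq hW 𝒟.pairing
  -- The energy of φ in the mean field of γ equals that of γ in the mean field of φ. The two mixed
  -- terms thus coincide, which removes the factor 1/2 in front of Tr b[|φ⟩⟨φ|]γ.
  have hx : ∀ i, inner ℂ μ.1 (meanField j W (𝒟.y i) μ.1) =
      inner ℂ (𝒟.x i) (meanField j W 𝒟.φ' (𝒟.x i)) := fun i => by
    rw [𝒟.φ_eq]
    exact inner_meanField_comm hW hve (𝒟.y i) 𝒟.φ'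
  refine ⟨_, meanField j W 𝒟.φ', ∑' i, meanField j W (𝒟.y i),
    (pairResolv d j 𝒟.K' : Pt d × Pt d → ℂ), _, _, _, 𝒟.oneBodyHam hT hB, 𝒟.isTrace_oneBody B,
    isMeanField_proj hW hve 𝒟.φ_eq, isTrace_comp 𝒟.sq_x 𝒟.hasSum_γ _,
    isMeanField_tsum hW hve 𝒟.sq 𝒟.hasSum_γ, isTrace_comp 𝒟.sq_x 𝒟.hasSum_γ _,
    isKernel_of_inner 𝒟.σ_eq, i1.congr hv, ?_⟩
  rw [hE, 𝒟.quartic_apply, i2, integral_congr_ae hv, 𝒟.tsum_meanField_prod, tsum_congr hx]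
  push_cast
  ring

end Decomp

/-- The expectation of the Hamiltonian in a quasifree state. -/
theorem Quasifree.isEnergy (hj : 2 ≤ j) {V v : Pt d → ℝ} (hVm : Measurable V)
    (hV : InfinitesimallyLaplaceBounded V) (hvm : Measurable v) (hv : InfinitesimallyLaplaceBounded v)
    (hve : ∀ x, v (-x) = v x) {ω : State d} (Q : Quasifree ω) {μ : Triple d} (hμ : ω.HasMoments μ)
    (hX : MemX j μ) {E : ℝ} (hE : HasExp ω (hamOp V v) E) : IsEnergy V v μ E := by
  obtain ⟨D, hD⟩ := exists_totalWeight_bound d j (ENNReal.toReal_nonneg (a := XNorm j μ))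
  have h : totalWeight j (Q.W []) ≠ ⊤ :=
    ((hD _ Q μ hμ hX (ENNReal.ofReal_toReal hX.1.ne).ge).trans_lt ENNReal.coe_lt_top).ne
  obtain ⟨T, hT, hTs, hTb⟩ := exists_hamiltonian (d := d) hj hVm hV
  obtain ⟨B, hB, hB'⟩ := exists_kernel_of_bound (j := j) hTs hTb
  obtain ⟨W, hW⟩ := exists_pair_potential (d := d) hj hvm hv
  obtain ⟨𝒟⟩ := hX.nonempty_decomp
  refine 𝒟.isEnergy hT hB' hW hve ?_
  have hη : HasExp ω (hamOp V v) (inner ℂ (Q.W []) (hamVec h B W)) :=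
    Q.hasExp (hamOp_hamVec hT hB' hW h)
  have e := HasExp.unique (B := hamOp V v) (fun _ _ _ => hamOp_unique) hE hη
  rw [e, ← 𝒟.expect_one Q hμ h (kernel_pair hB' hB),
    ← 𝒟.expect_two Q hμ h hX.2.2 (pair_potential_symm hW)]
  exact (inner_add_right (𝕜 := ℂ) _ _ _).trans (congrArg _ (inner_smul_right _ _ _))

end HFB
end

theorem mainTheorem2 (d j : ℕ) (hj : 2 ≤ j) (V v : HFB.Pt d → ℝ)
    (hVm : Measurable V) (hV : HFB.InfinitesimallyLaplaceBounded V)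
    (hvm : Measurable v) (hv : HFB.InfinitesimallyLaplaceBounded v) (hve : ∀ x, v (-x) = v x)
    (I : Set ℝ) (hI : I.OrdConnected)
    (ω : ℝ → HFB.State d) (μ : ℝ → HFB.Triple d)
    (hqf : ∀ t ∈ I, (ω t).IsQuasifree) (hμ : ∀ t ∈ I, (ω t).HasMoments (μ t))
    (hX : HFB.MemXFamily j I μ) (hω : HFB.SolvesQuasifreeEq V v I ω) :
    (∀ A : HFB.QuadObs d j, HFB.FormCommute A.op A.adjoint.op (HFB.hamOp V v) →
      ∃ z : ℂ, ∀ t ∈ I, HFB.HasExp (ω t) A.op z) ∧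
    (∃ N : ℝ, ∀ t ∈ I, HFB.HasExp (ω t) (HFB.numberOp d) N) ∧
    (∃ E : ℝ, ∀ t ∈ I, HFB.HasExp (ω t) (HFB.hamOp V v) E ∧ HFB.IsEnergy V v (μ t) E) := by
  obtain ⟨h1, h2, E, hE⟩ := HFB.conservation hj hVm hV hvm hv hI hqf hμ hX hω
  exact ⟨h1, h2, E, fun t ht => ⟨hE t ht, (hqf t ht).nonempty.some.isEnergy hj hVm hV hvm hv hve
    (hμ t ht) (hX.1 t ht).1 (hE t ht)⟩⟩
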